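/- Let $F$ be the compact one-holed torus and let $E$ be the figure-eight knot complement (compact knot exterior), i.e. the once-punctured (one-holed) torus bundle over the circle $E=F\times[0,1]/\big((x,1)\sim(h(x),0)\big)$ whose monodromy $h:F\to F$ is the composite of two Dehn twists of opposite handedness along two simple closed curves meeting once; $h$ acts on $\pi_1(F)=\langle a,b\rangle$ by $a\mapsto aba,\ b\mapsto ab$ and fixes $\partial F$ pointwise. The boundary $\partial E=\partial F\times S^1$ is a torus, with meridian $m=\{p\}\times S^1$ (for a point $p\in\partial F$) and longitude $l=\partial F\times\{0\}$. Let $E_1,E_2$ be two copies of $E$ with meridians $m_i$ and longitudes $l_i$. Let $f:\partial E_1\to\partial E_2$ be any homeomorphism (orientation-preserving or orientation-reversing) which identifies the meridians, that is, $f(m_1)$ is freely homotopic in $\partial E_2$ to $m_2$ or to $m_2$ traversed backwards, and which does not also identify the longitudes, that is, $f(l_1)$ is freely homotopic in $\partial E_2$ neither to $l_2$ nor to $l_2$ traversed backwards. (Equivalently, up to the directions of the curves, $l_2$ is identified with $m_1^n l_1$ for some integer $n\neq 0$.) Let $M=E_1\cup_f E_2$ be the closed $3$-manifold obtained by gluing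 $E_1$ and $E_2$ along $f$. Then for every base point: 1. $\pi_1(M)$ does not embed in $SL(2,\mathbb C)$, i.e. there is no injective homomorphism $\pi_1(M)\to SL(2,\mathbb C)$; 2. $\pi_1(M)$ is CSA: every maximal abelian subgroup $A$ is malnormal, meaning that $gAg^{-1}\cap A=\{e\}$ for all $g\notin A$; 3. $\pi_1(M)$ is CT (commutative transitive): commuting is a transitive relation on the non-identity elements. -/

import Mathlib

noncomputable section

namespace FigureEight

/-! ### Group theory: commutative transitive and CSA groups, malnormal subgroups -/

/-- `G` is commutative transitive: commuting is a transitive relation on `G - {e}`. -/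
def IsCT (G : Type*) [Group G] : Prop :=
  ∀ x y z : G, x ≠ 1 → y ≠ 1 → z ≠ 1 → Commute x y → Commute y z → Commute x z

/-- `H` is malnormal in `G`: `g H g⁻¹ ∩ H = {e}` for all `g ∈ G - H`. -/
def IsMalnormal {G : Type*} [Group G] (H : Subgroup G) : Prop :=
  ∀ g : G, g ∉ H → ∀ x ∈ H, g * x * g⁻¹ ∈ H → x = 1

/-- `M` is an abelian subgroup of `G` that lies in no larger abelian subgroup. -/
def IsMaximalAbelian {G : Type*} [Group G] (M : Subgroup G) : Prop :=
  Maximal (fun H : Subgroup G => ∀ x ∈ H, ∀ y ∈ H, x * y = y * x) M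

/-- `G` is CSA (conjugately separated abelian): every maximal abelian subgroup is malnormal. -/
def IsCSA (G : Type*) [Group G] : Prop :=
  ∀ M : Subgroup G, IsMaximalAbelian M → IsMalnormal M

/-! ### Topology: mapping tori, gluing along subspaces, unoriented closed curves -/

section Topology

variable {X : Type*} [TopologicalSpace X]

/-- The equivalence relation on `X × ℝ` generated by `(x, s + 1) ~ (h x, s)`. -/
def mappingTorusSetoid (h : X ≃ₜ X) : Setoid (X × ℝ) where
  r p q := ∃ k : ℤ, q = ((h ^ k) p.1, p.2 - k)
  iseqv :=
    { refl := fun p => ⟨0, by simp⟩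
      symm := by
        rintro p q ⟨k, rfl⟩
        refine ⟨-k, ?_⟩
        simp
      trans := by
        rintro p q r ⟨k, rfl⟩ ⟨l, rfl⟩
        refine ⟨l + k, ?_⟩
        have : (h ^ (l + k)) p.1 = (h ^ l) ((h ^ k) p.1) := by
          rw [zpow_add]; rfl
        rw [this]
        push_cast
        congr 1
        ring }

/-- The mapping torus of `h`, that is, `X × [0,1]` with `(x, 1)` glued to `(h x, 0)`, written as
the quotient of `X × ℝ` by `(x, s + 1) ~ (h x, s)`. -/
abbrev MappingTorus (h : X ≃ₜ X) : Type _ := Quotient (mappingTorusSetoid h)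

/-- The point of the mapping torus represented by `(x, s)`. -/
def MappingTorus.mk (h : X ≃ₜ X) (x : X) (s : ℝ) : MappingTorus h :=
  Quotient.mk (mappingTorusSetoid h) (x, s)

theorem MappingTorus.continuous_mk (h : X ≃ₜ X) :
    Continuous fun p : X × ℝ => MappingTorus.mk h p.1 p.2 :=
  continuous_quotient_mk'

theorem MappingTorus.mk_add_one (h : X ≃ₜ X) (x : X) (s : ℝ) :
    MappingTorus.mk h x (s + 1) = MappingTorus.mk h (h x) s :=
  Quotient.sound ⟨1, by simp⟩

/-- The space obtained from the disjoint union of two spaces `X` and `Y` by gluing the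
subspace `A` of `X` to the subspace `B` of `Y` along the homeomorphism `f : A ≃ₜ B`. -/
abbrev Glued {Y : Type*} [TopologicalSpace Y] {A : Set X} {B : Set Y} (f : A ≃ₜ B) : Type _ :=
  Quot fun p q : X ⊕ Y => ∃ a : A, p = Sum.inl (a : X) ∧ q = Sum.inr (f a : Y)

/-- The closed curve `γ` traversed backwards. -/
def reverse (γ : C(UnitAddCircle, X)) : C(UnitAddCircle, X) :=
  γ.comp ⟨fun t => -t, continuous_neg⟩

/-- Two closed curves are the same up to free homotopy and a choice of direction. For simple
closed essential curves in a torus this means that they are isotopic as unoriented curves. -/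
def SameCurve (γ δ : C(UnitAddCircle, X)) : Prop :=
  γ.Homotopic δ ∨ γ.Homotopic (reverse δ)

end Topology

/-! ### The fibre: a torus with one hole, and its monodromy -/

/-- The compact one-holed torus: the torus `(ℝ/ℤ)²` without the open square
`{(x, y) : |x| < 1/4, |y| < 1/4}` (the norm on the product is the sup norm). It is a
neighbourhood of a wedge of two circles, the union of the
two annuli `{1/4 ≤ |x|}` and `{1/4 ≤ |y|}`. -/
abbrev Fibre : Type := {p : UnitAddCircle × UnitAddCircle // 1 / 4 ≤ ‖p‖}

/-- The circle map of degree one which is `0` on `[-1/4, 1/4]` and stretches `[1/4, 3/4]`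
affinely once around the circle. -/
def twist : UnitAddCircle → UnitAddCircle :=
  AddCircle.liftIco 1 0 fun x : ℝ => ((max 0 (min 1 (2 * x - 1 / 2)) : ℝ) : UnitAddCircle)

theorem continuous_twist : Continuous twist := by
  refine AddCircle.liftIco_zero_continuous ?_ ?_
  · have h0 : max 0 (min 1 (2 * (0 : ℝ) - 1 / 2)) = 0 := by norm_num
    have h1 : max 0 (min 1 (2 * (1 : ℝ) - 1 / 2)) = 1 := by norm_num
    rw [h0, h1, AddCircle.coe_zero]
    exact (AddCircle.coe_period 1).symm
  · refine Continuous.continuousOn ?_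
    exact (AddCircle.continuous_mk' 1).comp (by fun_prop)

theorem norm_coe_of_abs_le {r : ℝ} (hr : |r| ≤ 1 / 2) : ‖(r : UnitAddCircle)‖ = |r| :=
  (AddCircle.norm_coe_eq_abs_iff 1 one_ne_zero).2 (by simpa using hr)

theorem norm_coe_of_mem_Icc {y : ℝ} (h0 : 0 ≤ y) (h1 : y ≤ 1) :
    ‖(y : UnitAddCircle)‖ = min y (1 - y) := by
  rcases le_total y (1 / 2) with h | h
  · rw [norm_coe_of_abs_le (by rwa [abs_of_nonneg h0]), abs_of_nonneg h0, min_eq_left (by linarith)]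
  · have : ((y - 1 : ℝ) : UnitAddCircle) = y := by
      rw [AddCircle.coe_sub, AddCircle.coe_period (1 : ℝ), sub_zero]
    rw [← this, norm_coe_of_abs_le (by rw [abs_of_nonpos] <;> linarith),
      abs_of_nonpos (by linarith), min_eq_right (by linarith)]
    ring

theorem twist_eq_zero {x : UnitAddCircle} (hx : ‖x‖ ≤ 1 / 4) : twist x = 0 := by
  obtain ⟨y, hy, rfl⟩ := AddCircle.eq_coe_Ico x
  rw [twist, AddCircle.liftIco_zero_coe_apply hy]
  rw [norm_coe_of_mem_Icc hy.1 hy.2.le] at hx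
  rcases min_le_iff.1 hx with h | h
  · rw [max_eq_left ((min_le_right _ _).trans (by linarith))]
    simp
  · rw [min_eq_left (by linarith), max_eq_right zero_le_one]
    exact AddCircle.coe_period 1

theorem fibre_or (p : Fibre) : 1 / 4 ≤ ‖p.1.1‖ ∨ 1 / 4 ≤ ‖p.1.2‖ := by
  have := p.2
  rwa [Prod.norm_def, le_max_iff] at this

/-- The Dehn twist `(x, y) ↦ (x + twist y, y)` of the one-holed torus, supported in the annulus
`{1/4 ≤ |y|}`. -/
def twistX : Fibre ≃ₜ Fibre where
  toFun p := ⟨(p.1.1 + twist p.1.2, p.1.2), by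
    rw [Prod.norm_def, le_max_iff]
    rcases le_total (1 / 4) ‖p.1.2‖ with h | h
    · exact Or.inr h
    · simpa [twist_eq_zero h] using fibre_or p⟩
  invFun p := ⟨(p.1.1 - twist p.1.2, p.1.2), by
    rw [Prod.norm_def, le_max_iff]
    rcases le_total (1 / 4) ‖p.1.2‖ with h | h
    · exact Or.inr h
    · simpa [twist_eq_zero h] using fibre_or p⟩
  left_inv p := by ext <;> simp
  right_inv p := by ext <;> simp
  continuous_toFun := by have := continuous_twist; fun_prop
  continuous_invFun := by have := continuous_twist; fun_prop

/-- The Dehn twist `(x, y) ↦ (x, y + twist x)` of the one-holed torus, supported in the annulus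
`{1/4 ≤ |x|}`. -/
def twistY : Fibre ≃ₜ Fibre where
  toFun p := ⟨(p.1.1, p.1.2 + twist p.1.1), by
    rw [Prod.norm_def, le_max_iff]
    rcases le_total (1 / 4) ‖p.1.1‖ with h | h
    · exact Or.inl h
    · simpa [twist_eq_zero h] using fibre_or p⟩
  invFun p := ⟨(p.1.1, p.1.2 - twist p.1.1), by
    rw [Prod.norm_def, le_max_iff]
    rcases le_total (1 / 4) ‖p.1.1‖ with h | h
    · exact Or.inl h
    · simpa [twist_eq_zero h] using fibre_or p⟩
  left_inv p := by ext <;> simp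
  right_inv p := by ext <;> simp
  continuous_toFun := by have := continuous_twist; fun_prop
  continuous_invFun := by have := continuous_twist; fun_prop

/-- The monodromy of the figure-eight knot: first `twistX`, then `twistY`. These are Dehn twists
of opposite handedness along two curves that meet once. On homology the composite is
`!![1, 1; 1, 2]`; on the free group on the horizontal loop `b` and the vertical loop `a` through
the boundary point `(1/4, 1/4)` it is `a ↦ a b a`, `b ↦ a b` (paths composed from left to right),
and it fixes the boundary of the fibre pointwise. -/
def monodromy : Fibre ≃ₜ Fibre := twistX.trans twistY

/-- The monodromy fixes the boundary of the one-holed torus pointwise. -/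
theorem monodromy_apply_of_norm_eq (p : Fibre) (hp : ‖p.1‖ = 1 / 4) : monodromy p = p := by
  have h1 : twist p.1.1 = 0 := twist_eq_zero ((norm_fst_le p.1).trans hp.le)
  have h2 : twist p.1.2 = 0 := twist_eq_zero ((norm_snd_le p.1).trans hp.le)
  ext <;> simp [monodromy, twistX, twistY, h1, h2]

/-! ### The figure-eight knot complement with its boundary torus, meridian and longitude -/

/-- The compact figure-eight knot complement (the knot exterior): the once-punctured (one-holed)
torus bundle over the circle with the monodromy of the figure-eight knot. -/
abbrev KnotComplement : Type := MappingTorus monodromy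

/-- The boundary torus of the figure-eight knot complement: the boundary of the fibre times the
circle. -/
def boundary : Set KnotComplement :=
  {z | ∃ (p : Fibre) (s : ℝ), ‖p.1‖ = 1 / 4 ∧ z = MappingTorus.mk monodromy p s}

/-- A trapezoidal wave: `1/4` for `|t| ≤ 1/8`, `-1/4` for `3/8 ≤ |t|`, affine in between. -/
def wave (t : UnitAddCircle) : ℝ := max (-(1 / 4)) (min (1 / 4) (1 / 2 - 2 * ‖t‖))

theorem abs_wave_le (t : UnitAddCircle) : |wave t| ≤ 1 / 4 :=
  abs_le.2 ⟨le_max_left _ _, max_le (by norm_num) (min_le_left _ _)⟩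

theorem abs_wave_eq {t : UnitAddCircle} (ht : ‖t‖ ≤ 1 / 8 ∨ 3 / 8 ≤ ‖t‖) :
    |wave t| = 1 / 4 := by
  rcases ht with h | h
  · rw [wave, min_eq_left (by linarith), max_eq_right (by norm_num), abs_of_nonneg (by norm_num)]
  · rw [wave, min_eq_right (by linarith), max_eq_left (by linarith), abs_neg,
      abs_of_nonneg (by norm_num)]

theorem continuous_wave : Continuous wave := by unfold wave; fun_prop

/-- The boundary of the hole, the square `{max(|x|, |y|) = 1/4}`, traversed once. -/
def square (t : UnitAddCircle) : UnitAddCircle × UnitAddCircle :=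
  ((wave t : ℝ), (wave (t - ((1 / 4 : ℝ) : UnitAddCircle)) : ℝ))

theorem norm_square (t : UnitAddCircle) : ‖square t‖ = 1 / 4 := by
  have key : (‖t‖ ≤ 1 / 8 ∨ 3 / 8 ≤ ‖t‖) ∨
      (‖t - ((1 / 4 : ℝ) : UnitAddCircle)‖ ≤ 1 / 8 ∨
        3 / 8 ≤ ‖t - ((1 / 4 : ℝ) : UnitAddCircle)‖) := by
    obtain ⟨y, hy, rfl⟩ := AddCircle.eq_coe_Ico t
    rw [← AddCircle.coe_sub, norm_coe_of_mem_Icc hy.1 hy.2.le]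
    simp only [min_le_iff, le_min_iff]
    rcases le_total y (1 / 4) with h | h
    · rw [norm_coe_of_abs_le (by rw [abs_of_nonpos] <;> linarith [hy.1]),
        abs_of_nonpos (by linarith)]
      grind
    · rw [norm_coe_of_mem_Icc (by linarith) (by linarith [hy.2])]
      simp only [min_le_iff, le_min_iff]
      grind
  have h1 := abs_wave_le t
  have h2 := abs_wave_le (t - ((1 / 4 : ℝ) : UnitAddCircle))
  rw [square, Prod.norm_def, norm_coe_of_abs_le (h1.trans (by norm_num)),
    norm_coe_of_abs_le (h2.trans (by norm_num))]
  rcases key with h | h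
  · rw [abs_wave_eq h, max_eq_left h2]
  · rw [abs_wave_eq h, max_eq_right h1]

theorem continuous_square : Continuous square := by
  have h := continuous_wave
  have hc : Continuous ((↑) : ℝ → UnitAddCircle) := AddCircle.continuous_mk' 1
  exact (hc.comp h).prodMk (hc.comp (h.comp (by fun_prop)))

/-- The boundary of the fibre as a closed curve in the fibre. -/
def fibreBoundary (t : UnitAddCircle) : Fibre := ⟨square t, (norm_square t).ge⟩

/-- The longitude of the figure-eight knot: the boundary of one fibre, as a closed curve in the
boundary torus. -/
def longitude : C(UnitAddCircle, boundary) where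
  toFun t := ⟨MappingTorus.mk monodromy (fibreBoundary t) 0, fibreBoundary t, 0, norm_square t, rfl⟩
  continuous_toFun := by
    refine Continuous.subtype_mk ?_ _
    exact (MappingTorus.continuous_mk monodromy).comp
      ((continuous_square.subtype_mk _).prodMk continuous_const)

/-- The point over the time `s` of the closed curve `{p} × S¹`, where `p` is a boundary point of
the fibre. -/
def meridianPoint (s : ℝ) : boundary :=
  ⟨MappingTorus.mk monodromy (fibreBoundary 0) s, fibreBoundary 0, s, norm_square 0, rfl⟩

theorem continuous_meridianPoint : Continuous meridianPoint :=
  ((MappingTorus.continuous_mk monodromy).comp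
    (continuous_const.prodMk continuous_id)).subtype_mk _

theorem periodic_meridianPoint : Function.Periodic meridianPoint 1 := by
  intro s
  apply Subtype.ext
  change MappingTorus.mk monodromy _ (s + 1) = MappingTorus.mk monodromy _ s
  rw [MappingTorus.mk_add_one, monodromy_apply_of_norm_eq (fibreBoundary 0) (norm_square 0)]

/-- The meridian of the figure-eight knot: a boundary point of the fibre times the circle, as a
closed curve in the boundary torus. -/
def meridian : C(UnitAddCircle, boundary) where
  toFun := periodic_meridianPoint.lift
  continuous_toFun :=
    isQuotientMap_quotient_mk'.continuous_iff.2 continuous_meridianPoint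

end FigureEight

end

/-! By the theorem of van Kampen, `π₁(M)` is an amalgam of two copies of the knot group `G = F₂ ⋊ ℤ`
along their peripheral subgroups `⟨l, m⟩ ≅ ℤ²`. The three claims follow from the algebra of `G`.

CSA and CT. The only conjugacy classes of `F₂` that are periodic under the monodromy are those of
the powers of the boundary word (`exists_conj_bdry_of_periodic`). The monodromy is the square of `a
↦ ab`, `b ↦ a`, and the letter counts of cyclic words along an orbit satisfy convexity-like
inequalities (`wt_climb_false`, `wt_climb_true`). On a periodic orbit they are equalities, and this
forces the cyclic word `x y x⁻¹ y⁻¹ x y …`. Together with the Heisenberg quotient of `F₂`, in which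
the boundary word generates the centre, this makes the peripheral subgroup malnormal in `G`
(`KnotGroup.periph_malnormal`). It also yields two properties of `G`: commuting is transitive
(`KnotGroup.commute_trans`), and a nontrivial `x` that commutes with `g x g⁻¹` commutes with `g`
(`KnotGroup.commute_of_conj`). By malnormality only the identity fixes a path of length two in the
Bass–Serre tree of the amalgam (`BassSerre.action`). Hence both properties pass from `G` to the
amalgam: elements with a fixed vertex are treated in its stabilizer, the others through their axis.
The two properties imply CT and CSA.

`SL(2, ℂ)`. Let `A, B, T, C` be the matrices of `a`, `b`, the meridian and the longitude in a
faithful representation of `G`, and `s = tr A + tr B`. Trace identities give `(tr T)² = s + 1`, `tr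
C = s² - 3s - 2` and `T - T⁻¹ = c (C - C⁻¹)`, where `c²` is a function of `tr T`. So the meridian
determines the longitude up to inversion (`SL2.KnotRep.longitude_eq`). A faithful representation of
the amalgam restricts to two faithful representations of `G` with the same meridian up to inversion,
so the gluing would also match the longitudes.

Topology. Fundamental groups are computed with functors from the fundamental groupoid to a group,
built from locally constant transition functions (`exists_pathFunctor`). On the fibre such a functor
counts crossings of the coordinate axes (`bijective_fibreFunctor`). On `F × ℝ` it is corrected so as
to be invariant under deck transformations and then descends to `E` (`bijective_knotFunctor`). For
glued spaces the same method proves van Kampen's theorem (`exists_functor_pushout`). Displacement in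
the universal covering of the boundary torus classifies its closed curves (`homotopic_of_along_eq`),
which turns the hypotheses on `f` into statements about loops. -/

noncomputable section

namespace FigureEight

open FreeGroup

/-! ### The automorphism `a ↦ ab`, `b ↦ a` of the free group and its effect on reduced words -/

/-- The free group on `a = genA` and `b = genB`. -/
abbrev F2 : Type := FreeGroup Bool

abbrev genA : F2 := of false

abbrev genB : F2 := of true

/-- The automorphism `a ↦ ab`, `b ↦ a`. -/
def fib : F2 ≃* F2 :=
  MonoidHom.toMulEquiv (lift fun i => if i then genA else genA * genB)
    (lift fun i => if i then genB⁻¹ * genA else genB)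
    (by ext i; cases i <;> simp) (by ext i; cases i <;> simp)

@[simp] theorem fib_genA : fib genA = genA * genB := by simp [fib]
@[simp] theorem fib_genB : fib genB = genA := by simp [fib]

abbrev Letter : Type := Bool × Bool

/-- The reduced form of the image under `fib` of a reduced word. -/
def fibWord : List Letter → List Letter
  | [] => []
  | (false, false) :: (true, true) :: r => (true, false) :: fibWord r
  | (true, false) :: (false, true) :: r => (true, true) :: fibWord r
  | (false, true) :: r => (false, true) :: (true, true) :: fibWord r
  | (true, true) :: r => (false, true) :: fibWord r
  | (false, false) :: r => (true, false) :: (false, false) :: fibWord r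
  | (true, false) :: r => (false, false) :: fibWord r

theorem mk_cons (x : Letter) (L : List Letter) : mk (x :: L) = mk [x] * mk L := by
  simp [mul_mk]

theorem mk_pos (i : Bool) : mk [(i, true)] = of i := rfl
theorem mk_neg (i : Bool) : mk [(i, false)] = (of i)⁻¹ := by simp [of, inv_mk, invRev]

theorem mk_fibWord (L : List Letter) : mk (fibWord L) = fib (mk L) := by
  induction L using fibWord.induct with
  | case1 => simp [fibWord, ← one_eq_mk]
  | case2 r ih | case3 r ih =>
    rw [fibWord, mk_cons _ (fibWord r), ih, mk_cons _ (_ :: r), mk_cons _ r]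
    simp only [mk_pos, mk_neg, _root_.map_mul, _root_.map_inv, fib_genA, fib_genB]
    group
  | case4 r ih | case5 r ih =>
    rw [fibWord, mk_cons, mk_cons (_, _) r]
    try rw [mk_cons _ (fibWord r)]
    rw [ih]
    simp only [mk_pos, mk_neg, _root_.map_mul, _root_.map_inv, fib_genA, fib_genB]
    try group
  | case6 r h ih | case7 r h ih =>
    first | rw [fibWord.eq_6 r h] | rw [fibWord.eq_7 r h]
    rw [mk_cons, mk_cons (_, _) r]
    try rw [mk_cons _ (fibWord r)]
    rw [ih]
    simp only [mk_pos, mk_neg, _root_.map_mul, _root_.map_inv, fib_genA, fib_genB]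
    try group

/-- Can `y` follow `x` in a reduced word? -/
abbrev Follows (x y : Letter) : Prop := x.1 = y.1 → x.2 = y.2

theorem isReduced_cons {x : Letter} {L : List Letter} :
    FreeGroup.IsReduced (x :: L) ↔ (∀ y ∈ L.head?, Follows x y) ∧ FreeGroup.IsReduced L := by
  rw [FreeGroup.IsReduced, List.isChain_cons]; rfl

/-- The possible first letters of `fibWord L`, in terms of the first letter of `L`. -/
def fibHead : Letter → Letter → Prop
  | (false, true), y => y = (false, true)
  | (true, true), y => y = (false, true)
  | (false, false), y => y = (true, false)
  | (true, false), y => y = (false, false) ∨ y = (true, true)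

theorem head_fibWord (L : List Letter) (x y : Letter) (hx : x ∈ L.head?)
    (hy : y ∈ (fibWord L).head?) : fibHead x y := by
  induction L using fibWord.induct with
  | case1 => simp at hx
  | case2 r ih | case3 r ih | case4 r ih | case5 r ih =>
    simp only [fibWord, List.head?_cons, Option.mem_some_iff] at hx hy
    subst hx hy; simp [fibHead]
  | case6 r h ih | case7 r h ih =>
    first | rw [fibWord.eq_6 r h] at hy | rw [fibWord.eq_7 r h] at hy
    simp only [List.head?_cons, Option.mem_some_iff] at hx hy
    subst hx hy; simp [fibHead]

theorem head_exists_of_fibWord {L : List Letter} {y : Letter} (hy : y ∈ (fibWord L).head?) :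
    ∃ x ∈ L.head?, fibHead x y := by
  cases L with
  | nil => simp [fibWord] at hy
  | cons x L => exact ⟨x, rfl, head_fibWord _ x y rfl hy⟩

/-- Images of adjacent letters cancel only at `a⁻¹ b` and `b⁻¹ a`, and the cancellation never
propagates: none of the possible next letters listed by `fibHead` is inverse to the letter emitted
before it. -/
theorem isReduced_fibWord {L : List Letter} (hL : FreeGroup.IsReduced L) : FreeGroup.IsReduced (fibWord L) := by
  induction L using fibWord.induct with
  | case1 => simp [fibWord]
  | case2 r ih | case3 r ih =>
    rw [isReduced_cons, isReduced_cons] at hL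
    obtain ⟨-, h2, h3⟩ := hL
    rw [fibWord, isReduced_cons]
    refine ⟨fun y hy => ?_, ih h3⟩
    obtain ⟨⟨i, j⟩, hx, hxy⟩ := head_exists_of_fibWord hy
    have := h2 _ hx
    cases i <;> cases j <;> simp_all [fibHead, Follows]
    try aesop
  | case4 r ih =>
    rw [isReduced_cons] at hL
    obtain ⟨h2, h3⟩ := hL
    rw [fibWord, isReduced_cons, isReduced_cons]
    refine ⟨by simp [Follows], fun y hy => ?_, ih h3⟩
    obtain ⟨⟨i, j⟩, hx, hxy⟩ := head_exists_of_fibWord hy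
    have := h2 _ hx
    cases i <;> cases j <;> simp_all [fibHead, Follows]
    try aesop
  | case5 r ih =>
    rw [isReduced_cons] at hL
    obtain ⟨h2, h3⟩ := hL
    rw [fibWord, isReduced_cons]
    refine ⟨fun y hy => ?_, ih h3⟩
    obtain ⟨⟨i, j⟩, hx, hxy⟩ := head_exists_of_fibWord hy
    have := h2 _ hx
    cases i <;> cases j <;> simp_all [fibHead, Follows]
    try aesop
  | case6 r h ih =>
    rw [isReduced_cons] at hL
    obtain ⟨h2, h3⟩ := hL
    rw [fibWord.eq_6 r h, isReduced_cons, isReduced_cons]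
    refine ⟨by simp [Follows], fun y hy => ?_, ih h3⟩
    obtain ⟨⟨i, j⟩, hx, hxy⟩ := head_exists_of_fibWord hy
    have := h2 _ hx
    cases r with
    | nil => simp at hx
    | cons z r =>
      simp only [List.head?_cons, Option.mem_some_iff] at hx
      subst hx
      cases i <;> cases j <;> simp_all [fibHead, Follows]
      aesop
  | case7 r h ih =>
    rw [isReduced_cons] at hL
    obtain ⟨h2, h3⟩ := hL
    rw [fibWord.eq_7 r h, isReduced_cons]
    refine ⟨fun y hy => ?_, ih h3⟩
    obtain ⟨⟨i, j⟩, hx, hxy⟩ := head_exists_of_fibWord hy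
    have := h2 _ hx
    cases r with
    | nil => simp at hx
    | cons z r =>
      simp only [List.head?_cons, Option.mem_some_iff] at hx
      subst hx
      cases i <;> cases j <;> simp_all [fibHead, Follows]
      aesop

theorem toWord_fib (g : F2) : (fib g).toWord = fibWord g.toWord := by
  conv_lhs => rw [← mk_toWord (x := g), ← mk_fibWord, toWord_mk]
  exact (isReduced_fibWord isReduced_toWord).reduce_eq

/-! ### Counting letters and cancellations under `fib` and its inverse. -/

/-- The number of letters of a word that involve the generator `i`. -/
def cnt (i : Bool) (L : List Letter) : ℕ := L.countP fun x => x.1 = i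

/-- The number of adjacent pairs of letters of a word that satisfy `p`. -/
def pairs (p : Letter → Letter → Bool) : List Letter → ℕ
  | x :: y :: r => (if p x y then 1 else 0) + pairs p (y :: r)
  | _ => 0

/-- The pairs of letters where cancellation takes place when `fib` is applied. -/
def cancelPair : Letter → Letter → Bool
  | (false, false), (true, true) => true
  | (true, false), (false, true) => true
  | _, _ => false

/-- The pairs of letters where cancellation takes place when the inverse of `fib` is applied. -/
def cancelPair' : Letter → Letter → Bool
  | (false, true), (true, true) => true
  | (true, false), (false, false) => true
  | _, _ => false

def samePair (i : Bool) (x y : Letter) : Bool := x.1 = i && y.1 = i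

theorem cnt_cons (i : Bool) (x : Letter) (L : List Letter) :
    cnt i (x :: L) = (if x.1 = i then 1 else 0) + cnt i L := by
  simp [cnt, List.countP_cons, add_comm]

/-- Each `a`-letter contributes one `b`-letter to the image, a `b`-letter contributes none, and
cancellation removes only `a`-letters. -/
theorem cnt_true_fibWord (L : List Letter) : cnt true (fibWord L) = cnt false L := by
  induction L using fibWord.induct with
  | case1 => simp [fibWord, cnt]
  | case2 r ih | case3 r ih | case4 r ih | case5 r ih => simp_all [fibWord, cnt]
  | case6 r h ih | case7 r h ih => simp_all [fibWord, cnt]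

/-- Every letter contributes one `a`-letter to the image, and every cancelling pair loses two of
them. -/
theorem cnt_false_fibWord (L : List Letter) :
    cnt false (fibWord L) + 2 * pairs cancelPair L = cnt false L + cnt true L := by
  induction L using fibWord.induct with
  | case1 => simp [fibWord, cnt, pairs]
  | case2 r ih | case3 r ih =>
    cases r <;> simp_all [fibWord, cnt, pairs, cancelPair] <;> omega
  | case4 r ih | case5 r ih =>
    cases r <;> simp_all [fibWord, cnt, pairs, cancelPair] <;> omega
  | case6 r h ih | case7 r h ih =>
    rcases r with _ | ⟨⟨i, j⟩, r⟩
    · simp_all [fibWord, cnt, pairs, cancelPair]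
    · cases i <;> cases j <;> simp_all [fibWord, cnt, pairs, cancelPair] <;> omega

/-- The letter permutation `a ↦ b⁻¹`, `b ↦ a`. -/
def turn : Letter → Letter
  | (false, e) => (true, !e)
  | (true, e) => (false, e)

/-- The automorphism induced by `turn`. It intertwines `fib` with its inverse, so that all counts
for `fib.symm` reduce to counts for `fib`. -/
def turnEquiv : F2 ≃* F2 :=
  MonoidHom.toMulEquiv (lift fun i => if i then genA else genB⁻¹)
    (lift fun i => if i then genA⁻¹ else genB)
    (by ext i; cases i <;> simp) (by ext i; cases i <;> simp)

theorem turnEquiv_mk (L : List Letter) : turnEquiv (mk L) = mk (L.map turn) := by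
  induction L with
  | nil => simp [← one_eq_mk]
  | cons x L ih =>
    rw [mk_cons, _root_.map_mul, ih, List.map_cons, mk_cons (turn x)]
    congr 1
    rcases x with ⟨i, j⟩
    cases i <;> cases j <;>
      simp [turn, mk_pos, mk_neg, turnEquiv]

theorem isReduced_map_turn {L : List Letter} (hL : FreeGroup.IsReduced L) : FreeGroup.IsReduced (L.map turn) := by
  rw [FreeGroup.IsReduced, List.isChain_map]
  refine List.IsChain.imp ?_ hL
  rintro ⟨i, j⟩ ⟨k, l⟩ h
  cases i <;> cases k <;> simp_all [turn]

theorem toWord_turnEquiv (g : F2) : (turnEquiv g).toWord = g.toWord.map turn := by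
  conv_lhs => rw [← mk_toWord (x := g), turnEquiv_mk, toWord_mk]
  exact (isReduced_map_turn isReduced_toWord).reduce_eq

/-- The letter permutation `a ↦ b`, `b ↦ a⁻¹` after the inverse of `fib` is `fib` after `turn`. -/
theorem turnEquiv_symm_fib_symm (g : F2) : turnEquiv.symm (fib.symm g) = fib (turnEquiv g) := by
  have : (turnEquiv.symm.toMonoidHom.comp fib.symm.toMonoidHom) =
      fib.toMonoidHom.comp turnEquiv.toMonoidHom := by
    ext i
    cases i <;> simp [turnEquiv, fib]
  exact DFunLike.congr_fun this g

theorem cnt_map_turn (i : Bool) (L : List Letter) : cnt i (L.map turn) = cnt (!i) L := by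
  rw [cnt, List.countP_map, cnt]
  congr 1
  ext ⟨k, l⟩
  cases i <;> cases k <;> simp [turn]

theorem cnt_toWord_turnEquiv (i : Bool) (g : F2) :
    cnt i (turnEquiv g).toWord = cnt (!i) g.toWord := by
  rw [toWord_turnEquiv, cnt_map_turn]

theorem pairs_map_turn (p : Letter → Letter → Bool) (L : List Letter) :
    pairs p (L.map turn) = pairs (fun x y => p (turn x) (turn y)) L := by
  induction L with
  | nil => rfl
  | cons x L ih => cases L <;> simp_all [pairs]

theorem pairs_congr_add {p q r : Letter → Letter → Bool}
    (h : ∀ x y, (if p x y then 1 else 0) + (if q x y then 1 else 0) = if r x y then 1 else 0)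
    (L : List Letter) : pairs p L + pairs q L = pairs r L := by
  induction L with
  | nil => rfl
  | cons x L ih =>
    cases L with
    | nil => simp [pairs]
    | cons y L =>
      have := h x y
      simp only [pairs]
      omega

def anyCancelPair (x y : Letter) : Bool := cancelPair x y || cancelPair' x y

/-- `turn` carries the pairs of `cancelPair'` to those of `cancelPair`, so the two losses, under
`fib` and under its inverse, can be added up on one word. -/
theorem pairs_cancelPair (L : List Letter) :
    pairs cancelPair L + pairs cancelPair (L.map turn) = pairs anyCancelPair L := by
  rw [pairs_map_turn]
  refine pairs_congr_add ?_ L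
  decide

/-- The pairs of `anyCancelPair` are an `a`-letter followed by `b`, and `b⁻¹` followed by an
`a`-letter. Charge a `b` with the pair that ends at it and a `b⁻¹` with the pair that starts at it.
No letter is charged twice, pairs `b b` and `b⁻¹ b⁻¹` are charged by the same rule, and an initial
`b` is not charged. -/
theorem anyCancelPair_bound_true (x : Letter) (L : List Letter) (hL : FreeGroup.IsReduced (x :: L)) :
    pairs anyCancelPair (x :: L) + pairs (samePair true) (x :: L) +
      (if x = (true, true) then 1 else 0) ≤ cnt true (x :: L) := by
  induction L generalizing x with
  | nil =>
    have : ∀ x : Letter, (if x = (true, true) then 1 else 0) ≤ (if x.1 = true then 1 else 0) := by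
      decide
    simpa [pairs, cnt_cons, cnt] using this x
  | cons y L ih =>
    rw [isReduced_cons] at hL
    have key : ∀ x y : Letter, Follows x y → (if anyCancelPair x y then 1 else 0) +
        (if samePair true x y then 1 else 0) + (if x = (true, true) then 1 else 0) ≤
        (if x.1 = true then 1 else 0) + (if y = (true, true) then 1 else 0) := by decide
    have h1 := ih y hL.2
    have h2 := key x y (hL.1 y rfl)
    rw [cnt_cons true x]
    simp only [pairs] at h1 ⊢
    omega

/-- Charge an `a`-letter with the pair that starts at it if the next letter is `b` or an `a`-letter;
if a run of `b⁻¹` follows, charge it with the pair that ends this run. Only an initial run of `b⁻¹`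
has no `a`-letter to pay for it, whence the extra term. -/
theorem anyCancelPair_bound_false (x : Letter) (L : List Letter)
    (hL : FreeGroup.IsReduced (x :: L)) :
    pairs anyCancelPair (x :: L) + pairs (samePair false) (x :: L) ≤ cnt false (x :: L) +
      (if x = (true, false) then 1 else 0) := by
  induction L generalizing x with
  | nil => simp [pairs]
  | cons y L ih =>
    rw [isReduced_cons] at hL
    have key : ∀ x y : Letter, Follows x y → (if anyCancelPair x y then 1 else 0) +
        (if samePair false x y then 1 else 0) + (if y = (true, false) then 1 else 0) ≤
        (if x.1 = false then 1 else 0) + (if x = (true, false) then 1 else 0) := by decide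
    have h1 := ih y hL.2
    have h2 := key x y (hL.1 y rfl)
    rw [cnt_cons false x]
    simp only [pairs] at h1 ⊢
    omega

/-- The number of occurrences of `i` in the reduced form of `g`. -/
abbrev wt (i : Bool) (g : F2) : ℕ := cnt i g.toWord

theorem wt_true_fib (g : F2) : wt true (fib g) = wt false g := by
  rw [wt, toWord_fib, cnt_true_fibWord]

theorem wt_false_fib (g : F2) :
    wt false (fib g) + 2 * pairs cancelPair g.toWord = wt false g + wt true g := by
  rw [wt, toWord_fib, cnt_false_fibWord]

/-- This is `wt_false_fib` for the turned element. -/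
theorem wt_true_fib_symm (g : F2) :
    wt true (fib.symm g) + 2 * pairs cancelPair (g.toWord.map turn) = wt false g + wt true g := by
  have h1 : wt true (fib.symm g) = wt false (fib (turnEquiv g)) := by
    rw [← turnEquiv_symm_fib_symm]
    conv_lhs => rw [← turnEquiv.apply_symm_apply (fib.symm g), wt, cnt_toWord_turnEquiv]
    rfl
  have h2 := wt_false_fib (turnEquiv g)
  rw [toWord_turnEquiv] at h2
  rw [h1, h2, wt, cnt_toWord_turnEquiv, wt, cnt_toWord_turnEquiv]
  simp [add_comm]

/-- The right-hand side is twice the length of `g` minus twice the number of cancelling pairs of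
both kinds, and `anyCancelPair_bound_true` bounds the latter by the number of `b`-letters. Along an
orbit of `fib` all these counts are terms of one sequence, so this is a recursive inequality for it,
with the pairs of adjacent `b`-letters as its defect. -/
theorem wt_climb_false (g : F2) :
    2 * wt false g + 2 * pairs (samePair true) g.toWord ≤
      wt false (fib g) + wt true (fib.symm g) := by
  have h1 := wt_false_fib g
  have h2 := wt_true_fib_symm g
  have h3 := pairs_cancelPair g.toWord
  have h4 : pairs anyCancelPair g.toWord + pairs (samePair true) g.toWord ≤ wt true g := by
    have := isReduced_toWord (x := g)
    rw [wt]
    cases hw : g.toWord with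
    | nil => simp [pairs]
    | cons x L => rw [hw] at this; have := anyCancelPair_bound_true x L this; omega
  omega

/-- The same estimate with the roles of the generators exchanged. The `+ 2` accounts for a word that
starts with `b⁻¹`; it becomes negligible when `g` is replaced by high powers. -/
theorem wt_climb_true (g : F2) :
    2 * wt true g + 2 * pairs (samePair false) g.toWord ≤
      wt false (fib g) + wt true (fib.symm g) + 2 := by
  have h1 := wt_false_fib g
  have h2 := wt_true_fib_symm g
  have h3 := pairs_cancelPair g.toWord
  have h4 : pairs anyCancelPair g.toWord + pairs (samePair false) g.toWord ≤ wt false g + 1 := by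
    have := isReduced_toWord (x := g)
    rw [wt]
    cases hw : g.toWord with
    | nil => simp [pairs]
    | cons x L =>
      rw [hw] at this
      have := anyCancelPair_bound_false x L this
      split_ifs at this <;> omega
  omega

end FigureEight
end

noncomputable section

namespace FigureEight

open FreeGroup
open scoped commutatorElement

/-! ### Growth under iteration, and the conjugacy classes that are periodic under `fib` -/

/-- The number of occurrences of `i` in the cyclically reduced form of `g`. -/
def cwt (i : Bool) (g : F2) : ℕ := cnt i (reduceCyclically g.toWord)

theorem cnt_append (i : Bool) (L L' : List Letter) : cnt i (L ++ L') = cnt i L + cnt i L' := by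
  simp [cnt]

theorem cnt_flatten_replicate (i : Bool) (L : List Letter) (N : ℕ) :
    cnt i (List.replicate N L).flatten = N * cnt i L := by
  induction N with
  | zero => simp [cnt]
  | succ N ih => rw [List.replicate_succ, List.flatten_cons, cnt_append, ih]; ring

/-- The reduced word of `g ^ N` consists of a conjugator, `N` copies of the cyclic word and the
inverse of the conjugator. So `cwt` is the growth rate of `wt` on powers, and inequalities for `wt`
with bounded errors become exact ones for `cwt`. -/
theorem wt_pow (i : Bool) (g : F2) : ∃ K, ∀ N : ℕ, N * cwt i g ≤ wt i (g ^ N) ∧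
    wt i (g ^ N) ≤ N * cwt i g + K := by
  refine ⟨cnt i (reduceCyclically.conjugator g.toWord) +
    cnt i (invRev (reduceCyclically.conjugator g.toWord)), fun N => ?_⟩
  rw [wt, toWord_pow, reduceCyclically.reduce_flatten_replicate isReduced_toWord]
  split_ifs with h
  · simp [h, cnt]
  · rw [cnt_append, cnt_append, cnt_flatten_replicate, cwt]
    omega

theorem wt_mul_le (i : Bool) (g h : F2) : wt i (g * h) ≤ wt i g + wt i h := by
  rw [wt, wt, wt, ← cnt_append]
  exact (toWord_mul_sublist g h).countP_le

theorem le_of_forall_mul_le {x y K : ℕ} (h : ∀ N : ℕ, N * x ≤ N * y + K) : x ≤ y := by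
  by_contra! hxy
  have := h (K + 1)
  nlinarith

/-- Conjugation changes `wt` of all powers by a bounded amount, so it does not change the growth
rate. -/
theorem cwt_conj_le (i : Bool) (u g : F2) : cwt i (u * g * u⁻¹) ≤ cwt i g := by
  obtain ⟨K, hK⟩ := wt_pow i g
  obtain ⟨K', hK'⟩ := wt_pow i (u * g * u⁻¹)
  refine le_of_forall_mul_le (K := K + wt i u + wt i u⁻¹) fun N => ?_
  have h1 := (hK N).2
  have h2 := (hK' N).1
  rw [conj_pow] at h2
  have h3 := wt_mul_le i (u * g ^ N) u⁻¹
  have h4 := wt_mul_le i u (g ^ N)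
  omega

theorem cwt_conj (i : Bool) (u g : F2) : cwt i (u * g * u⁻¹) = cwt i g := by
  refine (cwt_conj_le i u g).antisymm ?_
  have := cwt_conj_le i u⁻¹ (u * g * u⁻¹)
  simpa [mul_assoc] using this

theorem cwt_true_fib (g : F2) : cwt true (fib g) = cwt false g := by
  obtain ⟨K, hK⟩ := wt_pow true (fib g)
  obtain ⟨K', hK'⟩ := wt_pow false g
  have h (N : ℕ) : wt true (fib g ^ N) = wt false (g ^ N) := by rw [← map_pow, wt_true_fib]
  refine le_antisymm (le_of_forall_mul_le (K := K') fun N => ?_)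
    (le_of_forall_mul_le (K := K) fun N => ?_)
  · have := h N; have := (hK N).1; have := (hK' N).2; omega
  · have := h N; have := (hK N).2; have := (hK' N).1; omega

/-- The bounded errors are collected in `K`, whereas the defects are kept: they are needed when the
inequalities become equalities. -/
theorem cwt_climb (g : F2) : ∃ K, ∀ N : ℕ,
    N * (2 * cwt false g) + 2 * pairs (samePair true) (g ^ N).toWord ≤
      N * (cwt false (fib g) + cwt true (fib.symm g)) + K ∧
    N * (2 * cwt true g) + 2 * pairs (samePair false) (g ^ N).toWord ≤
      N * (cwt false (fib g) + cwt true (fib.symm g)) + K := by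
  obtain ⟨K₁, h₁⟩ := wt_pow false g
  obtain ⟨K₂, h₂⟩ := wt_pow true g
  obtain ⟨K₃, h₃⟩ := wt_pow false (fib g)
  obtain ⟨K₄, h₄⟩ := wt_pow true (fib.symm g)
  refine ⟨K₃ + K₄ + 2, fun N => ?_⟩
  have h5 := wt_climb_false (g ^ N)
  have h6 := wt_climb_true (g ^ N)
  rw [map_pow, map_pow] at h5 h6
  have h7 := (h₁ N).1
  have h8 := (h₂ N).1
  have h9 := (h₃ N).2
  have h10 := (h₄ N).2
  constructor <;> linarith

/-- A periodic sequence attains its maximum, and the two inequalities spread the maximum to both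
neighbours. -/
theorem eq_of_periodic_of_climb (f : ℤ → ℕ) (p : ℤ) (hp : p ≠ 0) (hper : ∀ n, f (n + p) = f n)
    (h1 : ∀ n, 2 * f n ≤ f (n + 2) + f (n - 1))
    (h2 : ∀ n, 2 * f (n + 1) ≤ f (n + 2) + f (n - 1)) (n m : ℤ) : f n = f m := by
  have hfin : (Set.range f).Finite := by
    have hsub : Set.range f ⊆ f '' (Set.Ico 0 |p|) := by
      rintro _ ⟨n, rfl⟩
      refine ⟨n % p, ⟨Int.emod_nonneg n hp, Int.emod_lt_abs n hp⟩, ?_⟩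
      have hper' : ∀ k : ℤ, ∀ n, f (n + k * p) = f n := by
        intro k
        induction k using Int.induction_on with
        | zero => simp
        | succ k ih => intro n; rw [add_mul, one_mul, ← add_assoc, hper, ih]
        | pred k ih =>
          intro n
          rw [← hper (n + (-(k : ℤ) - 1) * p), ← ih n]
          congr 1; ring
      rw [Int.emod_def, show n - p * (n / p) = n + (-(n / p)) * p by ring, hper']
    exact ((Set.finite_Ico 0 |p|).image f).subset hsub
  obtain ⟨_, ⟨m₀, rfl⟩, hm⟩ := hfin.exists_maximal ⟨f 0, 0, rfl⟩
  have hmax : ∀ n, f n ≤ f m₀ := fun n => by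
    by_contra! h
    exact absurd (hm ⟨n, rfl⟩ h.le) (by simpa using h)
  -- At a maximum `n`, the bound `h1 n` forces `f (n - 1)` to be maximal and `h2 (n - 1)` forces `f
  -- (n + 1)`.
  have hstep : ∀ n, f n = f m₀ → f (n + 1) = f m₀ ∧ f (n - 1) = f m₀ := by
    intro n hn
    have a1 := h1 n
    have a2 := h2 (n - 1)
    rw [show n - 1 + 1 = n by ring, show n - 1 + 2 = n + 1 by ring,
      show n - 1 - 1 = n - 2 by ring] at a2
    have := hmax (n + 1); have := hmax (n + 2); have := hmax (n - 1); have := hmax (n - 2)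
    omega
  have hall : ∀ k : ℤ, f (m₀ + k) = f m₀ := by
    intro k
    induction k using Int.induction_on with
    | zero => simp
    | succ k ih => rw [← add_assoc]; exact (hstep _ ih).1
    | pred k ih => rw [← add_sub_assoc]; exact (hstep _ ih).2
  rw [← add_sub_cancel m₀ n, hall, ← add_sub_cancel m₀ m, hall]

/-- If `f n` is the cyclic `b`-count of `fib ^ n` of `x`, then the cyclic `a`-count is `f (n + 1)`,
and `f` is periodic, hence constant. The linear terms of `cwt_climb` then cancel, and a bound on the
defect that is independent of `N` remains. -/
theorem pairs_le_of_periodic {x w : F2} {k : ℤ} (hk : k ≠ 0)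
    (h : ((fib : MulAut F2) ^ k) x = w * x * w⁻¹) (n : ℤ) (i : Bool) :
    ∃ K, ∀ N : ℕ, pairs (samePair i) ((((fib : MulAut F2) ^ n) x) ^ N).toWord ≤ K := by
  set f : ℤ → ℕ := fun n => cwt true (((fib : MulAut F2) ^ n) x) with hf
  have hsucc (n : ℤ) : ((fib : MulAut F2) ^ (n + 1)) x = fib (((fib : MulAut F2) ^ n) x) := by
    rw [add_comm, zpow_add, zpow_one]; rfl
  have hpred (n : ℤ) :
      ((fib : MulAut F2) ^ (n - 1)) x = fib.symm (((fib : MulAut F2) ^ n) x) := by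
    rw [sub_eq_add_neg, add_comm, zpow_add, zpow_neg_one]; rfl
  have h1 (n : ℤ) : cwt false (((fib : MulAut F2) ^ n) x) = f (n + 1) := by
    simp only [hf]
    rw [hsucc, cwt_true_fib]
  have h2 (n : ℤ) : cwt false (fib (((fib : MulAut F2) ^ n) x)) = f (n + 2) := by
    rw [← hsucc, h1]; congr 1; ring
  have h3 (n : ℤ) : cwt true (fib.symm (((fib : MulAut F2) ^ n) x)) = f (n - 1) := by
    simp only [hf]; rw [hpred]
  have hper (n : ℤ) : f (n + k) = f n := by
    simp only [hf]
    rw [zpow_add, MulAut.mul_apply, h, _root_.map_mul, _root_.map_mul, _root_.map_inv, cwt_conj]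
  have hc := eq_of_periodic_of_climb f k hk hper
    (fun n => by
      obtain ⟨K, hK⟩ := cwt_climb (((fib : MulAut F2) ^ n) x)
      rw [h1, h2, h3] at hK
      exact le_of_forall_mul_le (K := K) fun N => (Nat.le_add_right _ _).trans (hK N).2)
    (fun n => by
      obtain ⟨K, hK⟩ := cwt_climb (((fib : MulAut F2) ^ n) x)
      rw [h1, h2, h3] at hK
      exact le_of_forall_mul_le (K := K) fun N => by have := (hK N).1; omega)
  obtain ⟨K, hK⟩ := cwt_climb (((fib : MulAut F2) ^ n) x)
  rw [h1, h2, h3] at hK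
  refine ⟨K, fun N => ?_⟩
  have h4 := hK N
  have h5 : cwt true (((fib : MulAut F2) ^ n) x) = f 0 := hc n 0
  rw [h5, hc (n + 1) 0, hc (n + 2) 0, hc (n - 1) 0, two_mul] at h4
  cases i <;> omega

/-! ### Reading off the cyclic word of a periodic class. -/

theorem pairs_append_le (p : Letter → Letter → Bool) (L L' : List Letter) :
    pairs p L + pairs p L' ≤ pairs p (L ++ L') := by
  induction L with
  | nil => simp [pairs]
  | cons x L ih =>
    rcases L with _ | ⟨y, L⟩
    · cases L' <;> simp [pairs]
    · simp only [List.cons_append, pairs] at ih ⊢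
      omega

theorem flatten_replicate_mul (M N : ℕ) (L : List Letter) :
    (List.replicate (M * N) L).flatten =
      (List.replicate M (List.replicate N L).flatten).flatten := by
  induction M with
  | zero => simp
  | succ M ih =>
    rw [add_mul, one_mul, add_comm, List.replicate_add, List.flatten_append, ih,
      List.replicate_succ, List.flatten_cons]

/-- On the `N`-th power of `L` the value is at least `N * f L`, which is unbounded unless `f L = 0`.
-/
theorem eq_zero_of_superadditive (f : List Letter → ℕ)
    (hf : ∀ L L', f L + f L' ≤ f (L ++ L')) (L : List Letter) (K : ℕ)
    (h : ∀ N : ℕ, f (List.replicate N L).flatten ≤ K) : f L = 0 := by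
  have hN (N : ℕ) : N * f L ≤ f (List.replicate N L).flatten := by
    induction N with
    | zero => simp
    | succ N ih =>
      rw [List.replicate_succ, List.flatten_cons]
      have := hf L (List.replicate N L).flatten
      linarith
  have := le_of_forall_mul_le (x := f L) (y := 0) (K := K) fun N => by
    have := hN N; have := h N; omega
  omega

def sameGen (x y : Letter) : Bool := x.1 = y.1

theorem pairs_samePair (L : List Letter) :
    pairs (samePair false) L + pairs (samePair true) L = pairs sameGen L :=
  pairs_congr_add (by decide) L

/-- The number of subwords `a b^{±1} a` and `a⁻¹ b^{±1} a⁻¹`. -/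
def triples : List Letter → ℕ
  | x :: y :: z :: r =>
    (if x.1 = false ∧ y.1 = true ∧ z.1 = false ∧ x.2 = z.2 then 1 else 0) + triples (y :: z :: r)
  | _ => 0

theorem triples_append_le (L L' : List Letter) :
    triples L + triples L' ≤ triples (L ++ L') := by
  induction L with
  | nil => simp [triples]
  | cons x L ih =>
    rcases L with _ | ⟨y, _ | ⟨z, L⟩⟩
    · rcases L' with _ | ⟨u, _ | ⟨v, L'⟩⟩ <;> simp [triples]
    · rcases L' with _ | ⟨u, L'⟩
      · simp [triples]
      · simp only [List.cons_append, List.nil_append, triples] at ih ⊢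
        omega
    · simp only [List.cons_append, triples] at ih ⊢
      omega

theorem pairs_cons_cons (p : Letter → Letter → Bool) (x y : Letter) (L : List Letter) :
    pairs p (x :: y :: L) = (if p x y then 1 else 0) + pairs p (y :: L) := rfl

theorem pairs_le_cons (p : Letter → Letter → Bool) (x : Letter) (L : List Letter) :
    pairs p L ≤ pairs p (x :: L) := by
  cases L with
  | nil => simp [pairs]
  | cons y L => rw [pairs_cons_cons]; omega

theorem fibWord_neg (L : List Letter) :
    ∃ R, fibWord ((false, false) :: L) = (true, false) :: R := by
  rcases L with _ | ⟨⟨i, j⟩, L⟩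
  · exact ⟨_, rfl⟩
  · cases i <;> cases j <;> exact ⟨_, rfl⟩

/-- Each triple leaves its own pair of letters of the same generator in the image: `a b a` gives
`ab·a·ab` with the pair `aa`, `a b⁻¹ a` gives `ab·b` with the pair `bb`, and the inverse triples
behave likewise. -/
theorem triples_le (W : List Letter) (hW : W.IsChain fun x y => x.1 ≠ y.1) :
    triples W ≤ pairs sameGen (fibWord W) := by
  -- `fibWord` consumes one or two letters at a time, so the bound is needed for both shorter tails.
  induction hn : W.length using Nat.strong_induction_on generalizing W with
  | _ n ih =>
  subst hn
  rcases W with _ | ⟨x, _ | ⟨y, r⟩⟩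
  · simp [triples]
  · simp [triples]
  have hxy : x.1 ≠ y.1 := (List.isChain_cons_cons.1 hW).1
  have hyr := (List.isChain_cons_cons.1 hW).2
  have ih1 := ih (y :: r).length (by simp) (y :: r) hyr rfl
  have ih2 := ih r.length (by simp) r hyr.tail rfl
  rcases r with _ | ⟨z, r⟩
  · simp [triples]
  have hyz : y.1 ≠ z.1 := (List.isChain_cons_cons.1 hyr).1
  rcases x with ⟨x1, x2⟩
  rcases y with ⟨y1, y2⟩
  rcases z with ⟨z1, z2⟩
  obtain ⟨R, hR⟩ := fibWord_neg r
  have key (L : List Letter) (u v w : Letter) := pairs_le_cons sameGen u L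
  cases x1 <;> cases y1 <;> cases z1 <;> try (simp at hxy hyz; done)
  · -- `x` and `z` involve `a`
    have h0 : triples ((true, y2) :: (false, z2) :: r) = triples ((false, z2) :: r) := by
      cases r <;> simp [triples]
    rw [triples, h0]
    cases x2 <;> cases y2 <;> cases z2
    · simp only [fibWord, hR, pairs_cons_cons, sameGen] at ih2 ⊢
      simp at ih2 ⊢
      omega
    · simp only [fibWord, pairs_cons_cons, sameGen] at ih2 ⊢
      simp at ih2 ⊢
      omega
    · simp only [fibWord, hR, pairs_cons_cons, sameGen] at ih2 ⊢
      simp at ih2 ⊢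
      omega
    · simp only [fibWord, pairs_cons_cons, sameGen] at ih2 ⊢
      simp at ih2 ⊢
      omega
    · simp only [fibWord, hR, pairs_cons_cons, sameGen] at ih2 ⊢
      simp at ih2 ⊢
      omega
    · simp only [fibWord, pairs_cons_cons, sameGen] at ih2 ⊢
      simp at ih2 ⊢
      omega
    · simp only [fibWord, hR, pairs_cons_cons, sameGen] at ih2 ⊢
      simp at ih2 ⊢
      omega
    · simp only [fibWord, pairs_cons_cons, sameGen] at ih2 ⊢
      simp at ih2 ⊢
      omega
  · have h0 : triples ((true, x2) :: (false, y2) :: (true, z2) :: r) =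
        triples ((false, y2) :: (true, z2) :: r) := by
      simp [triples]
    rw [h0]
    refine ih1.trans ?_
    cases x2 <;> cases y2 <;> simp only [fibWord] <;>
      first
      | exact pairs_le_cons _ _ _
      | simp [pairs_cons_cons, sameGen]

/-- The list `x, y, x⁻¹, y⁻¹, x, y, ...` of length `n`. -/
def commWord : ℕ → Letter → Letter → List Letter
  | 0, _, _ => []
  | n + 1, x, y => x :: commWord n y (x.1, !x.2)

/-- In an alternating word, letters at distance two have the same generator. The absence of triples
forces opposite signs for the `a`-letters, and the absence of triples after `turn` does so for the
`b`-letters. -/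
theorem eq_commWord (L : List Letter) (x y : Letter)
    (hL : (x :: y :: L).IsChain fun x y => x.1 ≠ y.1) (h1 : triples (x :: y :: L) = 0)
    (h2 : triples ((x :: y :: L).map turn) = 0) :
    x :: y :: L = commWord (L.length + 2) x y := by
  induction L generalizing x y with
  | nil => simp [commWord]
  | cons z L ih =>
    have hxy : x.1 ≠ y.1 := (List.isChain_cons_cons.1 hL).1
    have hyr := (List.isChain_cons_cons.1 hL).2
    have hyz : y.1 ≠ z.1 := (List.isChain_cons_cons.1 hyr).1
    simp only [triples, List.map_cons] at h1 h2
    have hz : z = (x.1, !x.2) := by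
      rcases x with ⟨x1, x2⟩
      rcases y with ⟨y1, y2⟩
      rcases z with ⟨z1, z2⟩
      cases x1 <;> cases y1 <;> cases z1 <;> simp_all [turn]
      · cases x2 <;> cases z2 <;> simp_all
      · cases x2 <;> cases z2 <;> simp_all
    have := ih y z hyr (by omega) (by simp only [List.map_cons]; omega)
    rw [this, hz]
    rfl

/-- The change of the first two letters of `commWord` when the first letter is deleted. -/
def commStep (p : Letter × Letter) : Letter × Letter := (p.2, (p.1.1, !p.1.2))

theorem commWord_append (n m : ℕ) (x y : Letter) :
    ∃ u v, commWord (n + m) x y = commWord n x y ++ commWord m u v ∧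
      (u, v) = commStep^[n] (x, y) := by
  induction n generalizing x y with
  | zero => exact ⟨x, y, by simp [commWord], rfl⟩
  | succ n ih =>
    obtain ⟨u, v, h1, h2⟩ := ih y (x.1, !x.2)
    refine ⟨u, v, ?_, ?_⟩
    · rw [show n + 1 + m = (n + m) + 1 by ring, commWord, h1, commWord]; rfl
    · rw [Function.iterate_succ_apply, h2, commStep]

theorem length_commWord (n : ℕ) (x y : Letter) : (commWord n x y).length = n := by
  induction n generalizing x y with
  | zero => rfl
  | succ n ih => simp [commWord, ih]

theorem mk_commWord (m : ℕ) (x y : Letter) :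
    mk (commWord (4 * m) x y) = ⁅mk [x], mk [y]⁆ ^ m := by
  have hinv (x : Letter) : mk [(x.1, !x.2)] = (mk [x])⁻¹ := by simp [inv_mk, invRev]
  induction m with
  | zero => simp [commWord, ← one_eq_mk]
  | succ m ih =>
    rw [show 4 * (m + 1) = 4 * m + 1 + 1 + 1 + 1 by ring]
    simp only [commWord, Bool.not_not]
    change mk ([x] ++ ([y] ++ ([(x.1, !x.2)] ++ ([(y.1, !y.2)] ++ commWord (4 * m) x y)))) = _
    rw [← mul_mk, ← mul_mk, ← mul_mk, ← mul_mk, hinv, hinv, ih, pow_succ', commutatorElement_def]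
    simp only [mul_assoc]

/-- The second copy of `L` starts with the state `commStep^[n] (x, y)`, which must be `(x, y)`
again. `commStep` has order four on states: one or three steps exchange the generators, and two
steps invert both letters. -/
theorem four_dvd_of_commWord {n : ℕ} {x y : Letter} (hxy : x.1 ≠ y.1) (hn : 2 ≤ n)
    {L : List Letter} (h1 : L = commWord n x y) (h2 : L ++ L = commWord (n + n) x y) : 4 ∣ n := by
  obtain ⟨u, v, h3, h4⟩ := commWord_append n n x y
  rw [h3, ← h1, List.append_cancel_left_eq, h1] at h2
  obtain ⟨n', rfl⟩ : ∃ n', n = n' + 2 := ⟨n - 2, by omega⟩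
  simp only [commWord, List.cons.injEq] at h2
  rw [← h2.1, ← h2.2.1] at h4
  have hφ4 : commStep^[4] = id := by ext p <;> simp [commStep]
  have hmod := Nat.div_add_mod (n' + 2) 4
  rw [← hmod, Function.iterate_add_apply, Function.iterate_mul, hφ4, Function.iterate_id] at h4
  have hlt := Nat.mod_lt (n' + 2) (show 4 > 0 by norm_num)
  rcases x with ⟨x1, x2⟩
  rcases y with ⟨y1, y2⟩
  simp only at hxy
  generalize hr : (n' + 2) % 4 = r at *
  interval_cases r
  · exact Nat.dvd_of_mod_eq_zero hr
  · simp only [Function.iterate_succ, Function.iterate_zero, Function.comp, id, commStep,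
      Prod.mk.injEq] at h4
    exact absurd h4.1.1 hxy
  · simp only [Function.iterate_succ, Function.iterate_zero, Function.comp, id, commStep,
      Prod.mk.injEq] at h4
    exact absurd h4.1.2 (by cases x2 <;> decide)
  · simp only [Function.iterate_succ, Function.iterate_zero, Function.comp, id, commStep,
      Prod.mk.injEq] at h4
    exact absurd h4.1.1 hxy

/-- The boundary element `a⁻¹ b⁻¹ a b` of the free group. -/
def bdry : F2 := genA⁻¹ * genB⁻¹ * genA * genB

/-- Each of the eight commutators is a cyclic rotation of the boundary word or of its inverse. -/
theorem commutator_letters (x y : Letter) (hxy : x.1 ≠ y.1) :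
    ∃ u : F2, ∃ e : ℤ, ⁅mk [x], mk [y]⁆ = u * bdry ^ e * u⁻¹ := by
  rcases x with ⟨x1, x2⟩
  rcases y with ⟨y1, y2⟩
  simp only [commutatorElement_def, bdry]
  cases x1 <;> cases y1 <;> try (simp at hxy; done)
  all_goals cases x2 <;> cases y2 <;> simp only [mk_pos, mk_neg]
  · exact ⟨1, 1, by group⟩
  · exact ⟨genB, -1, by group⟩
  · exact ⟨genA, -1, by group⟩
  · exact ⟨genA * genB, 1, by group⟩
  · exact ⟨1, -1, by group⟩
  · exact ⟨genA, 1, by group⟩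
  · exact ⟨genB, 1, by group⟩
  · exact ⟨genB * genA, -1, by group⟩

/-- An element whose conjugacy class is periodic under `fib` is conjugate to a power of the
boundary element. -/
theorem exists_conj_bdry_of_periodic {x w : F2} {k : ℤ} (hk : k ≠ 0)
    (h : ((fib : MulAut F2) ^ k) x = w * x * w⁻¹) :
    ∃ (u : F2) (m : ℤ), x = u * bdry ^ m * u⁻¹ := by
  -- The claim is invariant under conjugation, so `x` may be replaced by its cyclically reduced form
  -- `y`, whose powers are spelled by concatenating `L`.
  set L := reduceCyclically x.toWord with hLdef
  have hLred : IsCyclicallyReduced L := reduceCyclically.isCyclicallyReduced isReduced_toWord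
  set y : F2 := mk L with hy
  set u : F2 := mk (reduceCyclically.conjugator x.toWord) with hu
  have hx : x = u * y * u⁻¹ := by
    conv_lhs => rw [← mk_toWord (x := x),
      ← reduceCyclically.conj_conjugator_reduceCyclically x.toWord]
    rw [hu, hy, inv_mk, mul_mk, mul_mk]
  obtain ⟨w', hw'⟩ : ∃ w', ((fib : MulAut F2) ^ k) y = w' * y * w'⁻¹ := by
    refine ⟨(((fib : MulAut F2) ^ k) u)⁻¹ * w * u, ?_⟩
    rw [hx, _root_.map_mul, _root_.map_mul, _root_.map_inv] at h
    have := congrArg (fun z => (((fib : MulAut F2) ^ k) u)⁻¹ * z * ((fib : MulAut F2) ^ k) u) h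
    simp only [mul_assoc, inv_mul_cancel_left, inv_mul_cancel, mul_one] at this
    rw [this]
    group
  have hword (N : ℕ) : (y ^ N).toWord = (List.replicate N L).flatten := by
    rw [hy, pow_mk, toWord_mk]
    exact (hLred.flatten_replicate N).isReduced.reduce_eq
  -- `L ++ L` also contains the subwords across the seam between two copies, so the conclusions hold
  -- cyclically.
  have hdouble (f : List Letter → ℕ) (hf : ∀ L L', f L + f L' ≤ f (L ++ L')) (K : ℕ)
      (hK : ∀ N : ℕ, f (y ^ N).toWord ≤ K) : f (L ++ L) = 0 := by
    refine eq_zero_of_superadditive f hf (L ++ L) K fun N => ?_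
    have := hK (N * 2)
    rw [hword] at this
    convert this using 2
    rw [flatten_replicate_mul]
    simp [List.replicate_succ]
  have hsame : pairs sameGen (L ++ L) = 0 := by
    rw [← pairs_samePair]
    have (i : Bool) : pairs (samePair i) (L ++ L) = 0 := by
      obtain ⟨K, hK⟩ := pairs_le_of_periodic hk hw' 0 i
      exact hdouble _ (pairs_append_le _) K (by simpa using hK)
    rw [this, this]
  have hchain_of (W : List Letter) (hW : pairs sameGen W = 0) :
      W.IsChain fun x y => x.1 ≠ y.1 := by
    induction W with
    | nil => simp
    | cons z W ih =>
      cases W with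
      | nil => simp
      | cons v W =>
        rw [pairs_cons_cons] at hW
        refine List.isChain_cons_cons.2 ⟨fun h => ?_, ih (by omega)⟩
        simp [sameGen, h] at hW
  have hsameN (N : ℕ) : pairs sameGen (y ^ N).toWord = 0 := by
    obtain ⟨K, hK⟩ := pairs_le_of_periodic hk hw' 0 true
    obtain ⟨K', hK'⟩ := pairs_le_of_periodic hk hw' 0 false
    refine eq_zero_of_superadditive _ (pairs_append_le sameGen) _ (K + K') fun M => ?_
    have h1 := hK (M * N)
    have h2 := hK' (M * N)
    simp only [zpow_zero, MulAut.one_apply] at h1 h2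
    have h3 := pairs_samePair (y ^ (M * N)).toWord
    have h4 : (List.replicate M (y ^ N).toWord).flatten = (y ^ (M * N)).toWord := by
      rw [hword, hword, flatten_replicate_mul]
    rw [h4]
    omega
  -- Triples in the powers of `y` produce pairs of equal generators in the powers of `fib y`, and
  -- the latter are bounded too.
  have htri : triples (L ++ L) = 0 := by
    obtain ⟨K, hK⟩ := pairs_le_of_periodic hk hw' 1 true
    obtain ⟨K', hK'⟩ := pairs_le_of_periodic hk hw' 1 false
    refine hdouble _ triples_append_le (K + K') fun N => ?_
    refine (triples_le _ (hchain_of _ (hsameN N))).trans ?_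
    have h1 := hK N
    have h2 := hK' N
    rw [zpow_one, ← map_pow, toWord_fib] at h1 h2
    rw [← pairs_samePair]
    omega
  -- The same argument for the preimage of `y` under `fib`, which `turn` converts into an image
  -- under `fib`.
  have htri' : triples ((L ++ L).map turn) = 0 := by
    obtain ⟨K, hK⟩ := pairs_le_of_periodic hk hw' (-1) true
    obtain ⟨K', hK'⟩ := pairs_le_of_periodic hk hw' (-1) false
    refine hdouble (fun L => triples (L.map turn))
      (fun L L' => by rw [List.map_append]; exact triples_append_le _ _) (K + K') fun N => ?_
    have hch := hchain_of _ (hsameN N)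
    refine (triples_le _ ?_).trans ?_
    · rw [List.isChain_map]
      refine List.IsChain.imp ?_ hch
      rintro ⟨i, j⟩ ⟨k, l⟩ h
      clear * - h
      cases i <;> cases k <;> simp_all [turn]
    · have h1 := hK N
      have h2 := hK' N
      have h3 : ((((fib : MulAut F2) ^ (-1 : ℤ)) y) ^ N).toWord =
          (fibWord ((y ^ N).toWord.map turn)).map turn := by
        rw [← toWord_turnEquiv, ← toWord_fib, ← toWord_turnEquiv, ← turnEquiv_symm_fib_symm,
          MulEquiv.apply_symm_apply, map_pow, zpow_neg_one]
        rfl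
      have h4 : pairs sameGen ((fibWord ((y ^ N).toWord.map turn)).map turn) =
          pairs sameGen (fibWord ((y ^ N).toWord.map turn)) := by
        rw [pairs_map_turn]
        congr 1
        ext ⟨i, j⟩ ⟨k, l⟩
        cases i <;> cases k <;> simp [turn, sameGen]
      rw [h3] at h1 h2
      rw [← h4, ← pairs_samePair]
      omega
  suffices ∃ (v : F2) (m : ℤ), y = v * bdry ^ m * v⁻¹ by
    obtain ⟨v, m, hv⟩ := this
    exact ⟨u * v, m, by rw [hx, hv]; group⟩
  have hch := hchain_of _ hsame
  rcases hL : L with _ | ⟨z, _ | ⟨v, L'⟩⟩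
  · exact ⟨1, 0, by rw [hy, hL, ← one_eq_mk]; simp⟩
  · rw [hL] at hch
    simp at hch
  · rw [hL, List.cons_append, List.cons_append] at hch htri htri'
    -- `L ++ L` is an initial segment of `x y x⁻¹ y⁻¹ x y …`. Comparing its halves shows that `L`
    -- itself is a power of a commutator.
    have h1 := eq_commWord _ _ _ hch htri htri'
    have hzv : z.1 ≠ v.1 := (List.isChain_cons_cons.1 hch).1
    have hlen : (L' ++ z :: v :: L').length + 2 = L.length + L.length := by
      have := congrArg List.length hL
      simp only [List.length_append, List.length_cons] at this ⊢
      omega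
    rw [hlen, ← List.cons_append, ← List.cons_append, ← hL] at h1
    have h2 : L = commWord L.length z v := by
      obtain ⟨p, q, h3, -⟩ := commWord_append L.length L.length z v
      rw [h3] at h1
      exact List.append_inj_left h1 (length_commWord _ _ _).symm
    obtain ⟨m, hm⟩ := four_dvd_of_commWord hzv (by rw [hL]; exact Nat.le_add_left 2 _) h2 h1
    obtain ⟨p, e, hp⟩ := commutator_letters z v hzv
    refine ⟨p, e * m, ?_⟩
    rw [hy, h2, hm, mk_commWord, hp, conj_pow, zpow_mul, zpow_natCast]

end FigureEight
end

noncomputable section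

namespace FigureEight

open FreeGroup hiding map_mul map_one map_inv
open scoped commutatorElement

/-! ### Commuting elements of free groups -/

theorem subsingleton_of_freeGroup_comm {ι : Type*}
    (h : ∀ x y : FreeGroup ι, x * y = y * x) : Subsingleton ι := by
  refine ⟨fun i j => ?_⟩
  classical
  by_contra hij
  have h1 := congrArg toWord (h (of i) (of j))
  rw [toWord_mul, toWord_mul, toWord_of, toWord_of] at h1
  have h2 : ¬ (i = j) := hij
  simp [reduce, h2, Ne.symm h2] at h1

/-- Abelian subgroups of free groups are cyclic. -/
theorem exists_zpowers_of_comm {α : Type*} (H : Subgroup (FreeGroup α))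
    (h : ∀ x ∈ H, ∀ y ∈ H, x * y = y * x) : ∃ s, H = Subgroup.zpowers s := by
  -- By the Nielsen–Schreier theorem `H` is free; being abelian, it has at most one free generator.
  let e := IsFreeGroup.mulEquiv H
  have hsub : Subsingleton (IsFreeGroup.Generators H) := subsingleton_of_freeGroup_comm fun x y => by
    apply e.injective
    rw [map_mul, map_mul]
    exact Subtype.ext (h _ (e x).2 _ (e y).2)
  have hcyc : IsCyclic H := by
    rcases isEmpty_or_nonempty (IsFreeGroup.Generators H) with hE | ⟨⟨i⟩⟩
    · have : Subsingleton H := e.symm.toEquiv.subsingleton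
      infer_instance
    · have : Unique (IsFreeGroup.Generators H) := ⟨⟨i⟩, fun j => Subsingleton.elim _ _⟩
      exact isCyclic_of_surjective e e.surjective
  obtain ⟨⟨s, hs⟩, hgen⟩ := hcyc.exists_generator
  refine ⟨s, le_antisymm (fun x hx => ?_) (by simpa using hs)⟩
  obtain ⟨n, hn⟩ := hgen ⟨x, hx⟩
  exact ⟨n, by simpa using congrArg Subtype.val hn⟩

section TorsionFree

variable {K : Type*} [Group K] [IsMulTorsionFree K]

/-- Roots are unique in these groups, and `x` and `y x y⁻¹` have the same `n`-th power. -/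
theorem commute_of_commute_zpow {x y : K} {n : ℤ} (hn : n ≠ 0) (h : Commute (x ^ n) y) :
    Commute x y := by
  have h1 : (y * x * y⁻¹) ^ n = x ^ n := by
    rw [conj_zpow, ← h.eq, mul_inv_cancel_right]
  have h2 := (zpow_left_injective hn) h1
  rw [mul_inv_eq_iff_eq_mul] at h2
  exact h2.symm

/-- The square of `v` commutes with `x`, hence so does `v`; then `x = x⁻¹`. -/
theorem eq_one_of_conj_eq_inv {x v : K} (h : v * x * v⁻¹ = x⁻¹) : x = 1 := by
  have h1 : Commute (v ^ (2 : ℤ)) x := by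
    have : v ^ (2 : ℤ) * x * (v ^ (2 : ℤ))⁻¹ = x := by
      calc v ^ (2 : ℤ) * x * (v ^ (2 : ℤ))⁻¹ = v * (v * x * v⁻¹) * v⁻¹ := by
            rw [zpow_two]; simp only [mul_assoc, mul_inv_rev]
        _ = v * x⁻¹ * v⁻¹ := by rw [h]
        _ = (v * x * v⁻¹)⁻¹ := by simp only [mul_assoc, mul_inv_rev, inv_inv]
        _ = x := by rw [h, inv_inv]
    exact mul_inv_eq_iff_eq_mul.1 this
  have h2 := commute_of_commute_zpow two_ne_zero h1
  rw [h2.eq, mul_inv_cancel_right] at h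
  have h3 : x ^ (2 : ℤ) = 1 ^ (2 : ℤ) := by
    rw [zpow_two, one_zpow]; nth_rewrite 1 [h]; simp
  exact zpow_left_injective two_ne_zero h3

end TorsionFree

/-- Commuting elements are powers of a common root. The roots for the pairs `x, y` and `y, z`
commute because they share the nontrivial power `y`. -/
theorem freeGroup_commute_trans {α : Type*} {x y z : FreeGroup α} (hy : y ≠ 1)
    (hxy : Commute x y) (hyz : Commute y z) : Commute x z := by
  have hroot (u v : FreeGroup α) (huv : Commute u v) : ∃ s, ∃ i j : ℤ, s ^ i = u ∧ s ^ j = v := by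
    obtain ⟨s, hs⟩ := exists_zpowers_of_comm (Subgroup.closure {u, v}) (by
      have := Subgroup.isMulCommutative_closure (k := {u, v}) (by
        rintro a (rfl | rfl) b (rfl | rfl)
        exacts [rfl, huv, huv.symm, rfl])
      intro a ha b hb
      exact congrArg Subtype.val (mul_comm' (⟨a, ha⟩ : Subgroup.closure {u, v}) ⟨b, hb⟩))
    have hu : u ∈ Subgroup.closure {u, v} := Subgroup.subset_closure (by simp)
    have hv : v ∈ Subgroup.closure {u, v} := Subgroup.subset_closure (by simp)
    rw [hs] at hu hv
    obtain ⟨i, hi⟩ := hu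
    obtain ⟨j, hj⟩ := hv
    exact ⟨s, i, j, hi, hj⟩
  obtain ⟨s, i, j, rfl, rfl⟩ := hroot x y hxy
  obtain ⟨r, k, l, hk, rfl⟩ := hroot _ z hyz
  have hj : j ≠ 0 := by rintro rfl; simp at hy
  have : Commute s r := commute_of_commute_zpow hj (by rw [← hk]; exact Commute.zpow_self r k)
  exact this.zpow_zpow i l

/-- If an automorphism of a free group moves a nontrivial element to one that commutes with it,
then it preserves or inverts a root of that element. -/
theorem exists_root_of_commute_map {α : Type*} (φ : FreeGroup α ≃* FreeGroup α) {x : FreeGroup α}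
    (hx : x ≠ 1) (h : Commute (φ x) x) :
    ∃ s, (∃ i : ℤ, s ^ i = x) ∧ (φ s = s ∨ φ s = s⁻¹) := by
  -- The centralizer of `x` is infinite cyclic, and `φ` maps it onto itself because `φ x` has the
  -- same centralizer. So `φ` sends its generator to a generator.
  obtain ⟨s, hs⟩ := exists_zpowers_of_comm (Subgroup.centralizer {x}) fun u hu v hv => by
    rw [Subgroup.mem_centralizer_singleton_iff] at hu hv
    exact freeGroup_commute_trans hx hu hv.symm
  have hmem (u : FreeGroup α) : u ∈ Subgroup.zpowers s ↔ Commute u x := by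
    rw [← hs, Subgroup.mem_centralizer_singleton_iff]; exact Iff.rfl
  have hφx : φ x ≠ 1 := fun h => hx (by simpa using h)
  have hφ (u : FreeGroup α) : Commute u x ↔ Commute (φ u) x := by
    constructor
    · intro hu
      exact freeGroup_commute_trans hφx (hu.map φ) h
    · intro hu
      have h1 := freeGroup_commute_trans hx hu h.symm
      have := h1.map φ.symm
      simpa using this
  obtain ⟨i, hi⟩ := (hmem x).2 rfl
  obtain ⟨j, hj⟩ := (hmem (φ s)).2 ((hφ s).1 ((hmem s).1 (Subgroup.mem_zpowers s)))
  obtain ⟨k, hk⟩ := (hmem (φ.symm s)).2 ((hφ _).2 (by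
    rw [MulEquiv.apply_symm_apply]; exact (hmem s).1 (Subgroup.mem_zpowers s)))
  simp only at hi hj hk
  have hs1 : s ≠ 1 := by rintro rfl; simp at hi; exact hx hi.symm
  have hjk : s ^ (j * k) = s ^ (1 : ℤ) := by
    rw [zpow_mul, hj, ← map_zpow, hk, MulEquiv.apply_symm_apply, zpow_one]
  have hinj : Function.Injective fun n : ℤ => s ^ n :=
    injective_zpow_iff_not_isOfFinOrder.2 (not_isOfFinOrder_of_isMulTorsionFree hs1)
  have := Int.eq_one_or_neg_one_of_mul_eq_one (hinj hjk)
  refine ⟨s, ⟨i, hi⟩, ?_⟩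
  rcases this with rfl | rfl
  · left; rw [← hj, zpow_one]
  · right; rw [← hj, zpow_neg_one]

/-! ### The Heisenberg quotient -/

/-- Integral unitriangular matrices. In this quotient of `F2` the boundary word becomes the
generator `heis 0 1 0` of the centre, so that its powers stay visible while its commutators vanish.
-/
def heis (p q r : ℤ) : Matrix.SpecialLinearGroup (Fin 3) ℤ :=
  ⟨!![1, p, q; 0, 1, r; 0, 0, 1], by simp [Matrix.det_fin_three]⟩

theorem heis_mul (p q r p' q' r' : ℤ) :
    heis p q r * heis p' q' r' = heis (p + p') (q + q' + p * r') (r + r') := by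
  ext i j
  rw [Matrix.SpecialLinearGroup.coe_mul]
  simp only [heis]
  fin_cases i <;> fin_cases j <;> simp [Matrix.mul_apply, Fin.sum_univ_three]
  all_goals ring

theorem heis_injective {p q r p' q' r' : ℤ} (h : heis p q r = heis p' q' r') :
    p = p' ∧ q = q' ∧ r = r' := by
  have h1 := fun i j => congrArg (fun m : Matrix.SpecialLinearGroup (Fin 3) ℤ => m.1 i j) h
  exact ⟨by simpa [heis] using h1 0 1, by simpa [heis] using h1 0 2, by simpa [heis] using h1 1 2⟩

theorem heis_zero : heis 0 0 0 = 1 := by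
  ext i j
  fin_cases i <;> fin_cases j <;> simp [heis]

theorem heis_inv (p q r : ℤ) : (heis p q r)⁻¹ = heis (-p) (-q + p * r) (-r) := by
  rw [inv_eq_iff_mul_eq_one, heis_mul, ← heis_zero]
  congr 1 <;> ring

theorem heis_center_zpow (q n : ℤ) : heis 0 q 0 ^ n = heis 0 (n * q) 0 := by
  let φ : Multiplicative ℤ →* Matrix.SpecialLinearGroup (Fin 3) ℤ :=
    { toFun := fun n => heis 0 (n.toAdd * q) 0
      map_one' := by simp [heis_zero]
      map_mul' := fun a b => by simp [heis_mul, add_mul] }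
  have h1 : heis 0 q 0 = φ (Multiplicative.ofAdd 1) := by simp [φ]
  rw [h1, ← map_zpow, ← ofAdd_zsmul]
  simp [φ]

def toHeis : F2 →* Matrix.SpecialLinearGroup (Fin 3) ℤ :=
  lift fun i => if i then heis 0 0 1 else heis 1 0 0

theorem exists_toHeis (w : F2) : ∃ p q r, toHeis w = heis p q r := by
  induction w using FreeGroup.induction_on with
  | C1 => exact ⟨0, 0, 0, by rw [map_one, heis_zero]⟩
  | of i => cases i <;> exact ⟨_, _, _, by simp [toHeis]; rfl⟩
  | inv_of i h => obtain ⟨p, q, r, h⟩ := h; exact ⟨_, _, _, by rw [map_inv, h, heis_inv]⟩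
  | mul x y hx hy =>
    obtain ⟨p, q, r, h⟩ := hx
    obtain ⟨p', q', r', h'⟩ := hy
    exact ⟨_, _, _, by rw [map_mul, h, h', heis_mul]⟩

theorem toHeis_bdry : toHeis bdry = heis 0 1 0 := by
  simp [bdry, toHeis, heis_mul, heis_inv]

theorem toHeis_bdry_zpow (n : ℤ) : toHeis (bdry ^ n) = heis 0 n 0 := by
  rw [map_zpow, toHeis_bdry, heis_center_zpow, mul_one]

theorem bdry_zpow_eq_one {n : ℤ} (h : bdry ^ n = 1) : n = 0 := by
  have := congrArg toHeis h
  rw [toHeis_bdry_zpow, map_one, ← heis_zero] at this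
  exact (heis_injective this).2.1

theorem toHeis_commute_bdry_zpow (w : F2) (n : ℤ) :
    toHeis w * heis 0 n 0 = heis 0 n 0 * toHeis w := by
  obtain ⟨p, q, r, h⟩ := exists_toHeis w
  rw [h, heis_mul, heis_mul]
  congr 1 <;> ring

/-- A commutator with the boundary element that is conjugate to a power of it is trivial. -/
theorem commute_bdry_of_commutator {w u : F2} {m : ℤ}
    (h : w * bdry * w⁻¹ * bdry⁻¹ = u * bdry ^ m * u⁻¹) : Commute w bdry := by
  have h1 := congrArg toHeis h
  simp only [map_mul, map_inv, toHeis_bdry_zpow] at h1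
  -- Since the image of `bdry` is central, the left side dies in the Heisenberg group and the right
  -- side becomes `heis 0 m 0`; so `m = 0`, and the commutator was trivial.
  rw [toHeis_bdry, toHeis_commute_bdry_zpow, toHeis_commute_bdry_zpow, mul_inv_cancel_right,
    mul_inv_cancel_right, mul_inv_cancel, ← heis_zero] at h1
  have hm := (heis_injective h1).2.1
  rw [← hm, zpow_zero, mul_one, mul_inv_cancel, mul_inv_eq_one, mul_inv_eq_iff_eq_mul] at h
  exact h

theorem bdry_ne_one : bdry ≠ 1 := fun h => by
  have := bdry_zpow_eq_one (n := 1) (by simpa using h)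
  omega

/-- The centralizer of the boundary element is generated by it. -/
theorem mem_zpowers_bdry {w : F2} {m : ℤ} (hm : m ≠ 0) (h : Commute w (bdry ^ m)) :
    ∃ n : ℤ, w = bdry ^ n := by
  have h0 : Commute w bdry := (commute_of_commute_zpow hm h.symm).symm
  obtain ⟨s, hs⟩ := exists_zpowers_of_comm (Subgroup.centralizer {bdry}) fun u hu v hv => by
    rw [Subgroup.mem_centralizer_singleton_iff] at hu hv
    exact freeGroup_commute_trans bdry_ne_one hu hv.symm
  have h1 : bdry ∈ Subgroup.zpowers s := by
    rw [← hs, Subgroup.mem_centralizer_singleton_iff]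
  have h2 : w ∈ Subgroup.zpowers s := by
    rw [← hs, Subgroup.mem_centralizer_singleton_iff]; exact h0
  obtain ⟨k, hk⟩ := h1
  obtain ⟨l, hl⟩ := h2
  simp only at hk hl
  obtain ⟨p, q, r, hpqr⟩ := exists_toHeis s
  -- The abelianization is torsion free and kills `bdry = s ^ k`, so it kills `s`. Then `s` maps to
  -- `heis 0 q' 0`, and `k * q' = 1` shows that `bdry` generates its centralizer.
  let ab : F2 →* Multiplicative (ℤ × ℤ) :=
    lift fun i => Multiplicative.ofAdd (if i then (0, 1) else (1, 0))
  have hab (w : F2) : ∃ q, toHeis w = heis (ab w).toAdd.1 q (ab w).toAdd.2 := by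
    induction w using FreeGroup.induction_on with
    | C1 => exact ⟨0, by simp [heis_zero]⟩
    | of i => cases i <;> exact ⟨0, by simp [toHeis, ab]⟩
    | inv_of i h => obtain ⟨q, h⟩ := h; exact ⟨_, by rw [map_inv, h, heis_inv, map_inv]; rfl⟩
    | mul x y hx hy =>
      obtain ⟨q, h⟩ := hx
      obtain ⟨q', h'⟩ := hy
      exact ⟨_, by rw [map_mul, h, h', heis_mul, map_mul]; rfl⟩
  have hk0 : k ≠ 0 := by
    rintro rfl
    exact bdry_ne_one (by simpa using hk.symm)
  have hab0 : ab s = 1 := by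
    have h3 : ab s ^ k = 1 := by
      rw [← map_zpow, hk]; simp [ab, bdry]
    have h4 : k • (ab s).toAdd = 0 := by
      rw [← toAdd_zpow, h3]; rfl
    have h5 := (smul_eq_zero.1 h4).resolve_left hk0
    exact Multiplicative.toAdd.injective h5
  obtain ⟨q', hq'⟩ := hab s
  rw [hab0] at hq'
  have h6 : k * q' = 1 := by
    have := congrArg toHeis hk
    rw [map_zpow, hq', toHeis_bdry, toAdd_one, Prod.fst_zero, Prod.snd_zero,
      heis_center_zpow] at this
    exact (heis_injective this).2.1
  rcases Int.eq_one_or_neg_one_of_mul_eq_one h6 with rfl | rfl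
  · exact ⟨l, by rw [← hk, zpow_one, hl]⟩
  · exact ⟨-l, by rw [← hk, zpow_neg_one, inv_zpow, zpow_neg, inv_inv, hl]⟩

end FigureEight
end

noncomputable section

namespace FigureEight

open FreeGroup hiding map_mul map_one map_inv
open scoped commutatorElement

/-! ### The group of the figure-eight knot -/

/-- The automorphism `a ↦ aba`, `b ↦ ab`. -/
def knotAut : MulAut F2 := (fib : MulAut F2) ^ (2 : ℤ)

theorem knotAut_apply (x : F2) : knotAut x = fib (fib x) := by
  rw [knotAut, zpow_two]; rfl

theorem knotAut_genA : knotAut genA = genA * genB * genA := by simp [knotAut_apply]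
theorem knotAut_genB : knotAut genB = genA * genB := by simp [knotAut_apply]

theorem knotAut_bdry : knotAut bdry = bdry := by
  simp only [bdry, map_mul, map_inv, knotAut_genA, knotAut_genB]
  group

theorem knotAut_zpow_bdry (k : ℤ) : (knotAut ^ k) bdry = bdry := by
  induction k using Int.induction_on with
  | zero => simp
  | succ k ih => rw [zpow_add_one, MulAut.mul_apply, knotAut_bdry, ih]
  | pred k ih =>
    rw [zpow_sub_one, MulAut.mul_apply]
    conv_lhs => rw [← knotAut_bdry]
    rw [MulAut.inv_apply_self, ih]

theorem knotAut_zpow (k : ℤ) : knotAut ^ k = (fib : MulAut F2) ^ (2 * k) := by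
  rw [knotAut, zpow_mul]

/-- The group of the figure-eight knot, as the semidirect product of the free group of rank two
with the infinite cyclic group. -/
abbrev KnotGroup : Type := F2 ⋊[zpowersHom (MulAut F2) knotAut] Multiplicative ℤ

namespace KnotGroup

/-- The inclusion of the fibre group. -/
abbrev ofF : F2 →* KnotGroup := SemidirectProduct.inl

/-- The meridian. -/
def mer : KnotGroup := SemidirectProduct.inr (Multiplicative.ofAdd 1)

/-- The longitude. -/
def lon : KnotGroup := ofF bdry

/-- The exponent of the meridian. -/
def deg (g : KnotGroup) : ℤ := g.right.toAdd

theorem ofF_injective : Function.Injective ofF := SemidirectProduct.inl_injective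

theorem mer_zpow (k : ℤ) : mer ^ k = SemidirectProduct.inr (Multiplicative.ofAdd k) := by
  rw [mer, ← map_zpow, ← ofAdd_zsmul, smul_eq_mul, mul_one]

theorem eq_ofF_mul_mer (g : KnotGroup) : g = ofF g.left * mer ^ g.deg := by
  rw [mer_zpow, deg, ofAdd_toAdd, SemidirectProduct.inl_left_mul_inr_right]

@[simp] theorem deg_one : deg 1 = 0 := rfl
@[simp] theorem deg_mul (g h : KnotGroup) : deg (g * h) = deg g + deg h := rfl
@[simp] theorem deg_inv (g : KnotGroup) : deg g⁻¹ = -deg g := rfl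
@[simp] theorem deg_ofF (x : F2) : deg (ofF x) = 0 := rfl
@[simp] theorem deg_mer : deg mer = 1 := rfl

theorem eq_ofF_of_deg {g : KnotGroup} (h : deg g = 0) : g = ofF g.left := by
  conv_lhs => rw [eq_ofF_mul_mer g, h, zpow_zero, mul_one]

theorem deg_zpow (g : KnotGroup) (n : ℤ) : deg (g ^ n) = n * deg g := by
  let d : KnotGroup →* Multiplicative ℤ := SemidirectProduct.rightHom
  have : deg (g ^ n) = (d (g ^ n)).toAdd := rfl
  rw [this, map_zpow, toAdd_zpow]
  rfl

/-- The automorphism of the fibre group given by conjugation. -/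
def conjAut (g : KnotGroup) : F2 ≃* F2 := MulAut.conj g.left * knotAut ^ g.deg

theorem conj_ofF (g : KnotGroup) (x : F2) : g * ofF x * g⁻¹ = ofF (conjAut g x) := by
  conv_lhs => rw [eq_ofF_mul_mer g, mer_zpow]
  have h := SemidirectProduct.inl_aut (φ := zpowersHom (MulAut F2) knotAut)
    (Multiplicative.ofAdd g.deg) x
  rw [zpowersHom_apply, toAdd_ofAdd] at h
  rw [map_inv SemidirectProduct.inr (Multiplicative.ofAdd g.deg)] at h
  rw [conjAut, MulAut.mul_apply, MulAut.conj_apply, map_mul, map_mul, h, map_inv ofF g.left]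
  simp only [mul_assoc, mul_inv_rev]

theorem conjAut_apply (g : KnotGroup) (x : F2) :
    conjAut g x = g.left * (knotAut ^ g.deg) x * g.left⁻¹ := rfl

theorem commute_ofF_iff {g : KnotGroup} {x : F2} : Commute g (ofF x) ↔ conjAut g x = x := by
  rw [← ofF_injective.eq_iff, ← conj_ofF, mul_inv_eq_iff_eq_mul]
  rfl

theorem ofF_commute_ofF {x y : F2} : Commute (ofF x) (ofF y) ↔ Commute x y :=
  ⟨fun h => ofF_injective (by simpa using h.eq), fun h => h.map ofF⟩

theorem eq_one_of_pow_eq_one {g : KnotGroup} {n : ℕ} (hn : n ≠ 0) (h : g ^ n = 1) : g = 1 := by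
  have h1 : deg g = 0 := by
    have h2 := deg_zpow g n
    rw [zpow_natCast, h, deg_one] at h2
    rcases mul_eq_zero.1 h2.symm with h3 | h3
    · omega
    · exact h3
  rw [eq_ofF_of_deg h1, ← map_pow] at h
  have h4 : g.left ^ n = 1 := ofF_injective (by simpa using h)
  have h5 : g.left = 1 := by
    have : g.left ^ n = 1 ^ n := by rw [h4, one_pow]
    exact pow_left_injective hn this
  rw [eq_ofF_of_deg h1, h5, map_one]

/-- An element of nonzero degree that centralizes `x` makes the conjugacy class of `x` periodic
under a nontrivial power of `fib`. -/
theorem exists_conj_bdry {g : KnotGroup} (hg : deg g ≠ 0) {x : F2} (h : conjAut g x = x) :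
    ∃ (u : F2) (m : ℤ), x = u * bdry ^ m * u⁻¹ := by
  rw [conjAut_apply, knotAut_zpow] at h
  refine exists_conj_bdry_of_periodic (k := 2 * deg g) (w := g.left⁻¹) (by omega) ?_
  conv_rhs => rw [← h]
  simp only [mul_assoc, inv_inv, inv_mul_cancel_left, inv_mul_cancel, mul_one]

/-! ### Malnormality of the peripheral subgroup and commuting elements of the knot group. -/

/-- The peripheral subgroup, generated by the meridian and the longitude. -/
def periph : Subgroup KnotGroup where
  carrier := {g | ∃ i j : ℤ, g = lon ^ i * mer ^ j}
  one_mem' := ⟨0, 0, by simp⟩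
  mul_mem' := by
    rintro _ _ ⟨i, j, rfl⟩ ⟨k, l, rfl⟩
    refine ⟨i + k, j + l, ?_⟩
    have h : Commute lon mer :=
      (commute_ofF_iff.2 (by rw [conjAut_apply]; simp [mer, deg, knotAut_bdry])).symm
    rw [zpow_add, zpow_add]
    have := (h.zpow_zpow k j).eq
    simp only [mul_assoc]
    rw [← mul_assoc (mer ^ j), ← this, mul_assoc]
  inv_mem' := by
    rintro _ ⟨i, j, rfl⟩
    refine ⟨-i, -j, ?_⟩
    have h : Commute lon mer :=
      (commute_ofF_iff.2 (by rw [conjAut_apply]; simp [mer, deg, knotAut_bdry])).symm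
    rw [mul_inv_rev, zpow_neg, zpow_neg, ← zpow_neg, ← zpow_neg, (h.zpow_zpow (-i) (-j)).eq]

theorem lon_commute_mer : Commute lon mer :=
  (commute_ofF_iff.2 (by rw [conjAut_apply]; simp [mer, deg, knotAut_bdry])).symm

theorem periph_comm {x y : KnotGroup} (hx : x ∈ periph) (hy : y ∈ periph) : Commute x y := by
  obtain ⟨i, j, rfl⟩ := hx
  obtain ⟨k, l, rfl⟩ := hy
  have h := lon_commute_mer
  exact (((Commute.refl lon).zpow_zpow i k).mul_right (h.zpow_zpow i l)).mul_left
    ((h.symm.zpow_zpow j k).mul_right ((Commute.refl mer).zpow_zpow j l))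

theorem lon_mul_mer_eq_one {i j : ℤ} (h : lon ^ i * mer ^ j = 1) : i = 0 ∧ j = 0 := by
  have h1 : j = 0 := by
    have := congrArg deg h
    simpa [deg_zpow, lon] using this
  subst h1
  rw [zpow_zero, mul_one, lon, ← map_zpow] at h
  exact ⟨bdry_zpow_eq_one (ofF_injective (by simpa using h)), rfl⟩

/-- The monodromy fixes `bdry`, so the fibre part of `g` centralizes `bdry ^ m` in the free group
and is a power of `bdry`. -/
theorem mem_periph_of_commute {g : KnotGroup} {m : ℤ} (hm : m ≠ 0)
    (h : Commute g (ofF (bdry ^ m))) : g ∈ periph := by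
  rw [commute_ofF_iff, conjAut_apply, map_zpow, knotAut_zpow_bdry, mul_inv_eq_iff_eq_mul] at h
  obtain ⟨n, hn⟩ := mem_zpowers_bdry hm h
  refine ⟨n, deg g, ?_⟩
  conv_lhs => rw [eq_ofF_mul_mer g, hn, map_zpow]
  rfl

theorem conj_lon_of_mem {g : KnotGroup} (hg : g ∈ periph) : Commute g lon :=
  periph_comm hg ⟨1, 0, by simp⟩

/-- Conjugates by elements of positive degree that commute with the given element are equal to
it. -/
theorem commute_ofF_of_conj {g : KnotGroup} {x : F2} (hx : x ≠ 1)
    (h : Commute (conjAut g x) x) : Commute g (ofF x) := by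
  obtain ⟨s, ⟨i, rfl⟩, hs⟩ := exists_root_of_commute_map (conjAut g) hx h
  have hs1 : s ≠ 1 := by rintro rfl; simp at hx
  have key : conjAut g s = s := by
    rcases hs with hs | hs
    · exact hs
    -- Inversion of the root is impossible. In degree zero, `s` would be conjugate to its inverse in
    -- a free group. Otherwise `g ^ 2` fixes `s`, so `s` is a conjugate of some `bdry ^ m`, and
    -- since the monodromy fixes `bdry`, this power would be conjugate to its inverse in the free
    -- group.
    exfalso
    by_cases hk : deg g = 0
    · rw [conjAut_apply, hk, zpow_zero, MulAut.one_apply] at hs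
      exact hs1 (eq_one_of_conj_eq_inv hs)
    · have h2 : conjAut (g ^ 2) s = s := by
        rw [← commute_ofF_iff]
        rw [← ofF_injective.eq_iff, ← conj_ofF, map_inv] at hs
        have : g ^ 2 * ofF s * (g ^ 2)⁻¹ = ofF s := by
          calc g ^ 2 * ofF s * (g ^ 2)⁻¹ = g * (g * ofF s * g⁻¹) * g⁻¹ := by
                rw [pow_two]; simp only [mul_assoc, mul_inv_rev]
            _ = g * (ofF s)⁻¹ * g⁻¹ := by rw [hs]
            _ = (g * ofF s * g⁻¹)⁻¹ := by simp only [mul_assoc, mul_inv_rev, inv_inv]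
            _ = ofF s := by rw [hs, inv_inv]
        exact mul_inv_eq_iff_eq_mul.1 this
      obtain ⟨u, m, rfl⟩ := exists_conj_bdry (g := g ^ 2) (by simpa [pow_two] using by omega) h2
      rw [conjAut_apply] at hs
      simp only [map_mul, map_inv, map_zpow, knotAut_zpow_bdry] at hs
      have h3 : bdry ^ m = 1 := by
        refine eq_one_of_conj_eq_inv (v := u⁻¹ * g.left * (knotAut ^ g.deg) u) ?_
        calc _ = u⁻¹ * (g.left * ((knotAut ^ g.deg) u * bdry ^ m * ((knotAut ^ g.deg) u)⁻¹) *
              g.left⁻¹) * u := by simp only [mul_assoc, mul_inv_rev, inv_inv]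
          _ = _ := by rw [hs]; group
      rw [h3] at hs1
      simp at hs1
  rw [map_zpow]
  exact (commute_ofF_iff.2 key).zpow_right i

/-- In degree zero, `x` is a power of the longitude that commutes with its conjugate by `g`, so
`commute_ofF_of_conj` applies. In nonzero degree, `g x g⁻¹` centralizes both the longitude and its
conjugate by `g`, hence their quotient; by periodicity this quotient is conjugate to a power of
`bdry`, and the Heisenberg group shows that it is trivial. -/
theorem periph_malnormal {g x : KnotGroup} (hx : x ∈ periph) (hx1 : x ≠ 1)
    (h : g * x * g⁻¹ ∈ periph) : g ∈ periph := by
  have hcx := conj_lon_of_mem hx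
  have hcy := conj_lon_of_mem h
  by_cases hd : deg x = 0
  · obtain ⟨i, j, rfl⟩ := hx
    have hj : j = 0 := by simpa [deg_zpow, lon] using hd
    subst hj
    have hi : i ≠ 0 := by rintro rfl; simp at hx1
    have hz : lon ^ i * mer ^ (0 : ℤ) = ofF (bdry ^ i) := by simp [lon]
    rw [hz] at h hx1
    rw [conj_ofF] at h
    have h2 : Commute (conjAut g (bdry ^ i)) (bdry ^ i) := by
      rw [← ofF_commute_ofF]
      exact periph_comm h ⟨i, 0, hz.symm⟩
    exact mem_periph_of_commute hi (commute_ofF_of_conj (fun h => hi (bdry_zpow_eq_one h)) h2)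
  · set y := g * x * g⁻¹ with hy
    have hdy : deg y ≠ 0 := by simpa [hy] using hd
    have h1 : conjAut y bdry = bdry := commute_ofF_iff.1 hcy
    have h2 : conjAut y (conjAut g bdry) = conjAut g bdry := by
      rw [← commute_ofF_iff, ← conj_ofF]
      have := (show Commute x (ofF bdry) from hcx)
      exact (Commute.conj_iff g).2 this
    have h3 : conjAut g bdry = g.left * bdry * g.left⁻¹ := by
      rw [conjAut_apply, knotAut_zpow_bdry]
    -- The element fixed here is the commutator of `g.left` and `bdry`, which is the form that
    -- `commute_bdry_of_commutator` requires.
    have h4 : conjAut y (g.left * bdry * g.left⁻¹ * bdry⁻¹) = g.left * bdry * g.left⁻¹ * bdry⁻¹ := by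
      rw [← h3, map_mul, h2, map_inv, h1]
    obtain ⟨u, m, hum⟩ := exists_conj_bdry hdy h4
    have h5 := commute_bdry_of_commutator hum
    refine mem_periph_of_commute one_ne_zero ?_
    rw [commute_ofF_iff, zpow_one, h3, h5.eq, mul_inv_cancel_right]

/-- If a nontrivial fibre element commutes with an element outside of the fibre group, then the
latter is conjugate into the peripheral subgroup, as is the former. -/
theorem exists_conj_periph {x : KnotGroup} {v : F2} (hv : v ≠ 1) (hx : deg x ≠ 0)
    (h : Commute x (ofF v)) :
    ∃ (u : F2) (m : ℤ), m ≠ 0 ∧ v = u * bdry ^ m * u⁻¹ := by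
  obtain ⟨u, m, rfl⟩ := exists_conj_bdry hx (commute_ofF_iff.1 h)
  exact ⟨u, m, by rintro rfl; simp at hv, rfl⟩

theorem conj_mem_periph {x : KnotGroup} {u : F2} {m : ℤ} (hm : m ≠ 0)
    (h : Commute x (ofF (u * bdry ^ m * u⁻¹))) : (ofF u)⁻¹ * x * ofF u ∈ periph := by
  refine mem_periph_of_commute hm ?_
  have := (Commute.conj_iff (ofF u)⁻¹).2 h
  simp only [map_mul, map_inv, inv_inv] at this
  simpa [mul_assoc] using this

/-- In nonzero degree, `v = g x g⁻¹ x⁻¹` is a fibre element that commutes with `x` and with `g x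
g⁻¹`. If it is nontrivial, both lie in one conjugate of the peripheral subgroup, and malnormality
puts `g` there as well. -/
theorem commute_of_conj {g x : KnotGroup} (hx : x ≠ 1) (h : Commute (g * x * g⁻¹) x) :
    Commute g x := by
  by_cases hd : deg x = 0
  · rw [eq_ofF_of_deg hd] at h hx ⊢
    rw [conj_ofF, ofF_commute_ofF] at h
    exact commute_ofF_of_conj (fun h => hx (by rw [h, map_one])) h
  · set v := g * x * g⁻¹ * x⁻¹ with hv
    have hvd : deg v = 0 := by simp [hv]
    have hvx : Commute x v := (h.mul_left (Commute.inv_left (Commute.refl x))).symm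
    by_cases hv1 : v = 1
    · rw [hv, mul_inv_eq_one, mul_inv_eq_iff_eq_mul] at hv1
      exact hv1
    · rw [eq_ofF_of_deg hvd] at hvx hv1
      obtain ⟨u, m, hm, hu⟩ := exists_conj_periph (fun h => hv1 (by rw [h, map_one])) hd hvx
      rw [hu] at hvx
      have hx' := conj_mem_periph hm hvx
      have hy : Commute (g * x * g⁻¹) (ofF (u * bdry ^ m * u⁻¹)) := by
        rw [← hu, ← eq_ofF_of_deg hvd, hv]
        exact (Commute.refl _).mul_right h.inv_right
      have hy' := conj_mem_periph hm hy
      have hg : (ofF u)⁻¹ * g * ofF u ∈ periph := by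
        refine periph_malnormal hx' ?_ ?_
        · intro h
          rw [mul_assoc, inv_mul_eq_one, eq_comm, mul_eq_right] at h
          exact hx h
        · convert hy' using 1
          group
      have := (Commute.conj_iff (ofF u)).2 (periph_comm hg hx')
      simpa [mul_assoc] using this

/-- Either everything happens in the free fibre group; or `x` commutes with a fibre element that is
conjugate to a power of the longitude, and then the centralizer of `x` lies in a conjugate of the
peripheral subgroup; or `x` commutes with no nontrivial fibre element, and then neither with the
commutator of `y` and `z` unless this is trivial. -/
theorem commute_trans {x y z : KnotGroup} (hx : x ≠ 1) (hy : Commute y x) (hz : Commute z x) :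
    Commute y z := by
  have key : ∀ {u : F2} {y z : KnotGroup}, (ofF u)⁻¹ * y * ofF u ∈ periph →
      (ofF u)⁻¹ * z * ofF u ∈ periph → Commute y z := by
    intro u y z h1 h2
    have := (Commute.conj_iff (ofF u)).2 (periph_comm h1 h2)
    simpa [mul_assoc] using this
  have hout : ∀ {x y z : KnotGroup} {v : F2}, v ≠ 1 → x = ofF v → deg y ≠ 0 → Commute y x →
      Commute z x → Commute y z := by
    intro x y z v hv hxv hyd hy hz
    rw [hxv] at hy hz
    obtain ⟨u, m, hm, hu⟩ := exists_conj_periph hv hyd hy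
    rw [hu] at hy hz
    exact key (conj_mem_periph hm hy) (conj_mem_periph hm hz)
  by_cases hd : deg x = 0
  · have hxe := eq_ofF_of_deg hd
    have hv : x.left ≠ 1 := fun h => hx (by rw [hxe, h, map_one])
    by_cases hyd : deg y = 0
    · by_cases hzd : deg z = 0
      · have hye := eq_ofF_of_deg hyd
        have hze := eq_ofF_of_deg hzd
        rw [hxe, hye, ofF_commute_ofF] at hy
        rw [hxe, hze, ofF_commute_ofF] at hz
        rw [hye, hze, ofF_commute_ofF]
        exact freeGroup_commute_trans hv hy hz.symm
      · exact (hout hv hxe hzd hz hy).symm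
    · exact hout hv hxe hyd hy hz
  · by_cases hex : ∃ v : F2, v ≠ 1 ∧ Commute x (ofF v)
    · obtain ⟨v, hv, hxv⟩ := hex
      obtain ⟨u, m, hm, hu⟩ := exists_conj_periph hv hd hxv
      rw [hu] at hxv
      have hx' := conj_mem_periph hm hxv
      have hx'1 : (ofF u)⁻¹ * x * ofF u ≠ 1 := by
        intro h
        rw [mul_assoc, inv_mul_eq_one, eq_comm, mul_eq_right] at h
        exact hx h
      have hmem : ∀ {y : KnotGroup}, Commute y x → (ofF u)⁻¹ * y * ofF u ∈ periph := by
        intro y hy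
        refine periph_malnormal hx' hx'1 ?_
        convert hx' using 1
        calc _ = (ofF u)⁻¹ * (y * x) * y⁻¹ * ofF u := by group
          _ = _ := by rw [hy.eq]; group
      exact key (hmem hy) (hmem hz)
    · push Not at hex
      have hc : deg (y * z * y⁻¹ * z⁻¹) = 0 := by simp
      by_contra hyz
      refine hex (y * z * y⁻¹ * z⁻¹).left ?_ ?_
      · intro h
        rw [← (ofF_injective.eq_iff), ← eq_ofF_of_deg hc, map_one, mul_inv_eq_one,
          mul_inv_eq_iff_eq_mul] at h
        exact hyz h
      · rw [← eq_ofF_of_deg hc]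
        exact ((hy.symm.mul_right hz.symm).mul_right hy.symm.inv_right).mul_right hz.symm.inv_right

/-- This rules out trace `2` for the longitude in a faithful representation, via
`SL2.commute_of_tr_commutator`. -/
theorem not_commute_conj_lon : ¬ Commute (ofF genA * lon * (ofF genA)⁻¹) lon := by
  intro h
  have h1 := commute_of_conj (fun h => bdry_ne_one (ofF_injective (by simpa [lon] using h))) h
  rw [lon, ofF_commute_ofF] at h1
  have : genA * bdry ≠ bdry * genA := by
    rw [bdry]; decide
  exact this h1

end KnotGroup

end FigureEight
end

noncomputable section

namespace FigureEight

/-! ### Groups acting on trees with trivial stabilizers of paths of length two -/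

/-- `Γ` acts without inversions (it preserves a two-colouring) on the tree `T`, and only the
identity fixes a path of length two. -/
structure AcylindricalAction (Γ : Type*) {V : Type*} [Group Γ] [MulAction Γ V]
    (T : SimpleGraph V) (col : T.Coloring Bool) : Prop where
  isTree : T.IsTree
  adj_smul : ∀ (g : Γ) {u v : V}, T.Adj u v → T.Adj (g • u) (g • v)
  col_smul : ∀ (g : Γ) (v : V), col (g • v) = col v
  eq_one_of_path : ∀ (g : Γ) {u v w : V}, T.Adj u v → T.Adj v w → u ≠ w →
    g • u = u → g • v = v → g • w = w → g = 1

/-- A line in a graph: a bi-infinite walk without backtracking. -/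
def IsLine {V : Type*} (T : SimpleGraph V) (l : ℤ → V) : Prop :=
  (∀ n, T.Adj (l n) (l (n + 1))) ∧ ∀ n, l n ≠ l (n + 2)

theorem IsLine.neg {V : Type*} {T : SimpleGraph V} {l : ℤ → V} (hl : IsLine T l) :
    IsLine T fun n => l (-n) := by
  refine ⟨fun n => ?_, fun n => ?_⟩
  · have := (hl.1 (-(n + 1))).symm
    rwa [show -(n + 1) + 1 = -n by ring] at this
  · have := (hl.2 (-(n + 2))).symm
    rwa [show -(n + 2) + 2 = -n by ring] at this

/-- In a tree each vertex has at most one neighbour that is closer to `w`. -/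
theorem eq_of_closer {V : Type*} {T : SimpleGraph V} (hT : T.IsTree) {v u u' w : V}
    (hu : T.Adj v u) (hu' : T.Adj v u') (h : T.dist u w < T.dist v w)
    (h' : T.dist u' w < T.dist v w) : u = u' := by
  classical
  have key : ∀ {u}, T.Adj v u → T.dist u w < T.dist v w →
      ∃ p : T.Walk v w, p.IsPath ∧ p.getVert 1 = u := by
    intro u hu h
    obtain ⟨q, hq⟩ := hT.1.exists_walk_length_eq_dist u w
    refine ⟨.cons hu q, ?_, by simp⟩
    apply SimpleGraph.Walk.isPath_of_length_eq_dist
    apply le_antisymm _ (SimpleGraph.dist_le _)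
    rw [SimpleGraph.Walk.length_cons]
    omega
  obtain ⟨p, hp, rfl⟩ := key hu h
  obtain ⟨q, hq, rfl⟩ := key hu' h'
  have := (hT.2.subsingleton_path _ _).elim ⟨p, hp⟩ ⟨q, hq⟩
  rw [Subtype.mk.injEq] at this
  rw [this]

theorem even_dist_iff {V : Type*} {T : SimpleGraph V} (hT : T.Connected) (col : T.Coloring Bool)
    (u v : V) : Even (T.dist u v) ↔ (col u = col v) := by
  obtain ⟨p, hp⟩ := hT.exists_walk_length_eq_dist u v
  rw [← hp, col.even_length_iff_congr p]
  exact Bool.eq_iff_iff.symm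

theorem dist_adj_cases {V : Type*} {T : SimpleGraph V} (hT : T.Connected) (col : T.Coloring Bool)
    {u v : V} (w : V) (h : T.Adj u v) :
    T.dist u w = T.dist v w + 1 ∨ T.dist v w = T.dist u w + 1 := by
  have h1 : T.dist u v = 1 := SimpleGraph.dist_eq_one_iff_adj.2 h
  have h2 := hT.dist_triangle (u := u) (v := v) (w := w)
  have h3 := hT.dist_triangle (u := v) (v := u) (w := w)
  rw [SimpleGraph.dist_comm (u := v) (v := u), h1] at h3
  have h4 : T.dist u w ≠ T.dist v w := by
    intro h5
    have h6 := even_dist_iff hT col u w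
    have h7 := even_dist_iff hT col v w
    have h8 := col.valid h
    rw [h5, h7] at h6
    revert h6 h8
    generalize col u = a
    generalize col v = b
    generalize col w = c
    revert a b c
    decide
  omega

theorem exists_closer {V : Type*} {T : SimpleGraph V} (hT : T.Connected)
    {u w : V} (h : u ≠ w) : ∃ v, T.Adj u v ∧ T.dist v w + 1 = T.dist u w := by
  obtain ⟨p, hp⟩ := hT.exists_walk_length_eq_dist u w
  cases p with
  | nil => exact absurd rfl h
  | cons ha q =>
    refine ⟨_, ha, ?_⟩
    have h1 := SimpleGraph.dist_le q
    rw [SimpleGraph.Walk.length_cons] at hp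
    rename_i x
    have h3 := hT.dist_triangle (u := u) (v := x) (w := w)
    rw [SimpleGraph.dist_eq_one_iff_adj.2 ha] at h3
    omega

/-- A line that has started to move away from `v` goes on doing so: at a turning point both
neighbours would be closer to `v`, hence equal, and a line does not backtrack. -/
theorem IsLine.dist_add {V : Type*} {T : SimpleGraph V} (hT : T.IsTree) (col : T.Coloring Bool)
    {l : ℤ → V} (hl : IsLine T l) {n : ℤ} {v : V} (h : T.dist (l (n + 1)) v = T.dist (l n) v + 1)
    (k : ℕ) : T.dist (l (n + k)) v = T.dist (l n) v + k := by
  have step : ∀ k : ℕ, T.dist (l (n + k + 1)) v = T.dist (l (n + k)) v + 1 := by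
    intro k
    induction k with
    | zero => simpa using h
    | succ k ih =>
      rcases dist_adj_cases hT.1 col v (hl.1 (n + k + 1)) with h1 | h1
      · exact absurd (eq_of_closer hT (hl.1 (n + k)).symm (hl.1 (n + k + 1)) (w := v)
          (by omega) (by omega)) (by simpa [add_assoc] using hl.2 (n + k))
      · push_cast
        rw [← add_assoc, h1]
  induction k with
  | zero => simp
  | succ k ih =>
    push_cast
    rw [← add_assoc, step k, ih, add_assoc]

theorem IsLine.dist_add_self {V : Type*} {T : SimpleGraph V} (hT : T.IsTree)
    (col : T.Coloring Bool) {l : ℤ → V} (hl : IsLine T l) (n : ℤ) (k : ℕ) :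
    T.dist (l (n + k)) (l n) = k := by
  rw [hl.dist_add hT col, SimpleGraph.dist_self, zero_add]
  rw [SimpleGraph.dist_eq_one_iff_adj.2 (hl.1 n).symm, SimpleGraph.dist_self]

namespace AcylindricalAction

variable {Γ V : Type*} [Group Γ] [MulAction Γ V] {T : SimpleGraph V} {col : T.Coloring Bool}

theorem dist_smul (hA : AcylindricalAction Γ T col) (g : Γ) (u v : V) :
    T.dist (g • u) (g • v) = T.dist u v := by
  have key : ∀ (g : Γ) (u v : V), T.dist (g • u) (g • v) ≤ T.dist u v := by
    intro g u v
    obtain ⟨p, hp⟩ := hA.isTree.1.exists_walk_length_eq_dist u v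
    let f : T →g T := ⟨fun x => g • x, hA.adj_smul g⟩
    have := SimpleGraph.dist_le (p.map f)
    rwa [SimpleGraph.Walk.length_map, hp] at this
  apply le_antisymm (key g u v)
  simpa using key g⁻¹ (g • u) (g • v)

theorem isLine_smul (hA : AcylindricalAction Γ T col) (g : Γ) {l : ℤ → V} (hl : IsLine T l) :
    IsLine T fun n => g • l n :=
  ⟨fun n => hA.adj_smul g (hl.1 n), fun n h => hl.2 n (smul_left_cancel g h)⟩

theorem eq_one_of_line (hA : AcylindricalAction Γ T col) {g : Γ} {l : ℤ → V} (hl : IsLine T l)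
    (h : ∀ n, g • l n = l n) : g = 1 :=
  hA.eq_one_of_path g (hl.1 0) (by simpa using hl.1 (0 + 1)) (by simpa using hl.2 0) (h _) (h _)
    (h _)

/-- An element that fixes two vertices fixes the geodesic between them, and a nontrivial one fixes
no path of length two. -/
theorem dist_le_one (hA : AcylindricalAction Γ T col) {x : Γ} (hx : x ≠ 1) {v w : V}
    (hv : x • v = v) (hw : x • w = w) : T.dist v w ≤ 1 := by
  by_contra! h
  have fixed : ∀ {v}, x • v = v → ∀ {u}, T.Adj v u → T.dist u w + 1 = T.dist v w → x • u = u := by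
    intro v hv u hu h
    refine eq_of_closer hA.isTree (v := v) (w := w) ?_ hu ?_ (by omega)
    · simpa [hv] using hA.adj_smul x hu
    · have := hA.dist_smul x u w
      rw [hw] at this
      omega
  obtain ⟨u, hu, hu'⟩ := exists_closer hA.isTree.1 (u := v) (w := w) (by
    rintro rfl; simp at h)
  have h1 := fixed hv hu hu'
  obtain ⟨t, ht, ht'⟩ := exists_closer hA.isTree.1 (u := u) (w := w) (by
    rintro rfl; simp at hu'; omega)
  exact hx (hA.eq_one_of_path x hu ht (by rintro rfl; omega) hv h1 (fixed h1 ht ht'))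

/-- Both `v` and `y • v` are fixed by `x`, so their distance is at most one; it is even because the
action preserves the colours. -/
theorem smul_eq_of_commute (hA : AcylindricalAction Γ T col) {x y : Γ} (hx : x ≠ 1) {v : V}
    (hv : x • v = v) (h : Commute y x) : y • v = v := by
  have h1 : x • (y • v) = y • v := by rw [← mul_smul, ← h.eq, mul_smul, hv]
  have h2 := hA.dist_le_one hx hv h1
  have h3 := even_dist_iff hA.isTree.1 col v (y • v)
  rw [hA.col_smul, eq_self_iff_true, iff_true] at h3
  have h4 : T.dist v (y • v) = 0 := by
    rcases h3 with ⟨k, hk⟩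
    omega
  exact (hA.isTree.1.dist_eq_zero_iff.1 h4).symm

/-- If the lines diverge from `l m` and `l' n`, then the distance between the translates of these
points by `x` is larger by `L + L'`, but `x` is an isometry. -/
theorem false_of_diverge (hA : AcylindricalAction Γ T col) {x : Γ} {l l' : ℤ → V}
    (hl : IsLine T l) (hl' : IsLine T l') {L L' : ℕ} (hL : 0 < L)
    (hx : ∀ n, x • l n = l (n + L)) (hx' : ∀ n, x • l' n = l' (n + L')) {m n : ℤ}
    (h1 : T.dist (l (m + 1)) (l' n) = T.dist (l m) (l' n) + 1)
    (h2 : T.dist (l m) (l' (n + 1)) = T.dist (l m) (l' n) + 1)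
    (h3 : T.dist (l (m + 1)) (l' (n + 1)) = T.dist (l m) (l' (n + 1)) + 1) : False := by
  have e1 := hl.dist_add hA.isTree col h1 L
  have e2 := hl.dist_add hA.isTree col h3 L
  have e3 := hl'.dist_add hA.isTree col (n := n) (v := l (m + L)) (by
    rw [SimpleGraph.dist_comm, e2, SimpleGraph.dist_comm (u := l' n), e1, h2]; ring) L'
  rw [← hx, ← hx', hA.dist_smul] at e3
  rw [SimpleGraph.dist_comm (u := l' n) (v := x • _), hx, e1,
    SimpleGraph.dist_comm (u := l' n)] at e3
  omega

theorem line_step (hA : AcylindricalAction Γ T col) {x : Γ} {l l' : ℤ → V}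
    (hl : IsLine T l) (hl' : IsLine T l') {L L' : ℕ} (hL : 0 < L)
    (hx : ∀ n, x • l n = l (n + L)) (hx' : ∀ n, x • l' n = l' (n + L')) {m n : ℤ}
    (h : l m = l' n) : l (m + 1) = l' (n + 1) := by
  by_contra hne
  have h0 : T.dist (l m) (l' n) = 0 := by rw [h, SimpleGraph.dist_self]
  have h1 : T.dist (l (m + 1)) (l' n) = 1 := by
    rw [← h]; exact SimpleGraph.dist_eq_one_iff_adj.2 (hl.1 m).symm
  have h2 : T.dist (l m) (l' (n + 1)) = 1 := by
    rw [h]; exact SimpleGraph.dist_eq_one_iff_adj.2 (hl'.1 n)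
  refine hA.false_of_diverge hl hl' hL hx hx' (m := m) (n := n) (by omega) (by omega) ?_
  rcases dist_adj_cases hA.isTree.1 col (l' (n + 1)) (hl.1 m) with h3 | h3
  · rw [h2] at h3
    exact absurd (hA.isTree.1.dist_eq_zero_iff.1 (by omega)) hne
  · exact h3

/-- Two lines translated by the same element agree up to a shift. -/
theorem line_unique (hA : AcylindricalAction Γ T col) {x : Γ} {l l' : ℤ → V}
    (hl : IsLine T l) (hl' : IsLine T l') {L L' : ℕ} (hL : 0 < L)
    (hx : ∀ n, x • l n = l (n + L)) (hx' : ∀ n, x • l' n = l' (n + L')) :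
    ∃ c, ∀ n, l' n = l (n + c) := by
  -- Lines that do not meet would diverge from a pair of closest points.
  obtain ⟨m, n, hmin⟩ : ∃ m n, ∀ m' n', T.dist (l m) (l' n) ≤ T.dist (l m') (l' n') := by
    let F : ℤ × ℤ → ℕ := fun p => T.dist (l p.1) (l' p.2)
    refine ⟨(Function.argmin F).1, (Function.argmin F).2, fun m' n' => ?_⟩
    exact Function.argmin_le F (m', n')
  have hmeet : l m = l' n := by
    by_contra hne
    have h1 : T.dist (l (m + 1)) (l' n) = T.dist (l m) (l' n) + 1 := by
      have := hmin (m + 1) n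
      rcases dist_adj_cases hA.isTree.1 col (l' n) (hl.1 m) with h | h <;> omega
    have h2 : T.dist (l m) (l' (n + 1)) = T.dist (l m) (l' n) + 1 := by
      have := hmin m (n + 1)
      have h3 := dist_adj_cases hA.isTree.1 col (l m) (hl'.1 n)
      rw [SimpleGraph.dist_comm (u := l' n), SimpleGraph.dist_comm (u := l' (n + 1))] at h3
      rcases h3 with h | h <;> omega
    refine hA.false_of_diverge hl hl' hL hx hx' h1 h2 ?_
    rcases dist_adj_cases hA.isTree.1 col (l' (n + 1)) (hl.1 m) with h3 | h3
    swap
    · exact h3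
    exfalso
    -- If `l (m + 1)` were closer to `l' (n + 1)` than `l m`, it would be the first vertex `u` on
    -- the geodesic from `l m` to `l' n`, against minimality.
    obtain ⟨u, hu, hu'⟩ := exists_closer hA.isTree.1 hne
    have h4 := hA.isTree.1.dist_triangle (u := u) (v := l' n) (w := l' (n + 1))
    rw [SimpleGraph.dist_eq_one_iff_adj.2 (hl'.1 n)] at h4
    have h5 := eq_of_closer hA.isTree hu (hl.1 m) (w := l' (n + 1)) (by omega) (by omega)
    subst h5
    omega
  have fwd : ∀ k : ℕ, l (m + k) = l' (n + k) := by
    intro k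
    induction k with
    | zero => simpa using hmeet
    | succ k ih =>
      have := hA.line_step hl hl' hL hx hx' ih
      push_cast
      rwa [← add_assoc, ← add_assoc]
  have inv : ∀ {l : ℤ → V} {L : ℕ}, (∀ n, x • l n = l (n + L)) →
      ∀ n, x⁻¹ • l (-n) = l (-(n + L)) := by
    intro l L h n
    rw [inv_smul_eq_iff, h]
    congr 1
    ring
  have bwd : ∀ k : ℕ, l (-(-m + k)) = l' (-(-n + k)) := by
    intro k
    induction k with
    | zero => simpa using hmeet
    | succ k ih =>
      have := hA.line_step hl.neg hl'.neg hL (inv hx) (inv hx') ih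
      push_cast
      rwa [← add_assoc, ← add_assoc]
  refine ⟨m - n, fun k => ?_⟩
  rcases le_total n k with h | h
  · have := fwd (k - n).toNat
    rw [Int.toNat_of_nonneg (by omega)] at this
    rw [show k + (m - n) = m + (k - n) by ring, this]
    congr 1; ring
  · have := bwd (n - k).toNat
    rw [Int.toNat_of_nonneg (by omega)] at this
    rw [show k + (m - n) = -(-m + (n - k)) by ring, this]
    congr 1; ring

/-- An element acting on a tree without a fixed point translates a line. -/
theorem exists_axis (hA : AcylindricalAction Γ T col) (x : Γ) (hx : ∀ v : V, x • v ≠ v) :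
    ∃ (l : ℤ → V) (L : ℕ), IsLine T l ∧ 0 < L ∧ ∀ n, x • l n = l (n + L) := by
  have : Nonempty V := hA.isTree.1.nonempty
  let F : V → ℕ := fun v => T.dist v (x • v)
  -- The axis passes through a vertex that is moved as little as possible.
  obtain ⟨v, hv⟩ : ∃ v, ∀ w, F v ≤ F w := ⟨Function.argmin F, fun w => Function.argmin_le F w⟩
  obtain ⟨p, hp⟩ := hA.isTree.1.exists_walk_length_eq_dist v (x • v)
  have hpath := p.isPath_of_length_eq_dist hp
  set L := p.length with hLdef
  have hL0 : 0 < L := by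
    rw [hp]
    exact Nat.pos_of_ne_zero fun h => hx v (hA.isTree.1.dist_eq_zero_iff.1 h).symm
  have hLeven : Even L := by
    rw [hp, even_dist_iff hA.isTree.1 col, hA.col_smul]
  have hL2 : 2 ≤ L := by
    obtain ⟨k, hk⟩ := hLeven
    omega
  -- The line consists of the translates of the geodesic `p` from `v` to `x • v`; the quotient `n /
  -- L` selects the translate.
  let l : ℤ → V := fun n => x ^ (n / L) • p.getVert (n % L).toNat
  have hLz : (L : ℤ) ≠ 0 := by omega
  have hper : ∀ n, x • l n = l (n + L) := by
    intro n
    simp only [l]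
    rw [Int.add_emod_right, Int.add_ediv_of_dvd_right (dvd_refl _), Int.ediv_self hLz, add_comm,
      zpow_add, zpow_one, mul_smul]
  have hperz : ∀ q n : ℤ, l (n + q * L) = x ^ q • l n := by
    intro q
    induction q using Int.induction_on with
    | zero => simp
    | succ q ih =>
      intro n
      rw [add_comm (q : ℤ), zpow_add, zpow_one, mul_smul, ← ih, hper]
      congr 1; ring
    | pred q ih =>
      intro n
      rw [sub_eq_neg_add, zpow_add, zpow_neg_one, mul_smul, ← ih, eq_inv_smul_iff, hper]
      congr 1; ring
  have hsmall : ∀ r : ℕ, r ≤ L → l r = p.getVert r := by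
    intro r hr
    rcases hr.lt_or_eq with h | rfl
    · simp only [l]
      rw [Int.ediv_eq_zero_of_lt (by omega) (by omega), Int.emod_eq_of_lt (by omega) (by omega)]
      simp
    · simp only [l]
      rw [Int.ediv_self hLz, Int.emod_self]
      simp [hLdef]
  have hred : ∀ (P : ℤ → Prop), (∀ q n : ℤ, P n → P (n + q * L)) → (∀ r : ℕ, r < L → P r) →
      ∀ n, P n := by
    intro P hP h0 n
    have h1 := Int.emod_nonneg n hLz
    have h2 := Int.emod_lt_of_pos n (b := L) (by omega)
    have := hP (n / L) _ (h0 (n % L).toNat (by omega))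
    rwa [Int.toNat_of_nonneg h1, mul_comm, Int.emod_add_mul_ediv] at this
  refine ⟨l, L, ⟨hred _ ?_ ?_, hred _ ?_ ?_⟩, hL0, hper⟩
  · intro q n h
    rw [add_right_comm, hperz, hperz]
    exact hA.adj_smul _ h
  · intro r hr
    rw [hsmall r hr.le]
    have := hsmall (r + 1) hr
    push_cast at this
    rw [this]
    exact p.adj_getVert_succ hr
  · intro q n h
    rw [add_right_comm, hperz, hperz]
    exact fun h' => h (smul_left_cancel _ h')
  · intro r hr h
    rw [hsmall r hr.le] at h
    by_cases hr' : r + 2 ≤ L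
    · have := hsmall (r + 2) hr'
      push_cast at this
      rw [this] at h
      have := hpath.getVert_injOn (by simp; omega) (by simp; omega) h
      omega
    · obtain rfl : r = L - 1 := by omega
      rw [show ((L - 1 : ℕ) : ℤ) + 2 = ((1 : ℕ) : ℤ) + L by omega, ← hper,
        hsmall 1 (by omega)] at h
      -- Backtracking at the joint of two translates would mean `x • p 1 = p (L - 1)`, and `p 1`
      -- would be moved by at most `L - 2`.
      have h1 := hv (p.getVert 1)
      simp only [F] at h1
      rw [← h, ← hp] at h1
      have h2 : T.dist (p.getVert 1) (p.getVert (L - 1)) ≤ L - 2 := by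
        have h3 := SimpleGraph.dist_le ((p.drop 1).take (L - 2))
        rw [SimpleGraph.Walk.take_length] at h3
        rw [SimpleGraph.Walk.drop_getVert] at h3
        rw [show L - 1 = 1 + (L - 2) by omega]
        exact h3.trans (min_le_left _ _)
      omega

/-- An element which fixes no vertex and an element commuting with it translate a common line. -/
theorem exists_shift (hA : AcylindricalAction Γ T col) {x y : Γ} {l : ℤ → V} (hl : IsLine T l)
    {L : ℕ} (hL : 0 < L) (hx : ∀ n, x • l n = l (n + L)) (h : Commute y x) :
    ∃ c, ∀ n, y • l n = l (n + c) := by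
  refine hA.line_unique (L' := L) hl (hA.isLine_smul y hl) hL hx fun n => ?_
  rw [← hx, ← mul_smul, ← mul_smul, h.eq]

/-- Shifts of a line commute, so the commutator fixes the line pointwise and is trivial. -/
theorem commute_of_shift (hA : AcylindricalAction Γ T col) {x y : Γ} {l : ℤ → V}
    (hl : IsLine T l) {c d : ℤ} (hx : ∀ n, x • l n = l (n + c)) (hy : ∀ n, y • l n = l (n + d)) :
    Commute x y := by
  have h : (y * x)⁻¹ * (x * y) = 1 := hA.eq_one_of_line hl fun n => by
    rw [mul_smul, inv_smul_eq_iff, mul_smul, mul_smul, hx, hy, hx, hy]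
    congr 1; ring
  exact (inv_mul_eq_one.1 h).symm

/-- If `x` fixes `v`, then `g x g⁻¹` fixes both `v` and `g • v`, and parity forces `g • v = v`.
Otherwise `g` maps the axis of `x` to the axis of `g x g⁻¹`, which is the same line. If `g` shifts
it, `g` commutes with `x`; reversal is excluded by the absence of elements of order two in the
stabilizers. -/
theorem commute_of_conj (hA : AcylindricalAction Γ T col)
    (htor : ∀ (g : Γ) (v : V), g • v = v → g * g = 1 → g = 1)
    (hcc : ∀ (v : V) (x g : Γ), x • v = v → g • v = v → x ≠ 1 →
      Commute (g * x * g⁻¹) x → Commute g x)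
    {x g : Γ} (hx : x ≠ 1) (h : Commute (g * x * g⁻¹) x) : Commute g x := by
  have hy1 : g * x * g⁻¹ ≠ 1 := by rwa [Ne, conj_eq_one_iff]
  by_cases hfix : ∃ v : V, x • v = v
  · obtain ⟨v, hv⟩ := hfix
    have h1 := hA.smul_eq_of_commute hx hv h
    have h2 : (g * x * g⁻¹) • (g • v) = g • v := by simp [mul_smul, hv]
    have h3 := hA.dist_le_one hy1 h1 h2
    have h4 := even_dist_iff hA.isTree.1 col v (g • v)
    rw [hA.col_smul, eq_self_iff_true, iff_true] at h4
    have h5 : T.dist v (g • v) = 0 := by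
      rcases h4 with ⟨k, hk⟩
      omega
    exact hcc v x g hv (hA.isTree.1.dist_eq_zero_iff.1 h5).symm hx h
  push Not at hfix
  obtain ⟨l, L, hl, hL, hxl⟩ := hA.exists_axis x hfix
  obtain ⟨c, hc⟩ := hA.exists_shift hl hL hxl h
  have hgl : ∀ n, (g * x * g⁻¹) • g • l n = g • l (n + L) := by
    intro n
    rw [← mul_smul, inv_mul_cancel_right, mul_smul, hxl]
  rcases lt_trichotomy c 0 with hc0 | rfl | hc0
  -- A negative shift `c` means that `g` reverses the axis. Then `g` has order at most two, and
  -- since it preserves the colours, `d` is even and `g` fixes a vertex of the axis.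
  · obtain ⟨d, hd⟩ := hA.line_unique (x := g * x * g⁻¹) (L := c.natAbs) (L' := L) hl.neg
      (hA.isLine_smul g hl) (by omega) (fun n => by
        rw [hc]; congr 1; omega) hgl
    have hsq : g * g = 1 := hA.eq_one_of_line hl fun n => by
      rw [mul_smul, hd, hd]
      congr 1; ring
    have hev : Even d := by
      have h1 := hA.col_smul g (l 0)
      rw [hd, ← even_dist_iff hA.isTree.1] at h1
      rcases le_total 0 (-(0 + d)) with h2 | h2
      · have h3 := hl.dist_add_self hA.isTree col 0 (-(0 + d)).toNat
        rw [Int.toNat_of_nonneg h2, zero_add] at h3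
        rw [h3] at h1
        obtain ⟨k, hk⟩ := h1
        exact ⟨-k, by omega⟩
      · have h3 := hl.dist_add_self hA.isTree col (-(0 + d)) (0 + d).toNat
        rw [Int.toNat_of_nonneg (by omega), neg_add_cancel, SimpleGraph.dist_comm] at h3
        rw [h3] at h1
        obtain ⟨k, hk⟩ := h1
        exact ⟨k, by omega⟩
    obtain ⟨k, rfl⟩ := hev
    have : g = 1 := htor g (l (-k)) (by rw [hd]; congr 1; ring) hsq
    rw [this]
    exact Commute.one_left x
  · exact absurd (hA.eq_one_of_line hl fun n => by rw [hc, add_zero]) hy1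
  · obtain ⟨d, hd⟩ := hA.line_unique (x := g * x * g⁻¹) (L := c.toNat) (L' := L) hl
      (hA.isLine_smul g hl) (by omega) (fun n => by
        rw [hc]; congr 1; omega) hgl
    exact hA.commute_of_shift hl hd hxl

/-- Elements commuting with `x` fix the vertex that `x` fixes, or else shift the axis of `x`. -/
theorem commute_trans (hA : AcylindricalAction Γ T col)
    (hct : ∀ (v : V) (x y z : Γ), x • v = v → y • v = v → z • v = v → x ≠ 1 →
      Commute y x → Commute z x → Commute y z)
    {x y z : Γ} (hx : x ≠ 1) (hy : Commute y x) (hz : Commute z x) : Commute y z := by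
  by_cases hfix : ∃ v : V, x • v = v
  · obtain ⟨v, hv⟩ := hfix
    exact hct v x y z hv (hA.smul_eq_of_commute hx hv hy) (hA.smul_eq_of_commute hx hv hz) hx hy hz
  push Not at hfix
  obtain ⟨l, L, hl, hL, hxl⟩ := hA.exists_axis x hfix
  obtain ⟨c, hc⟩ := hA.exists_shift hl hL hxl hy
  obtain ⟨d, hd⟩ := hA.exists_shift hl hL hxl hz
  exact hA.commute_of_shift hl hc hd

end AcylindricalAction

end FigureEight

end

noncomputable section

namespace FigureEight

/-! ### The Bass–Serre tree of an amalgamated product of two groups -/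

open Monoid

namespace BassSerre

variable {H : Type*} {G : Bool → Type*} [∀ i, Group (G i)] [Group H] {φ : ∀ i, H →* G i}

/-- The normal form theorem for amalgams: a nonempty reduced word does not represent an element of
the amalgamated subgroup. -/
theorem prod_notMem_range (hφ : ∀ i, Function.Injective (φ i)) {w : List (Σ i, G i)}
    (hw : w ≠ []) (hr : ∀ l ∈ w, l.2 ∉ (φ l.1).range)
    (hc : w.IsChain fun l l' => l.1 ≠ l'.1) :
    (w.map fun l => PushoutI.of (φ := φ) l.1 l.2).prod ∉ (PushoutI.base φ).range := by
  intro h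
  let w' : CoprodI.Word G := ⟨w, fun l hl h1 => hr l hl (h1 ▸ one_mem _), hc⟩
  have h1 : PushoutI.Reduced φ w' := hr
  have h2 : PushoutI.ofCoprodI (φ := φ) w'.prod =
      (w.map fun l => PushoutI.of (φ := φ) l.1 l.2).prod := by
    simp [CoprodI.Word.prod, map_list_prod, w', Function.comp_def]
  have h3 := h1.eq_empty_of_mem_range hφ (h2 ▸ h)
  exact hw (congrArg CoprodI.Word.toList h3)

/-- If the product were an element `k` of the factor, appending `k⁻¹` would give a reduced word for
the identity. -/
theorem prod_notMem_range_of (hφ : ∀ i, Function.Injective (φ i)) {w : List (Σ i, G i)}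
    (hw : w ≠ []) (hr : ∀ l ∈ w, l.2 ∉ (φ l.1).range)
    (hc : w.IsChain fun l l' => l.1 ≠ l'.1) {i : Bool} (hi : ∀ l ∈ w.getLast?, l.1 ≠ i) :
    (w.map fun l => PushoutI.of (φ := φ) l.1 l.2).prod ∉ (PushoutI.of (φ := φ) i).range := by
  rintro ⟨k, hk⟩
  by_cases hk' : k ∈ (φ i).range
  · obtain ⟨p, rfl⟩ := hk'
    rw [PushoutI.of_apply_eq_base] at hk
    exact prod_notMem_range hφ hw hr hc ⟨p, hk⟩
  · refine prod_notMem_range hφ (w := w ++ [⟨i, k⁻¹⟩]) (by simp) ?_ ?_ ?_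
    · intro l hl
      rcases List.mem_append.1 hl with h | h
      · exact hr l h
      · obtain rfl := List.mem_singleton.1 h
        simpa using hk'
    · rw [List.isChain_append]
      refine ⟨hc, by simp, ?_⟩
      intro l hl l' hl'
      simp only [List.head?_cons, Option.mem_def, Option.some.injEq] at hl'
      subst hl'
      exact hi l hl
    · rw [List.map_append, List.prod_append, ← hk]
      simp

variable (φ) in
/-- The vertices of the Bass–Serre tree: the cosets of the two factors. -/
abbrev Vertex : Type _ := Σ i : Bool, PushoutI φ ⧸ (PushoutI.of (φ := φ) i).range

variable (φ) in
/-- The coset of `g` of the factor with index `i`. -/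
def vert (i : Bool) (g : PushoutI φ) : Vertex φ := ⟨i, (g : PushoutI φ ⧸ _)⟩

theorem exists_vert (v : Vertex φ) : ∃ g, v = vert φ v.1 g := by
  obtain ⟨i, q⟩ := v
  obtain ⟨g, rfl⟩ := QuotientGroup.mk_surjective q
  exact ⟨g, rfl⟩

theorem vert_eq {i : Bool} {g h : PushoutI φ} :
    vert φ i g = vert φ i h ↔ g⁻¹ * h ∈ (PushoutI.of (φ := φ) i).range := by
  rw [vert, vert, Sigma.mk.injEq, ← QuotientGroup.eq]
  simp

theorem smul_vert (g h : PushoutI φ) (i : Bool) : g • vert φ i h = vert φ i (g * h) := rfl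

theorem smul_vert_eq {i : Bool} {g h : PushoutI φ} :
    g • vert φ i h = vert φ i h ↔ h⁻¹ * g * h ∈ (PushoutI.of (φ := φ) i).range := by
  rw [smul_vert, eq_comm, vert_eq, mul_assoc]

variable (φ) in
/-- The Bass–Serre tree. -/
def tree : SimpleGraph (Vertex φ) where
  Adj p q := ∃ i g, p = vert φ i g ∧ q = vert φ (!i) g
  symm := ⟨by
    rintro _ _ ⟨i, g, rfl, rfl⟩
    exact ⟨!i, g, rfl, by rw [Bool.not_not]⟩⟩
  loopless := ⟨by
    rintro _ ⟨i, g, rfl, h⟩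
    exact Bool.not_ne_self i (congrArg Sigma.fst h).symm⟩

variable (φ) in
/-- The two-colouring of the Bass–Serre tree. -/
def color : (tree φ).Coloring Bool :=
  SimpleGraph.Coloring.mk Sigma.fst (by
    rintro _ _ ⟨i, g, rfl, rfl⟩
    exact (Bool.not_ne_self i).symm)

theorem adj_fst {p q : Vertex φ} (h : (tree φ).Adj p q) : q.1 = !p.1 := by
  obtain ⟨i, g, rfl, rfl⟩ := h
  rfl

theorem adj_vert {p q : Vertex φ} (h : (tree φ).Adj p q) :
    ∃ g, p = vert φ p.1 g ∧ q = vert φ q.1 g := by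
  obtain ⟨i, g, rfl, rfl⟩ := h
  exact ⟨g, rfl, rfl⟩

theorem tree_adj (i : Bool) (g : PushoutI φ) : (tree φ).Adj (vert φ i g) (vert φ (!i) g) :=
  ⟨i, g, rfl, rfl⟩

theorem reachable_same (i j : Bool) (g : PushoutI φ) :
    (tree φ).Reachable (vert φ i g) (vert φ j g) := by
  by_cases h : i = j
  · rw [h]
  · obtain rfl : j = !i := by revert i j; decide
    exact (tree_adj i g).reachable

/-- Multiplying on the right by an element of one factor fixes one end of an edge, and such elements
generate. -/
theorem tree_connected : (tree φ).Connected := by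
  have step : ∀ g h : PushoutI φ, (tree φ).Reachable (vert φ false h) (vert φ false (h * g)) := by
    intro g
    have hof : ∀ i (k : G i) h, (tree φ).Reachable (vert φ false h)
        (vert φ false (h * PushoutI.of i k)) := by
      intro i k h
      have : vert φ i h = vert φ i (h * PushoutI.of i k) := by
        rw [vert_eq]
        exact ⟨k, by group⟩
      refine (reachable_same false i h).trans ?_
      rw [this]
      exact reachable_same i false _
    induction g using PushoutI.induction_on with
    | of i k => exact hof i k
    | base p =>
      intro h
      rw [← PushoutI.of_apply_eq_base φ false]
      exact hof _ _ _
    | mul x y hx hy =>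
      intro h
      rw [← mul_assoc]
      exact (hx h).trans (hy _)
  have : Nonempty (Vertex φ) := ⟨vert φ false 1⟩
  refine SimpleGraph.connected_iff_exists_forall_reachable _ |>.2 ⟨vert φ false 1, fun v => ?_⟩
  obtain ⟨g, hg⟩ := exists_vert v
  rw [hg]
  have := step g 1
  rw [one_mul] at this
  exact this.trans (reachable_same _ _ _)

/-- Consecutive edges of a cycle differ by an element of the factor at their common vertex, and this
element is outside the amalgamated subgroup because the cycle does not backtrack. The resulting
reduced word would represent an element of the factor at the starting vertex. -/
theorem tree_isAcyclic (hφ : ∀ i, Function.Injective (φ i)) : (tree φ).IsAcyclic := by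
  intro v c hc
  have h3 := hc.three_le_length
  have hadj : ∀ m, m < c.length → (tree φ).Adj (c.getVert m) (c.getVert (m + 1)) :=
    fun m hm => c.adj_getVert_succ hm
  -- `e m` is a group element that represents the `m`-th edge; beyond the end of the cycle it has
  -- the dummy value `1`.
  have he : ∀ m, ∃ e, m < c.length →
      c.getVert m = vert φ (c.getVert m).1 e ∧ c.getVert (m + 1) = vert φ (c.getVert (m + 1)).1 e := by
    intro m
    by_cases hm : m < c.length
    · obtain ⟨g, hg⟩ := adj_vert (hadj m hm)
      exact ⟨g, fun _ => hg⟩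
    · exact ⟨1, fun h => absurd h hm⟩
  choose e he using he
  have key : ∀ j, j < c.length → ∃ w : List (Σ i, G i), w.length = j ∧
      (∀ l ∈ w, l.2 ∉ (φ l.1).range) ∧ (w.IsChain fun l l' => l.1 ≠ l'.1) ∧
      (∀ l ∈ w.getLast?, l.1 = (c.getVert j).1) ∧
      (w.map fun l => PushoutI.of (φ := φ) l.1 l.2).prod = (e 0)⁻¹ * e j := by
    intro j
    induction j with
    | zero => exact fun _ => ⟨[], by simp⟩
    | succ j ih =>
      intro hj
      obtain ⟨w, hlen, hr, hch, hlast, hprod⟩ := ih (by omega)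
      have h1 := (he j (by omega)).2
      have h2 := (he (j + 1) hj).1
      obtain ⟨k, hk⟩ : (e j)⁻¹ * e (j + 1) ∈
          (PushoutI.of (φ := φ) (c.getVert (j + 1)).1).range := by
        rw [← vert_eq, ← h1, ← h2]
      refine ⟨w ++ [⟨(c.getVert (j + 1)).1, k⟩], by simp [hlen], ?_, ?_, ?_, ?_⟩
      · intro l hl
        rcases List.mem_append.1 hl with h | h
        · exact hr l h
        obtain rfl := List.mem_singleton.1 h
        rintro ⟨p, hp⟩
        dsimp only at hp
        rw [← hp, PushoutI.of_apply_eq_base] at hk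
        have h4 : c.getVert j = c.getVert (j + 2) := by
          rw [(he j (by omega)).1, (he (j + 1) hj).2]
          rw [adj_fst (hadj (j + 1) hj), adj_fst (hadj j (by omega)), Bool.not_not, vert_eq, ← hk,
            ← PushoutI.of_apply_eq_base φ (c.getVert j).1]
          exact ⟨_, rfl⟩
        rcases Nat.eq_zero_or_pos j with rfl | hj0
        · have := hc.getVert_injOn' (by simp) (by simp; omega) h4
          omega
        · have := hc.getVert_injOn (by simp; omega) (by simp; omega) h4
          omega
      · rw [List.isChain_append]
        refine ⟨hch, by simp, ?_⟩
        intro l hl l' hl'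
        simp only [List.head?_cons, Option.mem_def, Option.some.injEq] at hl'
        subst hl'
        rw [hlast l hl]
        exact fun h => Bool.not_ne_self _ ((adj_fst (hadj j (by omega))).symm.trans h.symm)
      · intro l hl
        simp only [List.getLast?_append, List.getLast?_singleton, Option.some_or, Option.mem_def,
          Option.some.injEq] at hl
        rw [← hl]
      · rw [List.map_append, List.prod_append, hprod]
        simp only [List.map_cons, List.map_nil, List.prod_cons, List.prod_nil, mul_one]
        rw [hk]
        group
  -- One letter for each vertex of the cycle except the starting vertex, whose factor contains the
  -- product of these letters.
  obtain ⟨w, hlen, hr, hch, hlast, hprod⟩ := key (c.length - 1) (by omega)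
  have hend : c.getVert (c.length - 1 + 1) = v := by
    rw [Nat.sub_add_cancel (by omega), c.getVert_length]
  refine prod_notMem_range_of hφ (w := w) (i := v.1) ?_ hr hch ?_ ?_
  · rintro rfl
    simp at hlen
    omega
  · intro l hl h
    rw [hlast l hl] at h
    have := adj_fst (hadj (c.length - 1) (by omega))
    rw [hend, h] at this
    exact Bool.not_ne_self _ this.symm
  · rw [hprod, ← vert_eq]
    have h1 := (he 0 (by omega)).1
    have h2 := (he (c.length - 1) (by omega)).2
    rw [c.getVert_zero] at h1
    rw [hend] at h2
    rw [← h1, ← h2]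

/-- An element that fixes a path of length two lies in two conjugates of the amalgamated subgroup,
which differ by an element `k` of the middle factor outside of that subgroup; malnormality makes it
trivial. -/
theorem action (hφ : ∀ i, Function.Injective (φ i))
    (hm : ∀ i (k : G i) (p : H), p ≠ 1 → k * φ i p * k⁻¹ ∈ (φ i).range → k ∈ (φ i).range) :
    AcylindricalAction (PushoutI φ) (tree φ) (color φ) where
  isTree := ⟨tree_connected, tree_isAcyclic hφ⟩
  adj_smul := by
    rintro g _ _ ⟨i, h, rfl, rfl⟩
    exact ⟨i, g * h, rfl, rfl⟩
  col_smul _ _ := rfl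
  eq_one_of_path := by
    rintro g _ _ w ⟨i, a, rfl, rfl⟩ hw hne hu hv hw'
    have hi : w.1 = i := by simpa [vert] using adj_fst hw
    obtain ⟨b, hb, hb'⟩ := adj_vert hw
    rw [hi] at hb'
    subst hb'
    change vert φ (!i) a = vert φ (!i) b at hb
    have hb2 : g • vert φ (!i) b = vert φ (!i) b := by rw [← hb, hv]
    obtain ⟨k, hk⟩ := vert_eq.1 hb
    rw [smul_vert_eq] at hu hv hw' hb2
    have hij : i ≠ !i := (Bool.not_ne_self i).symm
    obtain ⟨p, hp⟩ : a⁻¹ * g * a ∈ (PushoutI.base φ).range := by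
      rw [← PushoutI.inf_of_range_eq_base_range hφ hij]
      exact ⟨hu, hv⟩
    obtain ⟨q, hq⟩ : b⁻¹ * g * b ∈ (PushoutI.base φ).range := by
      rw [← PushoutI.inf_of_range_eq_base_range hφ hij]
      exact ⟨hw', hb2⟩
    have hkr : k ∉ (φ (!i)).range := by
      rintro ⟨r, rfl⟩
      rw [PushoutI.of_apply_eq_base] at hk
      refine hne (vert_eq.2 ?_)
      rw [← hk, ← PushoutI.of_apply_eq_base φ i]
      exact ⟨_, rfl⟩
    have hp1 : p = 1 := by
      by_contra hp1
      refine hkr (inv_mem_iff.1 (hm (!i) k⁻¹ p hp1 ⟨q, ?_⟩))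
      apply PushoutI.of_injective hφ (!i)
      simp only [inv_inv, map_mul, map_inv, PushoutI.of_apply_eq_base]
      rw [hk, hp, hq]
      group
    rw [hp1, map_one] at hp
    calc g = a * (a⁻¹ * g * a) * a⁻¹ := by group
      _ = 1 := by rw [← hp]; group

/-- Vertex stabilizers are conjugates of the factors, which carries the hypotheses on the factors to
them. -/
theorem exists_of_smul_eq {g : PushoutI φ} {i : Bool} {h : PushoutI φ}
    (hg : g • vert φ i h = vert φ i h) : ∃ k : G i, g = h * PushoutI.of i k * h⁻¹ := by
  obtain ⟨k, hk⟩ := smul_vert_eq.1 hg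
  exact ⟨k, by rw [hk]; group⟩

theorem commute_of_conj (hφ : ∀ i, Function.Injective (φ i))
    (hm : ∀ i (k : G i) (p : H), p ≠ 1 → k * φ i p * k⁻¹ ∈ (φ i).range → k ∈ (φ i).range)
    (htor : ∀ i (x : G i), x * x = 1 → x = 1)
    (hcc : ∀ i (x g : G i), x ≠ 1 → Commute (g * x * g⁻¹) x → Commute g x)
    {x g : PushoutI φ} (hx : x ≠ 1) (h : Commute (g * x * g⁻¹) x) : Commute g x := by
  refine (action hφ hm).commute_of_conj ?_ ?_ hx h
  · intro g v hv hg
    obtain ⟨a, ha⟩ := exists_vert v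
    rw [ha] at hv
    obtain ⟨k, rfl⟩ := exists_of_smul_eq hv
    rw [conj_mul, conj_eq_one_iff, ← map_mul] at hg
    rw [htor _ k (PushoutI.of_injective hφ _ (hg.trans (map_one _).symm))]
    simp
  · intro v x g hx hg hx1 h
    obtain ⟨a, ha⟩ := exists_vert v
    rw [ha] at hx hg
    obtain ⟨k, rfl⟩ := exists_of_smul_eq hx
    obtain ⟨l, rfl⟩ := exists_of_smul_eq hg
    rw [Ne, conj_eq_one_iff] at hx1
    rw [Commute.conj_iff]
    have e : a * PushoutI.of (φ := φ) v.1 l * a⁻¹ * (a * PushoutI.of v.1 k * a⁻¹) *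
        (a * PushoutI.of v.1 l * a⁻¹)⁻¹ = a * PushoutI.of v.1 (l * k * l⁻¹) * a⁻¹ := by
      simp only [map_mul, map_inv]
      group
    rw [e, Commute.conj_iff] at h
    refine (hcc _ k l (fun hk => hx1 (by rw [hk, map_one])) ?_).map _
    exact Commute.of_map (PushoutI.of_injective hφ _) h

theorem commute_trans (hφ : ∀ i, Function.Injective (φ i))
    (hm : ∀ i (k : G i) (p : H), p ≠ 1 → k * φ i p * k⁻¹ ∈ (φ i).range → k ∈ (φ i).range)
    (hct : ∀ i (x y z : G i), x ≠ 1 → Commute y x → Commute z x → Commute y z)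
    {x y z : PushoutI φ} (hx : x ≠ 1) (hy : Commute y x) (hz : Commute z x) : Commute y z := by
  refine (action hφ hm).commute_trans ?_ hx hy hz
  intro v x y z hx hy hz hx1 hyx hzx
  obtain ⟨a, ha⟩ := exists_vert v
  rw [ha] at hx hy hz
  obtain ⟨k, rfl⟩ := exists_of_smul_eq hx
  obtain ⟨l, rfl⟩ := exists_of_smul_eq hy
  obtain ⟨m, rfl⟩ := exists_of_smul_eq hz
  rw [Ne, conj_eq_one_iff] at hx1
  rw [Commute.conj_iff] at hyx hzx ⊢
  have inj {x y : G v.1} (h : Commute (PushoutI.of (φ := φ) v.1 x) (PushoutI.of v.1 y)) :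
      Commute x y := Commute.of_map (PushoutI.of_injective hφ _) h
  exact (hct _ k l m (fun hk => hx1 (by rw [hk, map_one])) (inj hyx) (inj hzx)).map _

end BassSerre

/-! ### CSA and CT from properties of commuting elements -/

theorem isCT_of_commute_trans {Γ : Type*} [Group Γ]
    (h : ∀ x y z : Γ, x ≠ 1 → Commute y x → Commute z x → Commute y z) : IsCT Γ :=
  fun x y z _ hy _ hxy hyz => h y x z hy hxy hyz.symm

/-- A maximal abelian subgroup is the centralizer of each of its nontrivial elements. -/
theorem isCSA_of_commute_of_conj {Γ : Type*} [Group Γ]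
    (hct : ∀ x y z : Γ, x ≠ 1 → Commute y x → Commute z x → Commute y z)
    (hcc : ∀ x g : Γ, x ≠ 1 → Commute (g * x * g⁻¹) x → Commute g x) : IsCSA Γ := by
  intro M hM g hg x hx hgx
  by_contra hx1
  have hgc : Commute g x := hcc x g hx1 (hM.1 _ hgx _ hx)
  let C : Subgroup Γ := Subgroup.centralizer {x}
  have hC : ∀ a ∈ C, Commute a x := fun a ha => (Subgroup.mem_centralizer_iff.1 ha x rfl).symm
  have hle : M ≤ C := fun a ha => Subgroup.mem_centralizer_iff.2 fun y hy => by
    rw [Set.mem_singleton_iff.1 hy]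
    exact hM.1 _ hx _ ha
  have := hM.2 (y := C) (fun a ha b hb => hct x a b hx1 (hC a ha) (hC b hb)) hle
  refine hg (this (Subgroup.mem_centralizer_iff.2 fun y hy => ?_))
  rw [Set.mem_singleton_iff.1 hy]
  exact hgc.symm

end FigureEight

end

noncomputable section

namespace FigureEight

/-! ### Representations of the figure-eight group in `SL(2, ℂ)` -/

/-- The group `SL(2, ℂ)`. -/
abbrev SL2 : Type := Matrix.SpecialLinearGroup (Fin 2) ℂ

namespace SL2

/-- The trace of an element of `SL(2, ℂ)`. -/
def tr (X : SL2) : ℂ := X.1.trace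

theorem tr_eq (X : SL2) : tr X = X.1 0 0 + X.1 1 1 := Matrix.trace_fin_two _

theorem tr_one : tr 1 = 2 := by
  rw [tr_eq]; norm_num

theorem tr_mul_comm (X Y : SL2) : tr (X * Y) = tr (Y * X) := Matrix.trace_mul_comm _ _

theorem tr_inv (X : SL2) : tr X⁻¹ = tr X := by
  rw [tr_eq, tr_eq, Matrix.SpecialLinearGroup.coe_inv, Matrix.adjugate_fin_two]
  simp [add_comm]

/-- Cayley–Hamilton in the form `Y + Y⁻¹ = tr Y`. -/
theorem tr_mul (X Y : SL2) : tr (X * Y) = tr X * tr Y - tr (X * Y⁻¹) := by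
  simp only [tr_eq, Matrix.SpecialLinearGroup.coe_mul, Matrix.SpecialLinearGroup.coe_inv,
    Matrix.adjugate_fin_two, Matrix.mul_apply, Fin.sum_univ_two]
  simp
  ring

theorem tr_conj (X Y : SL2) : tr (X * Y * X⁻¹) = tr Y := by
  rw [tr_mul_comm, inv_mul_cancel_left]

theorem tr_conj' (X Y : SL2) : tr (X⁻¹ * Y * X) = tr Y := by
  rw [tr_mul_comm, mul_inv_cancel_left]

theorem tr_sq (X : SL2) : tr (X * X) = tr X ^ 2 - 2 := by
  rw [tr_mul, mul_inv_cancel, tr_one, sq]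

/-- Fricke's identity, by repeated use of `tr_mul`. -/
theorem tr_commutator (A B : SL2) : tr (A⁻¹ * B⁻¹ * A * B) =
    tr A ^ 2 + tr B ^ 2 + tr (A * B) ^ 2 - tr A * tr B * tr (A * B) - 2 := by
  have h1 : tr (A⁻¹ * B⁻¹) = tr (A * B) := by
    rw [← mul_inv_rev, tr_inv, tr_mul_comm]
  have h2 : tr (B * A⁻¹) = tr A * tr B - tr (A * B) := by
    rw [tr_mul B, tr_inv, inv_inv, tr_mul_comm B A]; ring
  have h3 := tr_mul (A⁻¹ * B⁻¹ * A) B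
  have h4 := tr_mul (A⁻¹ * B⁻¹) (A * B⁻¹)
  have h5 : tr (A * B⁻¹) = tr (B * A⁻¹) := by
    rw [← tr_inv, mul_inv_rev, inv_inv]
  rw [h5, h1, h2, show A⁻¹ * B⁻¹ * (A * B⁻¹)⁻¹ = (A * A)⁻¹ by group, tr_inv, tr_sq,
    ← mul_assoc] at h4
  rw [tr_conj', tr_inv] at h3
  rw [h3, h4]
  ring

theorem coe_add_inv (X : SL2) : X.1 + (X⁻¹).1 = tr X • (1 : Matrix (Fin 2) (Fin 2) ℂ) := by
  rw [tr_eq, Matrix.SpecialLinearGroup.coe_inv, Matrix.adjugate_fin_two]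
  ext i j
  fin_cases i <;> fin_cases j <;> simp [add_comm]

/-- Traceless matrices which commute are proportional. -/
theorem exists_smul_of_commute {D E : Matrix (Fin 2) (Fin 2) ℂ} (hD : D.trace = 0)
    (hE : E.trace = 0) (hD0 : D ≠ 0) (h : D * E = E * D) : ∃ c : ℂ, E = c • D := by
  rw [Matrix.trace_fin_two] at hD hE
  have hD' : D 1 1 = -D 0 0 := by linear_combination hD
  have hE' : E 1 1 = -E 0 0 := by linear_combination hE
  have h00 := congrFun (congrFun h 0) 0
  have h01 := congrFun (congrFun h 0) 1
  have h10 := congrFun (congrFun h 1) 0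
  simp only [Matrix.mul_apply, Fin.sum_univ_two, hD', hE'] at h00 h01 h10
  have h1 : D 0 1 * E 1 0 = E 0 1 * D 1 0 := by linear_combination h00
  have h2 : D 0 0 * E 0 1 = E 0 0 * D 0 1 := by linear_combination h01 / 2
  have h3 : D 1 0 * E 0 0 = E 1 0 * D 0 0 := by linear_combination h10 / 2
  have build : ∀ c : ℂ, E 0 0 = c * D 0 0 → E 0 1 = c * D 0 1 → E 1 0 = c * D 1 0 →
      E = c • D := by
    intro c h1 h2 h3
    ext i j
    fin_cases i <;> fin_cases j <;> simp [h1, h2, h3, hE', hD']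
  by_cases d00 : D 0 0 = 0
  · by_cases d01 : D 0 1 = 0
    · by_cases d10 : D 1 0 = 0
      · exact absurd (by ext i j; fin_cases i <;> fin_cases j <;> simp [d00, d01, d10, hD']) hD0
      · refine ⟨E 1 0 / D 1 0, build _ ?_ ?_ ?_⟩ <;> field_simp
        · linear_combination h3
        · linear_combination -h1
    · refine ⟨E 0 1 / D 0 1, build _ ?_ ?_ ?_⟩ <;> field_simp
      · linear_combination -h2
      · linear_combination h1
  · refine ⟨E 0 0 / D 0 0, build _ ?_ ?_ ?_⟩ <;> field_simp
    · linear_combination h2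
    · linear_combination -h3

/-- The matrix `X - X⁻¹`. -/
def skew (X : SL2) : Matrix (Fin 2) (Fin 2) ℂ := X.1 - (X⁻¹).1

theorem trace_skew (X : SL2) : (skew X).trace = 0 := by
  rw [skew, Matrix.trace_sub]
  exact sub_eq_zero.2 (tr_inv X).symm

theorem skew_mul_skew (X : SL2) :
    skew X * skew X = (tr X ^ 2 - 4) • (1 : Matrix (Fin 2) (Fin 2) ℂ) := by
  have h := coe_add_inv X
  have h1 : X.1 * (X⁻¹).1 = 1 := by
    rw [← Matrix.SpecialLinearGroup.coe_mul, mul_inv_cancel]; rfl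
  have h2 : (X⁻¹).1 * X.1 = 1 := by
    rw [← Matrix.SpecialLinearGroup.coe_mul, inv_mul_cancel]; rfl
  have h3 : skew X * skew X = (X.1 + (X⁻¹).1) * (X.1 + (X⁻¹).1) -
      (4 : ℂ) • 1 := by
    rw [skew, mul_sub, sub_mul, sub_mul, mul_add, add_mul, add_mul, h1, h2]
    module
  rw [h3, h]
  ext i j
  fin_cases i <;> fin_cases j <;> simp [sq]

theorem skew_mul_comm {X Y : SL2} (h : Commute X Y) : skew X * skew Y = skew Y * skew X := by
  have e : ∀ {X Y : SL2}, Commute X Y → X.1 * Y.1 = Y.1 * X.1 := fun h => congrArg Subtype.val h.eq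
  rw [skew, skew, mul_sub, sub_mul, sub_mul, mul_sub, sub_mul, sub_mul, e h, e h.inv_left,
    e h.inv_right, e h.inv_left.inv_right]
  abel

theorem trace_skew_mul (X Y : SL2) : (skew X * Y.1).trace = tr (X * Y) - tr (X⁻¹ * Y) := by
  rw [skew, sub_mul, Matrix.trace_sub]
  rfl

theorem skew_inv (X : SL2) : skew X⁻¹ = -skew X := by
  rw [skew, skew, inv_inv, neg_sub]

theorem two_smul_coe (X : SL2) :
    (2 : ℂ) • X.1 = tr X • (1 : Matrix (Fin 2) (Fin 2) ℂ) + skew X := by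
  rw [← coe_add_inv, skew, two_smul]
  abel

theorem eq_of_tr_of_skew {X Y : SL2} (h : tr X = tr Y) (h' : skew X = skew Y) : X = Y := by
  apply Subtype.ext
  have h1 := two_smul_coe X
  rw [h, h', ← two_smul_coe] at h1
  exact smul_right_injective _ two_ne_zero h1

/-- If the commutator of `A` and `B` has trace `2`, then it commutes with its conjugate by `A`. -/
theorem commute_of_tr_commutator {A B C : SL2} (hC : C = A⁻¹ * B⁻¹ * A * B) (h : tr C = 2) :
    Commute (A * C * A⁻¹) C := by
  -- The product is conjugate to the commutator of `A * A` and `B`, so Fricke's identity gives its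
  -- trace.
  have h1 : tr (C * (A * C * A⁻¹)) = 2 := by
    have e : C * (A * C * A⁻¹) = A * ((A * A)⁻¹ * B⁻¹ * (A * A) * B) * A⁻¹ := by
      rw [hC]; group
    have e2 : tr (A * A * B) = tr (A * B) * tr A - tr B := by
      rw [mul_assoc, tr_mul_comm, tr_mul, tr_mul_comm _ A⁻¹, tr_mul_comm A B, tr_mul_comm B A,
        inv_mul_cancel_left]
    rw [e, tr_conj, tr_commutator, tr_sq, e2]
    rw [hC, tr_commutator] at h
    linear_combination (tr A ^ 2) * h
  have h2 : tr (A * C * A⁻¹) = 2 := by rw [tr_conj, h]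
  generalize A * C * A⁻¹ = E at h1 h2 ⊢
  have dC := Matrix.det_fin_two C.1
  have dE := Matrix.det_fin_two E.1
  rw [C.2] at dC
  rw [E.2] at dE
  rw [tr_eq] at h h1 h2
  simp only [Matrix.SpecialLinearGroup.coe_mul, Matrix.mul_apply, Fin.sum_univ_two] at h1
  have hC1 : C.1 1 1 = 2 - C.1 0 0 := by linear_combination h
  have hE1 : E.1 1 1 = 2 - E.1 0 0 := by linear_combination h2
  rw [hC1] at dC h1
  rw [hE1] at dE h1
  set p := C.1 0 0
  set q := C.1 0 1
  set r := C.1 1 0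
  set p' := E.1 0 0
  set q' := E.1 0 1
  set r' := E.1 1 0
  -- `C - 1` and `E - 1` are nilpotent and the trace of their product vanishes. So their entries are
  -- proportional, which is expressed by vanishing minors, and the matrices commute.
  have a1 : ((p - 1) * q' - (p' - 1) * q) ^ 2 = 0 := by
    linear_combination q' ^ 2 * dC + q ^ 2 * dE - q * q' * h1
  have a2 : ((p - 1) * r' - (p' - 1) * r) ^ 2 = 0 := by
    linear_combination r' ^ 2 * dC + r ^ 2 * dE - r * r' * h1
  have a3 : (q * r' - r * q') ^ 2 = 0 := by
    linear_combination (q * r' + r * q' - 2 * (p - 1) * (p' - 1)) * h1 +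
      4 * (p - 1) ^ 2 * dE - 4 * q' * r' * dC
  rw [sq_eq_zero_iff] at a1 a2 a3
  apply Subtype.ext
  change E.1 * C.1 = C.1 * E.1
  ext i j
  fin_cases i <;> fin_cases j <;>
    simp only [Matrix.mul_apply, Fin.sum_univ_two, hC1, hE1, Fin.zero_eta, Fin.mk_one]
  · linear_combination -a3
  · linear_combination -2 * a1
  · linear_combination 2 * a2
  · linear_combination a3

/-! ### Trace relations between the meridian and the longitude. -/

/-- The relations of the figure-eight knot group on the matrices of `a`, `b` and the meridian. -/
structure KnotRep (A B T C : SL2) : Prop where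
  conjA : T * A * T⁻¹ = A * B * A
  conjB : T * B * T⁻¹ = A * B
  comm : C = A⁻¹ * B⁻¹ * A * B
  trace_ne : tr C ≠ 2
  ne_inv : C ≠ C⁻¹

theorem commute_iff_conj {A B T : SL2} (hA : T * A * T⁻¹ = A * B * A) (hB : T * B * T⁻¹ = A * B) :
    Commute T (A⁻¹ * B⁻¹ * A * B) := by
  have h : T * (A⁻¹ * B⁻¹ * A * B) * T⁻¹ = A⁻¹ * B⁻¹ * A * B := by
    have e : T * (A⁻¹ * B⁻¹ * A * B) * T⁻¹ =
        (T * A * T⁻¹)⁻¹ * (T * B * T⁻¹)⁻¹ * (T * A * T⁻¹) * (T * B * T⁻¹) := by group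
    rw [e, hA, hB]
    group
  exact mul_inv_eq_iff_eq_mul.1 h

namespace KnotRep

variable {A B T C : SL2}

theorem tr_mul_eq (h : KnotRep A B T C) : tr (A * B) = tr B := by
  rw [← h.conjB, tr_conj]

/-- Both `A B A` and `A` are conjugate under `T`, and `tr (A B) = tr B`. -/
theorem add_eq_mul (h : KnotRep A B T C) : tr A + tr B = tr A * tr B := by
  have h1 : tr (A * B * A) = tr A := by rw [← h.conjA, tr_conj]
  rw [tr_mul, tr_conj, h.tr_mul_eq] at h1
  linear_combination -h1

theorem tr_comm (h : KnotRep A B T C) :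
    tr C = (tr A + tr B) ^ 2 - 3 * (tr A + tr B) - 2 := by
  rw [h.comm, tr_commutator, h.tr_mul_eq]
  have := h.add_eq_mul
  linear_combination (3 + tr B) * this

/-- Moving `T` across `A` and `B` by the relations gives the equations `r1`, `r2`, `r3`, linear in
`tr T`, `tr (T * A)` and `tr (T * B)`; they are solved with `tr A + tr B = tr A * tr B`. -/
theorem tr_mul_left (h : KnotRep A B T C) :
    tr (T * A) = (tr A - 1) * tr T ∧ tr (T * B) = (tr B - 1) * tr T := by
  have hz := h.tr_mul_eq
  have hs := h.add_eq_mul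
  have r1 : tr (T * A) = tr (T * A) * tr (A * B) - (tr T * tr B - tr (T * B)) := by
    have e1 : T * A = A * B * A * T := by rw [← h.conjA]; group
    have e2 : tr (A * B * A * T) = tr ((A * T) * (A * B)) := by
      rw [tr_mul_comm (A * T)]; simp only [mul_assoc]
    have e3 : A * T * (A * B)⁻¹ = A * (T * B⁻¹) * A⁻¹ := by group
    have e4 := tr_mul T B⁻¹
    rw [inv_inv, tr_inv] at e4
    have e5 := tr_mul (A * T) (A * B)
    rw [e3, tr_conj, e4, tr_mul_comm A T, ← e2, ← e1] at e5
    rw [← e5]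
  have r2 : tr (T * B) = tr (T * (A * B)) := by
    have e1 : T * B = A * B * T := by rw [← h.conjB]; group
    rw [e1, tr_mul_comm]
  have r3 : tr T = tr (T * B) * tr A - (tr T * tr A - tr (T * A)) * tr B +
      tr T * tr (A * B) - tr (T * (A * B)) := by
    have e1 : T * A = A * B * A * T := by rw [← h.conjA]; group
    have e2 : tr T = tr (T * B * A) := by
      have : B * A * T = A⁻¹ * T * A := by rw [mul_assoc A⁻¹, e1]; group
      rw [mul_assoc, tr_mul_comm, this, tr_conj']
    have e3 := tr_mul (T * B) A
    have e4 := tr_mul (A⁻¹ * T) B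
    have e5 := tr_mul A⁻¹ T⁻¹
    have e6 := tr_mul T (A * B)
    have e7 : tr (A⁻¹ * T * B⁻¹) = tr (T * (A * B)⁻¹) := by
      rw [mul_assoc, tr_mul_comm, mul_inv_rev, mul_assoc]
    have e8 : tr (A⁻¹ * T⁻¹) = tr (T * A) := by rw [← mul_inv_rev, tr_inv]
    rw [inv_inv, tr_inv, tr_inv, e8] at e5
    have e9 : tr (T * B * A⁻¹) = tr (A⁻¹ * T * B) := by rw [tr_mul_comm, mul_assoc]
    rw [← e2] at e3
    linear_combination e3 - e9 - e4 + e7 + e6 + (-tr B) * e5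
  rw [hz] at r1 r3
  rw [← r2] at r3
  generalize tr (T * A) = u1 at *
  generalize tr (T * B) = u2 at *
  generalize tr T = u0 at *
  generalize tr A = x at *
  generalize tr B = y at *
  have hu1 : (y - 1) * u1 = u0 := by
    linear_combination -r3 - (1 - x) * r1 - u1 * hs
  have hu1' : u1 = (x - 1) * u0 := by
    linear_combination (x - 1) * hu1 + u1 * hs
  refine ⟨hu1', ?_⟩
  linear_combination -r1 - hu1

/-- If the sum vanishes, then so do the traces of `A`, `B` and `A B`. These matrices have square
`-1`, so they generate the quaternion group and the commutator equals its inverse. -/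
theorem add_ne_zero (h : KnotRep A B T C) : tr A + tr B ≠ 0 := by
  intro h0
  have hs := h.add_eq_mul
  have hx : tr A = 0 := by
    have : tr A ^ 2 = 0 := by linear_combination tr A * h0 - h0 + hs
    exact pow_eq_zero_iff two_ne_zero |>.1 this
  have hy : tr B = 0 := by linear_combination h0 - hx
  have hz : tr (A * B) = 0 := h.tr_mul_eq.trans hy
  have key : ∀ X : SL2, tr X = 0 → (X * X).1 = -1 := by
    intro X hX
    have h1 := coe_add_inv X
    rw [hX, zero_smul] at h1
    have h2 : X.1 * (X⁻¹).1 = 1 := by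
      rw [← Matrix.SpecialLinearGroup.coe_mul, mul_inv_cancel]; rfl
    rw [eq_neg_of_add_eq_zero_right h1, mul_neg] at h2
    rw [Matrix.SpecialLinearGroup.coe_mul, ← h2, neg_neg]
  have hAB : A * B * (A * B) = A * A := Subtype.ext ((key _ hz).trans (key _ hx).symm)
  have hBB : B * B = A * A := Subtype.ext ((key _ hy).trans (key _ hx).symm)
  have hAA : A * A * (A * A) = 1 := by
    apply Subtype.ext
    rw [Matrix.SpecialLinearGroup.coe_mul, key _ hx]
    simp
  refine h.ne_inv ?_
  have e1 : A * B = A * A * (A * B)⁻¹ := by rw [← hAB]; group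
  have e2 : C = (A * A)⁻¹ := by
    calc C = A⁻¹ * B⁻¹ * (A * B) := by rw [h.comm]; group
      _ = A⁻¹ * B⁻¹ * (B * B * (A * B)⁻¹) := by rw [hBB, ← e1]
      _ = (A * A)⁻¹ := by group
  rw [e2, inv_inv]
  exact inv_eq_of_mul_eq_one_left hAA

/-- The traces of the meridian and of the commutator determine each other, and the longitude is
determined by the meridian up to inversion. -/
theorem skew_eq (h : KnotRep A B T C) : ∃ c : ℂ, c ≠ 0 ∧ tr T ≠ 0 ∧
    skew T = c • skew C ∧ tr T ^ 2 = tr A + tr B + 1 ∧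
    c ^ 2 * ((tr T ^ 2 - 1) * (tr T ^ 2 - 5) * (tr T ^ 2) ^ 2) = tr T ^ 2 := by
  have hs0 := h.add_ne_zero
  have hs := h.add_eq_mul
  have hk := h.tr_comm
  have hk2 := h.trace_ne
  obtain ⟨hTA, -⟩ := h.tr_mul_left
  have hcomm : Commute T C := by
    rw [h.comm]; exact commute_iff_conj h.conjA h.conjB
  have hC0 : skew C ≠ 0 := by
    intro h0
    exact h.ne_inv (Subtype.ext (sub_eq_zero.1 h0))
  obtain ⟨c, hc⟩ := exists_smul_of_commute (trace_skew C) (trace_skew T) hC0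
    (skew_mul_comm hcomm.symm)
  have hCA : tr (C * A) = tr A := by
    have : C * A = (B * A)⁻¹ * A * (B * A) := by rw [h.comm]; group
    rw [this, tr_conj']
  have hCA' : tr (C⁻¹ * A) = tr A * tr C - tr A := by
    have e1 := tr_mul A C⁻¹
    rw [inv_inv, tr_inv, tr_mul_comm A C, hCA, tr_mul_comm] at e1
    exact e1
  have hdet := skew_mul_skew T
  have hdetC := skew_mul_skew C
  -- The proportionality of `skew T` and `skew C` is tested against `A` under the trace, giving
  -- `e1`, and squared, giving `e3`.
  have e1 : tr (T * A) - tr (T⁻¹ * A) = c * (tr A * (2 - tr C)) := by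
    rw [← trace_skew_mul, hc, Matrix.smul_mul, Matrix.trace_smul, trace_skew_mul, hCA, hCA',
      smul_eq_mul]
    ring
  have e2 : tr (T⁻¹ * A) = tr A * tr T - tr (T * A) := by
    rw [tr_mul_comm, tr_mul, inv_inv, tr_inv, tr_mul_comm A T]
  have e3 : (tr T ^ 2 - 4) = c ^ 2 * (tr C ^ 2 - 4) := by
    rw [hc, smul_mul_smul_comm, hdetC, smul_smul] at hdet
    have := congrFun (congrFun hdet 0) 0
    simp at this
    linear_combination -this
  rw [e2, hTA, hk] at e1
  rw [hk] at e3 hk2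
  generalize tr T = t at *
  generalize tr A = x at *
  generalize tr B = y at *
  -- With `s = x + y`, `tr C - 2 = (s - 4) (s + 1)`, so neither factor vanishes.
  have hs4 : x + y - 4 ≠ 0 := by
    intro h0
    apply hk2
    linear_combination (x + y + 1) * h0
  have hs1 : x + y + 1 ≠ 0 := by
    intro h0
    apply hk2
    linear_combination (x + y - 4) * h0
  have f1 : t * (x - y) = -c * (x + y) * (x + y - 4) * (x + y + 1) := by
    linear_combination y * e1 + (t + c * ((x + y) ^ 2 - 3 * (x + y) - 4)) * hs
  -- The square of `f1`, divided by `s (s - 4)`, which is the value of `(x - y) ^ 2` since `x y =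
  -- s`.
  have f2 : t ^ 2 = c ^ 2 * (x + y) * (x + y - 4) * (x + y + 1) ^ 2 := by
    apply mul_left_cancel₀ (mul_ne_zero hs0 hs4)
    linear_combination (t * (x - y) - c * (x + y) * (x + y - 4) * (x + y + 1)) * f1 -
      4 * t ^ 2 * hs
  -- Here `c` is eliminated between `e3`, whose right side is `c² s (s - 3) (s - 4) (s + 1)`, and
  -- `f2`.
  have f3 : t ^ 2 = x + y + 1 := by
    linear_combination (1 / 4) * (x + y + 1) * e3 - (1 / 4) * (x + y - 3) * f2
  have ht : t ≠ 0 := by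
    rintro rfl
    exact hs1 (by linear_combination -f3)
  refine ⟨c, ?_, ht, hc, f3, ?_⟩
  · rintro rfl
    exact ht (pow_eq_zero_iff two_ne_zero |>.1 (by linear_combination f2))
  · have hs' : x + y = t ^ 2 - 1 := by linear_combination -f3
    rw [hs'] at f2
    linear_combination -f2

/-- Two representations with the same meridian up to inversion have the same longitude up to
inversion. -/
theorem longitude_eq {A B T C A' B' T' C' : SL2} (h : KnotRep A B T C) (h' : KnotRep A' B' T' C')
    (hT : T' = T ∨ T' = T⁻¹) : C' = C ∨ C' = C⁻¹ := by
  obtain ⟨c, hc0, ht, hc, hs, hc2⟩ := h.skew_eq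
  obtain ⟨c', hc0', ht', hc', hs', hc2'⟩ := h'.skew_eq
  have hk := h.tr_comm
  have hk' := h'.tr_comm
  have htr : tr T' = tr T := by
    rcases hT with rfl | rfl
    · rfl
    · exact tr_inv T
  have hsk : skew T' = skew T ∨ skew T' = -skew T := by
    rcases hT with rfl | rfl
    · exact Or.inl rfl
    · exact Or.inr (skew_inv T)
  rw [htr] at hs' hc2'
  have hss : tr A' + tr B' = tr A + tr B := by linear_combination hs - hs'
  have htrC : tr C' = tr C := by rw [hk, hk', hss]
  -- The square of the factor is a function of `tr T`, so the skew parts of the longitudes agree up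
  -- to sign; the traces agree as well.
  have hcc : c' ^ 2 = c ^ 2 := by
    have hK : (tr T ^ 2 - 1) * (tr T ^ 2 - 5) * (tr T ^ 2) ^ 2 ≠ 0 := by
      intro h0
      rw [h0, mul_zero] at hc2
      exact ht (pow_eq_zero_iff two_ne_zero |>.1 hc2.symm)
    exact mul_right_cancel₀ hK (hc2'.trans hc2.symm)
  have key : skew C' = skew C ∨ skew C' = -skew C := by
    have inj : ∀ X Y : Matrix (Fin 2) (Fin 2) ℂ, c • X = c • Y → X = Y := fun X Y hXY =>
      smul_right_injective _ hc0 hXY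
    rcases sq_eq_sq_iff_eq_or_eq_neg.1 hcc with rfl | rfl <;> rcases hsk with e | e
    · exact Or.inl (inj _ _ (by rw [← hc, ← hc', e]))
    · exact Or.inr (inj _ _ (by rw [smul_neg, ← hc, ← hc', e]))
    · exact Or.inr (inj _ _ (by rw [smul_neg, ← hc, ← e, hc', neg_smul, neg_neg]))
    · exact Or.inl (inj _ _ (by rw [← hc, ← neg_eq_iff_eq_neg.2 e, hc', neg_smul, neg_neg]))
  rcases key with e | e
  · exact Or.inl (eq_of_tr_of_skew htrC e)
  · exact Or.inr (eq_of_tr_of_skew (by rw [tr_inv, htrC]) (by rw [skew_inv, e]))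

end KnotRep

end SL2

end FigureEight

end

noncomputable section

namespace FigureEight

/-! ### Functors from the fundamental groupoid to a group -/

open Path.Homotopic (Quotient)

/-- To prove a property of all classes of paths that is closed under concatenation, it suffices to
prove it for the paths in the members of an open cover. -/
theorem path_induction {X ι : Type*} [TopologicalSpace X] {U : ι → Set X}
    (hU : ∀ i, IsOpen (U i)) (hcov : ∀ x, ∃ i, x ∈ U i)
    {P : ∀ {x y : X}, Path.Homotopic.Quotient x y → Prop}
    (htrans : ∀ {x y z : X} (p : Path.Homotopic.Quotient x y) (q : Path.Homotopic.Quotient y z),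
      P p → P q → P (p.trans q))
    (hsmall : ∀ (i : ι) {x y : X} (γ : Path x y), (∀ t, γ t ∈ U i) →
      P (Path.Homotopic.Quotient.mk γ))
    {x y : X} (p : Path.Homotopic.Quotient x y) : P p := by
  induction p using Path.Homotopic.Quotient.ind with
  | mk γ =>
  -- A Lebesgue number subdivision of the path.
  obtain ⟨t, ht0, htm, ⟨n, hn⟩, ht⟩ := exists_monotone_Icc_subset_open_cover_unitInterval
    (c := fun i => γ ⁻¹' U i) (fun i => (hU i).preimage γ.continuous) (by
      intro s _
      obtain ⟨i, hi⟩ := hcov (γ s)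
      exact Set.mem_iUnion.2 ⟨i, hi⟩)
  have key : ∀ m, P (Path.Homotopic.Quotient.mk (γ.subpath 0 (t m))) := by
    intro m
    induction m with
    | zero =>
      obtain ⟨i, hi⟩ := hcov (γ 0)
      rw [ht0, Path.subpath_self]
      exact hsmall i _ fun _ => hi
    | succ m ih =>
      rw [← Path.Homotopic.Quotient.eq.2 ⟨Path.Homotopy.subpathTransSubpath γ 0 (t m) (t (m + 1))⟩,
        Path.Homotopic.Quotient.mk_trans]
      refine htrans _ _ ih ?_
      obtain ⟨i, hi⟩ := ht m
      refine hsmall i _ fun s => ?_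
      have h1 : γ.subpath (t m) (t (m + 1)) s ∈ Set.range (γ.subpath (t m) (t (m + 1))) := ⟨s, rfl⟩
      rw [Path.range_subpath_of_le _ _ _ (htm (Nat.le_succ m))] at h1
      obtain ⟨r, hr, hr'⟩ := h1
      rw [← hr']
      exact hi hr
  have hcast : ∀ {x y x' y' : X} (p : Path.Homotopic.Quotient x y) (hx : x' = x) (hy : y' = y),
      P (p.cast hx hy) → P p := by
    intro x y x' y' p hx hy h
    subst hx hy
    simpa using h
  have h1 := key n
  rw [hn n le_rfl, Path.subpath_zero_one, Path.Homotopic.Quotient.mk_cast] at h1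
  exact hcast _ _ _ h1

/-- A functor from the fundamental groupoid of `X` to the group `Λ`. -/
structure PathFunctor (X Λ : Type*) [TopologicalSpace X] [Group Λ] where
  /-- The value on a class of paths. -/
  map : ∀ {x y : X}, Path.Homotopic.Quotient x y → Λ
  -- The factors appear in reverse order, as in the multiplication of `FundamentalGroup`.
  map_trans : ∀ {x y z : X} (p : Path.Homotopic.Quotient x y) (q : Path.Homotopic.Quotient y z),
    map (p.trans q) = map q * map p

namespace PathFunctor

variable {X Y Λ Λ' : Type*} [TopologicalSpace X] [TopologicalSpace Y] [Group Λ] [Group Λ']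

/-- The value on a path. -/
abbrev val (F : PathFunctor X Λ) {x y : X} (γ : Path x y) : Λ := F.map (.mk γ)

theorem val_trans (F : PathFunctor X Λ) {x y z : X} (γ : Path x y) (δ : Path y z) :
    F.val (γ.trans δ) = F.val δ * F.val γ := by
  rw [val, Path.Homotopic.Quotient.mk_trans, F.map_trans]

@[simp] theorem map_refl (F : PathFunctor X Λ) (x : X) :
    F.map (Path.Homotopic.Quotient.refl x) = 1 := by
  have h := F.map_trans (Path.Homotopic.Quotient.refl x) (Path.Homotopic.Quotient.refl x)
  have e : (Path.Homotopic.Quotient.refl x).trans (Path.Homotopic.Quotient.refl x) =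
      Path.Homotopic.Quotient.refl x := by simp
  rw [e] at h
  exact (mul_eq_left.1 h.symm)

theorem val_refl (F : PathFunctor X Λ) (x : X) : F.val (Path.refl x) = 1 := F.map_refl x

theorem map_symm (F : PathFunctor X Λ) {x y : X} (p : Path.Homotopic.Quotient x y) :
    F.map p.symm = (F.map p)⁻¹ := by
  have h := F.map_trans p p.symm
  have e : p.trans p.symm = Path.Homotopic.Quotient.refl x := by simp
  rw [e, map_refl] at h
  exact (inv_eq_of_mul_eq_one_left h.symm).symm

theorem val_symm (F : PathFunctor X Λ) {x y : X} (γ : Path x y) :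
    F.val γ.symm = (F.val γ)⁻¹ := by
  rw [val, Path.Homotopic.Quotient.mk_symm, map_symm]

theorem map_cast (F : PathFunctor X Λ) {x y x' y' : X} (p : Path.Homotopic.Quotient x y)
    (hx : x' = x) (hy : y' = y) : F.map (p.cast hx hy) = F.map p := by
  subst hx hy
  simp

theorem val_cast (F : PathFunctor X Λ) {x y x' y' : X} (γ : Path x y)
    (hx : x' = x) (hy : y' = y) : F.val (γ.cast hx hy) = F.val γ := by
  subst hx hy
  rfl

/-- The homomorphism from the fundamental group. -/
def hom (F : PathFunctor X Λ) (x : X) : FundamentalGroup X x →* Λ where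
  toFun p := F.map (FundamentalGroup.toPath p)
  map_one' := F.map_refl x
  map_mul' _ _ := F.map_trans _ _

/-- The pullback along a continuous map. -/
def comap (F : PathFunctor X Λ) (f : C(Y, X)) : PathFunctor Y Λ where
  map p := F.map (p.map f)
  map_trans {x y z} p q := by
    induction p using Path.Homotopic.Quotient.ind with
    | mk p =>
    induction q using Path.Homotopic.Quotient.ind with
    | mk q =>
    rw [← F.map_trans, ← Path.Homotopic.Quotient.mk_trans, ← Path.Homotopic.Quotient.mk_map,
      Path.map_trans, ← Path.Homotopic.Quotient.mk_map, ← Path.Homotopic.Quotient.mk_map,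
      Path.Homotopic.Quotient.mk_trans]

/-- Composition with a homomorphism. -/
def mapHom (F : PathFunctor X Λ) (φ : Λ →* Λ') : PathFunctor X Λ' where
  map p := φ (F.map p)
  map_trans p q := by rw [F.map_trans, map_mul]

/-- A naturally isomorphic functor. -/
def gauge (F : PathFunctor X Λ) (k : X → Λ) : PathFunctor X Λ where
  map {x y} p := k y * F.map p * (k x)⁻¹
  map_trans p q := by rw [F.map_trans]; group

/-- The functor which extends a homomorphism from the fundamental group, for a choice of paths
from the base point. -/
def ofHom {x₀ : X} (φ : FundamentalGroup X x₀ →* Λ) (κ : ∀ x, Path x₀ x) : PathFunctor X Λ where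
  map {x y} p := φ (FundamentalGroup.fromPath
    (((Path.Homotopic.Quotient.mk (κ x)).trans p).trans (Path.Homotopic.Quotient.mk (κ y)).symm))
  map_trans {x y z} p q := by
    rw [← map_mul, FundamentalGroup.mul_def]
    congr 1
    have key : ∀ {a b c d e : X} (u : Path.Homotopic.Quotient a b)
        (p : Path.Homotopic.Quotient b c) (v : Path.Homotopic.Quotient a c)
        (q : Path.Homotopic.Quotient c d) (w : Path.Homotopic.Quotient e d),
        (u.trans (p.trans q)).trans w.symm =
          ((u.trans p).trans v.symm).trans ((v.trans q).trans w.symm) := by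
      intro a b c d e u p v q w
      have h : v.symm.trans (v.trans (q.trans w.symm)) = q.trans w.symm := by
        rw [← Path.Homotopic.Quotient.trans_assoc, Path.Homotopic.Quotient.symm_trans,
          Path.Homotopic.Quotient.refl_trans]
      simp only [Path.Homotopic.Quotient.trans_assoc, h]
    exact key _ _ _ _ _

/-- `F` is given by `γ ↦ g (γ 1) * (g (γ 0))⁻¹` on the paths in `U`. -/
def TrivialOn (F : PathFunctor X Λ) (U : Set X) (g : X → Λ) : Prop :=
  ∀ {x y : X} (γ : Path x y), (∀ t, γ t ∈ U) → F.val γ = g y * (g x)⁻¹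

/-- `F` is trivial in a neighbourhood of each point. -/
def LocallyTrivial (F : PathFunctor X Λ) : Prop :=
  ∀ x, ∃ U : Set X, IsOpen U ∧ x ∈ U ∧ ∃ g : X → Λ, F.TrivialOn U g

end PathFunctor

section Develop

variable {X Λ ι : Type*} [TopologicalSpace X] [Group Λ] 

/-- The principal bundle with discrete fibre and the locally constant transition functions
`(g j)⁻¹ * g i`. -/
def developCore [TopologicalSpace Λ] [DiscreteTopology Λ] (U : ι → Set X) (g : ι → X → Λ)
    (hU : ∀ i, IsOpen (U i)) (idx : X → ι) (hcov : ∀ x, x ∈ U (idx x))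
    (hg : ∀ i j, ∀ x ∈ U i ∩ U j, ∀ᶠ y in nhds x, (g j y)⁻¹ * g i y = (g j x)⁻¹ * g i x) :
    FiberBundleCore ι X Λ where
  baseSet := U
  isOpen_baseSet := hU
  indexAt := idx
  mem_baseSet_at := hcov
  coordChange i j x v := (g j x)⁻¹ * g i x * v
  coordChange_self i x _ v := by group
  continuousOn_coordChange i j := by
    rintro ⟨x, v⟩ ⟨hx, -⟩
    refine ContinuousAt.continuousWithinAt ?_
    refine continuousAt_const (y := (g j x)⁻¹ * g i x * v) |>.congr ?_
    have h1 : ∀ᶠ p : X × Λ in nhds (x, v), (g j p.1)⁻¹ * g i p.1 = (g j x)⁻¹ * g i x :=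
      (continuous_fst.tendsto (x, v)).eventually (hg i j x hx)
    have h2 : ∀ᶠ p : X × Λ in nhds (x, v), p.2 = v :=
      (continuous_snd.tendsto (x, v)).eventually (p := fun w => w = v) (by simp [nhds_discrete])
    filter_upwards [h1, h2] with p hp1 hp2
    rw [hp1, hp2]
  coordChange_comp i j k x _ v := by group

/-- A cocycle of locally constant transition functions `(g j)⁻¹ * g i` determines a functor which
is given by `γ ↦ g i (γ 1) * (g i (γ 0))⁻¹` on the paths in `U i`. -/
theorem exists_pathFunctor (U : ι → Set X) (g : ι → X → Λ)
    (hU : ∀ i, IsOpen (U i)) (hcov : ∀ x, ∃ i, x ∈ U i)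
    (hg : ∀ i j, ∀ x ∈ U i ∩ U j, ∀ᶠ y in nhds x, (g j y)⁻¹ * g i y = (g j x)⁻¹ * g i x) :
    ∃ F : PathFunctor X Λ, ∀ i, F.TrivialOn (U i) (g i) := by
  let _ : TopologicalSpace Λ := ⊥
  have : DiscreteTopology Λ := ⟨rfl⟩
  choose idx hidx using hcov
  let Z := developCore U g hU idx hidx hg
  have cov : IsCoveringMap Z.proj :=
    IsFiberBundle.isCoveringMap fun x => ⟨Z.localTriv (idx x), hidx x⟩
  let coord : Z.TotalSpace → Λ := fun e => e.2
  -- In the total space of the covering, `dev` multiplies by the developing map of the chart, so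
  -- that monodromy becomes left multiplication by the value of the functor.
  let dev : Z.TotalSpace → Λ := fun e => g (idx e.1) e.1 * coord e
  have small : ∀ (i : ι) {x y : X} (γ : Path x y), (∀ t, γ t ∈ U i) → ∀ e : Z.proj ⁻¹' {x},
      dev (cov.monodromy (.mk γ) e).1 = g i y * (g i x)⁻¹ * dev e := by
    intro i x y γ hγ e
    let T := Z.localTriv i
    let v : Λ := (g i x)⁻¹ * dev e
    have hsymm : ∀ z, T.toOpenPartialHomeomorph.symm (z, v) =
        ⟨z, (g (idx z) z)⁻¹ * g i z * v⟩ := fun z => Z.localTriv_symm_apply i (z, v)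
    -- The lift of a path inside `U i` has a constant `i`-th coordinate `v`.
    let Γ : unitInterval → Z.TotalSpace := fun t => T.toOpenPartialHomeomorph.symm (γ t, v)
    have hΓ : Γ = cov.liftPath γ e.1 (γ.source.trans e.2.symm) := by
      rw [cov.eq_liftPath_iff]
      refine ⟨?_, ?_, ?_⟩
      · refine T.toOpenPartialHomeomorph.continuousOn_symm.comp_continuous (by fun_prop) fun t => ?_
        exact (Z.mem_localTriv_target i _).2 (hγ t)
      · funext t
        simp only [Γ, Function.comp_apply, hsymm]
        rfl
      · obtain ⟨⟨z, w⟩, rfl⟩ := e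
        have h0 : γ 0 = z := γ.source
        simp only [Γ]
        rw [h0, hsymm]
        have h1 : (g (idx z) z)⁻¹ * g i z * v = w := by
          simp only [v, dev, coord, FiberBundleCore.proj]
          rw [mul_assoc, mul_inv_cancel_left]
          exact inv_mul_cancel_left _ _
        rw [h1]
    change dev (cov.liftPath γ e.1 (γ.source.trans e.2.symm) 1) = _
    rw [← congrFun hΓ 1]
    simp only [Γ]
    rw [γ.target, hsymm]
    change g (idx y) y * ((g (idx y) y)⁻¹ * g i y * v) = _
    simp only [v]
    group
  have all : ∀ {x y : X} (p : Path.Homotopic.Quotient x y), ∃ c : Λ, ∀ e : Z.proj ⁻¹' {x},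
      dev (cov.monodromy p e).1 = c * dev e := by
    refine fun {x y} p => path_induction (U := U) hU (fun x => ⟨idx x, hidx x⟩)
      (P := fun {x y} p => ∃ c : Λ, ∀ e : Z.proj ⁻¹' {x}, dev (cov.monodromy p e).1 = c * dev e)
      ?_ ?_ p
    · rintro x y z p q ⟨c, hc⟩ ⟨d, hd⟩
      refine ⟨d * c, fun e => ?_⟩
      rw [cov.monodromy_trans_apply, hd (cov.monodromy p e), hc e, mul_assoc]
    · intro i x y γ hγ
      exact ⟨_, small i γ hγ⟩
  have fib : ∀ x, ∃ e : Z.proj ⁻¹' {x}, True := fun x => ⟨⟨⟨x, (1 : Λ)⟩, rfl⟩, trivial⟩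
  choose c hc using @all
  refine ⟨⟨fun p => c p, fun {x y z} p q => ?_⟩, fun i x y γ hγ => ?_⟩
  · obtain ⟨e, -⟩ := fib x
    have := hc (p.trans q) e
    rw [cov.monodromy_trans_apply, hc q (cov.monodromy p e), hc p e, ← mul_assoc] at this
    exact (mul_right_cancel this).symm
  · obtain ⟨e, -⟩ := fib x
    have := hc (.mk γ) e
    rw [small i γ hγ] at this
    exact (mul_right_cancel this).symm

end Develop

end FigureEight

end

/-! ### Natural isomorphisms, values along curves, and gluing of path functors. -/

noncomputable section

namespace FigureEight

namespace PathFunctor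

variable {X Y Λ Λ' : Type*} [TopologicalSpace X] [TopologicalSpace Y] [Group Λ] [Group Λ']

theorem val_congr (F : PathFunctor X Λ) {x y x' y' : X} (γ : Path x y) (δ : Path x' y')
    (h : ∀ t, γ t = δ t) : F.val γ = F.val δ := by
  obtain rfl : x = x' := by rw [← γ.source, h, δ.source]
  obtain rfl : y = y' := by rw [← γ.target, h, δ.target]
  rw [show γ = δ from Path.ext (funext h)]

theorem val_of_homotopic (F : PathFunctor X Λ) {x y : X} {γ δ : Path x y} (h : γ.Homotopic δ) :
    F.val γ = F.val δ := by
  rw [val, Path.Homotopic.Quotient.eq.2 h]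

@[simp] theorem val_comap (F : PathFunctor X Λ) (f : C(Y, X)) {x y : Y} (γ : Path x y) :
    (F.comap f).val γ = F.val (γ.map f.continuous) := rfl

@[simp] theorem val_gauge (F : PathFunctor X Λ) (k : X → Λ) {x y : X} (γ : Path x y) :
    (F.gauge k).val γ = k y * F.val γ * (k x)⁻¹ := rfl

@[simp] theorem val_mapHom (F : PathFunctor X Λ) (φ : Λ →* Λ') {x y : X} (γ : Path x y) :
    (F.mapHom φ).val γ = φ (F.val γ) := rfl

/-- Naturality along a homotopy, for the four sides of a square. -/
theorem val_square (F : PathFunctor X Λ) {x y x' y' : X} (γ : Path x y) (δ : Path x' y')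
    (α : Path x x') (β : Path y y') (Q : unitInterval × unitInterval → X) (hQ : Continuous Q)
    (h0 : ∀ s, Q (s, 0) = γ s) (h1 : ∀ s, Q (s, 1) = δ s) (hα : ∀ t, Q (0, t) = α t)
    (hβ : ∀ t, Q (1, t) = β t) : F.val δ * F.val α = F.val β * F.val γ := by
  let f : C(unitInterval, X) := ⟨fun s => Q (s, 0), by fun_prop⟩
  let g : C(unitInterval, X) := ⟨fun s => Q (s, 1), by fun_prop⟩
  let H : f.Homotopy g :=
    { toFun := fun p => Q (p.2, p.1)
      continuous_toFun := by fun_prop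
      map_zero_left := fun _ => rfl
      map_one_left := fun _ => rfl }
  have h := F.val_of_homotopic (Path.Homotopic.map_trans_evalAt H unitInterval.path01)
  rw [val_trans, val_trans] at h
  rw [F.val_congr γ (unitInterval.path01.map (map_continuous f)) fun s => (h0 s).symm,
    F.val_congr δ (unitInterval.path01.map (map_continuous g)) fun s => (h1 s).symm,
    F.val_congr α (H.evalAt 0) fun t => (hα t).symm,
    F.val_congr β (H.evalAt 1) fun t => (hβ t).symm, h]

/-- If two functors agree on the loops at a point of a path connected space, then they are
naturally isomorphic. -/
theorem exists_gauge [PathConnectedSpace X] (F F' : PathFunctor X Λ) (x₀ : X)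
    (h : F.hom x₀ = F'.hom x₀) : ∃ u : X → Λ, u x₀ = 1 ∧
      ∀ {x y : X} (p : Path.Homotopic.Quotient x y), F.map p = u y * F'.map p * (u x)⁻¹ := by
  let κ : ∀ x, Path.Homotopic.Quotient x₀ x := fun x => .mk (PathConnectedSpace.somePath x₀ x)
  have hl : ∀ p : Path.Homotopic.Quotient x₀ x₀, F.map p = F'.map p := fun p =>
    DFunLike.congr_fun h (FundamentalGroup.fromPath p)
  refine ⟨fun x => F.map (κ x) * (F'.map (κ x))⁻¹, by
    change F.map (κ x₀) * _ = 1
    rw [hl, mul_inv_cancel], fun {x y} p => ?_⟩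
  have h1 := hl (((κ x).trans p).trans (κ y).symm)
  simp only [map_trans, map_symm] at h1
  have h2 : F.map p = F.map (κ y) * ((F.map (κ y))⁻¹ * (F.map p * F.map (κ x))) *
      (F.map (κ x))⁻¹ := by group
  rw [h2, h1]
  group

/-- Changing the base point conjugates by the value of the connecting path. -/
theorem hom_bijective_of_path (F : PathFunctor X Λ) {x₀ x : X} (κ : Path.Homotopic.Quotient x₀ x)
    (h : Function.Bijective (F.hom x₀)) : Function.Bijective (F.hom x) := by
  constructor
  · rw [injective_iff_map_eq_one]
    intro p hp
    have h1 : F.hom x₀ (FundamentalGroup.fromPath ((κ.trans p).trans κ.symm)) = 1 := by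
      change F.map ((κ.trans p).trans κ.symm) = 1
      change F.map p = 1 at hp
      rw [map_trans, map_trans, hp, map_symm]
      group
    have h2 := h.1 (h1.trans (map_one _).symm)
    have h3 : p = (κ.symm.trans ((κ.trans p).trans κ.symm)).trans κ := by
      simp only [Path.Homotopic.Quotient.trans_assoc, Path.Homotopic.Quotient.symm_trans,
        Path.Homotopic.Quotient.trans_refl]
      rw [← Path.Homotopic.Quotient.trans_assoc, Path.Homotopic.Quotient.symm_trans,
        Path.Homotopic.Quotient.refl_trans]
    change (κ.trans p).trans κ.symm = Path.Homotopic.Quotient.refl x₀ at h2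
    rw [h3, h2, Path.Homotopic.Quotient.trans_refl, Path.Homotopic.Quotient.symm_trans]
    rfl
  · intro c
    obtain ⟨p, hp⟩ := h.2 ((F.map κ)⁻¹ * c * F.map κ)
    refine ⟨FundamentalGroup.fromPath ((κ.symm.trans p).trans κ), ?_⟩
    change F.map p = _ at hp
    change F.map ((κ.symm.trans p).trans κ) = c
    rw [map_trans, map_trans, hp, map_symm]
    group

theorem hom_bijective [PathConnectedSpace X] (F : PathFunctor X Λ) {x₀ : X} (x : X)
    (h : Function.Bijective (F.hom x₀)) : Function.Bijective (F.hom x) :=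
  F.hom_bijective_of_path (.mk (PathConnectedSpace.somePath x₀ x)) h

/-- The straight path between two real numbers. -/
def linePath (s t : ℝ) : Path s t where
  toFun r := s + r * (t - s)
  continuous_toFun := by fun_prop
  source' := by simp
  target' := by simp

theorem linePath_apply (s t : ℝ) (r : unitInterval) : linePath s t r = s + r * (t - s) := rfl

theorem linePath_mem {s t : ℝ} (h : s ≤ t) (r : unitInterval) : linePath s t r ∈ Set.Icc s t := by
  have h0 := r.2.1
  have h1 := r.2.2
  rw [linePath_apply]
  constructor <;> nlinarith

/-- The value on the segment from `s` to `t` of a curve. -/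
def along (F : PathFunctor X Λ) (γ : C(ℝ, X)) (s t : ℝ) : Λ := (F.comap γ).val (linePath s t)

theorem along_eq (F : PathFunctor X Λ) (γ : C(ℝ, X)) {s t : ℝ} (p : Path s t) :
    (F.comap γ).val p = F.along γ s t :=
  val_of_homotopic _ (SimplyConnectedSpace.paths_homotopic _ _)

theorem along_trans (F : PathFunctor X Λ) (γ : C(ℝ, X)) (s t u : ℝ) :
    F.along γ s u = F.along γ t u * F.along γ s t := by
  rw [← F.along_eq γ ((linePath s t).trans (linePath t u)), val_trans]
  rfl

theorem along_of_trivialOn (F : PathFunctor X Λ) (γ : C(ℝ, X)) {s t : ℝ} (hst : s ≤ t)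
    {U : Set X} {g : X → Λ} (hU : F.TrivialOn U g) (h : ∀ r ∈ Set.Icc s t, γ r ∈ U) :
    F.along γ s t = g (γ t) * (g (γ s))⁻¹ :=
  hU ((linePath s t).map γ.continuous) fun r => h _ (linePath_mem hst r)

theorem TrivialOn.mono {F : PathFunctor X Λ} {U V : Set X} {g : X → Λ} (h : F.TrivialOn U g)
    (hV : V ⊆ U) : F.TrivialOn V g := fun γ hγ => h γ fun t => hV (hγ t)

theorem TrivialOn.mul_const {F : PathFunctor X Λ} {U : Set X} {g : X → Λ} (h : F.TrivialOn U g)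
    (c : Λ) : F.TrivialOn U fun x => g x * c := fun γ hγ => by
  rw [h γ hγ]; group

theorem TrivialOn.comap {F : PathFunctor X Λ} {U : Set X} {g : X → Λ} (h : F.TrivialOn U g)
    (f : C(Y, X)) : (F.comap f).TrivialOn (f ⁻¹' U) (g ∘ f) := fun γ hγ =>
  h (γ.map f.continuous) hγ

theorem TrivialOn.gauge {F : PathFunctor X Λ} {U : Set X} {g : X → Λ} (h : F.TrivialOn U g)
    (k : X → Λ) : (F.gauge k).TrivialOn U fun x => k x * g x := fun γ hγ => by
  rw [val_gauge, h γ hγ]; group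

theorem TrivialOn.mapHom {F : PathFunctor X Λ} {U : Set X} {g : X → Λ} (h : F.TrivialOn U g)
    (φ : Λ →* Λ') : (F.mapHom φ).TrivialOn U fun x => φ (g x) := fun γ hγ => by
  rw [val_mapHom, h γ hγ, map_mul, map_inv]

theorem LocallyTrivial.comap {F : PathFunctor X Λ} (h : F.LocallyTrivial) (f : C(Y, X)) :
    (F.comap f).LocallyTrivial := fun y => by
  obtain ⟨U, hU, hy, g, hg⟩ := h (f y)
  exact ⟨f ⁻¹' U, hU.preimage f.continuous, hy, _, hg.comap f⟩

theorem LocallyTrivial.gauge {F : PathFunctor X Λ} (h : F.LocallyTrivial) (k : X → Λ) :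
    (F.gauge k).LocallyTrivial := fun y => by
  obtain ⟨U, hU, hy, g, hg⟩ := h y
  exact ⟨U, hU, hy, _, hg.gauge k⟩

theorem LocallyTrivial.mapHom {F : PathFunctor X Λ} (h : F.LocallyTrivial) (φ : Λ →* Λ') :
    (F.mapHom φ).LocallyTrivial := fun y => by
  obtain ⟨U, hU, hy, g, hg⟩ := h y
  exact ⟨U, hU, hy, _, hg.mapHom φ⟩

/-- Two functors that agree on the paths in the members of an open cover are equal. -/
theorem map_eq_of_cover {F F' : PathFunctor X Λ} {ι : Type*} {U : ι → Set X}
    (hU : ∀ i, IsOpen (U i)) (hcov : ∀ x, ∃ i, x ∈ U i)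
    (h : ∀ i {x y : X} (γ : Path x y), (∀ t, γ t ∈ U i) → F.val γ = F'.val γ)
    {x y : X} (p : Path.Homotopic.Quotient x y) : F.map p = F'.map p := by
  refine path_induction hU hcov (P := fun p => F.map p = F'.map p) ?_ (fun i _ _ => h i) p
  intro x y z p q hp hq
  rw [map_trans, map_trans, hp, hq]

/-- On an open set of a locally path connected space, two developing maps of the same functor
differ by a locally constant function. -/
theorem isOpen_develop [LocallyPathConnectedSpace X] {U : Set X} (hU : IsOpen U) {g g' : X → Λ}
    (h : ∀ {x y : X} (γ : Path x y), (∀ t, γ t ∈ U) → g y * (g x)⁻¹ = g' y * (g' x)⁻¹) (c : Λ) :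
    IsOpen {x ∈ U | (g' x)⁻¹ * g x = c} := by
  rw [isOpen_iff_mem_nhds]
  rintro x ⟨hx, hc⟩
  filter_upwards [(hU.pathComponentIn x).mem_nhds (mem_pathComponentIn_self hx)] with y hy
  obtain ⟨γ, hγ⟩ := hy
  refine ⟨by simpa using hγ 1, ?_⟩
  have := h γ hγ
  rw [← hc]
  calc (g' y)⁻¹ * g y = (g' y)⁻¹ * (g y * (g x)⁻¹) * g x := by group
    _ = _ := by rw [this]; group

/-- Functors on two locally path connected spaces define a functor on a space glued from them if
they have common developing maps locally. -/
theorem exists_glue {M : Type*} [TopologicalSpace M] [LocallyPathConnectedSpace X]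
    [LocallyPathConnectedSpace Y] (i : C(X, M)) (j : C(Y, M))
    (hopen : ∀ S : Set M, IsOpen (i ⁻¹' S) → IsOpen (j ⁻¹' S) → IsOpen S)
    (F : PathFunctor X Λ) (F' : PathFunctor Y Λ)
    (h : ∀ z : M, ∃ U : Set M, IsOpen U ∧ z ∈ U ∧ ∃ g : M → Λ,
      F.TrivialOn (i ⁻¹' U) (g ∘ i) ∧ F'.TrivialOn (j ⁻¹' U) (g ∘ j)) :
    ∃ Φ : PathFunctor M Λ, (∀ {x y : X} (p : Path.Homotopic.Quotient x y),
        (Φ.comap i).map p = F.map p) ∧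
      ∀ {x y : Y} (p : Path.Homotopic.Quotient x y), (Φ.comap j).map p = F'.map p := by
  choose U hU hz g hg hg' using h
  obtain ⟨Φ, hΦ⟩ := exists_pathFunctor U g hU (fun z => ⟨z, hz z⟩) (by
    intro a b z hzab
    -- Openness can be tested on the two pieces. On each of them both developing maps belong to the
    -- same functor and differ by a locally constant function.
    have hopenc : IsOpen {w ∈ U a ∩ U b | (g b w)⁻¹ * g a w = (g b z)⁻¹ * g a z} := by
      apply hopen
      · refine isOpen_develop (U := i ⁻¹' (U a ∩ U b)) (g := g a ∘ i) (g' := g b ∘ i)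
          (((hU a).inter (hU b)).preimage i.continuous) (fun γ hγ => ?_) _
        exact (hg a γ fun t => (hγ t).1).symm.trans (hg b γ fun t => (hγ t).2)
      · refine isOpen_develop (U := j ⁻¹' (U a ∩ U b)) (g := g a ∘ j) (g' := g b ∘ j)
          (((hU a).inter (hU b)).preimage j.continuous) (fun γ hγ => ?_) _
        exact (hg' a γ fun t => (hγ t).1).symm.trans (hg' b γ fun t => (hγ t).2)
    filter_upwards [hopenc.mem_nhds ⟨hzab, rfl⟩] with w hw
    exact hw.2)
  refine ⟨Φ, fun p => ?_, fun p => ?_⟩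
  · refine map_eq_of_cover (U := fun z => i ⁻¹' U z) (fun z => (hU z).preimage i.continuous)
      (fun x => ⟨i x, hz _⟩) (fun z x y γ hγ => ?_) p
    rw [hg z γ hγ]
    exact TrivialOn.comap (hΦ z) i γ hγ
  · refine map_eq_of_cover (U := fun z => j ⁻¹' U z) (fun z => (hU z).preimage j.continuous)
      (fun x => ⟨j x, hz _⟩) (fun z x y γ hγ => ?_) p
    rw [hg' z γ hγ]
    exact TrivialOn.comap (hΦ z) j γ hγ

end PathFunctor

end FigureEight

end

noncomputable section

namespace FigureEight

/-! ### Representatives of the points of the circle -/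

instance : Fact ((0 : ℝ) < 1) := ⟨one_pos⟩

/-- The representative in `[a, a + 1)`. -/
def rep (a : ℝ) (x : UnitAddCircle) : ℝ := AddCircle.equivIco 1 a x

theorem coe_rep (a : ℝ) (x : UnitAddCircle) : ((rep a x : ℝ) : UnitAddCircle) = x :=
  AddCircle.coe_equivIco

theorem rep_mem (a : ℝ) (x : UnitAddCircle) : rep a x ∈ Set.Ico a (a + 1) :=
  (AddCircle.equivIco 1 a x).2

theorem rep_coe {a r : ℝ} (h : r ∈ Set.Ico a (a + 1)) : rep a (r : UnitAddCircle) = r :=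
  AddCircle.equivIco_coe_of_mem h

theorem continuousAt_rep {a : ℝ} {x : UnitAddCircle} (h : x ≠ (a : UnitAddCircle)) :
    ContinuousAt (rep a) x :=
  continuous_subtype_val.continuousAt.comp (AddCircle.continuousAt_equivIco 1 a h)

theorem norm_eq_abs_rep (x : UnitAddCircle) : ‖x‖ = |rep (-(1 / 2)) x| := by
  have h := rep_mem (-(1 / 2)) x
  conv_lhs => rw [← coe_rep (-(1 / 2)) x]
  exact norm_coe_of_abs_le (abs_le.2 ⟨h.1, by linarith [h.2]⟩)

theorem norm_eq_min_rep (x : UnitAddCircle) : ‖x‖ = min (rep 0 x) (1 - rep 0 x) := by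
  have h := rep_mem 0 x
  conv_lhs => rw [← coe_rep 0 x]
  exact norm_coe_of_mem_Icc h.1 (by linarith [h.2])

theorem norm_lt_quarter_iff (x : UnitAddCircle) :
    ‖x‖ < 1 / 4 ↔ rep (-(1 / 2)) x ∈ Set.Ioo (-(1 / 4) : ℝ) (1 / 4) := by
  rw [norm_eq_abs_rep, abs_lt]
  rfl

theorem quarter_le_norm_iff (x : UnitAddCircle) :
    1 / 4 ≤ ‖x‖ ↔ rep 0 x ∈ Set.Icc (1 / 4 : ℝ) (3 / 4) := by
  rw [norm_eq_min_rep, le_min_iff, Set.mem_Icc]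
  constructor <;> rintro ⟨h1, h2⟩ <;> constructor <;> linarith

theorem quarter_le_norm_coe {r : ℝ} (h : r ∈ Set.Icc (1 / 4 : ℝ) (3 / 4)) :
    1 / 4 ≤ ‖(r : UnitAddCircle)‖ := by
  rw [quarter_le_norm_iff, rep_coe ⟨by linarith [h.1], by linarith [h.2]⟩]
  exact h

theorem norm_coe_lt_quarter {r : ℝ} (h : r ∈ Set.Ioo (-(1 / 4) : ℝ) (1 / 4)) :
    ‖(r : UnitAddCircle)‖ < 1 / 4 := by
  rw [norm_lt_quarter_iff, rep_coe ⟨by linarith [h.1], by linarith [h.2]⟩]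
  exact h

theorem coe_ne_zero {r : ℝ} (h : r ∈ Set.Ioo (0 : ℝ) 1) : (r : UnitAddCircle) ≠ 0 := by
  intro h0
  have h1 := rep_coe (a := 0) ⟨h.1.le, by simpa using h.2⟩
  rw [h0, ← AddCircle.coe_zero, rep_coe ⟨le_rfl, by norm_num⟩] at h1
  exact h.1.ne h1

theorem rep_zero_pos {x : UnitAddCircle} (h : x ≠ 0) : rep 0 x ∈ Set.Ioo (0 : ℝ) 1 := by
  have h1 := rep_mem 0 x
  refine ⟨lt_of_le_of_ne h1.1 fun h0 => h ?_, by simpa using h1.2⟩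
  rw [← coe_rep 0 x, ← h0, AddCircle.coe_zero]

theorem rep_half_ne_zero {x : UnitAddCircle} (h : x ≠ 0) : rep (-(1 / 2)) x ≠ 0 := by
  intro h0
  apply h
  rw [← coe_rep (-(1 / 2)) x, h0, AddCircle.coe_zero]

theorem ne_half_of_norm_lt {x : UnitAddCircle} (h : ‖x‖ < 1 / 4) :
    x ≠ ((-(1 / 2) : ℝ) : UnitAddCircle) := by
  rintro rfl
  rw [norm_coe_of_abs_le (by norm_num [abs_of_neg]), abs_of_neg (by norm_num)] at h
  norm_num at h

theorem coe_add_one (r : ℝ) : ((r + 1 : ℝ) : UnitAddCircle) = r := by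
  rw [AddCircle.coe_add, AddCircle.coe_period (1 : ℝ), add_zero]

theorem coe_add_intCast (r : ℝ) (n : ℤ) : ((r + n : ℝ) : UnitAddCircle) = r := by
  have h : ((n : ℝ) : UnitAddCircle) = 0 := (AddCircle.coe_eq_zero_iff 1).2 ⟨n, by simp⟩
  rw [AddCircle.coe_add, h, add_zero]

/-- A locally constant choice between two values on the two sides of zero. -/
theorem eventually_nonneg_iff {x : UnitAddCircle} (h : ‖x‖ < 1 / 4) (h0 : x ≠ 0) :
    ∀ᶠ y in nhds x, (0 ≤ rep (-(1 / 2)) y ↔ 0 ≤ rep (-(1 / 2)) x) := by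
  have hc := continuousAt_rep (ne_half_of_norm_lt h)
  rcases lt_or_gt_of_ne (rep_half_ne_zero h0) with h1 | h1
  · filter_upwards [hc.eventually_lt_const h1] with y hy
    exact iff_of_false hy.not_ge h1.not_ge
  · filter_upwards [hc.eventually_const_lt h1] with y hy
    exact iff_of_true hy.le h1.le

end FigureEight

end

noncomputable section

namespace FigureEight

/-! ### The fundamental groupoid of the fibre -/

/-- The coordinates of a point of the fibre. -/
def coord (b : Bool) (p : Fibre) : UnitAddCircle := if b then p.1.2 else p.1.1

theorem continuous_coord (b : Bool) : Continuous (coord b) := by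
  cases b
  · exact continuous_fst.comp continuous_subtype_val
  · exact continuous_snd.comp continuous_subtype_val

/-- A cover of the fibre by simply connected sets: the complement of the coordinate axes and
neighbourhoods of the axes. -/
def fibreCover : Option Bool → Set Fibre
  | none => {p | ∀ b, coord b p ≠ 0}
  | some b => {p | ‖coord b p‖ < 1 / 4}

/-- The developing maps of the functor which counts the crossings of the coordinate axes. -/
def fibreDevelop : Option Bool → Fibre → F2
  | none => fun _ => 1
  -- An upward crossing contributes an inverse generator. As the values of a path multiply from
  -- right to left, a path with the word `w`, read from left to right, has the value `w⁻¹`.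
  | some b => fun p => if 0 ≤ rep (-(1 / 2)) (coord b p) then (FreeGroup.of !b)⁻¹ else 1

theorem isOpen_fibreCover (i : Option Bool) : IsOpen (fibreCover i) := by
  cases i with
  | none =>
    simp only [fibreCover, Set.ofPred_forall]
    exact isOpen_iInter_of_finite fun b => isOpen_ne_fun (continuous_coord b) continuous_const
  | some b => exact isOpen_lt (continuous_coord b).norm continuous_const

theorem exists_mem_fibreCover (p : Fibre) : ∃ i, p ∈ fibreCover i := by
  by_cases h : ∀ b, coord b p ≠ 0
  · exact ⟨none, h⟩
  · push Not at h
    obtain ⟨b, hb⟩ := h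
    exact ⟨some b, by simp [fibreCover, hb]⟩

theorem quarter_le_norm_coord {b c : Bool} (hbc : b ≠ c) {p : Fibre} (h : ‖coord b p‖ < 1 / 4) :
    1 / 4 ≤ ‖coord c p‖ := by
  have := fibre_or p
  cases b <;> cases c <;> simp_all [coord] <;> by_contra! <;> grind

theorem exists_fibreFunctor :
    ∃ F : PathFunctor Fibre F2, ∀ i, F.TrivialOn (fibreCover i) (fibreDevelop i) := by
  refine exists_pathFunctor fibreCover fibreDevelop isOpen_fibreCover exists_mem_fibreCover ?_
  have key : ∀ b, ∀ x : Fibre, x ∈ fibreCover none → x ∈ fibreCover (some b) →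
      ∀ᶠ y in nhds x, fibreDevelop (some b) y = fibreDevelop (some b) x := by
    intro b x h0 hb
    filter_upwards [(continuous_coord b).continuousAt.eventually
      (eventually_nonneg_iff hb (h0 b))] with y hy
    simp only [fibreDevelop, hy]
  rintro (_ | b) (_ | c) x ⟨hx, hx'⟩
  · exact Filter.Eventually.of_forall fun _ => by simp
  · filter_upwards [key c x hx hx'] with y hy
    rw [hy]
    rfl
  · filter_upwards [key b x hx' hx] with y hy
    rw [hy]
    rfl
  · rcases eq_or_ne b c with rfl | hbc
    · exact Filter.Eventually.of_forall fun _ => by simp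
    -- The neighbourhoods of the two axes meet only inside the hole.
    · exact absurd (quarter_le_norm_coord hbc hx) (not_le.2 hx')

/-- The functor to the free group which counts the crossings of the coordinate axes. -/
def fibreFunctor : PathFunctor Fibre F2 := exists_fibreFunctor.choose

theorem fibreFunctor_trivialOn (i : Option Bool) :
    fibreFunctor.TrivialOn (fibreCover i) (fibreDevelop i) := exists_fibreFunctor.choose_spec i

namespace PathFunctor

variable {X Y Λ Λ' : Type*} [TopologicalSpace X] [TopologicalSpace Y] [Group Λ] [Group Λ']

/-- A functor is trivial on the image of a simply connected space. -/
theorem exists_trivialOn_of_section [SimplyConnectedSpace Y] (K : PathFunctor X Λ) (q : C(Y, X)) :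
    ∃ d : Y → Λ, ∀ {U : Set X} {s : X → Y}, ContinuousOn s U → (∀ x ∈ U, q (s x) = x) →
      K.TrivialOn U (d ∘ s) := by
  have y₀ : Y := Classical.arbitrary Y
  obtain ⟨d, -, hd⟩ := (K.comap q).exists_gauge ((K.comap q).mapHom (1 : Λ →* Λ)) y₀ (by
    ext p
    change K.map ((FundamentalGroup.toPath p).map q) = 1
    rw [Subsingleton.elim (FundamentalGroup.toPath p) (Path.Homotopic.Quotient.refl y₀)]
    exact (K.comap q).map_refl y₀)
  refine ⟨d, fun {U s} hs hq x y γ hγ => ?_⟩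
  let δ : Path (s x) (s y) :=
    { toFun := s ∘ γ
      continuous_toFun := hs.comp_continuous γ.continuous hγ
      source' := by simp
      target' := by simp }
  have h := hd (.mk δ)
  rw [show ((K.comap q).mapHom (1 : Λ →* Λ)).map (.mk δ) = 1 from rfl, mul_one] at h
  rw [Function.comp_apply, Function.comp_apply, ← h]
  exact K.val_congr γ (δ.map q.continuous) fun t => (hq _ (hγ t)).symm

/-- A functor is injective on loops if the tautological functor factors through it. -/
theorem hom_injective_of_factor (F : PathFunctor X Λ) {x₀ : X} (κ : ∀ x, Path x₀ x)
    (ψ : Λ →* FundamentalGroup X x₀) (k : X → FundamentalGroup X x₀)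
    (h : ∀ p : Path.Homotopic.Quotient x₀ x₀,
      ((ofHom (MonoidHom.id (FundamentalGroup X x₀)) κ).gauge k).map p = ψ (F.map p)) :
    Function.Injective (F.hom x₀) := by
  rw [injective_iff_map_eq_one]
  intro p hp
  have h1 := h p
  rw [show F.map p = 1 from hp, map_one] at h1
  change k x₀ * _ * (k x₀)⁻¹ = 1 at h1
  rw [mul_inv_eq_one, mul_eq_left] at h1
  change ((Path.Homotopic.Quotient.mk (κ x₀)).trans p).trans (Path.Homotopic.Quotient.mk (κ x₀)).symm
    = Path.Homotopic.Quotient.refl x₀ at h1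
  generalize Path.Homotopic.Quotient.mk (κ x₀) = c at h1
  have h3 : p = (c.symm.trans ((c.trans p).trans c.symm)).trans c := by
    simp only [Path.Homotopic.Quotient.trans_assoc, Path.Homotopic.Quotient.symm_trans,
      Path.Homotopic.Quotient.trans_refl]
    rw [← Path.Homotopic.Quotient.trans_assoc, Path.Homotopic.Quotient.symm_trans,
      Path.Homotopic.Quotient.refl_trans]
  rw [h3, h1, Path.Homotopic.Quotient.trans_refl, Path.Homotopic.Quotient.symm_trans]
  rfl

end PathFunctor

end FigureEight

end

/-! ### Simply connected sheets and the universal property of the fibre functor. -/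

noncomputable section

namespace FigureEight

open PathFunctor

/-- Simply connected subsets of the plane above the members of the cover of the fibre. -/
def fibreSheet : Option Bool → Set (ℝ × ℝ)
  | none => {v | v.1 ∈ Set.Ioo (0 : ℝ) 1 ∧ v.2 ∈ Set.Ioo (0 : ℝ) 1 ∧
      (v.1 ∈ Set.Icc (1 / 4 : ℝ) (3 / 4) ∨ v.2 ∈ Set.Icc (1 / 4 : ℝ) (3 / 4))}
  | some false => Set.Ioo (-(1 / 4) : ℝ) (1 / 4) ×ˢ Set.Icc (1 / 4 : ℝ) (3 / 4)
  | some true => Set.Icc (1 / 4 : ℝ) (3 / 4) ×ˢ Set.Ioo (-(1 / 4) : ℝ) (1 / 4)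

theorem fibreSheet_or {i : Option Bool} {v : ℝ × ℝ} (h : v ∈ fibreSheet i) :
    v.1 ∈ Set.Icc (1 / 4 : ℝ) (3 / 4) ∨ v.2 ∈ Set.Icc (1 / 4 : ℝ) (3 / 4) := by
  rcases i with _ | _ | _
  · exact h.2.2
  · exact Or.inr h.2
  · exact Or.inl h.1

/-- The point of the fibre with the given real coordinates. -/
def fibreMk (v : ℝ × ℝ)
    (h : v.1 ∈ Set.Icc (1 / 4 : ℝ) (3 / 4) ∨ v.2 ∈ Set.Icc (1 / 4 : ℝ) (3 / 4)) : Fibre :=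
  ⟨((v.1 : UnitAddCircle), (v.2 : UnitAddCircle)), by
    rw [Prod.norm_def, le_max_iff]
    exact h.imp quarter_le_norm_coe quarter_le_norm_coe⟩

theorem continuous_coe : Continuous ((↑) : ℝ → UnitAddCircle) := AddCircle.continuous_mk' 1

/-- The projection of a sheet to the fibre. -/
def fibreProj (i : Option Bool) : C(fibreSheet i, Fibre) where
  toFun v := fibreMk v (fibreSheet_or v.2)
  continuous_toFun := by
    refine Continuous.subtype_mk ?_ _
    have := continuous_coe
    fun_prop

instance (i : Option Bool) : SimplyConnectedSpace (fibreSheet i) := by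
  have h : ContractibleSpace (fibreSheet i) := by
    rcases i with _ | _ | _
    -- The sheet over the complement of the axes is a cross, which is star-shaped about its centre.
    · refine StarConvex.contractibleSpace (x := ((1 / 2 : ℝ), (1 / 2 : ℝ))) ?_
        ⟨((1 / 2 : ℝ), (1 / 2 : ℝ)), by norm_num [fibreSheet]⟩
      rintro ⟨x, y⟩ ⟨⟨h1, h2⟩, ⟨h3, h4⟩, h5⟩ a b ha hb hab
      obtain rfl : a = 1 - b := by linarith
      simp only at h1 h2 h3 h4 h5
      have h6 : b ≤ 1 := by linarith
      simp only [fibreSheet, Set.mem_ofPred_eq, Prod.smul_mk, Prod.mk_add_mk, smul_eq_mul,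
        Set.mem_Ioo, Set.mem_Icc]
      refine ⟨⟨?_, ?_⟩, ⟨?_, ?_⟩, ?_⟩
      · rcases hb.eq_or_lt with rfl | hb' <;> nlinarith
      · rcases hb.eq_or_lt with rfl | hb' <;> nlinarith
      · rcases hb.eq_or_lt with rfl | hb' <;> nlinarith
      · rcases hb.eq_or_lt with rfl | hb' <;> nlinarith
      · refine h5.imp ?_ ?_ <;> rintro ⟨h7, h8⟩ <;> constructor <;> nlinarith
    · exact ((convex_Ioo _ _).prod (convex_Icc _ _)).contractibleSpace ⟨(0, 1 / 2), by norm_num [fibreSheet]⟩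
    · exact ((convex_Icc _ _).prod (convex_Ioo _ _)).contractibleSpace ⟨(1 / 2, 0), by norm_num [fibreSheet]⟩
  infer_instance

/-- The lower end of the interval of representatives of a coordinate on a sheet. -/
def cut (i : Option Bool) (b : Bool) : ℝ := if i = some b then -(1 / 2) else 0

theorem mem_fibreSheet {i : Option Bool} {p : Fibre} (h : p ∈ fibreCover i) :
    (rep (cut i false) (coord false p), rep (cut i true) (coord true p)) ∈ fibreSheet i := by
  have hor := fibre_or p
  rcases i with _ | _ | _
  · exact ⟨rep_zero_pos (h false), rep_zero_pos (h true),
      hor.imp (quarter_le_norm_iff _).1 (quarter_le_norm_iff _).1⟩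
  · exact ⟨(norm_lt_quarter_iff _).1 h,
      (quarter_le_norm_iff _).1 (quarter_le_norm_coord (by simp) h)⟩
  · exact ⟨(quarter_le_norm_iff _).1 (quarter_le_norm_coord (by simp) h),
      (norm_lt_quarter_iff _).1 h⟩

open Classical in
/-- The section of the projection of a sheet. -/
def fibreSection (i : Option Bool) (p : Fibre) : fibreSheet i :=
  if h : p ∈ fibreCover i then ⟨_, mem_fibreSheet h⟩ else Classical.arbitrary _

theorem fibreSection_coe {i : Option Bool} {p : Fibre} (h : p ∈ fibreCover i) :
    (fibreSection i p : ℝ × ℝ) =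
      (rep (cut i false) (coord false p), rep (cut i true) (coord true p)) := by
  rw [fibreSection, dif_pos h]

theorem coord_ne_cut {i : Option Bool} {p : Fibre} (h : p ∈ fibreCover i) (b : Bool) :
    coord b p ≠ (cut i b : UnitAddCircle) := by
  rcases i with _ | c
  · simpa [cut] using h b
  · rcases eq_or_ne c b with rfl | hcb
    · simpa [cut] using ne_half_of_norm_lt h
    · have := quarter_le_norm_coord hcb h
      have h2 : some c ≠ some b := by simpa using hcb
      rw [cut, if_neg h2, AddCircle.coe_zero]
      intro h0
      rw [h0, norm_zero] at this
      norm_num at this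

theorem continuousOn_fibreSection (i : Option Bool) :
    ContinuousOn (fibreSection i) (fibreCover i) := by
  rw [Topology.IsInducing.subtypeVal.continuousOn_iff]
  refine ContinuousOn.congr (f := fun p =>
    (rep (cut i false) (coord false p), rep (cut i true) (coord true p))) ?_
    fun p hp => fibreSection_coe hp
  intro p hp
  refine ContinuousAt.continuousWithinAt (ContinuousAt.prodMk ?_ ?_)
  · exact (continuousAt_rep (coord_ne_cut hp false)).comp (continuous_coord _).continuousAt
  · exact (continuousAt_rep (coord_ne_cut hp true)).comp (continuous_coord _).continuousAt

theorem fibreProj_fibreSection {i : Option Bool} {p : Fibre} (h : p ∈ fibreCover i) :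
    fibreProj i (fibreSection i p) = p := by
  apply Subtype.ext
  change (((fibreSection i p : ℝ × ℝ).1 : UnitAddCircle),
    ((fibreSection i p : ℝ × ℝ).2 : UnitAddCircle)) = p.1
  rw [fibreSection_coe h]
  simp only [coe_rep]
  rfl

theorem exists_trivialOn_fibreCover {Λ : Type*} [Group Λ] (K : PathFunctor Fibre Λ)
    (i : Option Bool) : ∃ g : Fibre → Λ, K.TrivialOn (fibreCover i) g := by
  obtain ⟨d, hd⟩ := K.exists_trivialOn_of_section (fibreProj i)
  exact ⟨_, hd (continuousOn_fibreSection i) fun p hp => fibreProj_fibreSection hp⟩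

theorem coord_fibreProj (i : Option Bool) (b : Bool) (v : fibreSheet i) :
    coord b (fibreProj i v) = ((if b then v.1.2 else v.1.1 : ℝ) : UnitAddCircle) := by
  cases b <;> rfl

theorem fibreSheet_mem {b : Bool} {v : ℝ × ℝ} (h : v ∈ fibreSheet (some b)) :
    (if b then v.2 else v.1) ∈ Set.Ioo (-(1 / 4) : ℝ) (1 / 4) ∧
      (if b then v.1 else v.2) ∈ Set.Icc (1 / 4 : ℝ) (3 / 4) := by
  cases b
  · exact ⟨h.1, h.2⟩
  · exact ⟨h.2, h.1⟩

theorem convex_fibreSheet_some (b : Bool) : Convex ℝ (fibreSheet (some b)) := by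
  cases b
  · exact (convex_Ioo _ _).prod (convex_Icc _ _)
  · exact (convex_Icc _ _).prod (convex_Ioo _ _)

theorem rep_coord_fibreProj {b : Bool} (v : fibreSheet (some b)) :
    rep (-(1 / 2)) (coord b (fibreProj (some b) v)) = if b then v.1.2 else v.1.1 := by
  have h := (fibreSheet_mem v.2).1
  rw [coord_fibreProj]
  exact rep_coe ⟨by linarith [h.1], by linarith [h.2]⟩

theorem fibreProj_mem (b : Bool) (v : fibreSheet (some b)) :
    fibreProj (some b) v ∈ fibreCover (some b) := by
  change ‖_‖ < _
  rw [coord_fibreProj]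
  exact norm_coe_lt_quarter (fibreSheet_mem v.2).1

theorem fibreProj_mem_none (b : Bool) (v : fibreSheet (some b))
    (h : (if b then v.1.2 else v.1.1) ≠ 0) : fibreProj (some b) v ∈ fibreCover none := by
  intro c h0
  rcases eq_or_ne b c with rfl | hbc
  · have h1 := rep_coord_fibreProj v
    rw [h0, ← AddCircle.coe_zero, rep_coe (by norm_num)] at h1
    exact h h1.symm
  · have h1 := quarter_le_norm_coord hbc (fibreProj_mem b v)
    rw [h0, norm_zero] at h1
    norm_num at h1

/-- Two points near a coordinate axis and on the same side of it are joined by a path on this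
side. -/
theorem exists_path_side {b : Bool} {p q : Fibre} (hp : p ∈ fibreCover (some b))
    (hq : q ∈ fibreCover (some b)) (hp0 : p ∈ fibreCover none) (hq0 : q ∈ fibreCover none)
    (h : 0 ≤ rep (-(1 / 2)) (coord b p) ↔ 0 ≤ rep (-(1 / 2)) (coord b q)) :
    ∃ γ : Path p q, ∀ t, γ t ∈ fibreCover none ∩ fibreCover (some b) := by
  let v := fibreSection (some b) p
  let w := fibreSection (some b) q
  have hv : fibreProj _ v = p := fibreProj_fibreSection hp
  have hw : fibreProj _ w = q := fibreProj_fibreSection hq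
  have hv' := rep_coord_fibreProj v
  have hw' := rep_coord_fibreProj w
  rw [hv] at hv'
  rw [hw] at hw'
  have hv0 := rep_half_ne_zero (hp0 b)
  have hw0 := rep_half_ne_zero (hq0 b)
  let δ : Path v w :=
    { toFun := fun t => ⟨(1 - (t : ℝ)) • v.1 + (t : ℝ) • w.1,
        convex_fibreSheet_some b v.2 w.2 (by linarith [t.2.2]) t.2.1 (by ring)⟩
      continuous_toFun := by fun_prop
      source' := by ext <;> simp
      target' := by ext <;> simp }
  have hδ : ∀ t : unitInterval, (if b then (δ t).1.2 else (δ t).1.1) =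
      (1 - (t : ℝ)) * rep (-(1 / 2)) (coord b p) + t * rep (-(1 / 2)) (coord b q) := by
    intro t
    rw [hv', hw']
    cases b <;> rfl
  refine ⟨(δ.map (fibreProj _).continuous).cast hv.symm hw.symm,
    fun t => ⟨fibreProj_mem_none b (δ t) ?_, fibreProj_mem b (δ t)⟩⟩
  rw [hδ]
  have h0 := t.2.1
  have h1 := t.2.2
  rcases lt_or_gt_of_ne hv0 with hv1 | hv1 <;> rcases lt_or_gt_of_ne hw0 with hw1 | hw1
  · refine ne_of_lt ?_
    rcases h0.eq_or_lt with h2 | h2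
    · rw [← h2]; linarith
    · nlinarith
  · exact absurd (h.2 hw1.le) hv1.not_ge
  · exact absurd (h.1 hv1.le) hw1.not_ge
  · refine ne_of_gt ?_
    rcases h0.eq_or_lt with h2 | h2
    · rw [← h2]; linarith
    · nlinarith

/-- Every functor on the fibre factors through the free group, up to natural isomorphism. -/
theorem exists_factor_fibre {Λ : Type*} [Group Λ] (K : PathFunctor Fibre Λ) :
    ∃ (ψ : F2 →* Λ) (k : Fibre → Λ), ∀ {x y : Fibre} (p : Path.Homotopic.Quotient x y),
      (K.gauge k).map p = ψ (fibreFunctor.map p) := by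
  choose g hg using exists_trivialOn_fibreCover K
  -- On each side of an axis the overlap is path connected, so the transition function is constant
  -- there; an empty side would get the default value `1`.
  have hconst : ∀ (b : Bool) (P : Prop), ∃ c : Λ, ∀ p ∈ fibreCover none ∩ fibreCover (some b),
      (0 ≤ rep (-(1 / 2)) (coord b p) ↔ P) → (g none p)⁻¹ * g (some b) p = c := by
    intro b P
    by_cases hex : ∃ q ∈ fibreCover none ∩ fibreCover (some b),
        (0 ≤ rep (-(1 / 2)) (coord b q) ↔ P)
    · obtain ⟨q, ⟨hq0, hq⟩, hqP⟩ := hex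
      refine ⟨(g none q)⁻¹ * g (some b) q, fun p hp hpP => ?_⟩
      obtain ⟨γ, hγ⟩ := exists_path_side hp.2 hq hp.1 hq0 (hpP.trans hqP.symm)
      have h1 := hg none γ fun t => (hγ t).1
      have h2 := hg (some b) γ fun t => (hγ t).2
      rw [h1] at h2
      calc (g none p)⁻¹ * g (some b) p
          = (g none q)⁻¹ * (g none q * (g none p)⁻¹) * g (some b) p := by group
        _ = _ := by rw [h2]; group
    · exact ⟨1, fun p hp hpP => (hex ⟨p, hp, hpP⟩).elim⟩
  choose c hc using hconst
  -- A generator goes to the jump of the transition constant across its axis.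
  let ψ : F2 →* Λ := FreeGroup.lift fun b => c (!b) False * (c (!b) True)⁻¹
  have hψ : ∀ b, ψ ((FreeGroup.of !b)⁻¹) = c b True * (c b False)⁻¹ := by
    intro b
    rw [map_inv, FreeGroup.lift_apply_of]
    simp
  classical
  -- The gauge turns the developing maps of `K` into `ψ` of the standard ones, up to a constant on
  -- the right. Points outside of the first chart lie on an axis.
  let k : Fibre → Λ := fun p => if p ∈ fibreCover none then (g none p)⁻¹ else
    if p ∈ fibreCover (some false) then c false True * (g (some false) p)⁻¹ else
      c true True * (g (some true) p)⁻¹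
  have hk : ∀ i, (K.gauge k).TrivialOn (fibreCover i) fun p => ψ (fibreDevelop i p) := by
    intro i x y γ hγ
    have h1 := TrivialOn.gauge (hg i) k γ hγ
    rw [h1]
    have hx : x ∈ fibreCover i := by simpa using hγ 0
    have hy : y ∈ fibreCover i := by simpa using hγ 1
    rcases i with _ | b
    · simp [k, hx, hy, fibreDevelop]
    · have key : ∀ p ∈ fibreCover (some b), k p * g (some b) p =
          ψ (fibreDevelop (some b) p) * c b False := by
        intro p hp
        by_cases h0 : p ∈ fibreCover none
        · simp only [k, if_pos h0, fibreDevelop]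
          split_ifs with hpos
          · rw [hψ, inv_mul_cancel_right]
            exact hc b True p ⟨h0, hp⟩ (iff_true_intro hpos)
          · rw [map_one, one_mul]
            exact hc b False p ⟨h0, hp⟩ (iff_false_intro hpos)
        · have hz : coord b p = 0 := by
            by_contra hne
            apply h0
            intro b' hb'
            rcases eq_or_ne b b' with rfl | hbb
            · exact hne hb'
            · have := quarter_le_norm_coord hbb hp
              rw [hb', norm_zero] at this
              norm_num at this
          have hrep : 0 ≤ rep (-(1 / 2)) (coord b p) := by
            rw [hz, ← AddCircle.coe_zero, rep_coe (by norm_num)]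
          simp only [k, if_neg h0, fibreDevelop, if_pos hrep, hψ, inv_mul_cancel_right]
          cases b
          · rw [if_pos hp, inv_mul_cancel_right]
          · have : p ∉ fibreCover (some false) := fun hf =>
              absurd (quarter_le_norm_coord (b := false) (c := true) (by simp) hf) (not_le.2 hp)
            rw [if_neg this, inv_mul_cancel_right]
      change k y * g (some b) y * (k x * g (some b) x)⁻¹ = ψ _ * (ψ _)⁻¹
      rw [key x hx, key y hy]
      group
  refine ⟨ψ, k, fun p => ?_⟩
  refine map_eq_of_cover (F := K.gauge k) (F' := fibreFunctor.mapHom ψ) isOpen_fibreCover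
    exists_mem_fibreCover (fun i x y γ hγ => ?_) p
  rw [hk i γ hγ]
  exact (TrivialOn.mapHom (fibreFunctor_trivialOn i) ψ γ hγ).symm

end FigureEight

end

noncomputable section

namespace FigureEight

open PathFunctor

instance : PathConnectedSpace Fibre := by
  let w : ∀ i, fibreSheet i := fun i => match i with
    | none => ⟨(1 / 5, 1 / 2), by norm_num [fibreSheet]⟩
    | some false => ⟨(1 / 5, 1 / 2), by norm_num [fibreSheet]⟩
    | some true => ⟨(1 / 2, 1 / 5), by norm_num [fibreSheet]⟩
  have hw : ∀ i, Joined (fibreProj none (w none)) (fibreProj i (w i)) := by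
    rintro (_ | _ | _)
    · exact Joined.refl _
    · exact Joined.refl _
    · let w' : fibreSheet none := ⟨(1 / 2, 1 / 5), by norm_num [fibreSheet]⟩
      have h := PathConnectedSpace.joined (w none) w'
      exact ⟨h.somePath.map (fibreProj none).continuous⟩
  have key : ∀ p : Fibre, Joined (fibreProj none (w none)) p := by
    intro p
    obtain ⟨i, hi⟩ := exists_mem_fibreCover p
    have h := PathConnectedSpace.joined (w i) (fibreSection i p)
    have h' : Joined (fibreProj i (w i)) (fibreProj i (fibreSection i p)) :=
      ⟨h.somePath.map (fibreProj i).continuous⟩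
    rw [fibreProj_fibreSection hi] at h'
    exact (hw i).trans h'
  exact ⟨⟨fibreProj none (w none)⟩, fun p q => (key p).symm.trans (key q)⟩

/-! ### Words of curves in the fibre -/

theorem mem_fibreCover_none_of_Ioo {p : Fibre} {x y : ℝ} {m n : ℤ}
    (h1 : p.1.1 = (x : UnitAddCircle)) (h2 : p.1.2 = (y : UnitAddCircle))
    (hx : x ∈ Set.Ioo (m : ℝ) (m + 1)) (hy : y ∈ Set.Ioo (n : ℝ) (n + 1)) :
    p ∈ fibreCover none := by
  have key : ∀ (z : ℝ) (k : ℤ), z ∈ Set.Ioo (k : ℝ) (k + 1) → (z : UnitAddCircle) ≠ 0 := by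
    intro z k hz
    have : ((z - k : ℝ) : UnitAddCircle) = z := by
      rw [← coe_add_intCast (z - k) k, sub_add_cancel]
    rw [← this]
    exact coe_ne_zero ⟨by linarith [hz.1], by linarith [hz.2]⟩
  rintro (_ | _)
  · change p.1.1 ≠ 0
    exact h1 ▸ key x m hx
  · change p.1.2 ≠ 0
    exact h2 ▸ key y n hy

theorem along_eq_one (γ : C(ℝ, Fibre)) {s t : ℝ} (hst : s ≤ t) (f g : ℝ → ℝ) (m n : ℤ)
    (hγ : ∀ r ∈ Set.Icc s t, (γ r).1 = ((f r : UnitAddCircle), (g r : UnitAddCircle)))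
    (hf : ∀ r ∈ Set.Icc s t, f r ∈ Set.Ioo (m : ℝ) (m + 1))
    (hg : ∀ r ∈ Set.Icc s t, g r ∈ Set.Ioo (n : ℝ) (n + 1)) :
    fibreFunctor.along γ s t = 1 := by
  rw [along_of_trivialOn _ γ hst (fibreFunctor_trivialOn none) fun r hr =>
    mem_fibreCover_none_of_Ioo (congrArg Prod.fst (hγ r hr)) (congrArg Prod.snd (hγ r hr))
      (hf r hr) (hg r hr)]
  simp [fibreDevelop]

theorem fibreDevelop_of_coord {b : Bool} {p : Fibre} {x : ℝ} {n : ℤ}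
    (h : coord b p = (x : UnitAddCircle)) (hx : x - n ∈ Set.Ioo (-(1 / 4) : ℝ) (1 / 4)) :
    p ∈ fibreCover (some b) ∧
      fibreDevelop (some b) p = if (n : ℝ) ≤ x then (FreeGroup.of !b)⁻¹ else 1 := by
  have h1 : coord b p = ((x - n : ℝ) : UnitAddCircle) := by
    rw [h, ← coe_add_intCast (x - n) n, sub_add_cancel]
  constructor
  · change ‖_‖ < _
    rw [h1]
    exact norm_coe_lt_quarter hx
  · have h2 : rep (-(1 / 2)) (coord b p) = x - n := by
      rw [h1]
      exact rep_coe ⟨by linarith [hx.1], by linarith [hx.2]⟩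
    simp only [fibreDevelop, h2, sub_nonneg]

theorem along_crossing (γ : C(ℝ, Fibre)) {s t : ℝ} (hst : s ≤ t) (b : Bool) (f : ℝ → ℝ) (n : ℤ)
    (hγ : ∀ r ∈ Set.Icc s t, coord b (γ r) = (f r : UnitAddCircle))
    (hf : ∀ r ∈ Set.Icc s t, f r - n ∈ Set.Ioo (-(1 / 4) : ℝ) (1 / 4)) :
    fibreFunctor.along γ s t = (if (n : ℝ) ≤ f t then (FreeGroup.of !b)⁻¹ else 1) *
      (if (n : ℝ) ≤ f s then (FreeGroup.of !b)⁻¹ else 1)⁻¹ := by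
  have hs := Set.left_mem_Icc.2 hst
  have ht := Set.right_mem_Icc.2 hst
  rw [along_of_trivialOn _ γ hst (fibreFunctor_trivialOn (some b)) fun r hr =>
    (fibreDevelop_of_coord (hγ r hr) (hf r hr)).1,
    (fibreDevelop_of_coord (hγ s hs) (hf s hs)).2, (fibreDevelop_of_coord (hγ t ht) (hf t ht)).2]

theorem along_up (γ : C(ℝ, Fibre)) {s t : ℝ} (hst : s ≤ t) (b : Bool) (f : ℝ → ℝ) (n : ℤ)
    (hγ : ∀ r ∈ Set.Icc s t, coord b (γ r) = (f r : UnitAddCircle))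
    (hf : ∀ r ∈ Set.Icc s t, f r - n ∈ Set.Ioo (-(1 / 4) : ℝ) (1 / 4))
    (hs : f s < n) (ht : n ≤ f t) : fibreFunctor.along γ s t = (FreeGroup.of !b)⁻¹ := by
  rw [along_crossing γ hst b f n hγ hf, if_pos ht, if_neg hs.not_ge, inv_one, mul_one]

theorem along_down (γ : C(ℝ, Fibre)) {s t : ℝ} (hst : s ≤ t) (b : Bool) (f : ℝ → ℝ) (n : ℤ)
    (hγ : ∀ r ∈ Set.Icc s t, coord b (γ r) = (f r : UnitAddCircle))
    (hf : ∀ r ∈ Set.Icc s t, f r - n ∈ Set.Ioo (-(1 / 4) : ℝ) (1 / 4))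
    (hs : n ≤ f s) (ht : f t < n) : fibreFunctor.along γ s t = FreeGroup.of !b := by
  rw [along_crossing γ hst b f n hγ hf, if_pos hs, if_neg ht.not_ge, inv_inv, one_mul]

/-- The closed curves parallel to the coordinate axes through a point with both coordinates `c`. -/
def axisCurve (b : Bool) (c : UnitAddCircle) (hc : 1 / 4 ≤ ‖c‖) : C(ℝ, Fibre) where
  toFun t := ⟨if b then (c, (t : UnitAddCircle)) else ((t : UnitAddCircle), c), by
    rw [Prod.norm_def, le_max_iff]
    cases b
    · exact Or.inr hc
    · exact Or.inl hc⟩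
  continuous_toFun := by
    refine Continuous.subtype_mk ?_ _
    have := continuous_coe
    cases b
    · simp only [Bool.false_eq_true, if_false]; fun_prop
    · simp only [if_true]; fun_prop

/-- The loop given by a segment of a curve. -/
def segmentLoop {X : Type*} [TopologicalSpace X] (γ : C(ℝ, X)) {s t : ℝ} (h : γ s = γ t) :
    FundamentalGroup X (γ s) :=
  FundamentalGroup.fromPath (.mk (((linePath s t).map γ.continuous).cast rfl h))

theorem hom_segmentLoop {X Λ : Type*} [TopologicalSpace X] [Group Λ] (F : PathFunctor X Λ)
    (γ : C(ℝ, X)) {s t : ℝ} (h : γ s = γ t) : F.hom (γ s) (segmentLoop γ h) = F.along γ s t :=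
  F.val_cast _ _ _

/-- Loops at a common base point which represent given values generate. -/
theorem mem_range_hom {X Λ : Type*} [TopologicalSpace X] [Group Λ] (F : PathFunctor X Λ)
    (γ : C(ℝ, X)) {s t : ℝ} (h : γ s = γ t) {x : X} (hx : γ s = x) :
    F.along γ s t ∈ (F.hom x).range := by
  subst hx
  exact ⟨segmentLoop γ h, hom_segmentLoop F γ h⟩

theorem along_axisCurve (b : Bool) (c : ℝ) (hc : 1 / 4 ≤ ‖(c : UnitAddCircle)‖)
    (hc' : c ∈ Set.Ioo (0 : ℝ) 1) {s : ℝ} (hs : s ∈ Set.Ioo (0 : ℝ) 1) :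
    fibreFunctor.along (axisCurve b c hc) s (s + 1) = (FreeGroup.of !b)⁻¹ := by
  have hpt : ∀ t, (axisCurve b c hc t).1 =
      (((if b then c else t : ℝ) : UnitAddCircle), ((if b then t else c : ℝ) : UnitAddCircle)) := by
    intro t
    cases b <;> rfl
  -- The only crossing is at parameter `1`. The cuts `4 / 5` and `6 / 5` keep the curve within `1 /
  -- 4` of the axis, and `max` and `min` cover starting points near the ends.
  have h3 : fibreFunctor.along (axisCurve b c hc) (max s (4 / 5)) (min (s + 1) (6 / 5)) =
      (FreeGroup.of !b)⁻¹ := by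
    refine along_up _ ?_ b id 1 ?_ ?_ ?_ ?_
    · rw [max_le_iff, le_min_iff, le_min_iff]
      refine ⟨⟨?_, ?_⟩, ?_, ?_⟩ <;> linarith [hs.1, hs.2]
    · intro r _
      cases b <;> rfl
    · rintro r ⟨h1, h2⟩
      have := (le_max_right _ _).trans h1
      have := h2.trans (min_le_right _ _)
      constructor <;> simp only [id, Int.cast_one] <;> linarith
    · simp only [id, Int.cast_one, max_lt_iff]
      exact ⟨hs.2, by norm_num⟩
    · simp only [id, Int.cast_one, le_min_iff]
      exact ⟨by linarith [hs.1], by norm_num⟩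
  have h1 : fibreFunctor.along (axisCurve b c hc) s (max s (4 / 5)) = 1 := by
    refine along_eq_one _ (le_max_left _ _) (fun t => if b then c else t)
      (fun t => if b then t else c) 0 0 (fun r _ => hpt r) ?_ ?_ <;> rintro r ⟨h1, h2⟩
    all_goals
      have : r < 1 := h2.trans_lt (max_lt hs.2 (by norm_num))
      have : 0 < r := hs.1.trans_le h1
      have := hc'.1
      have := hc'.2
      cases b <;> constructor <;> simp <;> linarith
  have h5 : fibreFunctor.along (axisCurve b c hc) (min (s + 1) (6 / 5)) (s + 1) = 1 := by
    refine along_eq_one _ (min_le_left _ _) (fun t => if b then c else t)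
      (fun t => if b then t else c) (if b then 0 else 1) (if b then 1 else 0)
      (fun r _ => hpt r) ?_ ?_ <;> rintro r ⟨h1, h2⟩
    all_goals
      have : 1 < r := (lt_min (by linarith [hs.1]) (by norm_num)).trans_le h1
      have : r < 2 := by linarith [hs.2]
      have := hc'.1
      have := hc'.2
      cases b <;> constructor <;> simp <;> linarith
  rw [along_trans _ _ s (max s (4 / 5)), along_trans _ _ (max s (4 / 5)) (min (s + 1) (6 / 5)),
    h1, h3, h5, mul_one, one_mul]

/-- Injective because the tautological functor factors through it by `exists_factor_fibre`;
surjective because the two axis curves represent the generators up to inversion. -/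
theorem bijective_fibreFunctor (p : Fibre) : Function.Bijective (fibreFunctor.hom p) := by
  have hh : 1 / 4 ≤ ‖((1 / 2 : ℝ) : UnitAddCircle)‖ := quarter_le_norm_coe (by norm_num)
  let x₀ : Fibre := axisCurve false _ hh (1 / 2)
  refine fibreFunctor.hom_bijective (x₀ := x₀) p ⟨?_, ?_⟩
  · obtain ⟨ψ, k, h⟩ := exists_factor_fibre
      (ofHom (MonoidHom.id (FundamentalGroup Fibre x₀)) (PathConnectedSpace.somePath x₀))
    exact hom_injective_of_factor _ _ ψ k h
  · rw [← MonoidHom.range_eq_top, eq_top_iff, ← FreeGroup.closure_range_of, Subgroup.closure_le]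
    rintro _ ⟨b, rfl⟩
    have h := mem_range_hom fibreFunctor (axisCurve (!b) _ hh) (s := 1 / 2) (t := 1 / 2 + 1) (by
      have := coe_add_one (1 / 2)
      apply Subtype.ext
      change (if _ then _ else _) = (if _ then _ else _)
      rw [this]) (x := x₀) (by cases b <;> rfl)
    rw [along_axisCurve _ _ _ (by norm_num) (by norm_num), inv_mem_iff, Bool.not_not] at h
    exact h

end FigureEight

end

noncomputable section

namespace FigureEight

open PathFunctor

/-! ### The action of the monodromy on the fundamental groupoid of the fibre -/

theorem twist_coe_of_mem {y : ℝ} (h : y ∈ Set.Icc (1 / 4 : ℝ) (3 / 4)) :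
    twist (y : UnitAddCircle) = ((2 * y - 1 / 2 : ℝ) : UnitAddCircle) := by
  rw [twist, AddCircle.liftIco_zero_coe_apply ⟨by linarith [h.1], by linarith [h.2]⟩,
    min_eq_right (by linarith [h.2]), max_eq_right (by linarith [h.1])]

theorem norm_coe_of_mem_side {y : ℝ} (h : y ∈ Set.Icc (3 / 4 : ℝ) (5 / 4)) :
    ‖(y : UnitAddCircle)‖ ≤ 1 / 4 := by
  have h1 : |y - 1| ≤ 1 / 4 := abs_le.2 ⟨by linarith [h.1], by linarith [h.2]⟩
  rw [← sub_add_cancel y 1, coe_add_one, norm_coe_of_abs_le (h1.trans (by norm_num))]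
  exact h1

theorem twist_coe_side {y : ℝ} (h : y ∈ Set.Icc (3 / 4 : ℝ) (5 / 4)) :
    twist (y : UnitAddCircle) = 0 := twist_eq_zero (norm_coe_of_mem_side h)

theorem twist_coe_quarter : twist ((1 / 4 : ℝ) : UnitAddCircle) = 0 :=
  twist_eq_zero (by rw [norm_coe_of_abs_le] <;> norm_num [abs_of_pos])

theorem monodromy_val (p : Fibre) : (monodromy p).1 =
    (p.1.1 + twist p.1.2, p.1.2 + twist (p.1.1 + twist p.1.2)) := rfl

theorem quarter_norm : 1 / 4 ≤ ‖((1 / 4 : ℝ) : UnitAddCircle)‖ :=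
  quarter_le_norm_coe (by norm_num)

/-- The monodromy as a continuous map. -/
abbrev monodromyMap : C(Fibre, Fibre) := ⟨monodromy, monodromy.continuous⟩

theorem monodromy_vertical₁ {t : ℝ} (h : t ∈ Set.Icc (1 / 4 : ℝ) (1 / 2)) :
    (monodromy (axisCurve true _ quarter_norm t)).1 =
      (((2 * t - 1 / 4 : ℝ) : UnitAddCircle), ((5 * t - 1 : ℝ) : UnitAddCircle)) := by
  have h1 : twist (t : UnitAddCircle) = ((2 * t - 1 / 2 : ℝ) : UnitAddCircle) :=
    twist_coe_of_mem ⟨h.1, by linarith [h.2]⟩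
  have h2 : ((1 / 4 : ℝ) : UnitAddCircle) + ((2 * t - 1 / 2 : ℝ) : UnitAddCircle) =
      ((2 * t - 1 / 4 : ℝ) : UnitAddCircle) := by
    rw [← AddCircle.coe_add]; congr 1; ring
  rw [monodromy_val]
  change (((1 / 4 : ℝ) : UnitAddCircle) + twist (t : UnitAddCircle), (t : UnitAddCircle) +
    twist (((1 / 4 : ℝ) : UnitAddCircle) + twist (t : UnitAddCircle))) = _
  rw [h1, h2, twist_coe_of_mem ⟨by linarith [h.1], by linarith [h.2]⟩, ← AddCircle.coe_add]
  congr 2; ring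

theorem monodromy_vertical₂ {t : ℝ} (h : t ∈ Set.Icc (1 / 2 : ℝ) (3 / 4)) :
    (monodromy (axisCurve true _ quarter_norm t)).1 =
      (((2 * t - 1 / 4 : ℝ) : UnitAddCircle), (t : UnitAddCircle)) := by
  have h1 : twist (t : UnitAddCircle) = ((2 * t - 1 / 2 : ℝ) : UnitAddCircle) :=
    twist_coe_of_mem ⟨by linarith [h.1], h.2⟩
  have h2 : ((1 / 4 : ℝ) : UnitAddCircle) + ((2 * t - 1 / 2 : ℝ) : UnitAddCircle) =
      ((2 * t - 1 / 4 : ℝ) : UnitAddCircle) := by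
    rw [← AddCircle.coe_add]; congr 1; ring
  rw [monodromy_val]
  change (((1 / 4 : ℝ) : UnitAddCircle) + twist (t : UnitAddCircle), (t : UnitAddCircle) +
    twist (((1 / 4 : ℝ) : UnitAddCircle) + twist (t : UnitAddCircle))) = _
  rw [h1, h2, twist_coe_side ⟨by linarith [h.1], by linarith [h.2]⟩, add_zero]

theorem monodromy_vertical₃ {t : ℝ} (h : t ∈ Set.Icc (3 / 4 : ℝ) (5 / 4)) :
    (monodromy (axisCurve true _ quarter_norm t)).1 =
      (((1 / 4 : ℝ) : UnitAddCircle), (t : UnitAddCircle)) := by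
  rw [monodromy_val]
  change (((1 / 4 : ℝ) : UnitAddCircle) + twist (t : UnitAddCircle), (t : UnitAddCircle) +
    twist (((1 / 4 : ℝ) : UnitAddCircle) + twist (t : UnitAddCircle))) = _
  rw [twist_coe_side h, add_zero, twist_coe_quarter, add_zero]

theorem monodromy_horizontal₁ {t : ℝ} (h : t ∈ Set.Icc (1 / 4 : ℝ) (3 / 4)) :
    (monodromy (axisCurve false _ quarter_norm t)).1 =
      ((t : UnitAddCircle), ((2 * t - 1 / 4 : ℝ) : UnitAddCircle)) := by
  rw [monodromy_val]
  change ((t : UnitAddCircle) + twist ((1 / 4 : ℝ) : UnitAddCircle),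
    ((1 / 4 : ℝ) : UnitAddCircle) +
      twist ((t : UnitAddCircle) + twist ((1 / 4 : ℝ) : UnitAddCircle))) = _
  rw [twist_coe_quarter, add_zero, twist_coe_of_mem h, ← AddCircle.coe_add]
  congr 2; ring

theorem monodromy_horizontal₂ {t : ℝ} (h : t ∈ Set.Icc (3 / 4 : ℝ) (5 / 4)) :
    (monodromy (axisCurve false _ quarter_norm t)).1 =
      ((t : UnitAddCircle), ((1 / 4 : ℝ) : UnitAddCircle)) := by
  rw [monodromy_val]
  change ((t : UnitAddCircle) + twist ((1 / 4 : ℝ) : UnitAddCircle),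
    ((1 / 4 : ℝ) : UnitAddCircle) +
      twist ((t : UnitAddCircle) + twist ((1 / 4 : ℝ) : UnitAddCircle))) = _
  rw [twist_coe_quarter, add_zero, twist_coe_side h, add_zero]

/-- The image of the vertical loop crosses the horizontal axis at `t = 2/5`, the vertical one at `t
= 5/8` and the horizontal one at `t = 1`, always upwards. The cuts isolate these crossings. -/
theorem along_monodromy_vertical :
    fibreFunctor.along (monodromyMap.comp (axisCurve true _ quarter_norm)) (1 / 4) (1 / 4 + 1) =
      (genA * genB * genA)⁻¹ := by
  set γ := monodromyMap.comp (axisCurve true _ quarter_norm)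
  have h1 : fibreFunctor.along γ (1 / 4) (9 / 25) = 1 :=
    along_eq_one γ (by norm_num) (fun t => 2 * t - 1 / 4) (fun t => 5 * t - 1) 0 0
      (fun r hr => monodromy_vertical₁ ⟨by linarith [hr.1], by linarith [hr.2]⟩)
      (by rintro r ⟨_, _⟩; constructor <;> norm_num <;> linarith)
      (by rintro r ⟨_, _⟩; constructor <;> norm_num <;> linarith)
  have h2 : fibreFunctor.along γ (9 / 25) (11 / 25) = genA⁻¹ :=
    along_up γ (by norm_num) true (fun t => 5 * t - 1) 1
      (fun r hr => congrArg Prod.snd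
        (monodromy_vertical₁ ⟨by linarith [hr.1], by linarith [hr.2]⟩))
      (by rintro r ⟨_, _⟩; constructor <;> norm_num <;> linarith) (by norm_num) (by norm_num)
  have h3 : fibreFunctor.along γ (11 / 25) (1 / 2) = 1 :=
    along_eq_one γ (by norm_num) (fun t => 2 * t - 1 / 4) (fun t => 5 * t - 1) 0 1
      (fun r hr => monodromy_vertical₁ ⟨by linarith [hr.1], by linarith [hr.2]⟩)
      (by rintro r ⟨_, _⟩; constructor <;> norm_num <;> linarith)
      (by rintro r ⟨_, _⟩; constructor <;> norm_num <;> linarith)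
  have h4 : fibreFunctor.along γ (1 / 2) (11 / 20) = 1 :=
    along_eq_one γ (by norm_num) (fun t => 2 * t - 1 / 4) (fun t => t) 0 0
      (fun r hr => monodromy_vertical₂ ⟨by linarith [hr.1], by linarith [hr.2]⟩)
      (by rintro r ⟨_, _⟩; constructor <;> norm_num <;> linarith)
      (by rintro r ⟨_, _⟩; constructor <;> norm_num <;> linarith)
  have h5 : fibreFunctor.along γ (11 / 20) (7 / 10) = genB⁻¹ :=
    along_up γ (by norm_num) false (fun t => 2 * t - 1 / 4) 1
      (fun r hr => congrArg Prod.fst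
        (monodromy_vertical₂ ⟨by linarith [hr.1], by linarith [hr.2]⟩))
      (by rintro r ⟨_, _⟩; constructor <;> norm_num <;> linarith) (by norm_num) (by norm_num)
  have h6 : fibreFunctor.along γ (7 / 10) (3 / 4) = 1 :=
    along_eq_one γ (by norm_num) (fun t => 2 * t - 1 / 4) (fun t => t) 1 0
      (fun r hr => monodromy_vertical₂ ⟨by linarith [hr.1], by linarith [hr.2]⟩)
      (by rintro r ⟨_, _⟩; constructor <;> norm_num <;> linarith)
      (by rintro r ⟨_, _⟩; constructor <;> norm_num <;> linarith)
  have h7 : fibreFunctor.along γ (3 / 4) (7 / 8) = 1 :=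
    along_eq_one γ (by norm_num) (fun _ => 1 / 4) (fun t => t) 0 0
      (fun r hr => monodromy_vertical₃ ⟨by linarith [hr.1], by linarith [hr.2]⟩)
      (by rintro r ⟨_, _⟩; constructor <;> norm_num)
      (by rintro r ⟨_, _⟩; constructor <;> norm_num <;> linarith)
  have h8 : fibreFunctor.along γ (7 / 8) (9 / 8) = genA⁻¹ :=
    along_up γ (by norm_num) true (fun t => t) 1
      (fun r hr => congrArg Prod.snd
        (monodromy_vertical₃ ⟨by linarith [hr.1], by linarith [hr.2]⟩))
      (by rintro r ⟨_, _⟩; constructor <;> norm_num <;> linarith) (by norm_num) (by norm_num)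
  have h9 : fibreFunctor.along γ (9 / 8) (1 / 4 + 1) = 1 :=
    along_eq_one γ (by norm_num) (fun _ => 1 / 4) (fun t => t) 0 1
      (fun r hr => monodromy_vertical₃ ⟨by linarith [hr.1], by linarith [hr.2]⟩)
      (by rintro r ⟨_, _⟩; constructor <;> norm_num)
      (by rintro r ⟨_, _⟩; constructor <;> norm_num <;> linarith)
  rw [along_trans _ _ (1 / 4) (9 / 25), along_trans _ _ (9 / 25) (11 / 25),
    along_trans _ _ (11 / 25) (1 / 2), along_trans _ _ (1 / 2) (11 / 20),
    along_trans _ _ (11 / 20) (7 / 10), along_trans _ _ (7 / 10) (3 / 4),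
    along_trans _ _ (3 / 4) (7 / 8), along_trans _ _ (7 / 8) (9 / 8),
    h1, h2, h3, h4, h5, h6, h7, h8, h9]
  group

/-- The image crosses the horizontal axis at `t = 5/8` and the vertical one at `t = 1`. -/
theorem along_monodromy_horizontal :
    fibreFunctor.along (monodromyMap.comp (axisCurve false _ quarter_norm)) (1 / 4) (1 / 4 + 1) =
      (genA * genB)⁻¹ := by
  set γ := monodromyMap.comp (axisCurve false _ quarter_norm)
  have h1 : fibreFunctor.along γ (1 / 4) (11 / 20) = 1 :=
    along_eq_one γ (by norm_num) (fun t => t) (fun t => 2 * t - 1 / 4) 0 0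
      (fun r hr => monodromy_horizontal₁ ⟨by linarith [hr.1], by linarith [hr.2]⟩)
      (by rintro r ⟨_, _⟩; constructor <;> norm_num <;> linarith)
      (by rintro r ⟨_, _⟩; constructor <;> norm_num <;> linarith)
  have h2 : fibreFunctor.along γ (11 / 20) (7 / 10) = genA⁻¹ :=
    along_up γ (by norm_num) true (fun t => 2 * t - 1 / 4) 1
      (fun r hr => congrArg Prod.snd
        (monodromy_horizontal₁ ⟨by linarith [hr.1], by linarith [hr.2]⟩))
      (by rintro r ⟨_, _⟩; constructor <;> norm_num <;> linarith) (by norm_num) (by norm_num)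
  have h3 : fibreFunctor.along γ (7 / 10) (3 / 4) = 1 :=
    along_eq_one γ (by norm_num) (fun t => t) (fun t => 2 * t - 1 / 4) 0 1
      (fun r hr => monodromy_horizontal₁ ⟨by linarith [hr.1], by linarith [hr.2]⟩)
      (by rintro r ⟨_, _⟩; constructor <;> norm_num <;> linarith)
      (by rintro r ⟨_, _⟩; constructor <;> norm_num <;> linarith)
  have h4 : fibreFunctor.along γ (3 / 4) (7 / 8) = 1 :=
    along_eq_one γ (by norm_num) (fun t => t) (fun _ => 1 / 4) 0 0
      (fun r hr => monodromy_horizontal₂ ⟨by linarith [hr.1], by linarith [hr.2]⟩)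
      (by rintro r ⟨_, _⟩; constructor <;> norm_num <;> linarith)
      (by rintro r ⟨_, _⟩; constructor <;> norm_num)
  have h5 : fibreFunctor.along γ (7 / 8) (9 / 8) = genB⁻¹ :=
    along_up γ (by norm_num) false (fun t => t) 1
      (fun r hr => congrArg Prod.fst
        (monodromy_horizontal₂ ⟨by linarith [hr.1], by linarith [hr.2]⟩))
      (by rintro r ⟨_, _⟩; constructor <;> norm_num <;> linarith) (by norm_num) (by norm_num)
  have h6 : fibreFunctor.along γ (9 / 8) (1 / 4 + 1) = 1 :=
    along_eq_one γ (by norm_num) (fun t => t) (fun _ => 1 / 4) 1 0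
      (fun r hr => monodromy_horizontal₂ ⟨by linarith [hr.1], by linarith [hr.2]⟩)
      (by rintro r ⟨_, _⟩; constructor <;> norm_num <;> linarith)
      (by rintro r ⟨_, _⟩; constructor <;> norm_num)
  rw [along_trans _ _ (1 / 4) (11 / 20), along_trans _ _ (11 / 20) (7 / 10),
    along_trans _ _ (7 / 10) (3 / 4), along_trans _ _ (3 / 4) (7 / 8),
    along_trans _ _ (7 / 8) (9 / 8), h1, h2, h3, h4, h5, h6]
  group

/-! ### The boundary of the fibre -/

theorem norm_coe_of_mem_Icc' {y : ℝ} (h0 : -(1 / 4) ≤ y) (h1 : y ≤ 3 / 4) :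
    ‖(y : UnitAddCircle)‖ = min |y| (1 - y) := by
  rcases le_total 0 y with h | h
  · rw [norm_coe_of_mem_Icc h (by linarith), abs_of_nonneg h]
  · rw [norm_coe_of_abs_le (by rw [abs_of_nonpos h]; linarith), abs_of_nonpos h,
      min_eq_left (by linarith)]

/-- The first coordinate of the boundary curve of the fibre. -/
def waveX (t : ℝ) : ℝ := max (-(1 / 4)) (min (1 / 4) (1 / 2 - 2 * min t (1 - t)))

/-- The second coordinate of the boundary curve of the fibre. -/
def waveY (t : ℝ) : ℝ := max (-(1 / 4)) (min (1 / 4) (1 / 2 - 2 * min |t - 1 / 4| (5 / 4 - t)))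

/-- The boundary curve of the fibre as a periodic curve. -/
def boundaryCurve : C(ℝ, Fibre) :=
  ⟨fun t => fibreBoundary t, (continuous_square.comp continuous_coe).subtype_mk _⟩

theorem boundaryCurve_val {t : ℝ} (h : t ∈ Set.Icc (0 : ℝ) 1) :
    (boundaryCurve t).1 = ((waveX t : UnitAddCircle), (waveY t : UnitAddCircle)) := by
  change square t = _
  rw [square, wave, wave, ← AddCircle.coe_sub, norm_coe_of_mem_Icc h.1 h.2,
    norm_coe_of_mem_Icc' (by linarith [h.1]) (by linarith [h.2]), waveX, waveY,
    show 1 - (t - 1 / 4) = 5 / 4 - t by ring]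

theorem along_boundaryCurve : fibreFunctor.along boundaryCurve 0 1 = bdry := by
  -- The curve starts and ends on the horizontal axis. Points on an axis count as its nonnegative
  -- side, so there is no crossing at the start and an upward one in the last segment.
  have h1 : fibreFunctor.along boundaryCurve 0 (1 / 10) = 1 := by
    rw [along_crossing boundaryCurve (by norm_num) true waveY 0
      (fun r hr => congrArg Prod.snd (boundaryCurve_val ⟨by linarith [hr.1], by linarith [hr.2]⟩))
      (by rintro r ⟨_, _⟩; simp only [waveY]; constructor <;> grind),
      if_pos (by simp only [waveY]; grind), if_pos (by simp only [waveY]; grind), mul_inv_cancel]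
  have h2 : fibreFunctor.along boundaryCurve (1 / 10) (3 / 20) = 1 :=
    along_eq_one _ (by norm_num) waveX waveY 0 0
      (fun r hr => boundaryCurve_val ⟨by linarith [hr.1], by linarith [hr.2]⟩)
      (by rintro r ⟨_, _⟩; simp only [waveX]; constructor <;> grind)
      (by rintro r ⟨_, _⟩; simp only [waveY]; constructor <;> grind)
  have h3 : fibreFunctor.along boundaryCurve (3 / 20) (7 / 20) = genB :=
    along_down _ (by norm_num) false waveX 0
      (fun r hr => congrArg Prod.fst (boundaryCurve_val ⟨by linarith [hr.1], by linarith [hr.2]⟩))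
      (by rintro r ⟨_, _⟩; simp only [waveX]; constructor <;> grind)
      (by simp only [waveX]; grind) (by simp only [waveX]; grind)
  have h4 : fibreFunctor.along boundaryCurve (7 / 20) (2 / 5) = 1 :=
    along_eq_one _ (by norm_num) waveX waveY (-1) 0
      (fun r hr => boundaryCurve_val ⟨by linarith [hr.1], by linarith [hr.2]⟩)
      (by rintro r ⟨_, _⟩; simp only [waveX]; constructor <;> grind)
      (by rintro r ⟨_, _⟩; simp only [waveY]; constructor <;> grind)
  have h5 : fibreFunctor.along boundaryCurve (2 / 5) (3 / 5) = genA :=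
    along_down _ (by norm_num) true waveY 0
      (fun r hr => congrArg Prod.snd (boundaryCurve_val ⟨by linarith [hr.1], by linarith [hr.2]⟩))
      (by rintro r ⟨_, _⟩; simp only [waveY]; constructor <;> grind)
      (by simp only [waveY]; grind) (by simp only [waveY]; grind)
  have h6 : fibreFunctor.along boundaryCurve (3 / 5) (13 / 20) = 1 :=
    along_eq_one _ (by norm_num) waveX waveY (-1) (-1)
      (fun r hr => boundaryCurve_val ⟨by linarith [hr.1], by linarith [hr.2]⟩)
      (by rintro r ⟨_, _⟩; simp only [waveX]; constructor <;> grind)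
      (by rintro r ⟨_, _⟩; simp only [waveY]; constructor <;> grind)
  have h7 : fibreFunctor.along boundaryCurve (13 / 20) (17 / 20) = genB⁻¹ :=
    along_up _ (by norm_num) false waveX 0
      (fun r hr => congrArg Prod.fst (boundaryCurve_val ⟨by linarith [hr.1], by linarith [hr.2]⟩))
      (by rintro r ⟨_, _⟩; simp only [waveX]; constructor <;> grind)
      (by simp only [waveX]; grind) (by simp only [waveX]; grind)
  have h8 : fibreFunctor.along boundaryCurve (17 / 20) (9 / 10) = 1 :=
    along_eq_one _ (by norm_num) waveX waveY 0 (-1)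
      (fun r hr => boundaryCurve_val ⟨by linarith [hr.1], by linarith [hr.2]⟩)
      (by rintro r ⟨_, _⟩; simp only [waveX]; constructor <;> grind)
      (by rintro r ⟨_, _⟩; simp only [waveY]; constructor <;> grind)
  have h9 : fibreFunctor.along boundaryCurve (9 / 10) 1 = genA⁻¹ :=
    along_up _ (by norm_num) true waveY 0
      (fun r hr => congrArg Prod.snd (boundaryCurve_val ⟨by linarith [hr.1], by linarith [hr.2]⟩))
      (by rintro r ⟨_, _⟩; simp only [waveY]; constructor <;> grind)
      (by simp only [waveY]; grind) (by simp only [waveY]; grind)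
  rw [along_trans _ _ 0 (1 / 10), along_trans _ _ (1 / 10) (3 / 20),
    along_trans _ _ (3 / 20) (7 / 20), along_trans _ _ (7 / 20) (2 / 5),
    along_trans _ _ (2 / 5) (3 / 5), along_trans _ _ (3 / 5) (13 / 20),
    along_trans _ _ (13 / 20) (17 / 20), along_trans _ _ (17 / 20) (9 / 10),
    h1, h2, h3, h4, h5, h6, h7, h8, h9, bdry]
  group

end FigureEight

end

noncomputable section

namespace FigureEight

open PathFunctor

/-! ### The radial structure near the hole -/

/-- The torus. -/
abbrev Torus : Type := UnitAddCircle × UnitAddCircle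

/-- Multiplication by `c` in the coordinates around the centre of the hole. -/
def radial (p : Torus) (c : ℝ) : Torus :=
  (((c * rep (-(1 / 2)) p.1 : ℝ) : UnitAddCircle), ((c * rep (-(1 / 2)) p.2 : ℝ) : UnitAddCircle))

theorem radial_one (p : Torus) : radial p 1 = p := by
  ext <;> simp [radial, coe_rep]

theorem norm_radial {p : Torus} {c : ℝ} (hc : 0 ≤ c) (h : c * ‖p‖ ≤ 1 / 2) :
    ‖radial p c‖ = c * ‖p‖ := by
  have key : ∀ x : UnitAddCircle, ‖x‖ ≤ ‖p‖ →
      ‖((c * rep (-(1 / 2)) x : ℝ) : UnitAddCircle)‖ = c * ‖x‖ := by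
    intro x hx
    have h1 : |c * rep (-(1 / 2)) x| = c * ‖x‖ := by
      rw [abs_mul, abs_of_nonneg hc, norm_eq_abs_rep]
    rw [norm_coe_of_abs_le, h1]
    rw [h1]
    exact (mul_le_mul_of_nonneg_left hx hc).trans h
  rw [Prod.norm_def, radial, key _ (norm_fst_le p), key _ (norm_snd_le p), Prod.norm_def,
    mul_max_of_nonneg _ _ hc]

theorem ne_half_of_norm_lt_half {x : UnitAddCircle} (h : ‖x‖ < 1 / 2) :
    x ≠ ((-(1 / 2) : ℝ) : UnitAddCircle) := by
  rintro rfl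
  rw [norm_coe_of_abs_le (by norm_num [abs_of_neg]), abs_of_neg (by norm_num)] at h
  norm_num at h

theorem continuousAt_radial {p : Torus} (h : ‖p‖ < 1 / 2) (c : ℝ) :
    ContinuousAt (fun x : Torus × ℝ => radial x.1 x.2) (p, c) := by
  have h1 := continuousAt_rep (ne_half_of_norm_lt_half ((norm_fst_le p).trans_lt h))
  have h2 := continuousAt_rep (ne_half_of_norm_lt_half ((norm_snd_le p).trans_lt h))
  have h1' : ContinuousAt (fun x : Torus × ℝ => rep (-(1 / 2)) x.1.1) (p, c) :=
    ContinuousAt.comp (f := fun x : Torus × ℝ => x.1.1) h1 (by fun_prop)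
  have h2' : ContinuousAt (fun x : Torus × ℝ => rep (-(1 / 2)) x.1.2) (p, c) :=
    ContinuousAt.comp (f := fun x : Torus × ℝ => x.1.2) h2 (by fun_prop)
  exact (continuous_coe.continuousAt.comp (continuous_snd.continuousAt.mul h1')).prodMk
    (continuous_coe.continuousAt.comp (continuous_snd.continuousAt.mul h2'))

/-- The radial retraction of the punctured torus to the fibre. -/
def retract (p : {p : Torus // p ≠ 0}) : Fibre :=
  ⟨if ‖p.1‖ < 1 / 2 then radial p.1 (max 1 (1 / (4 * ‖p.1‖))) else p.1, by
    have hp : 0 < ‖p.1‖ := norm_pos_iff.2 p.2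
    have h3 : 1 / (4 * ‖p.1‖) * ‖p.1‖ = 1 / 4 := by field_simp
    split_ifs with h
    · have h4 : max 1 (1 / (4 * ‖p.1‖)) * ‖p.1‖ = max ‖p.1‖ (1 / 4) := by
        rw [max_mul_of_nonneg _ _ hp.le, one_mul, h3]
      rw [norm_radial (by positivity) (by rw [h4]; exact max_le h.le (by norm_num)), h4]
      exact le_max_right _ _
    · linarith⟩

theorem retract_of_le {p : {p : Torus // p ≠ 0}} (h : 1 / 4 ≤ ‖p.1‖) :
    (retract p).1 = p.1 := by
  have hp : 0 < ‖p.1‖ := norm_pos_iff.2 p.2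
  have h1 : 1 / (4 * ‖p.1‖) ≤ 1 := by rw [div_le_one (by positivity)]; linarith
  simp only [retract, max_eq_left h1, radial_one, ite_self]

theorem continuous_retract : Continuous retract := by
  refine continuous_induced_rng.2 (continuous_iff_continuousAt.2 fun p => ?_)
  have hp : ‖p.1‖ ≠ 0 := norm_ne_zero_iff.2 p.2
  by_cases h : ‖p.1‖ < 1 / 2
  · have h1 : ContinuousAt (fun q : {p : Torus // p ≠ 0} =>
        radial q.1 (max 1 (1 / (4 * ‖q.1‖)))) p := by
      refine ContinuousAt.comp (f := fun q : {p : Torus // p ≠ 0} =>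
        (q.1, max 1 (1 / (4 * ‖q.1‖)))) (continuousAt_radial h _) ?_
      refine continuousAt_subtype_val.prodMk (continuousAt_const.max
        (continuousAt_const.div (by fun_prop) (by simpa using hp)))
    refine h1.congr ?_
    filter_upwards [(isOpen_lt (continuous_subtype_val.norm) continuous_const).mem_nhds h]
      with q hq
    have hq' : ‖q.1‖ < 1 / 2 := hq
    simp only [Function.comp_apply, retract, if_pos hq']
  · have h2 : 1 / 4 < ‖p.1‖ := by linarith
    refine continuousAt_subtype_val.congr ?_
    filter_upwards [(isOpen_lt continuous_const (continuous_subtype_val.norm)).mem_nhds h2]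
      with q hq
    exact (retract_of_le (le_of_lt hq)).symm

instance : LocallyPathConnectedSpace UnitAddCircle :=
  (QuotientAddGroup.isQuotientMap_mk (N := AddSubgroup.zmultiples (1 : ℝ))).locallyPathConnectedSpace

theorem ne_zero_of_fibre (p : Fibre) : p.1 ≠ 0 := fun h => by
  have := p.2
  rw [h, norm_zero] at this
  norm_num at this

/-- The radial retraction makes the fibre a quotient of an open subset of the torus. -/
instance : LocallyPathConnectedSpace Fibre := by
  have : LocallyPathConnectedSpace {p : Torus // p ≠ 0} :=
    (isOpen_ne (x := (0 : Torus))).locallyPathConnectedSpace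
  exact (Topology.IsQuotientMap.of_inverse
    (f := fun p : Fibre => (⟨p.1, ne_zero_of_fibre p⟩ : {p : Torus // p ≠ 0}))
    (continuous_subtype_val.subtype_mk _) continuous_retract
    fun p => Subtype.ext (retract_of_le (p := ⟨p.1, ne_zero_of_fibre p⟩) p.2)).locallyPathConnectedSpace

/-! ### The monodromy acts by the knot automorphism -/

theorem bool_closure {S : Subgroup F2} (h : ∀ b, (FreeGroup.of b)⁻¹ ∈ S) : S = ⊤ := by
  rw [eq_top_iff, ← FreeGroup.closure_range_of, Subgroup.closure_le]
  rintro _ ⟨b, rfl⟩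
  exact inv_mem_iff.1 (h b)

/-- Both homomorphisms agree on the two axis loops through the corner `(1/4, 1/4)` of the hole,
which generate. -/
theorem hom_comap_monodromy :
    (fibreFunctor.comap monodromyMap).hom (axisCurve true _ quarter_norm (1 / 4)) =
      (fibreFunctor.mapHom knotAut.toMonoidHom).hom (axisCurve true _ quarter_norm (1 / 4)) := by
  set v := axisCurve true _ quarter_norm (1 / 4)
  have hv : axisCurve false _ quarter_norm (1 / 4) = v := rfl
  have hloop : ∀ b, axisCurve b _ quarter_norm (1 / 4) =
      axisCurve b _ quarter_norm (1 / 4 + 1) := by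
    intro b
    apply Subtype.ext
    change (if _ then _ else _) = (if _ then _ else _)
    rw [coe_add_one (1 / 4)]
  let S := MonoidHom.eqLocus ((fibreFunctor.comap monodromyMap).hom v)
    ((fibreFunctor.mapHom knotAut.toMonoidHom).hom v)
  have hbase : ∀ b, axisCurve b _ quarter_norm (1 / 4) = v := by
    intro b; cases b <;> rfl
  have hS : S.map (fibreFunctor.hom v) = ⊤ := by
    refine bool_closure fun b => ?_
    have h1 : fibreFunctor.along (axisCurve (!b) _ quarter_norm) (1 / 4) (1 / 4 + 1) =
        (FreeGroup.of b)⁻¹ := by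
      rw [along_axisCurve _ _ _ (by norm_num) (by norm_num), Bool.not_not]
    have h2 : fibreFunctor.along (monodromyMap.comp (axisCurve (!b) _ quarter_norm)) (1 / 4)
        (1 / 4 + 1) = knotAut ((FreeGroup.of b)⁻¹) := by
      rw [map_inv]
      cases b
      · exact along_monodromy_vertical.trans (congrArg _ knotAut_genA.symm)
      · exact along_monodromy_horizontal.trans (congrArg _ knotAut_genB.symm)
    have key : ∀ w, axisCurve (!b) _ quarter_norm (1 / 4) = w →
        (FreeGroup.of b)⁻¹ ∈ (MonoidHom.eqLocus ((fibreFunctor.comap monodromyMap).hom w)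
          ((fibreFunctor.mapHom knotAut.toMonoidHom).hom w)).map (fibreFunctor.hom w) := by
      rintro w rfl
      refine ⟨segmentLoop _ (hloop _), ?_, ?_⟩
      · change (fibreFunctor.comap monodromyMap).hom _ _ = (fibreFunctor.mapHom _).hom _ _
        rw [hom_segmentLoop, hom_segmentLoop]
        change fibreFunctor.along (monodromyMap.comp (axisCurve (!b) _ quarter_norm)) _ _ =
          knotAut (fibreFunctor.along _ _ _)
        rw [h1, h2]
      · rw [hom_segmentLoop, h1]
    exact key v (hbase _)
  ext p
  have hp : fibreFunctor.hom v p ∈ S.map (fibreFunctor.hom v) := hS ▸ Subgroup.mem_top _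
  obtain ⟨p', hp', h⟩ := hp
  rw [(bijective_fibreFunctor v).1 h] at hp'
  exact hp'

/-- The base point of the fibre. -/
abbrev fibreBase : Fibre := fibreBoundary 0

theorem fibreBase_val : fibreBase.1 = (((1 / 4 : ℝ) : UnitAddCircle), 0) := by
  have h := boundaryCurve_val (t := 0) (by norm_num)
  have h1 : waveX 0 = 1 / 4 := by norm_num [waveX]
  have h2 : waveY 0 = 0 := by norm_num [waveY, abs_of_pos]
  rw [h1, h2] at h
  exact h

/-- The normalization of `u` moves from the corner to `fibreBase` along a boundary segment, which
the monodromy fixes pointwise and on which the functor is trivial. -/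
theorem exists_monodromy_gauge : ∃ u : Fibre → F2, u fibreBase = 1 ∧
    ∀ {x y : Fibre} (p : Path.Homotopic.Quotient x y),
      (fibreFunctor.comap monodromyMap).map p = u y * knotAut (fibreFunctor.map p) * (u x)⁻¹ := by
  obtain ⟨u, hu, h⟩ := exists_gauge _ _ _ hom_comap_monodromy
  refine ⟨u, ?_, h⟩
  have hend : axisCurve true _ quarter_norm 0 = fibreBase := by
    apply Subtype.ext
    rw [fibreBase_val]
    rfl
  have hfix : ∀ t ∈ Set.Icc (0 : ℝ) (1 / 4), monodromy (axisCurve true _ quarter_norm t) =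
      axisCurve true _ quarter_norm t := by
    intro t ht
    apply monodromy_apply_of_norm_eq
    have h2 : |t| ≤ 1 / 4 := by rw [abs_of_nonneg ht.1]; exact ht.2
    change ‖(((1 / 4 : ℝ) : UnitAddCircle), (t : UnitAddCircle))‖ = _
    rw [Prod.norm_def, norm_coe_of_abs_le (h2.trans (by norm_num)),
      norm_coe_of_abs_le (by norm_num [abs_of_pos]), abs_of_pos (by norm_num), max_eq_left h2]
  have h1 : fibreFunctor.along (axisCurve true _ quarter_norm) 0 (1 / 4) = 1 := by
    have h2 : fibreFunctor.along (axisCurve true _ quarter_norm) 0 (1 / 5) = 1 := by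
      rw [along_crossing _ (by norm_num) true id 0 (fun r _ => rfl)
        (by rintro r ⟨_, _⟩; constructor <;> simp <;> linarith), if_pos (by norm_num),
        if_pos (by norm_num), mul_inv_cancel]
    have h3 : fibreFunctor.along (axisCurve true _ quarter_norm) (1 / 5) (1 / 4) = 1 :=
      along_eq_one _ (by norm_num) (fun _ => 1 / 4) id 0 0 (fun r _ => rfl)
        (by rintro r ⟨_, _⟩; constructor <;> norm_num)
        (by rintro r ⟨_, _⟩; constructor <;> simp <;> linarith)
    rw [along_trans _ _ 0 (1 / 5), h2, h3, mul_one]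
  have h4 : fibreFunctor.along (monodromyMap.comp (axisCurve true _ quarter_norm)) 0 (1 / 4) =
      1 := by
    rw [← h1]
    exact fibreFunctor.val_congr _ _ fun r => hfix _ (linePath_mem (by norm_num) r)
  have h5 := h (.mk ((linePath 0 (1 / 4)).map (axisCurve true _ quarter_norm).continuous))
  change fibreFunctor.along (monodromyMap.comp (axisCurve true _ quarter_norm)) 0 (1 / 4) =
    u _ * knotAut (fibreFunctor.along (axisCurve true _ quarter_norm) 0 (1 / 4)) * (u _)⁻¹ at h5
  rw [h4, h1, map_one, hu, one_mul, one_mul, eq_comm, inv_eq_one, hend] at h5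
  exact h5

end FigureEight

end

noncomputable section

namespace FigureEight

namespace PathFunctor

variable {X Z Λ : Type*} [TopologicalSpace X] [TopologicalSpace Z] [Group Λ]

/-! ### Lifting paths and descending functors along covering maps -/

/-- `q` has a continuous local section through each point of the fibres over a small open set. -/
def HasSections (q : C(Z, X)) : Prop :=
  ∀ x : X, ∃ U : Set X, IsOpen U ∧ x ∈ U ∧ ∀ z : Z, q z ∈ U →
    ∃ s : X → Z, ContinuousOn s U ∧ (∀ y ∈ U, q (s y) = y) ∧ s (q z) = z

theorem isOpenMap_of_deck {G : Type*} (q : C(Z, X)) (hquot : Topology.IsQuotientMap q)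
    (T : G → Z ≃ₜ Z) (hT : ∀ x y, q x = q y ↔ ∃ k, y = T k x) : IsOpenMap q := by
  intro O hO
  rw [← hquot.isOpen_preimage]
  have : q ⁻¹' (q '' O) = ⋃ k, T k '' O := by
    ext y
    simp only [Set.mem_preimage, Set.mem_image, Set.mem_iUnion]
    constructor
    · rintro ⟨x, hx, hxy⟩
      obtain ⟨k, rfl⟩ := (hT x y).1 hxy
      exact ⟨k, x, hx, rfl⟩
    · rintro ⟨k, x, hx, rfl⟩
      exact ⟨x, hx, (hT _ _).2 ⟨k, rfl⟩⟩
  rw [this]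
  exact isOpen_iUnion fun k => (T k).isOpenMap O hO

/-- `q` is inverted on a small open set where it is injective, and a deck transformation then moves
the section to the prescribed point. -/
theorem hasSections_of_deck {G : Type*} (q : C(Z, X)) (hquot : Topology.IsQuotientMap q)
    (T : G → Z ≃ₜ Z) (hT : ∀ x y, q x = q y ↔ ∃ k, y = T k x)
    (hloc : ∀ z, ∃ O : Set Z, IsOpen O ∧ z ∈ O ∧ Set.InjOn q O) : HasSections q := by
  have hopen := isOpenMap_of_deck q hquot T hT
  intro x
  obtain ⟨z, rfl⟩ := hquot.surjective x
  obtain ⟨O, hO, hz, hinj⟩ := hloc z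
  refine ⟨q '' O, hopen O hO, ⟨z, hz, rfl⟩, ?_⟩
  rintro y ⟨o, ho, hoy⟩
  obtain ⟨k, rfl⟩ := (hT o y).1 hoy
  have hq : ∀ w, q (T k w) = q w := fun w => ((hT w _).2 ⟨k, rfl⟩).symm
  have : Nonempty Z := ⟨z⟩
  have himg : ∀ w ∈ O, Function.invFunOn q O (q w) = w := fun w hw =>
    hinj.leftInvOn_invFunOn hw
  refine ⟨fun w => T k (Function.invFunOn q O w), ?_, ?_, ?_⟩
  · refine (T k).continuous.comp_continuousOn ?_
    rintro _ ⟨w, hw, rfl⟩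
    refine ContinuousAt.continuousWithinAt fun N hN => ?_
    rw [himg w hw] at hN
    rw [Filter.mem_map]
    obtain ⟨N', hN', hN'o, hwN⟩ := mem_nhds_iff.1 hN
    refine Filter.mem_of_superset ((hopen _ (hN'o.inter hO)).mem_nhds ⟨w, ⟨hwN, hw⟩, rfl⟩) ?_
    rintro _ ⟨v, ⟨hv, hvO⟩, rfl⟩
    change Function.invFunOn q O (q v) ∈ N
    rw [himg v hvO]
    exact hN' hv
  · rintro _ ⟨w, hw, rfl⟩
    change q (T k (Function.invFunOn q O (q w))) = q w
    rw [himg w hw, hq]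
  · simp only [hq, himg o ho]

/-- Classes of paths lift. -/
theorem HasSections.exists_lift {q : C(Z, X)} (hq : HasSections q) {x y : X}
    (p : Path.Homotopic.Quotient x y) : ∀ (z : Z) (hz : x = q z), ∃ (w : Z) (hw : y = q w)
      (r : Path.Homotopic.Quotient z w), p = (r.map q).cast hz hw := by
  choose U hU hxU hs using hq
  refine path_induction (U := U) hU (fun x => ⟨x, hxU x⟩)
    (P := fun {x y} p => ∀ (z : Z) (hz : x = q z), ∃ (w : Z) (hw : y = q w)
      (r : Path.Homotopic.Quotient z w), p = (r.map q).cast hz hw) ?_ ?_ p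
  · intro x y x' p p' hp hp' z hz
    obtain ⟨w, hw, r, h⟩ := hp z hz
    obtain ⟨w', hw', r', h'⟩ := hp' w hw
    subst hz hw hw'
    refine ⟨w', rfl, r.trans r', ?_⟩
    rw [h, h']
    induction r using Path.Homotopic.Quotient.ind with
    | mk r =>
    induction r' using Path.Homotopic.Quotient.ind with
    | mk r' =>
    simp only [Path.Homotopic.Quotient.cast_rfl_rfl, ← Path.Homotopic.Quotient.mk_map,
      ← Path.Homotopic.Quotient.mk_trans, Path.map_trans]
  · intro i x y γ hγ z hz
    subst hz
    have h0 : q z ∈ U i := by simpa using hγ 0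
    obtain ⟨s, hs, hqs, hsz⟩ := hs i z h0
    have h1 : y ∈ U i := by simpa using hγ 1
    let δ : Path z (s y) :=
      { toFun := s ∘ γ
        continuous_toFun := hs.comp_continuous γ.continuous hγ
        source' := by simp [hsz]
        target' := by simp }
    refine ⟨s y, (hqs y h1).symm, .mk δ, ?_⟩
    rw [← Path.Homotopic.Quotient.mk_map, ← Path.Homotopic.Quotient.mk_cast]
    congr 1
    ext t
    exact (hqs _ (hγ t)).symm

/-- A locally trivial functor on a covering space which is invariant under the deck
transformations descends. -/
theorem HasSections.exists_descend [LocallyPathConnectedSpace X] {q : C(Z, X)}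
    (hq : HasSections q) (hsurj : Function.Surjective q) (F : PathFunctor Z Λ)
    (hF : F.LocallyTrivial)
    (hinv : ∀ {x y x' y' : Z} (γ : Path x y) (γ' : Path x' y'), (∀ t, q (γ t) = q (γ' t)) →
      F.val γ = F.val γ') :
    ∃ Φ : PathFunctor X Λ, Φ.LocallyTrivial ∧
      ∀ {x y : Z} (p : Path.Homotopic.Quotient x y), Φ.map (p.map q) = F.map p := by
  have chart : ∀ x : X, ∃ (V : Set X) (s : X → Z) (g : Z → Λ), IsOpen V ∧ x ∈ V ∧
      ContinuousOn s V ∧ (∀ y ∈ V, q (s y) = y) ∧ F.TrivialOn (s '' V) g := by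
    intro x
    obtain ⟨z, rfl⟩ := hsurj x
    obtain ⟨U, hU, hxU, h⟩ := hq (q z)
    obtain ⟨s, hs, hqs, hsz⟩ := h z hxU
    obtain ⟨W, hW, hzW, g, hg⟩ := hF z
    refine ⟨U ∩ s ⁻¹' W, s, g, hs.isOpen_inter_preimage hU hW, ⟨hxU, ?_⟩,
      hs.mono Set.inter_subset_left, fun y hy => hqs y hy.1, hg.mono ?_⟩
    · change s (q z) ∈ W
      rwa [hsz]
    · rintro _ ⟨y, hy, rfl⟩
      exact hy.2
  choose V s g hV hxV hs hqs hg using chart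
  have lift : ∀ (i : X) {x y : X} (γ : Path x y), (∀ t, γ t ∈ V i) →
      ∃ δ : Path (s i x) (s i y), (∀ t, δ t = s i (γ t)) ∧
        F.val δ = g i (s i y) * (g i (s i x))⁻¹ := by
    intro i x y γ hγ
    let δ : Path (s i x) (s i y) :=
      { toFun := s i ∘ γ
        continuous_toFun := (hs i).comp_continuous γ.continuous hγ
        source' := by simp
        target' := by simp }
    exact ⟨δ, fun _ => rfl, hg i δ fun t => ⟨_, hγ t, rfl⟩⟩
  -- The charts are pushed down along local sections. Two sections lift the same path differently,
  -- but by invariance `F` has the same value on both lifts.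
  obtain ⟨Φ, hΦ⟩ := exists_pathFunctor V (fun i => g i ∘ s i) hV (fun x => ⟨x, hxV x⟩) (by
    intro i j x hx
    have := isOpen_develop ((hV i).inter (hV j)) (g := g i ∘ s i) (g' := g j ∘ s j)
      (fun {x y} γ hγ => by
        obtain ⟨δ, hδ, h⟩ := lift i γ fun t => (hγ t).1
        obtain ⟨δ', hδ', h'⟩ := lift j γ fun t => (hγ t).2
        refine h.symm.trans ((hinv δ δ' fun t => ?_).trans h')
        rw [hδ, hδ', hqs i _ (hγ t).1, hqs j _ (hγ t).2])
      ((g j (s j x))⁻¹ * g i (s i x))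
    filter_upwards [this.mem_nhds ⟨hx, rfl⟩] with y hy
    exact hy.2)
  refine ⟨Φ, fun x => ⟨V x, hV x, hxV x, _, hΦ x⟩, fun p => ?_⟩
  refine map_eq_of_cover (F := Φ.comap q) (F' := F) (U := fun i => q ⁻¹' V i)
    (fun i => (hV i).preimage q.continuous) (fun z => ⟨q z, hxV _⟩) (fun i x y γ hγ => ?_) p
  obtain ⟨δ, hδ, h⟩ := lift i (γ.map q.continuous) hγ
  rw [val_comap, hΦ i _ hγ]
  refine h.symm.trans (hinv δ γ fun t => ?_)
  rw [hδ]
  exact hqs i _ (hγ t)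

end PathFunctor

end FigureEight

end

noncomputable section

namespace FigureEight

open PathFunctor

/-! ### The fundamental groupoid of the knot complement -/

/-- The projection to the knot complement. -/
def proj : C(Fibre × ℝ, KnotComplement) :=
  ⟨fun p => MappingTorus.mk monodromy p.1 p.2, MappingTorus.continuous_mk monodromy⟩

theorem proj_surjective : Function.Surjective proj := Quotient.mk_surjective

theorem isQuotientMap_proj : Topology.IsQuotientMap proj := isQuotientMap_quotient_mk'

/-- The deck transformations. -/
def deck (k : ℤ) : Fibre × ℝ ≃ₜ Fibre × ℝ :=
  (monodromy ^ k).prodCongr (Homeomorph.addRight (-(k : ℝ)))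

theorem deck_apply (k : ℤ) (p : Fibre × ℝ) : deck k p = ((monodromy ^ k) p.1, p.2 - k) := by
  rw [sub_eq_add_neg]; rfl

theorem proj_eq_iff (x y : Fibre × ℝ) : proj x = proj y ↔ ∃ k, y = deck k x := by
  simp only [deck_apply]
  exact Quotient.eq

theorem deck_zero (x : Fibre × ℝ) : deck 0 x = x := by
  rw [deck_apply]; simp

theorem deck_one_deck (k : ℤ) (x : Fibre × ℝ) : deck 1 (deck k x) = deck (k + 1) x := by
  simp only [deck_apply, add_comm k 1, zpow_add, zpow_one]
  ext
  · rfl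
  · rfl
  · push_cast; ring

theorem injOn_proj (s : ℝ) : Set.InjOn proj {x | x.2 ∈ Set.Ioo s (s + 1)} := by
  intro x hx y hy h
  obtain ⟨k, rfl⟩ := (proj_eq_iff x y).1 h
  have h1 : x.2 - k ∈ Set.Ioo s (s + 1) := hy
  have hx' : x.2 ∈ Set.Ioo s (s + 1) := hx
  have hk : k = 0 := by
    have a : (k : ℝ) < 1 := by linarith [h1.1, hx'.2]
    have b : (-1 : ℝ) < k := by linarith [h1.2, hx'.1]
    have a' : k < 1 := by exact_mod_cast a
    have b' : -1 < k := by exact_mod_cast b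
    omega
  rw [hk, deck_zero]

theorem hasSections_proj : HasSections proj :=
  hasSections_of_deck proj isQuotientMap_proj deck proj_eq_iff fun z =>
    ⟨{x | x.2 ∈ Set.Ioo (z.2 - 1 / 2) (z.2 - 1 / 2 + 1)},
      isOpen_Ioo.preimage continuous_snd, by
        change z.2 ∈ Set.Ioo _ _
        constructor <;> linarith, injOn_proj _⟩

instance : LocallyPathConnectedSpace KnotComplement :=
  isQuotientMap_proj.locallyPathConnectedSpace

instance : PathConnectedSpace KnotComplement :=
  proj_surjective.pathConnectedSpace proj.continuous

/-- A continuous family of integers over an interval is constant. -/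
theorem eq_of_continuous_intCast (k : unitInterval → ℤ) (h : Continuous fun t => (k t : ℝ))
    (s t : unitInterval) : k s = k t :=
  PreconnectedSpace.constant inferInstance
    (Int.isClosedEmbedding_coe_real.isInducing.continuous_iff.2 h)

section Gauge

variable {α Λ : Type*} [Group Λ] (h : Equiv.Perm α) (w : α → Λ)

/-- The permutation whose powers compute the cocycle with `w` as its value at time one. -/
def skewPerm : Equiv.Perm (α × Λ) where
  toFun x := (h x.1, x.2 * (w x.1)⁻¹)
  invFun x := (h.symm x.1, x.2 * w (h.symm x.1))
  left_inv x := by ext <;> simp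
  right_inv x := by ext <;> simp

/-- The cocycle with `w` as its value at time one. -/
def cocycle (n : ℤ) (a : α) : Λ := (((skewPerm h w) ^ n) (a, 1)).2⁻¹

theorem cocycle_zero (a : α) : cocycle h w 0 a = 1 := by simp [cocycle]

/-- Left multiplication on the second factor commutes with `skewPerm`, so the first step can be
split off a power, whatever the sign of `n`. -/
theorem cocycle_sub_one (n : ℤ) (a : α) :
    cocycle h w (n - 1) (h a) * w a = cocycle h w n a := by
  let L : Λ → Equiv.Perm (α × Λ) := fun μ =>
    (Equiv.refl α).prodCongr (Equiv.mulLeft μ)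
  have hL : ∀ μ, Commute (L μ) (skewPerm h w) := by
    intro μ
    ext x
    · rfl
    · exact (mul_assoc _ _ _).symm
  have h1 : (skewPerm h w) (a, 1) = L (w a)⁻¹ (h a, 1) := by
    ext
    · rfl
    · simp [skewPerm, L]
  have h2 : ((skewPerm h w) ^ n) (a, 1) =
      L (w a)⁻¹ (((skewPerm h w) ^ (n - 1)) (h a, 1)) := by
    rw [← Equiv.Perm.mul_apply, ((hL _).zpow_right _).eq, Equiv.Perm.mul_apply, ← h1,
      ← Equiv.Perm.mul_apply, ← zpow_add_one, sub_add_cancel]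
  rw [cocycle, cocycle, h2]
  simp [L]

theorem cocycle_fixed {a : α} (ha : h a = a) (n : ℤ) : cocycle h w n a = w a ^ n := by
  have step : ∀ n, cocycle h w (n - 1) a * w a = cocycle h w n a := fun n => by
    conv_lhs => rw [← ha]
    rw [ha]
    have := cocycle_sub_one h w n a
    rwa [ha] at this
  induction n using Int.induction_on with
  | zero => simp [cocycle_zero]
  | succ n ih => rw [← step, add_sub_cancel_right, ih, zpow_add_one]
  | pred n ih => rw [zpow_sub_one, ← ih, ← step (-(n : ℤ)), mul_inv_cancel_right]

end Gauge

theorem monodromy_zpow_fixed {p : Fibre} (hp : ‖p.1‖ = 1 / 4) (k : ℤ) :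
    (monodromy ^ k) p = p := by
  have h1 := monodromy_apply_of_norm_eq p hp
  induction k using Int.induction_on with
  | zero => rfl
  | succ k ih =>
    rw [zpow_add_one]
    change (monodromy ^ (k : ℤ)) (monodromy p) = p
    rw [h1, ih]
  | pred k ih =>
    rw [zpow_sub_one]
    change (monodromy ^ (-(k : ℤ))) (monodromy.symm p) = p
    rw [monodromy.symm_apply_eq.2 h1.symm, ih]

theorem norm_fibreBase : ‖fibreBase.1‖ = 1 / 4 := norm_square 0

open KnotGroup in
/-- The functor from the fundamental groupoid of the knot complement to the knot group. -/
theorem exists_knotFunctor : ∃ (Φ : PathFunctor KnotComplement KnotGroup)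
    (κ : Fibre × ℝ → KnotGroup), Φ.LocallyTrivial ∧ (∀ p, κ (p, 0) = 1) ∧
      (∀ k : ℤ, κ (fibreBase, k) = mer ^ k) ∧
      ∀ {x y : Fibre × ℝ} (p : Path.Homotopic.Quotient x y), Φ.map (p.map proj) =
        κ y * ofF (fibreFunctor.map (p.map ContinuousMap.fst)) * (κ x)⁻¹ := by
  obtain ⟨u, hu, hmon⟩ := exists_monodromy_gauge
  -- By `hmon` the generating deck transformation changes the pulled back functor by the gauge `w`.
  -- The cocycle of `w`, evaluated at the integer part of the height, compensates for this; a gauge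
  -- need not be continuous.
  let w : Fibre → KnotGroup := fun p => ofF (u p) * mer
  let κ : Fibre × ℝ → KnotGroup := fun x => cocycle monodromy.toEquiv w ⌊x.2⌋ x.1
  let F₀ : PathFunctor (Fibre × ℝ) KnotGroup :=
    (fibreFunctor.comap ContinuousMap.fst).mapHom ofF
  have hκ : ∀ x, κ (deck 1 x) * w x.1 = κ x := by
    intro x
    have := cocycle_sub_one monodromy.toEquiv w ⌊x.2⌋ x.1
    refine Eq.trans ?_ this
    simp only [κ, deck_apply, Int.cast_one, Int.floor_sub_one, zpow_one]
    rfl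
  have hinv1 : ∀ {x y : Fibre × ℝ} (γ : Path x y),
      (F₀.gauge κ).val (γ.map (deck 1).continuous) = (F₀.gauge κ).val γ := by
    intro x y γ
    have h1 : F₀.val (γ.map (deck 1).continuous) = w y.1 * F₀.val γ * (w x.1)⁻¹ := by
      have h2 := hmon (.mk (γ.map continuous_fst))
      have h3 : F₀.val (γ.map (deck 1).continuous) = ofF ((fibreFunctor.comap monodromyMap).map
          (.mk (γ.map continuous_fst))) := by
        change ofF (fibreFunctor.val _) = ofF (fibreFunctor.val _)
        congr 1
      rw [h3, h2, map_mul, map_mul, map_inv]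
      have h4 : ofF (knotAut (fibreFunctor.map (.mk (γ.map continuous_fst)))) =
          mer * F₀.val γ * mer⁻¹ := by
        change _ = mer * ofF _ * mer⁻¹
        rw [conj_ofF]
        simp [conjAut, mer, deg]
        rfl
      rw [h4]
      simp only [w]
      group
    rw [val_gauge, val_gauge, h1, ← hκ x, ← hκ y]
    group
  have hinvk : ∀ (k : ℤ) {x y x' y' : Fibre × ℝ} (γ : Path x y) (γ' : Path x' y'),
      (∀ t, γ' t = deck k (γ t)) → (F₀.gauge κ).val γ = (F₀.gauge κ).val γ' := by
    intro k
    induction k using Int.induction_on with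
    | zero =>
      intro x y x' y' γ γ' h
      exact val_congr _ _ _ fun t => by rw [h, deck_zero]
    | succ k ih =>
      intro x y x' y' γ γ' h
      rw [ih γ (γ.map (deck k).continuous) fun _ => rfl, ← hinv1]
      refine val_congr _ _ _ fun t => ?_
      rw [h, ← deck_one_deck]
      rfl
    | pred k ih =>
      intro x y x' y' γ γ' h
      rw [← hinv1 γ']
      refine ih γ _ fun t => ?_
      change deck 1 (γ' t) = _
      rw [h, deck_one_deck, sub_add_cancel]
  have hinv : ∀ {x y x' y' : Fibre × ℝ} (γ : Path x y) (γ' : Path x' y'),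
      (∀ t, proj (γ t) = proj (γ' t)) → (F₀.gauge κ).val γ = (F₀.gauge κ).val γ' := by
    intro x y x' y' γ γ' h
    -- Pointwise the paths differ by the deck transformation `k t`. Since `k t` is the difference of
    -- the heights, it is continuous, hence constant.
    choose k hk using fun t => (proj_eq_iff _ _).1 (h t)
    have hc : Continuous fun t => (k t : ℝ) := by
      have : (fun t => (k t : ℝ)) = fun t => (γ t).2 - (γ' t).2 := by
        funext t
        rw [hk, deck_apply]
        ring
      rw [this]
      fun_prop
    exact hinvk (k 0) γ γ' fun t => by rw [hk, eq_of_continuous_intCast k hc t 0]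
  have hloc : fibreFunctor.LocallyTrivial := fun p => by
    obtain ⟨i, hi⟩ := exists_mem_fibreCover p
    exact ⟨_, isOpen_fibreCover i, hi, _, fibreFunctor_trivialOn i⟩
  obtain ⟨Φ, hΦ, h⟩ := hasSections_proj.exists_descend proj_surjective (F₀.gauge κ)
    (((hloc.comap ContinuousMap.fst).mapHom ofF).gauge κ) hinv
  refine ⟨Φ, κ, hΦ, fun p => ?_, fun k => ?_, fun p => h p⟩
  · simp [κ, cocycle_zero]
  · simp only [κ, Int.floor_intCast]
    rw [cocycle_fixed _ _ (monodromy_apply_of_norm_eq fibreBase norm_fibreBase)]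
    simp [w, hu]

/-- The functor from the fundamental groupoid of the knot complement to the knot group. -/
def knotFunctor : PathFunctor KnotComplement KnotGroup := exists_knotFunctor.choose

/-- The trivialization of the functor at the points of the infinite cyclic covering. -/
def knotGauge : Fibre × ℝ → KnotGroup := exists_knotFunctor.choose_spec.choose

theorem locallyTrivial_knotFunctor : knotFunctor.LocallyTrivial :=
  exists_knotFunctor.choose_spec.choose_spec.1

theorem knotGauge_zero (p : Fibre) : knotGauge (p, 0) = 1 :=
  exists_knotFunctor.choose_spec.choose_spec.2.1 p

theorem knotGauge_intCast (k : ℤ) : knotGauge (fibreBase, k) = KnotGroup.mer ^ k :=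
  exists_knotFunctor.choose_spec.choose_spec.2.2.1 k

theorem knotFunctor_map_proj {x y : Fibre × ℝ} (p : Path.Homotopic.Quotient x y) :
    knotFunctor.map (p.map proj) = knotGauge y *
      KnotGroup.ofF (fibreFunctor.map (p.map ContinuousMap.fst)) * (knotGauge x)⁻¹ :=
  exists_knotFunctor.choose_spec.choose_spec.2.2.2 p

/-- The base point of the knot complement. -/
abbrev knotBase : KnotComplement := proj (fibreBase, 0)

theorem map_eq_refl_of_fibre {q : Fibre × ℝ} (p : Path.Homotopic.Quotient q q)
    (h : fibreFunctor.map (p.map ContinuousMap.fst) = 1) :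
    p = Path.Homotopic.Quotient.refl q := by
  have h1 : p.map ContinuousMap.fst = Path.Homotopic.Quotient.refl q.1 :=
    (injective_iff_map_eq_one _).1 (bijective_fibreFunctor q.1).1
      (FundamentalGroup.fromPath (p.map ContinuousMap.fst)) h
  have h2 : p.map ContinuousMap.snd = Path.Homotopic.Quotient.refl q.2 := Subsingleton.elim _ _
  have h3 := Path.Homotopic.prod_projLeft_projRight p
  rw [← h3]
  change Path.Homotopic.prod (p.map ContinuousMap.fst) (p.map ContinuousMap.snd) = _
  rw [h1, h2]
  rfl

/-- The path in the knot complement which runs once around the circle over the base point. -/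
def merPath : Path knotBase knotBase :=
  (((Path.refl fibreBase).prod (linePath 0 1)).map proj.continuous).cast rfl (by
    rw [proj_eq_iff]
    exact ⟨-1, by rw [deck_apply, monodromy_zpow_fixed norm_fibreBase]; simp⟩)

open KnotGroup in
theorem knotFunctor_merPath : knotFunctor.val merPath = mer := by
  rw [merPath, val_cast]
  refine (knotFunctor_map_proj (.mk ((Path.refl fibreBase).prod (linePath 0 1)))).trans ?_
  have h1 := knotGauge_intCast 1
  rw [Int.cast_one, zpow_one] at h1
  rw [h1, knotGauge_zero]
  have h2 : fibreFunctor.map ((Path.Homotopic.Quotient.mk ((Path.refl fibreBase).prod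
      (linePath 0 1))).map ContinuousMap.fst) = 1 := fibreFunctor.val_refl fibreBase
  rw [h2]
  simp

open KnotGroup in
-- A loop with trivial value lifts to `Fibre × ℝ`; its degree is the difference of the heights at
-- the ends, so the lift is closed, and `fibreFunctor` shows that it is null-homotopic. Loops in the
-- fibre and the meridian reach all of the knot group.
theorem bijective_knotFunctor (z : KnotComplement) : Function.Bijective (knotFunctor.hom z) := by
  refine knotFunctor.hom_bijective (x₀ := knotBase) z ⟨?_, ?_⟩
  · rw [injective_iff_map_eq_one]
    intro p hp
    obtain ⟨y, hy, r, hr⟩ := hasSections_proj.exists_lift (FundamentalGroup.toPath p)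
      (fibreBase, 0) rfl
    have hval : knotFunctor.map (r.map proj) = 1 := by
      rw [← hp]
      change _ = knotFunctor.map (FundamentalGroup.toPath p)
      rw [hr, map_cast]
    obtain ⟨k, rfl⟩ := (proj_eq_iff _ _).1 hy
    have hend : deck k (fibreBase, 0) = (fibreBase, ((-k : ℤ) : ℝ)) := by
      rw [deck_apply, monodromy_zpow_fixed norm_fibreBase]
      simp
    have hg : knotGauge (deck k (fibreBase, 0)) = mer ^ (-k) := by
      rw [hend, knotGauge_intCast]
    rw [knotFunctor_map_proj, knotGauge_zero, hg, inv_one, mul_one] at hval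
    have hk : k = 0 := by
      have := congrArg deg hval
      simpa [deg_zpow] using this
    subst hk
    have hy' : deck 0 (fibreBase, 0) = (fibreBase, (0 : ℝ)) := deck_zero _
    have hF : fibreFunctor.map (r.map ContinuousMap.fst) = 1 := by
      apply ofF_injective
      simpa using hval
    clear hend hg hval
    revert hy r
    rw [hy']
    intro hy r hr hF
    rw [map_eq_refl_of_fibre r hF] at hr
    change FundamentalGroup.toPath p = Path.Homotopic.Quotient.refl _
    rw [hr]
    rfl
  · rw [← MonoidHom.range_eq_top, eq_top_iff]
    intro g _
    rw [eq_ofF_mul_mer g]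
    refine mul_mem ?_ (zpow_mem ?_ _)
    · obtain ⟨p, hp⟩ := (bijective_fibreFunctor fibreBase).2 g.left
      let j : C(Fibre, Fibre × ℝ) := (ContinuousMap.id Fibre).prodMk (ContinuousMap.const _ 0)
      refine ⟨FundamentalGroup.fromPath (((FundamentalGroup.toPath p).map j).map proj), ?_⟩
      change knotFunctor.map (((FundamentalGroup.toPath p).map j).map proj) = _
      rw [knotFunctor_map_proj]
      change knotGauge (fibreBase, 0) * _ * (knotGauge (fibreBase, 0))⁻¹ = _
      rw [knotGauge_zero, one_mul, inv_one, mul_one, ← hp]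
      congr 1
      change _ = fibreFunctor.map (FundamentalGroup.toPath p)
      congr 1
      induction FundamentalGroup.toPath p using Path.Homotopic.Quotient.ind with
      | mk γ => rfl
    · exact ⟨FundamentalGroup.fromPath (.mk merPath), knotFunctor_merPath⟩

end FigureEight

end

noncomputable section

namespace FigureEight

open PathFunctor

/-! ### The boundary torus -/

theorem mem_boundary_iff (x : Fibre × ℝ) : proj x ∈ boundary ↔ ‖x.1.1‖ = 1 / 4 := by
  constructor
  · rintro ⟨p, s, hp, h⟩
    obtain ⟨k, hk⟩ := (proj_eq_iff (p, s) x).1 h.symm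
    rw [hk, deck_apply, monodromy_zpow_fixed hp]
    exact hp
  · intro h
    exact ⟨x.1, x.2, h, rfl⟩

theorem wave_cases {t : ℝ} (h : t ∈ Set.Icc (0 : ℝ) 1) :
    (t ∈ Set.Icc (0 : ℝ) (1 / 8) ∧ waveX t = 1 / 4 ∧ waveY t = 2 * t) ∨
    (t ∈ Set.Icc (1 / 8 : ℝ) (3 / 8) ∧ waveX t = 1 / 2 - 2 * t ∧ waveY t = 1 / 4) ∨
    (t ∈ Set.Icc (3 / 8 : ℝ) (5 / 8) ∧ waveX t = -(1 / 4) ∧ waveY t = 1 - 2 * t) ∨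
    (t ∈ Set.Icc (5 / 8 : ℝ) (7 / 8) ∧ waveX t = 2 * t - 3 / 2 ∧ waveY t = -(1 / 4)) ∨
    (t ∈ Set.Icc (7 / 8 : ℝ) 1 ∧ waveX t = 1 / 4 ∧ waveY t = 2 * t - 2) := by
  obtain ⟨h0, h1⟩ := h
  rcases le_total t (1 / 8) with h2 | h2
  · refine Or.inl ⟨⟨h0, h2⟩, ?_, ?_⟩ <;> simp only [waveX, waveY] <;> grind
  rcases le_total t (3 / 8) with h3 | h3
  · refine Or.inr (Or.inl ⟨⟨h2, h3⟩, ?_, ?_⟩) <;> simp only [waveX, waveY] <;> grind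
  rcases le_total t (5 / 8) with h4 | h4
  · refine Or.inr (Or.inr (Or.inl ⟨⟨h3, h4⟩, ?_, ?_⟩)) <;> simp only [waveX, waveY] <;> grind
  rcases le_total t (7 / 8) with h5 | h5
  · refine Or.inr (Or.inr (Or.inr (Or.inl ⟨⟨h4, h5⟩, ?_, ?_⟩))) <;>
      simp only [waveX, waveY] <;> grind
  · refine Or.inr (Or.inr (Or.inr (Or.inr ⟨⟨h5, h1⟩, ?_, ?_⟩))) <;>
      simp only [waveX, waveY] <;> grind

theorem eq_of_coe_eq {x y : ℝ} (hx : |x| ≤ 1 / 4) (hy : |y| ≤ 1 / 4)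
    (h : (x : UnitAddCircle) = y) : x = y := by
  have hx' := abs_le.1 hx
  have hy' := abs_le.1 hy
  rw [← rep_coe (a := -(1 / 2)) (r := x) ⟨by linarith [hx'.1], by linarith [hx'.2]⟩,
    ← rep_coe (a := -(1 / 2)) (r := y) ⟨by linarith [hy'.1], by linarith [hy'.2]⟩, h]

theorem abs_waveX_le (t : ℝ) : |waveX t| ≤ 1 / 4 :=
  abs_le.2 ⟨le_max_left _ _, max_le (by norm_num) (min_le_left _ _)⟩

theorem abs_waveY_le (t : ℝ) : |waveY t| ≤ 1 / 4 :=
  abs_le.2 ⟨le_max_left _ _, max_le (by norm_num) (min_le_left _ _)⟩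

theorem fibreBoundary_injective : Function.Injective fibreBoundary := by
  intro u v h
  obtain ⟨t, ht, rfl⟩ := AddCircle.eq_coe_Ico u
  obtain ⟨s, hs, rfl⟩ := AddCircle.eq_coe_Ico v
  have h1 := boundaryCurve_val ⟨ht.1, ht.2.le⟩
  have h2 := boundaryCurve_val ⟨hs.1, hs.2.le⟩
  have h3 : (boundaryCurve t).1 = (boundaryCurve s).1 := congrArg Subtype.val h
  rw [h1, h2, Prod.mk.injEq] at h3
  have hx := eq_of_coe_eq (abs_waveX_le t) (abs_waveX_le s) h3.1
  have hy := eq_of_coe_eq (abs_waveY_le t) (abs_waveY_le s) h3.2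
  have ht1 := ht.2
  have hs1 := hs.2
  congr 1
  rcases wave_cases ⟨ht.1, ht.2.le⟩ with ⟨⟨_, _⟩, _, _⟩ | ⟨⟨_, _⟩, _, _⟩ | ⟨⟨_, _⟩, _, _⟩ |
    ⟨⟨_, _⟩, _, _⟩ | ⟨⟨_, _⟩, _, _⟩ <;>
  rcases wave_cases ⟨hs.1, hs.2.le⟩ with ⟨⟨_, _⟩, _, _⟩ | ⟨⟨_, _⟩, _, _⟩ | ⟨⟨_, _⟩, _, _⟩ |
    ⟨⟨_, _⟩, _, _⟩ | ⟨⟨_, _⟩, _, _⟩ <;> linarith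

theorem exists_fibreBoundary {p : Fibre} (hp : ‖p.1‖ = 1 / 4) : ∃ u, fibreBoundary u = p := by
  have key : ∀ t ∈ Set.Icc (0 : ℝ) 1, waveX t = rep (-(1 / 2)) p.1.1 →
      waveY t = rep (-(1 / 2)) p.1.2 → ∃ u, fibreBoundary u = p := by
    intro t ht h1 h2
    refine ⟨t, Subtype.ext ?_⟩
    have h := boundaryCurve_val ht
    rw [h1, h2, coe_rep, coe_rep] at h
    exact h
  rw [Prod.norm_def, norm_eq_abs_rep, norm_eq_abs_rep] at hp
  generalize rep (-(1 / 2)) p.1.1 = x at hp key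
  generalize rep (-(1 / 2)) p.1.2 = y at hp key
  have hx : |x| ≤ 1 / 4 := (le_max_left _ _).trans hp.le
  have hy : |y| ≤ 1 / 4 := (le_max_right _ _).trans hp.le
  obtain ⟨hx1, hx2⟩ := abs_le.1 hx
  obtain ⟨hy1, hy2⟩ := abs_le.1 hy
  have hor : x = 1 / 4 ∨ x = -(1 / 4) ∨ y = 1 / 4 ∨ y = -(1 / 4) := by
    rcases max_choice |x| |y| with h | h
    · rw [h] at hp
      rcases (abs_eq (by norm_num)).1 hp with h | h <;> simp [h]
    · rw [h] at hp
      rcases (abs_eq (by norm_num)).1 hp with h | h <;> simp [h]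
  -- On each side of the square the parameter is found by inverting the affine formulas of
  -- `wave_cases`.
  rcases hor with h | h | h | h
  · rcases le_total 0 y with h0 | h0
    · refine key (y / 2) ⟨by linarith, by linarith⟩ ?_ ?_ <;> simp only [waveX, waveY] <;> grind
    · refine key ((y + 2) / 2) ⟨by linarith, by linarith⟩ ?_ ?_ <;>
        simp only [waveX, waveY] <;> grind
  · refine key ((1 - y) / 2) ⟨by linarith, by linarith⟩ ?_ ?_ <;>
      simp only [waveX, waveY] <;> grind
  · refine key ((1 / 2 - x) / 2) ⟨by linarith, by linarith⟩ ?_ ?_ <;>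
      simp only [waveX, waveY] <;> grind
  · refine key ((x + 3 / 2) / 2) ⟨by linarith, by linarith⟩ ?_ ?_ <;>
      simp only [waveX, waveY] <;> grind

theorem norm_fibreBoundary (u : UnitAddCircle) : ‖(fibreBoundary u).1‖ = 1 / 4 := norm_square u

theorem continuous_fibreBoundary : Continuous fibreBoundary := continuous_square.subtype_mk _

/-- The universal covering of the boundary torus; the first coordinate runs along the longitude
and the second one along the meridian. -/
def torusCover : C(ℝ × ℝ, boundary) where
  toFun x := ⟨proj (fibreBoundary x.1, x.2), (mem_boundary_iff (fibreBoundary _, _)).2 (norm_fibreBoundary _)⟩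
  continuous_toFun := by
    have h1 := continuous_fibreBoundary
    have h2 := continuous_coe
    refine Continuous.subtype_mk (proj.continuous.comp ?_) _
    fun_prop

theorem isOpenMap_proj : IsOpenMap proj :=
  isOpenMap_of_deck proj isQuotientMap_proj deck proj_eq_iff

/-- The part of the infinite cyclic covering over the boundary torus. -/
def boundaryLift (x : UnitAddCircle × ℝ) : proj ⁻¹' boundary :=
  ⟨(fibreBoundary x.1, x.2), (mem_boundary_iff (fibreBoundary _, _)).2 (norm_fibreBoundary _)⟩

theorem isOpenQuotientMap_boundaryLift : IsOpenQuotientMap boundaryLift := by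
  refine Topology.IsInducing.isOpenQuotientMap_of_surjective ?_ ?_
  · have h3 : Topology.IsInducing fibreBoundary :=
      (continuous_fibreBoundary.isClosedEmbedding fibreBoundary_injective).isInducing
    have h4 : Topology.IsInducing (Subtype.val ∘ boundaryLift) := h3.prodMap .id
    exact .of_comp (Continuous.subtype_mk
      ((continuous_fibreBoundary.comp continuous_fst).prodMk continuous_snd) _)
      continuous_subtype_val h4
  · rintro ⟨⟨p, s⟩, hx⟩
    obtain ⟨u, rfl⟩ := exists_fibreBoundary ((mem_boundary_iff _).1 hx)
    exact ⟨(u, s), rfl⟩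

/-- Restricting an open quotient map to a full preimage preserves this property, and the boundary of
the fibre is an embedded circle. -/
theorem isOpenQuotientMap_torusCover : IsOpenQuotientMap torusCover := by
  have h1 : IsOpenQuotientMap (boundary.restrictPreimage proj) :=
    IsOpenQuotientMap.restrictPreimage ⟨proj_surjective, proj.continuous, isOpenMap_proj⟩ _
  have h3 : IsOpenQuotientMap (Prod.map ((↑) : ℝ → UnitAddCircle) (id : ℝ → ℝ)) :=
    IsOpenQuotientMap.prodMap ⟨QuotientAddGroup.mk_surjective, continuous_coe,
      QuotientAddGroup.isOpenMap_coe⟩ .id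
  have h : ⇑torusCover = (boundary.restrictPreimage proj ∘ boundaryLift) ∘
      Prod.map ((↑) : ℝ → UnitAddCircle) (id : ℝ → ℝ) := by
    funext x
    apply Subtype.ext
    rfl
  rw [h]
  exact (h1.comp isOpenQuotientMap_boundaryLift).comp h3

theorem torusCover_eq_iff (x y : ℝ × ℝ) : torusCover x = torusCover y ↔
    ∃ k : ℤ × ℤ, y = (x.1 + k.1, x.2 + k.2) := by
  rw [Subtype.ext_iff]
  change proj _ = proj _ ↔ _
  rw [proj_eq_iff]
  simp only [deck_apply]
  constructor
  · rintro ⟨k, hk⟩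
    rw [monodromy_zpow_fixed (norm_fibreBoundary _), Prod.mk.injEq] at hk
    have h1 := fibreBoundary_injective hk.1
    have h2 : ((y.1 - x.1 : ℝ) : UnitAddCircle) = 0 := by
      rw [AddCircle.coe_sub, h1, sub_self]
    obtain ⟨m, hm⟩ := (AddCircle.coe_eq_zero_iff 1).1 h2
    refine ⟨(m, -k), ?_⟩
    ext
    · rw [zsmul_one] at hm
      simp [hm]
    · simp only [hk.2]
      push_cast
      ring
  · rintro ⟨⟨m, n⟩, rfl⟩
    refine ⟨-n, ?_⟩
    rw [monodromy_zpow_fixed (norm_fibreBoundary _)]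
    ext1
    · simp
    · simp

theorem hasSections_torusCover : HasSections torusCover := by
  refine hasSections_of_deck torusCover isOpenQuotientMap_torusCover.isQuotientMap
    (fun k : ℤ × ℤ => (Homeomorph.addRight (k.1 : ℝ)).prodCongr (Homeomorph.addRight (k.2 : ℝ)))
    torusCover_eq_iff fun z => ?_
  refine ⟨Set.Ioo (z.1 - 1 / 2) (z.1 + 1 / 2) ×ˢ Set.Ioo (z.2 - 1 / 2) (z.2 + 1 / 2),
    isOpen_Ioo.prod isOpen_Ioo, ⟨by constructor <;> linarith, by constructor <;> linarith⟩, ?_⟩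
  intro x hx y hy h
  obtain ⟨⟨m, n⟩, rfl⟩ := (torusCover_eq_iff x y).1 h
  have key : ∀ (a b : ℝ) (k : ℤ), a ∈ Set.Ioo (b - 1 / 2) (b + 1 / 2) →
      a + k ∈ Set.Ioo (b - 1 / 2) (b + 1 / 2) → k = 0 := by
    intro a b k h1 h2
    have ha : (k : ℝ) < 1 := by linarith [h1.1, h2.2]
    have hb : (-1 : ℝ) < k := by linarith [h1.2, h2.1]
    have ha' : k < 1 := by exact_mod_cast ha
    have hb' : -1 < k := by exact_mod_cast hb
    omega
  rw [key _ _ m hx.1 hy.1, key _ _ n hx.2 hy.2]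
  simp

instance : LocallyPathConnectedSpace boundary :=
  isOpenQuotientMap_torusCover.isQuotientMap.locallyPathConnectedSpace

instance : PathConnectedSpace boundary :=
  isOpenQuotientMap_torusCover.surjective.pathConnectedSpace torusCover.continuous

/-- The functor of displacements in the universal covering of the boundary torus. -/
theorem exists_torusFunctor : ∃ L : PathFunctor boundary (Multiplicative (ℝ × ℝ)),
    ∀ {x y : ℝ × ℝ} (p : Path.Homotopic.Quotient x y),
      L.map (p.map torusCover) = Multiplicative.ofAdd (y - x) := by
  let F : PathFunctor (ℝ × ℝ) (Multiplicative (ℝ × ℝ)) :=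
    { map := fun {x y} _ => Multiplicative.ofAdd (y - x)
      map_trans := fun {x y z} _ _ => by rw [← ofAdd_add, sub_add_sub_cancel] }
  obtain ⟨L, -, h⟩ := hasSections_torusCover.exists_descend
    isOpenQuotientMap_torusCover.surjective F
    (fun x => ⟨Set.univ, isOpen_univ, trivial, Multiplicative.ofAdd, fun {x y} γ _ => rfl⟩) (by
      intro x y x' y' γ γ' h
      choose k hk using fun t => (torusCover_eq_iff _ _).1 (h t)
      have h1 : ∀ t, (k t).1 = (k 0).1 := fun t =>
        eq_of_continuous_intCast (fun t => (k t).1) (by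
          have : (fun t => ((k t).1 : ℝ)) = fun t => (γ' t).1 - (γ t).1 := by
            funext t
            rw [hk]
            simp
          rw [this]
          fun_prop) t 0
      have h2 : ∀ t, (k t).2 = (k 0).2 := fun t =>
        eq_of_continuous_intCast (fun t => (k t).2) (by
          have : (fun t => ((k t).2 : ℝ)) = fun t => (γ' t).2 - (γ t).2 := by
            funext t
            rw [hk]
            simp
          rw [this]
          fun_prop) t 0
      have h0 := hk 0
      have h3 := hk 1
      rw [h1 1, h2 1, γ.target, γ'.target] at h3
      rw [γ.source, γ'.source] at h0
      change Multiplicative.ofAdd (y - x) = Multiplicative.ofAdd (y' - x')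
      rw [h0, h3]
      congr 1
      ext <;> simp)
  exact ⟨L, h⟩

/-- The functor of displacements in the universal covering of the boundary torus. -/
def torusFunctor : PathFunctor boundary (Multiplicative (ℝ × ℝ)) := exists_torusFunctor.choose

theorem torusFunctor_map {x y : ℝ × ℝ} (p : Path.Homotopic.Quotient x y) :
    torusFunctor.map (p.map torusCover) = Multiplicative.ofAdd (y - x) :=
  exists_torusFunctor.choose_spec p

end FigureEight

end

noncomputable section

namespace FigureEight

open PathFunctor

/-! ### Free homotopy classes of closed curves -/

section Circle

variable {X : Type*} [TopologicalSpace X]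

theorem coe_unitInterval_eq {s s' : unitInterval} (h : ((s : ℝ) : UnitAddCircle) = (s' : ℝ)) :
    s = s' ∨ (s = 0 ∧ s' = 1) ∨ (s = 1 ∧ s' = 0) := by
  have h1 : (((s : ℝ) - s' : ℝ) : UnitAddCircle) = 0 := by rw [AddCircle.coe_sub, h, sub_self]
  obtain ⟨m, hm⟩ := (AddCircle.coe_eq_zero_iff 1).1 h1
  rw [zsmul_one] at hm
  have a := s.2.1
  have b := s.2.2
  have c := s'.2.1
  have d := s'.2.2
  have hm1 : (-2 : ℝ) < m := by linarith
  have hm2 : (m : ℝ) < 2 := by linarith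
  have hm1' : -2 < m := by exact_mod_cast hm1
  have hm2' : m < 2 := by exact_mod_cast hm2
  obtain rfl | rfl | rfl : m = 0 ∨ m = 1 ∨ m = -1 := by omega
  · left
    ext
    push_cast at hm
    linarith
  · push_cast at hm
    exact Or.inr (Or.inr ⟨Subtype.ext (show (s : ℝ) = 1 by linarith),
      Subtype.ext (show (s' : ℝ) = 0 by linarith)⟩)
  · push_cast at hm
    exact Or.inr (Or.inl ⟨Subtype.ext (show (s : ℝ) = 0 by linarith),
      Subtype.ext (show (s' : ℝ) = 1 by linarith)⟩)

theorem exists_unitInterval_coe (u : UnitAddCircle) :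
    ∃ s : unitInterval, ((s : ℝ) : UnitAddCircle) = u := by
  obtain ⟨t, ht, rfl⟩ := AddCircle.eq_coe_Ico u
  exact ⟨⟨t, ht.1, ht.2.le⟩, rfl⟩

/-- A square with two identified opposite sides is a free homotopy of closed curves. -/
theorem homotopic_of_square {γ δ : C(UnitAddCircle, X)} (Q : C(unitInterval × unitInterval, X))
    (h0 : ∀ s : unitInterval, Q (s, 0) = γ (s : ℝ)) (h1 : ∀ s : unitInterval, Q (s, 1) = δ (s : ℝ))
    (hQ : ∀ t, Q (0, t) = Q (1, t)) : γ.Homotopic δ := by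
  let π : C(unitInterval × unitInterval, unitInterval × UnitAddCircle) :=
    ⟨fun x => (x.2, ((x.1 : ℝ) : UnitAddCircle)), by have := continuous_coe; fun_prop⟩
  have hπ : Topology.IsQuotientMap π := by
    refine Topology.IsQuotientMap.of_surjective_continuous ?_ π.continuous
    rintro ⟨t, u⟩
    obtain ⟨s, rfl⟩ := exists_unitInterval_coe u
    exact ⟨(s, t), rfl⟩
  have hfac : ∀ a b, π a = π b → Q a = Q b := by
    rintro ⟨s, t⟩ ⟨s', t'⟩ h
    obtain ⟨rfl, h'⟩ := Prod.mk.inj h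
    rcases coe_unitInterval_eq h' with rfl | ⟨rfl, rfl⟩ | ⟨rfl, rfl⟩
    · rfl
    · exact hQ _
    · exact (hQ _).symm
  have key : ∀ a, hπ.lift Q hfac (π a) = Q a := fun a =>
    DFunLike.congr_fun (hπ.lift_comp Q hfac) a
  exact ⟨{ toContinuousMap := hπ.lift Q hfac
           map_zero_left := fun u => by
             obtain ⟨s, rfl⟩ := exists_unitInterval_coe u
             exact (key (s, 0)).trans (h0 s)
           map_one_left := fun u => by
             obtain ⟨s, rfl⟩ := exists_unitInterval_coe u
             exact (key (s, 1)).trans (h1 s) }⟩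

/-- A loop is a closed curve. -/
theorem exists_circleMap {x : X} (p : Path x x) :
    ∃ γ : C(UnitAddCircle, X), ∀ s : unitInterval, γ (s : ℝ) = p s := by
  let π : C(unitInterval, UnitAddCircle) :=
    ⟨fun s => ((s : ℝ) : UnitAddCircle), by have := continuous_coe; fun_prop⟩
  have hπ : Topology.IsQuotientMap π :=
    Topology.IsQuotientMap.of_surjective_continuous exists_unitInterval_coe π.continuous
  have hfac : ∀ a b, π a = π b → (p : C(unitInterval, X)) a = (p : C(unitInterval, X)) b := by
    intro s s' h
    rcases coe_unitInterval_eq h with rfl | ⟨rfl, rfl⟩ | ⟨rfl, rfl⟩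
    · rfl
    · exact p.source.trans p.target.symm
    · exact p.target.trans p.source.symm
  exact ⟨hπ.lift _ hfac, fun s => DFunLike.congr_fun (hπ.lift_comp _ hfac) s⟩

/-- A closed curve as a periodic curve. -/
def unroll (γ : C(UnitAddCircle, X)) : C(ℝ, X) := γ.comp ⟨_, continuous_coe⟩

theorem coe_one_eq_coe_zero : ((1 : ℝ) : UnitAddCircle) = ((0 : ℝ) : UnitAddCircle) := by
  have := coe_add_one 0
  rwa [zero_add] at this

theorem unroll_one (γ : C(UnitAddCircle, X)) : unroll γ 1 = unroll γ 0 :=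
  congrArg γ coe_one_eq_coe_zero

/-- A free homotopy conjugates the value by the track of the base point, which has no effect in a
commutative group. -/
theorem along_eq_of_homotopic {Λ : Type*} [CommGroup Λ] (F : PathFunctor X Λ)
    {γ δ : C(UnitAddCircle, X)} (h : γ.Homotopic δ) :
    F.along (unroll γ) 0 1 = F.along (unroll δ) 0 1 := by
  obtain ⟨H⟩ := h
  have key : F.along (unroll δ) 0 1 * F.val (H.evalAt ((0 : ℝ) : UnitAddCircle)) =
      F.val (H.evalAt ((1 : ℝ) : UnitAddCircle)) * F.along (unroll γ) 0 1 := F.val_square ((linePath 0 1).map (unroll γ).continuous)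
    ((linePath 0 1).map (unroll δ).continuous) (H.evalAt ((0 : ℝ) : UnitAddCircle))
    (H.evalAt ((1 : ℝ) : UnitAddCircle)) (fun x => H (x.2, ((linePath 0 1 x.1 : ℝ) : UnitAddCircle)))
    (by have := continuous_coe; fun_prop) (fun s => H.apply_zero _) (fun s => H.apply_one _)
    (fun t => by rw [Path.source]; rfl) (fun t => by rw [Path.target]; rfl)
  have hends : F.val (H.evalAt ((0 : ℝ) : UnitAddCircle)) =
      F.val (H.evalAt ((1 : ℝ) : UnitAddCircle)) := F.val_congr _ _ fun t => by
    change H (t, _) = H (t, _)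
    rw [coe_one_eq_coe_zero]
  rw [hends, mul_comm] at key
  exact (mul_left_cancel key).symm

theorem along_reverse {Λ : Type*} [Group Λ] (F : PathFunctor X Λ) (γ : C(UnitAddCircle, X)) :
    F.along (unroll (reverse γ)) 0 1 = (F.along (unroll γ) 0 1)⁻¹ := by
  rw [along, along, ← val_symm]
  refine F.val_congr _ _ fun s => ?_
  change γ (-((linePath 0 1 s : ℝ) : UnitAddCircle)) =
    γ ((linePath 0 1 (unitInterval.symm s) : ℝ) : UnitAddCircle)
  rw [← AddCircle.coe_neg, ← coe_add_one, linePath_apply, linePath_apply]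
  congr 2
  simp
  ring

end Circle

/-! ### Curves and loops in the boundary torus -/

/-- The closed curve in the boundary torus which winds `d.1` times along the longitude and `d.2`
times along the meridian. -/
def linearCurve (d : ℤ × ℤ) : C(UnitAddCircle, boundary) where
  toFun := Function.Periodic.lift (f := fun t : ℝ => torusCover (t * d.1, t * d.2)) (c := 1)
    fun t => (torusCover_eq_iff _ _).2 ⟨-d, by ext <;> simp <;> ring⟩
  continuous_toFun := by
    refine isQuotientMap_quotient_mk'.continuous_iff.2 ?_
    change Continuous fun t : ℝ => torusCover (t * d.1, t * d.2)
    fun_prop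

theorem linearCurve_coe (d : ℤ × ℤ) (t : ℝ) :
    linearCurve d (t : UnitAddCircle) = torusCover (t * d.1, t * d.2) := rfl

theorem homotopic_linearCurve (γ : C(UnitAddCircle, boundary)) : ∃ d : ℤ × ℤ,
    torusFunctor.along (unroll γ) 0 1 = Multiplicative.ofAdd ((d.1 : ℝ), (d.2 : ℝ)) ∧
      γ.Homotopic (linearCurve d) := by
  obtain ⟨z, hz⟩ := isOpenQuotientMap_torusCover.surjective (unroll γ 0)
  let P : Path (unroll γ 0) (unroll γ 1) := (linePath 0 1).map (unroll γ).continuous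
  obtain ⟨w, hw, r, hr⟩ := hasSections_torusCover.exists_lift (.mk P) z hz.symm
  have hper := unroll_one γ
  obtain ⟨d, rfl⟩ := (torusCover_eq_iff z w).1 (by rw [hz, ← hw, hper])
  refine ⟨d, ?_, ?_⟩
  · change torusFunctor.map (.mk P) = _
    rw [hr, map_cast, torusFunctor_map]
    congr 1
    ext <;> simp
  · induction r using Path.Homotopic.Quotient.ind with
    | mk r =>
    rw [← Path.Homotopic.Quotient.mk_map, ← Path.Homotopic.Quotient.mk_cast] at hr
    obtain ⟨H⟩ := Path.Homotopic.Quotient.eq.1 hr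
    have hq : ∀ x : ℝ × ℝ, torusCover (x.1 + d.1, x.2 + d.2) = torusCover x := fun x =>
      ((torusCover_eq_iff _ _).2 ⟨d, rfl⟩).symm
    obtain ⟨δ, hδ⟩ := exists_circleMap ((r.map torusCover.continuous).cast rfl (hq z).symm)
    have h1 : γ.Homotopic δ := by
      refine homotopic_of_square ⟨fun x => H (x.2, x.1), by fun_prop⟩ (fun s => ?_) (fun s => ?_)
        fun t => ?_
      · change H (0, s) = _
        rw [H.apply_zero]
        change γ ((linePath 0 1 s : ℝ) : UnitAddCircle) = _
        rw [linePath_apply]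
        simp
      · change H (1, s) = _
        rw [H.apply_one, hδ]
        rfl
      · change H (t, 0) = H (t, 1)
        rw [H.source, H.target, hper]
    -- The lift and the segment with the same displacement are joined linearly in the plane; the
    -- opposite sides of the square differ by the translation `d`.
    refine h1.trans (homotopic_of_square
      ⟨fun x => torusCover ((1 - (x.2 : ℝ)) * (r x.1).1 + x.2 * (x.1 * d.1),
        (1 - (x.2 : ℝ)) * (r x.1).2 + x.2 * (x.1 * d.2)), by fun_prop⟩
      (fun s => ?_) (fun s => ?_) fun t => ?_)
    · rw [hδ]
      simp
    · rw [linearCurve_coe]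
      simp
    · simp only [ContinuousMap.coe_mk, r.source, r.target]
      rw [← hq]
      congr 1
      ext <;> simp <;> ring

theorem homotopic_of_along_eq {γ δ : C(UnitAddCircle, boundary)}
    (h : torusFunctor.along (unroll γ) 0 1 = torusFunctor.along (unroll δ) 0 1) :
    γ.Homotopic δ := by
  obtain ⟨d, hd, hγ⟩ := homotopic_linearCurve γ
  obtain ⟨e, he, hδ⟩ := homotopic_linearCurve δ
  rw [hd, he] at h
  have h' := Multiplicative.ofAdd.injective h
  rw [Prod.mk.injEq, Int.cast_inj, Int.cast_inj] at h'
  obtain rfl : d = e := Prod.ext h'.1 h'.2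
  exact hγ.trans hδ.symm

theorem torusFunctor_along_cover (γ : C(ℝ, ℝ × ℝ)) (s t : ℝ) :
    torusFunctor.along (torusCover.comp γ) s t = Multiplicative.ofAdd (γ t - γ s) :=
  torusFunctor_map (.mk ((linePath s t).map γ.continuous))

theorem along_longitude :
    torusFunctor.along (unroll longitude) 0 1 = Multiplicative.ofAdd ((1 : ℝ), (0 : ℝ)) := by
  refine (torusFunctor_along_cover ⟨fun t => (t, 0), by fun_prop⟩ 0 1).trans ?_
  simp

theorem along_meridian :
    torusFunctor.along (unroll meridian) 0 1 = Multiplicative.ofAdd ((0 : ℝ), (1 : ℝ)) := by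
  refine (torusFunctor_along_cover ⟨fun t => (0, t), by fun_prop⟩ 0 1).trans ?_
  simp

/-- The base point of the boundary torus. -/
abbrev torusBase : boundary := torusCover (0, 0)

theorem longitude_closed : unroll longitude 0 = unroll longitude 1 :=
  (unroll_one _).symm

theorem meridian_closed : unroll meridian 0 = unroll meridian 1 :=
  (unroll_one _).symm

/-- The longitude as a loop. -/
def lonLoop : FundamentalGroup boundary torusBase := segmentLoop (unroll longitude) longitude_closed

/-- The meridian as a loop. -/
def merLoop : FundamentalGroup boundary torusBase := segmentLoop (unroll meridian) meridian_closed

/-- A loop without displacement lifts to a closed loop in the plane. -/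
theorem injective_torusFunctor : Function.Injective (torusFunctor.hom torusBase) := by
  rw [injective_iff_map_eq_one]
  intro p hp
  obtain ⟨w, hw, r, hr⟩ := hasSections_torusCover.exists_lift (FundamentalGroup.toPath p)
    (0, 0) rfl
  have h : torusFunctor.map (r.map torusCover) = 1 := by
    rw [← hp]
    change _ = torusFunctor.map (FundamentalGroup.toPath p)
    rw [hr, map_cast]
  rw [torusFunctor_map] at h
  obtain rfl : w = (0, 0) := sub_eq_zero.1 (Multiplicative.ofAdd.injective h)
  change FundamentalGroup.toPath p = Path.Homotopic.Quotient.refl _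
  rw [hr, Subsingleton.elim r (Path.Homotopic.Quotient.refl _)]
  rfl

theorem hom_lonLoop :
    torusFunctor.hom torusBase lonLoop = Multiplicative.ofAdd ((1 : ℝ), (0 : ℝ)) :=
  (hom_segmentLoop _ _ longitude_closed).trans along_longitude

theorem hom_merLoop :
    torusFunctor.hom torusBase merLoop = Multiplicative.ofAdd ((0 : ℝ), (1 : ℝ)) :=
  (hom_segmentLoop _ _ meridian_closed).trans along_meridian

theorem hom_lonLoop_zpow_mul (i j : ℤ) :
    torusFunctor.hom torusBase (lonLoop ^ i * merLoop ^ j) =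
      Multiplicative.ofAdd ((i : ℝ), (j : ℝ)) := by
  rw [map_mul, map_zpow, map_zpow, hom_lonLoop, hom_merLoop, ← ofAdd_zsmul, ← ofAdd_zsmul,
    ← ofAdd_add]
  congr 1
  ext <;> simp

theorem exists_zpow_mul (p : FundamentalGroup boundary torusBase) :
    ∃ i j : ℤ, p = lonLoop ^ i * merLoop ^ j := by
  obtain ⟨w, hw, r, hr⟩ := hasSections_torusCover.exists_lift (FundamentalGroup.toPath p)
    (0, 0) rfl
  obtain ⟨⟨i, j⟩, rfl⟩ := (torusCover_eq_iff _ _).1 hw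
  refine ⟨i, j, injective_torusFunctor ?_⟩
  rw [hom_lonLoop_zpow_mul]
  change torusFunctor.map (FundamentalGroup.toPath p) = _
  rw [hr, map_cast, torusFunctor_map]
  simp

/-- The inclusion of the boundary torus. -/
def boundaryIncl : C(boundary, KnotComplement) := ⟨Subtype.val, continuous_subtype_val⟩

/-- The longitude lifts to height `0`, where `knotGauge` is trivial, so only the word of the
boundary curve remains. -/
theorem hom_boundaryIncl_lonLoop :
    (knotFunctor.comap boundaryIncl).hom torusBase lonLoop = KnotGroup.lon := by
  refine (hom_segmentLoop (knotFunctor.comap boundaryIncl) _ longitude_closed).trans ?_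
  let j : C(ℝ, Fibre × ℝ) := ⟨fun t => (boundaryCurve t, 0), by fun_prop⟩
  refine (knotFunctor_map_proj (.mk ((linePath 0 1).map j.continuous))).trans ?_
  change knotGauge (boundaryCurve 1, 0) * _ * (knotGauge (boundaryCurve 0, 0))⁻¹ = _
  rw [knotGauge_zero, knotGauge_zero, one_mul, inv_one, mul_one, KnotGroup.lon,
    ← along_boundaryCurve]
  rfl

theorem hom_boundaryIncl_merLoop :
    (knotFunctor.comap boundaryIncl).hom torusBase merLoop = KnotGroup.mer := by
  refine (hom_segmentLoop (knotFunctor.comap boundaryIncl) _ meridian_closed).trans ?_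
  rw [← knotFunctor_merPath]
  exact knotFunctor.val_congr (((linePath 0 1).map (unroll meridian).continuous).map
    boundaryIncl.continuous) merPath fun _ => rfl

theorem hom_boundaryIncl (i j : ℤ) :
    (knotFunctor.comap boundaryIncl).hom torusBase (lonLoop ^ i * merLoop ^ j) =
      KnotGroup.lon ^ i * KnotGroup.mer ^ j := by
  rw [map_mul, map_zpow, map_zpow, hom_boundaryIncl_lonLoop, hom_boundaryIncl_merLoop]

end FigureEight

end

noncomputable section

namespace FigureEight

open PathFunctor

/-! ### Spaces glued along closed subspaces -/

section Glue

variable {X Y : Type*} [TopologicalSpace X] [TopologicalSpace Y] {A : Set X} {B : Set Y}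
  (f : A ≃ₜ B)

/-- The map of the first space to the glued space. -/
def glueInl : C(X, Glued f) := ⟨fun x => Quot.mk _ (Sum.inl x), continuous_quot_mk.comp continuous_inl⟩

/-- The map of the second space to the glued space. -/
def glueInr : C(Y, Glued f) := ⟨fun y => Quot.mk _ (Sum.inr y), continuous_quot_mk.comp continuous_inr⟩

theorem glueInl_coe (a : A) : glueInl f a = glueInr f (f a) := Quot.sound ⟨a, rfl, rfl⟩

theorem glue_cases (z : Glued f) : (∃ x, z = glueInl f x) ∨ ∃ y, z = glueInr f y := by
  obtain ⟨x | y, rfl⟩ := Quot.exists_rep z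
  · exact Or.inl ⟨x, rfl⟩
  · exact Or.inr ⟨y, rfl⟩

open Classical in
/-- A normal form of the points of the glued space. -/
def glueNormal : Glued f → X ⊕ Y := Quot.lift
  (Sum.elim (fun x => if h : x ∈ A then Sum.inr (f ⟨x, h⟩ : Y) else Sum.inl x) Sum.inr) (by
    rintro _ _ ⟨a, rfl, rfl⟩
    simp)

theorem glueNormal_inl_mem (a : A) : glueNormal f (glueInl f a) = Sum.inr (f a : Y) :=
  dif_pos a.2

theorem glueNormal_inl_notMem {x : X} (h : x ∉ A) : glueNormal f (glueInl f x) = Sum.inl x :=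
  dif_neg h

theorem glueNormal_inr (y : Y) : glueNormal f (glueInr f y) = Sum.inr y := rfl

theorem glueInr_injective : Function.Injective (glueInr f) := fun _ _ h =>
  Sum.inr_injective (congrArg (glueNormal f) h)

theorem glueInl_injective : Function.Injective (glueInl f) := by
  intro x x' h
  have h1 := congrArg (glueNormal f) h
  by_cases hx : x ∈ A <;> by_cases hx' : x' ∈ A
  · rw [glueNormal_inl_mem f ⟨x, hx⟩, glueNormal_inl_mem f ⟨x', hx'⟩] at h1
    exact congrArg Subtype.val (f.injective (Subtype.ext (Sum.inr_injective h1)))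
  · rw [glueNormal_inl_mem f ⟨x, hx⟩, glueNormal_inl_notMem f hx'] at h1
    cases h1
  · rw [glueNormal_inl_notMem f hx, glueNormal_inl_mem f ⟨x', hx'⟩] at h1
    cases h1
  · rw [glueNormal_inl_notMem f hx, glueNormal_inl_notMem f hx'] at h1
    exact Sum.inl_injective h1

theorem glueInl_eq_glueInr {x : X} {y : Y} (h : glueInl f x = glueInr f y) :
    ∃ a : A, x = a ∧ y = f a := by
  have h1 := congrArg (glueNormal f) h
  rw [glueNormal_inr] at h1
  by_cases hx : x ∈ A
  · rw [glueNormal_inl_mem f ⟨x, hx⟩] at h1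
    exact ⟨⟨x, hx⟩, rfl, (Sum.inr_injective h1).symm⟩
  · rw [glueNormal_inl_notMem f hx] at h1
    cases h1

theorem isOpen_glued {S : Set (Glued f)} (h1 : IsOpen (glueInl f ⁻¹' S))
    (h2 : IsOpen (glueInr f ⁻¹' S)) : IsOpen S :=
  isQuotientMap_quot_mk.isOpen_preimage.1 (isOpen_sum_iff.2 ⟨h1, h2⟩)

theorem isClosed_glued {S : Set (Glued f)} (h1 : IsClosed (glueInl f ⁻¹' S))
    (h2 : IsClosed (glueInr f ⁻¹' S)) : IsClosed S :=
  ⟨isOpen_glued f h1.isOpen_compl h2.isOpen_compl⟩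

theorem isClosedEmbedding_glueInl (hB : IsClosed B) :
    Topology.IsClosedEmbedding (glueInl f) := by
  refine .of_continuous_injective_isClosedMap (glueInl f).continuous (glueInl_injective f) ?_
  intro C hC
  refine isClosed_glued f ?_ ?_
  · rwa [Set.preimage_image_eq _ (glueInl_injective f)]
  · have : glueInr f ⁻¹' (glueInl f '' C) = Subtype.val '' (f '' (Subtype.val ⁻¹' C)) := by
      ext y
      constructor
      · rintro ⟨x, hx, h⟩
        obtain ⟨a, rfl, rfl⟩ := glueInl_eq_glueInr f h
        exact ⟨f a, ⟨a, hx, rfl⟩, rfl⟩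
      · rintro ⟨_, ⟨a, ha, rfl⟩, rfl⟩
        exact ⟨a, ha, glueInl_coe f a⟩
    rw [this]
    exact hB.isClosedEmbedding_subtypeVal.isClosedMap _
      (f.isClosedMap _ (hC.preimage continuous_subtype_val))

theorem isClosedEmbedding_glueInr (hA : IsClosed A) :
    Topology.IsClosedEmbedding (glueInr f) := by
  refine .of_continuous_injective_isClosedMap (glueInr f).continuous (glueInr_injective f) ?_
  intro C hC
  refine isClosed_glued f ?_ ?_
  · have : glueInl f ⁻¹' (glueInr f '' C) = Subtype.val '' (f ⁻¹' (Subtype.val ⁻¹' C)) := by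
      ext y
      constructor
      · rintro ⟨x, hx, h⟩
        obtain ⟨a, rfl, rfl⟩ := glueInl_eq_glueInr f h.symm
        exact ⟨a, hx, rfl⟩
      · rintro ⟨a, ha, rfl⟩
        exact ⟨f a, ha, (glueInl_coe f a).symm⟩
    rw [this]
    exact hA.isClosedEmbedding_subtypeVal.isClosedMap _
      ((hC.preimage continuous_subtype_val).preimage f.continuous)
  · rwa [Set.preimage_image_eq _ (glueInr_injective f)]

/-- Two open sets which match along the gluing form an open set of the glued space. -/
theorem exists_glue_isOpen {O : Set X} {O' : Set Y} (hO : IsOpen O) (hO' : IsOpen O')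
    (h : ∀ a : A, (a : X) ∈ O ↔ (f a : Y) ∈ O') :
    ∃ U : Set (Glued f), IsOpen U ∧ glueInl f ⁻¹' U = O ∧ glueInr f ⁻¹' U = O' := by
  have h1 : glueInl f ⁻¹' (glueInl f '' O ∪ glueInr f '' O') = O := by
    ext x
    constructor
    · rintro (⟨x', hx', hxx⟩ | ⟨y, hy, hxy⟩)
      · rwa [← glueInl_injective f hxx]
      · obtain ⟨a, rfl, rfl⟩ := glueInl_eq_glueInr f hxy.symm
        exact (h a).2 hy
    · exact fun hx => Or.inl ⟨x, hx, rfl⟩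
  have h2 : glueInr f ⁻¹' (glueInl f '' O ∪ glueInr f '' O') = O' := by
    ext y
    constructor
    · rintro (⟨x, hx, hxy⟩ | ⟨y', hy', hyy⟩)
      · obtain ⟨a, rfl, rfl⟩ := glueInl_eq_glueInr f hxy
        exact (h a).1 hx
      · rwa [← glueInr_injective f hyy]
    · exact fun hy => Or.inr ⟨y, hy, rfl⟩
  exact ⟨_, isOpen_glued f (by rwa [h1]) (by rwa [h2]), h1, h2⟩

theorem exists_glue_fun {α : Type*} (g : X → α) (g' : Y → α) (h : ∀ a : A, g a = g' (f a)) :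
    ∃ k : Glued f → α, (∀ x, k (glueInl f x) = g x) ∧ ∀ y, k (glueInr f y) = g' y :=
  ⟨Quot.lift (Sum.elim g g') (by rintro _ _ ⟨a, rfl, rfl⟩; exact h a), fun _ => rfl, fun _ => rfl⟩

/-- Each point of `B` has a neighbourhood which can be pushed into `B`, keeping `B` fixed. -/
def HasCollar (B : Set Y) : Prop := ∀ b ∈ B, ∃ N : Set Y, IsOpen N ∧ b ∈ N ∧
  ∃ K : Y × unitInterval → Y, ContinuousOn K (N ×ˢ Set.univ) ∧ (∀ y ∈ N, K (y, 0) = y) ∧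
    (∀ y ∈ N, K (y, 1) ∈ B) ∧ ∀ y ∈ N ∩ B, ∀ t, K (y, t) = y

variable {Λ : Type*} [Group Λ]

theorem val_eq_of_lift {M Z : Type*} [TopologicalSpace M] [TopologicalSpace Z] (i : C(Z, M))
    {F F' : PathFunctor M Λ}
    (h : ∀ {x y : Z} (p : Path.Homotopic.Quotient x y), F.map (p.map i) = F'.map (p.map i))
    {x y : M} (γ : Path x y) (δ : C(unitInterval, Z)) (hδ : ∀ t, γ t = i (δ t)) :
    F.val γ = F'.val γ := by
  let δ' : Path (δ 0) (δ 1) := ⟨δ, rfl, rfl⟩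
  rw [F.val_congr γ (δ'.map i.continuous) hδ, F'.val_congr γ (δ'.map i.continuous) hδ]
  exact h (.mk δ')

theorem exists_lift_of_isClosedEmbedding {M Z : Type*} [TopologicalSpace M] [TopologicalSpace Z]
    {i : C(Z, M)} (hi : Topology.IsClosedEmbedding i) {x y : M} (γ : Path x y)
    (h : ∀ t, γ t ∈ Set.range i) : ∃ δ : C(unitInterval, Z), ∀ t, γ t = i (δ t) := by
  choose δ hδ using h
  refine ⟨⟨δ, hi.isInducing.continuous_iff.2 ?_⟩, fun t => (hδ t).symm⟩
  exact γ.continuous.congr fun t => (hδ t).symm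

/-- Two functors on a glued space which agree on the paths in the two pieces are equal. -/
theorem map_eq_of_glue (hA : IsClosed A) (hB : IsClosed B) (hcollar : HasCollar B)
    {F F' : PathFunctor (Glued f) Λ}
    (h1 : ∀ {x y : X} (p : Path.Homotopic.Quotient x y),
      F.map (p.map (glueInl f)) = F'.map (p.map (glueInl f)))
    (h2 : ∀ {x y : Y} (p : Path.Homotopic.Quotient x y),
      F.map (p.map (glueInr f)) = F'.map (p.map (glueInr f)))
    {x y : Glued f} (p : Path.Homotopic.Quotient x y) : F.map p = F'.map p := by
  have e1 := isClosedEmbedding_glueInl f hB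
  have e2 := isClosedEmbedding_glueInr f hA
  have cover : ∀ z : Glued f, ∃ U : Set (Glued f), IsOpen U ∧ z ∈ U ∧
      ∀ {x y : Glued f} (γ : Path x y), (∀ t, γ t ∈ U) → F.val γ = F'.val γ := by
    -- A path may cross the gluing locus infinitely often, so it cannot be cut into paths in the
    -- pieces. The collar pushes it into the first piece instead.
    have collar : ∀ a : A, ∃ U : Set (Glued f), IsOpen U ∧ glueInl f a ∈ U ∧
        ∀ {x y : Glued f} (γ : Path x y), (∀ t, γ t ∈ U) → F.val γ = F'.val γ := by
      intro a
      obtain ⟨N, hN, haN, K, hK, hK0, hK1, hKB⟩ := hcollar (f a) (f a).2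
      have hV : IsOpen {a' : A | (f a' : Y) ∈ N} := hN.preimage (by fun_prop)
      obtain ⟨O, hO, hOV⟩ := isOpen_induced_iff.1 hV
      obtain ⟨U, hU, hU1, hU2⟩ := exists_glue_isOpen f hO hN fun a' => by
        change a' ∈ Subtype.val ⁻¹' O ↔ _
        rw [hOV]
        rfl
      refine ⟨U, hU, ?_, ?_⟩
      · rw [glueInl_coe]
        change (f a : Y) ∈ glueInr f ⁻¹' U
        rwa [hU2]
      intro x y γ hγ
      have : Nonempty Y := ⟨(f a : Y)⟩
      let inv : Glued f → Y := Function.invFun (glueInr f)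
      have hinv : ∀ y, inv (glueInr f y) = y := Function.leftInverse_invFun (glueInr_injective f)
      classical
      -- The homotopy keeps the points of the first piece and moves those of the second along the
      -- collar. Its top lies in the first piece and each track in one of the pieces, so naturality
      -- along the square applies.
      let Q : unitInterval × unitInterval → Glued f := fun q =>
        if γ q.1 ∈ Set.range (glueInl f) then γ q.1 else glueInr f (K (inv (γ q.1), q.2))
      have hQ1 : ∀ q, γ q.1 ∈ Set.range (glueInl f) → Q q = γ q.1 := fun q hq => if_pos hq
      have hQ2 : ∀ (q : unitInterval × unitInterval) (y : Y), γ q.1 = glueInr f y →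
          Q q = glueInr f (K (y, q.2)) := by
        intro q y hy
        by_cases hq : γ q.1 ∈ Set.range (glueInl f)
        · rw [hQ1 q hq]
          obtain ⟨x', hx'⟩ := hq
          obtain ⟨a', rfl, rfl⟩ := glueInl_eq_glueInr f (hx'.trans hy)
          have : (f a' : Y) ∈ N := by
            rw [← hU2]
            change glueInr f _ ∈ U
            rw [← hy]
            exact hγ _
          rw [hKB _ ⟨this, (f a').2⟩, hy]
        · simp only [Q, if_neg hq]
          rw [hy, hinv]
      have hmem : ∀ s y, γ s = glueInr f y → y ∈ N := by
        intro s y hs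
        rw [← hU2]
        change glueInr f y ∈ U
        rw [← hs]
        exact hγ s
      have hor : ∀ s, γ s ∈ Set.range (glueInl f) ∨ ∃ y, γ s = glueInr f y := fun s =>
        (glue_cases f (γ s)).imp (fun ⟨x', hx'⟩ => ⟨x', hx'.symm⟩) id
      have hQc : Continuous Q := by
        have c1 : IsClosed {q : unitInterval × unitInterval | γ q.1 ∈ Set.range (glueInl f)} :=
          e1.isClosed_range.preimage (by fun_prop)
        have c2 : IsClosed {q : unitInterval × unitInterval | γ q.1 ∈ Set.range (glueInr f)} :=
          e2.isClosed_range.preimage (by fun_prop)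
        have k1 : ContinuousOn Q {q | γ q.1 ∈ Set.range (glueInl f)} :=
          ContinuousOn.congr (f := fun q => γ q.1) (by fun_prop) fun q hq => hQ1 q hq
        have k2 : ContinuousOn Q {q | γ q.1 ∈ Set.range (glueInr f)} := by
          have k3 : ContinuousOn (fun q : unitInterval × unitInterval => inv (γ q.1))
              {q | γ q.1 ∈ Set.range (glueInr f)} := by
            rw [e2.isInducing.continuousOn_iff]
            refine ContinuousOn.congr (f := fun q => γ q.1) (by fun_prop) ?_
            rintro q ⟨y, hy⟩
            simp only [Function.comp_apply]
            rw [← hy, hinv]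
          refine ContinuousOn.congr
            (f := fun q => glueInr f (K (inv (γ q.1), q.2))) ?_ ?_
          · refine (glueInr f).continuous.comp_continuousOn
              (hK.comp (k3.prodMk continuousOn_snd) ?_)
            rintro q ⟨y, hy⟩
            refine ⟨?_, trivial⟩
            change inv (γ q.1) ∈ N
            rw [← hy, hinv]
            exact hmem _ y hy.symm
          · rintro q ⟨y, hy⟩
            change Q q = glueInr f (K (inv (γ q.1), q.2))
            rw [hQ2 q y hy.symm, ← hy, hinv]
        have := k1.union_of_isClosed k2 c1 c2
        rw [← continuousOn_univ]
        refine this.mono fun q _ => ?_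
        rcases hor q.1 with h | ⟨y, hy⟩
        · exact Or.inl h
        · exact Or.inr ⟨y, hy.symm⟩
      have hQ0 : ∀ s, Q (s, 0) = γ s := by
        intro s
        rcases hor s with h | ⟨y, hy⟩
        · exact hQ1 _ h
        · rw [hQ2 _ y hy, hK0 y (hmem s y hy), hy]
      let top : Path (Q (0, 1)) (Q (1, 1)) := ⟨⟨fun s => Q (s, 1), by fun_prop⟩, rfl, rfl⟩
      let side : ∀ s, Path (γ s) (Q (s, 1)) := fun s =>
        ⟨⟨fun t => Q (s, t), by fun_prop⟩, hQ0 s, rfl⟩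
      have htop : F.val top = F'.val top := by
        obtain ⟨δ, hδ⟩ := exists_lift_of_isClosedEmbedding e1 top fun s => by
          change Q (s, 1) ∈ _
          rcases hor s with h | ⟨y, hy⟩
          · rwa [hQ1 _ h]
          · rw [hQ2 _ y hy]
            have hb := hK1 y (hmem s y hy)
            refine ⟨f.symm ⟨_, hb⟩, ?_⟩
            rw [glueInl_coe, f.apply_symm_apply]
        exact val_eq_of_lift _ h1 top δ hδ
      have hside : ∀ s, F.val (side s) = F'.val (side s) := by
        intro s
        rcases hor s with h | ⟨y, hy⟩
        · obtain ⟨δ, hδ⟩ := exists_lift_of_isClosedEmbedding e1 (side s) fun t => by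
            change Q (s, t) ∈ _
            rwa [hQ1 _ h]
          exact val_eq_of_lift _ h1 (side s) δ hδ
        · obtain ⟨δ, hδ⟩ := exists_lift_of_isClosedEmbedding e2 (side s) fun t => by
            change Q (s, t) ∈ _
            rw [hQ2 _ y hy]
            exact ⟨_, rfl⟩
          exact val_eq_of_lift _ h2 (side s) δ hδ
      have s1 := F.val_square (γ.cast γ.source γ.target) top (side 0) (side 1) Q hQc hQ0
        (fun _ => rfl) (fun _ => rfl) fun _ => rfl
      have s2 := F'.val_square (γ.cast γ.source γ.target) top (side 0) (side 1) Q hQc hQ0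
        (fun _ => rfl) (fun _ => rfl) fun _ => rfl
      rw [val_cast] at s1 s2
      rw [htop, hside, hside, s2] at s1
      exact (mul_left_cancel s1).symm
    intro z
    rcases glue_cases f z with ⟨x, rfl⟩ | ⟨y, rfl⟩
    · by_cases hx : x ∈ A
      · exact collar ⟨x, hx⟩
      · obtain ⟨U, hU, hU1, hU2⟩ := exists_glue_isOpen f hA.isOpen_compl isOpen_empty (fun a => by
          simp)
        refine ⟨U, hU, by rw [← Set.mem_preimage, hU1]; exact hx, fun γ hγ => ?_⟩
        obtain ⟨δ, hδ⟩ := exists_lift_of_isClosedEmbedding e1 γ fun t => by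
          rcases glue_cases f (γ t) with ⟨x', hx'⟩ | ⟨y', hy'⟩
          · exact ⟨x', hx'.symm⟩
          · have : y' ∈ glueInr f ⁻¹' U := by
              change glueInr f y' ∈ U
              rw [← hy']
              exact hγ t
            rw [hU2] at this
            exact this.elim
        exact val_eq_of_lift _ h1 γ δ hδ
    · by_cases hy : y ∈ B
      · have := collar (f.symm ⟨y, hy⟩)
        rwa [glueInl_coe, f.apply_symm_apply] at this
      · obtain ⟨U, hU, hU1, hU2⟩ := exists_glue_isOpen f isOpen_empty hB.isOpen_compl (fun a => by
          simp)
        refine ⟨U, hU, by rw [← Set.mem_preimage, hU2]; exact hy, fun γ hγ => ?_⟩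
        obtain ⟨δ, hδ⟩ := exists_lift_of_isClosedEmbedding e2 γ fun t => by
          rcases glue_cases f (γ t) with ⟨x', hx'⟩ | ⟨y', hy'⟩
          · have : x' ∈ glueInl f ⁻¹' U := by
              change glueInl f x' ∈ U
              rw [← hx']
              exact hγ t
            rw [hU1] at this
            exact this.elim
          · exact ⟨y', hy'.symm⟩
        exact val_eq_of_lift _ h2 γ δ hδ
  choose U hU hz h using cover
  exact map_eq_of_cover hU (fun z => ⟨z, hz z⟩) (fun z _ _ γ hγ => h z γ hγ) p

end Glue

end FigureEight

end

noncomputable section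

namespace FigureEight

open PathFunctor

/-! ### The fundamental group of a glued space -/

section VanKampen

variable {X Y Λ : Type*} [TopologicalSpace X] [TopologicalSpace Y] [Group Λ] {A : Set X}
  {B : Set Y} (f : A ≃ₜ B)

/-- The inclusion of the gluing locus in the second space. -/
def glueIncl : C(A, Y) := ⟨fun a => f a, by fun_prop⟩

/-- The inclusion of the gluing locus in the first space. -/
def subIncl (A : Set X) : C(A, X) := ⟨Subtype.val, continuous_subtype_val⟩

theorem val_glue (F : PathFunctor (Glued f) Λ) {a b : A} (γ : Path a b) :
    (F.comap (glueInl f)).val (γ.map (subIncl A).continuous) =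
      (F.comap (glueInr f)).val (γ.map (glueIncl f).continuous) :=
  F.val_congr ((γ.map (subIncl A).continuous).map (glueInl f).continuous)
    ((γ.map (glueIncl f).continuous).map (glueInr f).continuous) fun _ => glueInl_coe f _

/-- Locally trivial functors on the pieces which agree on the gluing locus extend. -/
theorem exists_functor_glued [LocallyPathConnectedSpace X] [LocallyPathConnectedSpace Y]
    [LocallyPathConnectedSpace A] (hA : IsClosed A) (hB : IsClosed B)
    {F : PathFunctor X Λ} {F' : PathFunctor Y Λ} (hF : F.LocallyTrivial) (hF' : F'.LocallyTrivial)
    (h : ∀ {a b : A} (γ : Path a b), F.val (γ.map (subIncl A).continuous) =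
      F'.val (γ.map (glueIncl f).continuous)) :
    ∃ Φ : PathFunctor (Glued f) Λ,
      (∀ {x y : X} (p : Path.Homotopic.Quotient x y), (Φ.comap (glueInl f)).map p = F.map p) ∧
      ∀ {x y : Y} (p : Path.Homotopic.Quotient x y), (Φ.comap (glueInr f)).map p = F'.map p := by
  have build : ∀ (O : Set X) (O' : Set Y) (g : X → Λ) (g' : Y → Λ), IsOpen O → IsOpen O' →
      (∀ a : A, (a : X) ∈ O ↔ (f a : Y) ∈ O') → (∀ a : A, (a : X) ∈ O → g a = g' (f a)) →
      F.TrivialOn O g → F'.TrivialOn O' g' →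
      ∃ U : Set (Glued f), IsOpen U ∧ glueInl f ⁻¹' U = O ∧ glueInr f ⁻¹' U = O' ∧
        ∃ k : Glued f → Λ, F.TrivialOn (glueInl f ⁻¹' U) (k ∘ glueInl f) ∧
          F'.TrivialOn (glueInr f ⁻¹' U) (k ∘ glueInr f) := by
    intro O O' g g' hO hO' hOO hgg hg hg'
    obtain ⟨U, hU, hU1, hU2⟩ := exists_glue_isOpen f hO hO' hOO
    classical
    obtain ⟨k, hk1, hk2⟩ := exists_glue_fun f g
      (fun y => if hy : y ∈ B then g (f.symm ⟨y, hy⟩) else g' y) fun a => by simp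
    have hk2' : ∀ y ∈ O', k (glueInr f y) = g' y := by
      intro y hy
      rw [hk2]
      split_ifs with hyB
      · have := hgg (f.symm ⟨y, hyB⟩)
        rw [f.apply_symm_apply] at this
        exact this ((hOO _).2 (by rwa [f.apply_symm_apply]))
      · rfl
    refine ⟨U, hU, hU1, hU2, k, fun {x y} γ hγ => ?_, fun {x y} γ hγ => ?_⟩
    · rw [hU1] at hγ
      rw [hg γ hγ, Function.comp_apply, Function.comp_apply, hk1, hk1]
    · rw [hU2] at hγ
      have hx := hγ 0
      have hy := hγ 1
      rw [γ.source] at hx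
      rw [γ.target] at hy
      rw [hg' γ hγ, Function.comp_apply, Function.comp_apply, hk2' x hx, hk2' y hy]
  have locus : ∀ a : A, ∃ U : Set (Glued f), IsOpen U ∧ glueInl f a ∈ U ∧
      ∃ k : Glued f → Λ, F.TrivialOn (glueInl f ⁻¹' U) (k ∘ glueInl f) ∧
        F'.TrivialOn (glueInr f ⁻¹' U) (k ∘ glueInr f) := by
    intro a
    obtain ⟨W, hW, haW, g, hg⟩ := hF a
    obtain ⟨W', hW', haW', g', hg'⟩ := hF' (f a)
    let V : Set A := subIncl A ⁻¹' W ∩ glueIncl f ⁻¹' W'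
    have hV : IsOpen V :=
      (hW.preimage (subIncl A).continuous).inter (hW'.preimage (glueIncl f).continuous)
    -- On the locus the two developing maps differ by a locally constant factor. Shrinking to the
    -- set where it equals `c` and multiplying `g'` by `c` makes them match.
    let c := (g' (f a))⁻¹ * g a
    have hV' := isOpen_develop hV (g := g ∘ subIncl A) (g' := g' ∘ glueIncl f)
      (fun {x y} γ hγ => by
        have e1 := hg (γ.map (subIncl A).continuous) fun t => (hγ t).1
        have e2 := hg' (γ.map (glueIncl f).continuous) fun t => (hγ t).2
        exact e1.symm.trans ((h γ).trans e2)) c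
    obtain ⟨O, hO, hOV⟩ := isOpen_induced_iff.1 hV'
    obtain ⟨O', hO', hOV'⟩ := isOpen_induced_iff.1 (f.symm.continuous.isOpen_preimage _ hV')
    have m1 : ∀ b : A, (b : X) ∈ O ↔ b ∈ V ∧ (g' (f b))⁻¹ * g b = c := fun b => by
      change b ∈ Subtype.val ⁻¹' O ↔ _
      rw [hOV]
      rfl
    have m2 : ∀ b : A, (f b : Y) ∈ O' ↔ b ∈ V ∧ (g' (f b))⁻¹ * g b = c := fun b => by
      change f b ∈ Subtype.val ⁻¹' O' ↔ _
      rw [hOV', Set.mem_preimage, f.symm_apply_apply]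
      rfl
    obtain ⟨U, hU, hU1, -, hk⟩ := build (W ∩ O) (W' ∩ O') g (fun y => g' y * c)
      (hW.inter hO) (hW'.inter hO')
      (fun b => by
        constructor
        · rintro ⟨-, h2⟩
          have h3 := (m1 b).1 h2
          exact ⟨h3.1.2, (m2 b).2 h3⟩
        · rintro ⟨-, h2⟩
          have h3 := (m2 b).1 h2
          exact ⟨h3.1.1, (m1 b).2 h3⟩)
      (fun b hb => by
        rw [← ((m1 b).1 hb.2).2]
        group)
      (hg.mono Set.inter_subset_left) (TrivialOn.mono (TrivialOn.mul_const hg' c) Set.inter_subset_left)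
    refine ⟨U, hU, ?_, hk⟩
    rw [← Set.mem_preimage, hU1]
    exact ⟨haW, (m1 a).2 ⟨⟨haW, haW'⟩, rfl⟩⟩
  refine exists_glue (glueInl f) (glueInr f) (fun S => isOpen_glued f) F F' fun z => ?_
  rcases glue_cases f z with ⟨x, rfl⟩ | ⟨y, rfl⟩
  · by_cases hx : x ∈ A
    · exact locus ⟨x, hx⟩
    · obtain ⟨W, hW, hxW, g, hg⟩ := hF x
      obtain ⟨U, hU, hU1, -, hk⟩ := build (W ∩ Aᶜ) ∅ g 1 (hW.inter hA.isOpen_compl) isOpen_empty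
        (fun a => by simp) (fun a ha => absurd a.2 ha.2) (hg.mono Set.inter_subset_left)
        fun γ hγ => (hγ 0).elim
      refine ⟨U, hU, ?_, hk⟩
      rw [← Set.mem_preimage, hU1]
      exact ⟨hxW, hx⟩
  · by_cases hy : y ∈ B
    · have := locus (f.symm ⟨y, hy⟩)
      rwa [glueInl_coe, f.apply_symm_apply] at this
    · obtain ⟨W, hW, hyW, g, hg⟩ := hF' y
      obtain ⟨U, hU, -, hU2, hk⟩ := build ∅ (W ∩ Bᶜ) 1 g isOpen_empty (hW.inter hB.isOpen_compl)
        (fun a => by simp) (fun a ha => ha.elim) (fun γ hγ => (hγ 0).elim)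
        (hg.mono Set.inter_subset_left)
      refine ⟨U, hU, ?_, hk⟩
      rw [← Set.mem_preimage, hU2]
      exact ⟨hyW, hy⟩

/-- The glued space is path connected. -/
theorem pathConnectedSpace_glued [PathConnectedSpace X] [PathConnectedSpace Y] [Nonempty A] :
    PathConnectedSpace (Glued f) := by
  obtain ⟨a⟩ := ‹Nonempty A›
  have key : ∀ z, Joined (glueInl f a) z := by
    intro z
    rcases glue_cases f z with ⟨x, rfl⟩ | ⟨y, rfl⟩
    · exact ⟨(PathConnectedSpace.somePath (a : X) x).map (glueInl f).continuous⟩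
    · rw [glueInl_coe]
      exact ⟨(PathConnectedSpace.somePath (f a : Y) y).map (glueInr f).continuous⟩
  exact ⟨⟨glueInl f a⟩, fun z w => (key z).symm.trans (key w)⟩

/-- A homomorphism which expresses one functor by another one on loops. -/
theorem exists_hom_of_bijective {X Λ Λ' : Type*} [TopologicalSpace X] [Group Λ] [Group Λ']
    (F : PathFunctor X Λ) (x : X) (hF : Function.Bijective (F.hom x)) (K : PathFunctor X Λ') :
    ∃ ψ : Λ →* Λ', ∀ p, ψ (F.hom x p) = K.hom x p := by
  let e := MulEquiv.ofBijective (F.hom x) hF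
  refine ⟨(K.hom x).comp e.symm.toMonoidHom, fun p => ?_⟩
  change K.hom x (e.symm (e p)) = _
  rw [e.symm_apply_apply]

open Monoid in
/-- The theorem of Seifert and van Kampen for two path connected spaces glued along path connected
subspaces, one of which has a collar. -/
theorem exists_functor_pushout {G : Type} [Group G] [LocallyPathConnectedSpace X]
    [LocallyPathConnectedSpace Y] [LocallyPathConnectedSpace A] [PathConnectedSpace X]
    [PathConnectedSpace Y] [PathConnectedSpace A] (hA : IsClosed A) (hB : IsClosed B)
    (hcollar : HasCollar B) (a : A) {F : PathFunctor X G} {F' : PathFunctor Y G}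
    (hF : F.LocallyTrivial) (hF' : F'.LocallyTrivial)
    (hb : Function.Bijective (F.hom (a : X))) (hb' : Function.Bijective (F'.hom (f a : Y)))
    (φ : Bool → (FundamentalGroup A a →* G)) (hφ : φ false = (F.comap (subIncl A)).hom a)
    (hφ' : φ true = (F'.comap (glueIncl f)).hom a) :
    ∃ Φ : PathFunctor (Glued f) (PushoutI φ),
      Function.Bijective (Φ.hom (glueInl f a)) := by
  let o : ∀ i, G →* PushoutI φ := fun i =>
    PushoutI.of (G := fun _ => G) (φ := φ) i
  obtain ⟨u, hu, hgauge⟩ := exists_gauge ((F.comap (subIncl A)).mapHom (o false))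
    ((F'.comap (glueIncl f)).mapHom (o true)) a (by
      ext p
      have h1 : o false (φ false p) = o true (φ true p) := by
        rw [PushoutI.of_apply_eq_base, PushoutI.of_apply_eq_base]
      rw [hφ, hφ'] at h1
      exact h1)
  classical
  -- The functor on the second piece is regauged by `u` on `B`, so that both functors agree exactly
  -- on the gluing locus.
  let k : Y → PushoutI φ := fun y => if hy : y ∈ B then u (f.symm ⟨y, hy⟩) else 1
  have hk : ∀ b : A, k (f b) = u b := fun b => by simp [k]
  obtain ⟨Φ, hΦ1, hΦ2⟩ := exists_functor_glued f hA hB (hF.mapHom (o false))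
    ((hF'.mapHom (o true)).gauge k) (fun {b c} γ => by
      have := hgauge (.mk γ)
      rw [val_gauge]
      change _ = k (f c) * _ * (k (f b))⁻¹
      rw [hk, hk]
      exact this)
  have := pathConnectedSpace_glued f
  refine ⟨Φ, ?_, ?_⟩
  · let z := glueInl f a
    -- Injectivity follows if the tautological functor `K` factors through `Φ`; the factorization
    -- `ψ` comes from the universal property of the pushout.
    let K := ofHom (MonoidHom.id (FundamentalGroup (Glued f) z)) (PathConnectedSpace.somePath z)
    obtain ⟨ψ₁, hψ₁⟩ := exists_hom_of_bijective F a hb (K.comap (glueInl f))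
    obtain ⟨ψ₂, hψ₂⟩ := exists_hom_of_bijective F' (f a) hb' (K.comap (glueInr f))
    have hcompat : ψ₁.comp (φ false) = ψ₂.comp (φ true) := by
      ext p
      rw [hφ, hφ']
      have e1 := hψ₁ (FundamentalGroup.fromPath ((FundamentalGroup.toPath p).map (subIncl A)))
      have e2 := hψ₂ (FundamentalGroup.fromPath ((FundamentalGroup.toPath p).map (glueIncl f)))
      refine e1.trans (Eq.trans ?_ e2.symm)
      change (K.comap (glueInl f)).map ((FundamentalGroup.toPath p).map (subIncl A)) =
        (K.comap (glueInr f)).map ((FundamentalGroup.toPath p).map (glueIncl f))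
      induction FundamentalGroup.toPath p using Path.Homotopic.Quotient.ind with
      | mk γ => exact val_glue f K γ
    let ψ : PushoutI φ →* FundamentalGroup (Glued f) z :=
      PushoutI.lift (fun i => if i then ψ₂ else ψ₁) (ψ₁.comp (φ false)) (by
        rintro (_ | _)
        · rfl
        · exact hcompat.symm)
    have hψf : ∀ g, ψ (o false g) = ψ₁ g := fun g => PushoutI.lift_of _ _ _ _
    have hψt : ∀ g, ψ (o true g) = ψ₂ g := fun g => PushoutI.lift_of _ _ _ _
    obtain ⟨k₁, hk₁, hg₁⟩ := exists_gauge (K.comap (glueInl f)) ((Φ.mapHom ψ).comap (glueInl f)) a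
      (by
        ext p
        rw [← hψ₁ p, ← hψf]
        exact congrArg ψ (hΦ1 (FundamentalGroup.toPath p)).symm)
    obtain ⟨k₂, hk₂, hg₂⟩ := exists_gauge (K.comap (glueInr f)) ((Φ.mapHom ψ).comap (glueInr f))
      (f a : Y) (by
        ext p
        rw [← hψ₂ p, ← hψt]
        refine (congrArg ψ ((hΦ2 (FundamentalGroup.toPath p)).trans ?_)).symm
        change k (f a) * o true (F'.map (FundamentalGroup.toPath p)) * (k (f a))⁻¹ = _
        rw [hk, hu, one_mul, inv_one, mul_one]
        rfl)
    -- Both gauges are `1` at the base point and are carried in the same way along a path in the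
    -- locus, so they glue to one gauge.
    have hk12 : ∀ b : A, k₁ b = k₂ (f b) := by
      intro b
      let ζ : Path a b := PathConnectedSpace.somePath a b
      have e1 := hg₁ (.mk (ζ.map (subIncl A).continuous))
      have e2 := hg₂ (.mk (ζ.map (glueIncl f).continuous))
      have e3 := val_glue f K ζ
      have e4 := val_glue f (Φ.mapHom ψ) ζ
      change (K.comap (glueInl f)).val _ = k₁ b * ((Φ.mapHom ψ).comap (glueInl f)).val _ *
        (k₁ a)⁻¹ at e1
      change (K.comap (glueInr f)).val _ = k₂ (f b) * ((Φ.mapHom ψ).comap (glueInr f)).val _ *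
        (k₂ (f a))⁻¹ at e2
      rw [e3, e2, e4, hk₁, hk₂] at e1
      exact (mul_right_cancel (mul_right_cancel e1)).symm
    obtain ⟨κ, hκ1, hκ2⟩ := exists_glue_fun f k₁ k₂ hk12
    refine hom_injective_of_factor Φ (PathConnectedSpace.somePath z) ψ (fun w => (κ w)⁻¹)
      fun p => ?_
    have key : K.map p = ((Φ.mapHom ψ).gauge κ).map p := by
      refine map_eq_of_glue f hA hB hcollar (fun {x y} p => ?_) (fun {x y} p => ?_) p
      · change _ = κ (glueInl f y) * _ * (κ (glueInl f x))⁻¹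
        rw [hκ1, hκ1]
        exact hg₁ p
      · change _ = κ (glueInr f y) * _ * (κ (glueInr f x))⁻¹
        rw [hκ2, hκ2]
        exact hg₂ p
    change (κ z)⁻¹ * K.map p * ((κ z)⁻¹)⁻¹ = ψ (Φ.map p)
    rw [key]
    change (κ z)⁻¹ * (κ z * ψ (Φ.map p) * (κ z)⁻¹) * ((κ z)⁻¹)⁻¹ = ψ (Φ.map p)
    group
  · rw [← MonoidHom.range_eq_top, eq_top_iff]
    have hf : ∀ g, o false g ∈ (Φ.hom (glueInl f a)).range := by
      intro g
      obtain ⟨p, rfl⟩ := hb.2 g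
      exact ⟨FundamentalGroup.fromPath ((FundamentalGroup.toPath p).map (glueInl f)),
        hΦ1 (FundamentalGroup.toPath p)⟩
    have ht : ∀ g, o true g ∈ (Φ.hom (glueInl f a)).range := by
      intro g
      obtain ⟨p, rfl⟩ := hb'.2 g
      refine ⟨FundamentalGroup.fromPath (((FundamentalGroup.toPath p).map (glueInr f)).cast
        (glueInl_coe f a) (glueInl_coe f a)), ?_⟩
      refine (Φ.map_cast _ _ _).trans ((hΦ2 (FundamentalGroup.toPath p)).trans ?_)
      change k (f a) * o true (F'.map (FundamentalGroup.toPath p)) * (k (f a))⁻¹ = _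
      rw [hk, hu, one_mul, inv_one, mul_one]
      rfl
    intro g _
    induction g using PushoutI.induction_on with
    | of i g =>
      cases i
      · exact hf g
      · exact ht g
    | base h =>
      rw [← PushoutI.of_apply_eq_base φ false]
      exact hf _
    | mul x y hx hy => exact mul_mem (hx trivial) (hy trivial)

end VanKampen

end FigureEight

end

noncomputable section

namespace FigureEight

open PathFunctor

/-! ### The collar of the boundary torus -/

theorem isClosed_boundary : IsClosed boundary := by
  rw [← isQuotientMap_proj.isClosed_preimage]
  have : proj ⁻¹' boundary = {x | ‖x.1.1‖ = 1 / 4} := Set.ext mem_boundary_iff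
  rw [this]
  exact isClosed_eq (by fun_prop) continuous_const

/-- The radial factor moves the norm linearly from `r` to `1 / 4`. -/
theorem push_mul_norm {r : ℝ} (hr : 1 / 4 ≤ r) (t : unitInterval) :
    ((1 - (t : ℝ)) + t * (1 / (4 * r))) * r = (1 - t) * r + t * (1 / 4) := by
  have : r ≠ 0 := by linarith
  field_simp

/-- The radial push of the fibre towards its boundary. -/
def push (x : Fibre × unitInterval) : Fibre :=
  ⟨if ‖x.1.1‖ < 1 / 2 then radial x.1.1 ((1 - (x.2 : ℝ)) + x.2 * (1 / (4 * ‖x.1.1‖)))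
    else x.1.1, by
    have hp := x.1.2
    have h0 := x.2.2.1
    have h1 := x.2.2.2
    have hm := push_mul_norm hp x.2
    split_ifs with h
    · rw [norm_radial (add_nonneg (by linarith) (by positivity)) (by rw [hm]; nlinarith), hm]
      nlinarith
    · exact hp⟩

theorem push_val {p : Fibre} (h : ‖p.1‖ < 1 / 2) (t : unitInterval) :
    (push (p, t)).1 = radial p.1 ((1 - (t : ℝ)) + t * (1 / (4 * ‖p.1‖))) := if_pos h

theorem push_zero {p : Fibre} (h : ‖p.1‖ < 1 / 2) : push (p, 0) = p := by
  apply Subtype.ext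
  rw [push_val h]
  simp [radial_one]

theorem push_boundary {p : Fibre} (h : ‖p.1‖ = 1 / 4) (t : unitInterval) : push (p, t) = p := by
  apply Subtype.ext
  rw [push_val (by rw [h]; norm_num), h]
  have : (1 - (t : ℝ)) + t * (1 / (4 * (1 / 4))) = 1 := by ring
  rw [this, radial_one]

theorem norm_push_one {p : Fibre} (h : ‖p.1‖ < 1 / 2) : ‖(push (p, 1)).1‖ = 1 / 4 := by
  have hp := p.2
  have hm := push_mul_norm hp 1
  have h1 : ((1 : unitInterval) : ℝ) = 1 := rfl
  rw [push_val h, norm_radial (by rw [h1]; positivity) (by rw [hm, h1]; norm_num), hm, h1]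
  ring

theorem continuousOn_push : ContinuousOn push {x | ‖x.1.1‖ < 1 / 2} := by
  have hind : Topology.IsInducing (Subtype.val : Fibre → Torus) := .subtypeVal
  rw [hind.continuousOn_iff]
  refine ContinuousOn.congr (f := fun x : Fibre × unitInterval =>
    radial x.1.1 ((1 - (x.2 : ℝ)) + x.2 * (1 / (4 * ‖x.1.1‖)))) ?_
    fun x hx => push_val (p := x.1) hx x.2
  intro x hx
  refine ContinuousAt.continuousWithinAt ?_
  have hp : 4 * ‖x.1.1‖ ≠ 0 := by have := x.1.2; linarith
  refine ContinuousAt.comp (f := fun x : Fibre × unitInterval =>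
    (x.1.1, (1 - (x.2 : ℝ)) + x.2 * (1 / (4 * ‖x.1.1‖)))) (continuousAt_radial hx _) ?_
  refine ContinuousAt.prodMk (by fun_prop) (ContinuousAt.add (by fun_prop)
    (ContinuousAt.mul (by fun_prop) (continuousAt_const.div (by fun_prop) hp)))

theorem hasCollar_boundary : HasCollar boundary := by
  intro b hb
  obtain ⟨U, hU, hbU, hs⟩ := hasSections_proj b
  obtain ⟨z, rfl⟩ := proj_surjective b
  obtain ⟨s, hs, hqs, hsz⟩ := hs z hbU
  have hO : IsOpen {x : Fibre × ℝ | ‖x.1.1‖ < 1 / 2} := isOpen_lt (by fun_prop) continuous_const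
  refine ⟨U ∩ s ⁻¹' {x | ‖x.1.1‖ < 1 / 2}, hs.isOpen_inter_preimage hU hO, ⟨hbU, ?_⟩,
    fun x => proj (push ((s x.1).1, x.2), (s x.1).2), ?_, ?_, ?_, ?_⟩
  · change ‖(s (proj z)).1.1‖ < 1 / 2
    rw [hsz, (mem_boundary_iff z).1 hb]
    norm_num
  · refine proj.continuous.comp_continuousOn ?_
    have h1 : ContinuousOn (fun x : KnotComplement × unitInterval => s x.1)
        ((U ∩ s ⁻¹' {x | ‖x.1.1‖ < 1 / 2}) ×ˢ Set.univ) :=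
      hs.comp continuousOn_fst fun x hx => hx.1.1
    have h2 : ContinuousOn (fun x : KnotComplement × unitInterval => ((s x.1).1, x.2))
        ((U ∩ s ⁻¹' {x | ‖x.1.1‖ < 1 / 2}) ×ˢ Set.univ) :=
      (continuous_fst.comp_continuousOn h1).prodMk continuousOn_snd
    exact (continuousOn_push.comp h2 fun x hx => hx.1.2).prodMk
      (continuous_snd.comp_continuousOn h1)
  · rintro y ⟨hyU, hy⟩
    change proj (push ((s y).1, 0), (s y).2) = y
    rw [push_zero hy]
    exact hqs y hyU
  · rintro y ⟨hyU, hy⟩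
    exact (mem_boundary_iff (push ((s y).1, 1), (s y).2)).2 (norm_push_one hy)
  · rintro y ⟨⟨hyU, hy⟩, hyb⟩ t
    change proj (push ((s y).1, t), (s y).2) = y
    rw [push_boundary ((mem_boundary_iff (s y)).1 (by rwa [hqs y hyU]))]
    exact hqs y hyU

/-! ### The gluing homeomorphism on the fundamental group of the boundary torus -/

/-- The map of loops induced by a self-map and a path from the base point to its image. -/
def transport {X : Type*} [TopologicalSpace X] {x : X} (f : C(X, X)) (ζ : Path x (f x))
    (p : FundamentalGroup X x) : FundamentalGroup X x :=
  FundamentalGroup.fromPath (((Path.Homotopic.Quotient.mk ζ).trans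
    ((FundamentalGroup.toPath p).map f)).trans (Path.Homotopic.Quotient.mk ζ).symm)

theorem hom_transport {X Λ : Type*} [TopologicalSpace X] [Group Λ] (F : PathFunctor X Λ) {x : X}
    (f : C(X, X)) (ζ : Path x (f x)) (p : FundamentalGroup X x) :
    F.hom x (transport f ζ p) = (F.val ζ)⁻¹ * (F.comap f).hom x p * F.val ζ := by
  change F.map (((Path.Homotopic.Quotient.mk ζ).trans
    ((FundamentalGroup.toPath p).map f)).trans (Path.Homotopic.Quotient.mk ζ).symm) = _
  rw [map_trans, map_trans, map_symm, ← mul_assoc]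
  rfl

theorem hom_transport_comm {X Λ : Type*} [TopologicalSpace X] [CommGroup Λ] (F : PathFunctor X Λ)
    {x : X} (f : C(X, X)) (ζ : Path x (f x)) (p : FundamentalGroup X x) :
    F.hom x (transport f ζ p) = (F.comap f).hom x p := by
  rw [hom_transport, mul_right_comm, inv_mul_cancel, one_mul]

theorem hom_comap_comap {X Λ : Type*} [TopologicalSpace X] [Group Λ] (F : PathFunctor X Λ)
    (f g : C(X, X)) (h : ∀ x, f (g x) = x) {x : X} (p : FundamentalGroup X x) :
    ((F.comap f).comap g).hom x p = F.hom x p := by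
  change ((F.comap f).comap g).map (FundamentalGroup.toPath p) = F.map (FundamentalGroup.toPath p)
  induction FundamentalGroup.toPath p using Path.Homotopic.Quotient.ind with
  | mk γ => exact F.val_congr ((γ.map g.continuous).map f.continuous) γ fun t => h _

/-- Displacements commute, so the connecting path has no influence on them and `f.symm` undoes `f`.
-/
theorem injective_transport (f : boundary ≃ₜ boundary) (ζ : Path torusBase (f torusBase)) :
    Function.Injective (transport (f : C(boundary, boundary)) ζ) := by
  intro p q h
  apply injective_torusFunctor
  have key : ∀ p, (torusFunctor.comap (f.symm : C(boundary, boundary))).hom torusBase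
      (transport (f : C(boundary, boundary)) ζ p) = torusFunctor.hom torusBase p := fun p => by
    rw [hom_transport_comm]
    exact hom_comap_comap torusFunctor (f.symm : C(boundary, boundary)) f
      (fun x => f.symm_apply_apply x) p
  rw [← key p, ← key q, h]

theorem surjective_transport (f : boundary ≃ₜ boundary) (ζ : Path torusBase (f torusBase)) :
    Function.Surjective (transport (f : C(boundary, boundary)) ζ) := by
  intro p
  let ξ : Path torusBase ((f.symm : C(boundary, boundary)) torusBase) :=
    PathConnectedSpace.somePath _ _
  refine ⟨transport (f.symm : C(boundary, boundary)) ξ p, injective_torusFunctor ?_⟩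
  rw [hom_transport_comm, hom_transport_comm]
  exact hom_comap_comap torusFunctor (f : C(boundary, boundary)) f.symm
    (fun x => f.apply_symm_apply x) p

theorem hom_transport_lonLoop (f : boundary ≃ₜ boundary) (ζ : Path torusBase (f torusBase)) :
    torusFunctor.hom torusBase (transport (f : C(boundary, boundary)) ζ lonLoop) =
      torusFunctor.along (unroll ((f : C(boundary, boundary)).comp longitude)) 0 1 := by
  rw [hom_transport_comm]
  exact hom_segmentLoop (torusFunctor.comap (f : C(boundary, boundary))) _ longitude_closed

theorem hom_transport_merLoop (f : boundary ≃ₜ boundary) (ζ : Path torusBase (f torusBase)) :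
    torusFunctor.hom torusBase (transport (f : C(boundary, boundary)) ζ merLoop) =
      torusFunctor.along (unroll ((f : C(boundary, boundary)).comp meridian)) 0 1 := by
  rw [hom_transport_comm]
  exact hom_segmentLoop (torusFunctor.comap (f : C(boundary, boundary))) _ meridian_closed

theorem transport_merLoop {f : boundary ≃ₜ boundary} (ζ : Path torusBase (f torusBase))
    (h : SameCurve ((f : C(boundary, boundary)).comp meridian) meridian) :
    transport (f : C(boundary, boundary)) ζ merLoop = merLoop ∨
      transport (f : C(boundary, boundary)) ζ merLoop = merLoop⁻¹ := by
  refine h.imp (fun h => injective_torusFunctor ?_) (fun h => injective_torusFunctor ?_)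
  · rw [hom_transport_merLoop, along_eq_of_homotopic _ h, along_meridian, hom_merLoop]
  · rw [hom_transport_merLoop, along_eq_of_homotopic _ h, along_reverse, along_meridian, map_inv,
      hom_merLoop]

theorem sameCurve_longitude {f : boundary ≃ₜ boundary} (ζ : Path torusBase (f torusBase))
    (h : transport (f : C(boundary, boundary)) ζ lonLoop = lonLoop ∨
      transport (f : C(boundary, boundary)) ζ lonLoop = lonLoop⁻¹) :
    SameCurve ((f : C(boundary, boundary)).comp longitude) longitude := by
  refine h.imp (fun h => homotopic_of_along_eq ?_) (fun h => homotopic_of_along_eq ?_)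
  · rw [← hom_transport_lonLoop f ζ, h, along_longitude, hom_lonLoop]
  · rw [← hom_transport_lonLoop f ζ, h, along_reverse, along_longitude, map_inv, hom_lonLoop]

/-! ### The knot group -/

namespace KnotGroup

theorem conj_mer (x : F2) : mer * ofF x * mer⁻¹ = ofF (knotAut x) := by
  rw [conj_ofF]
  simp [conjAut, mer, deg]

theorem lon_ne_one : lon ≠ 1 := fun h => by
  have := lon_mul_mer_eq_one (i := 1) (j := 0) (by simpa using h)
  omega

/-- A faithful representation of the knot group gives the data of a `KnotRep`. -/
theorem knotRep {ρ : KnotGroup →* SL2} (hρ : Function.Injective ρ) :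
    SL2.KnotRep (ρ (ofF genA)) (ρ (ofF genB)) (ρ mer) (ρ lon) where
  conjA := by simp only [← map_mul, ← map_inv, conj_mer, knotAut_genA]
  conjB := by simp only [← map_mul, ← map_inv, conj_mer, knotAut_genB]
  comm := by simp only [← map_mul, ← map_inv, lon, bdry]
  -- Trace `2` would make the longitude commute with its conjugate by `a`.
  trace_ne h := by
    have h1 := SL2.commute_of_tr_commutator (A := ρ (ofF genA)) (B := ρ (ofF genB)) (C := ρ lon)
      (by simp only [← map_mul, ← map_inv, lon, bdry]) h
    simp only [← map_mul, ← map_inv] at h1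
    exact not_commute_conj_lon (Commute.of_map hρ h1)
  -- An element equal to its inverse has order at most two, but the knot group is torsion free.
  ne_inv h := by
    rw [← map_inv] at h
    have h1 := hρ h
    exact lon_ne_one (eq_one_of_pow_eq_one two_ne_zero (by
      rw [pow_two]
      exact mul_eq_one_iff_eq_inv.2 h1))

end KnotGroup

end FigureEight

end

/-! ### The amalgam of two knot groups, and the longitudes under a faithful representation. -/

noncomputable section

namespace FigureEight

open PathFunctor KnotGroup

theorem injective_boundaryIncl :
    Function.Injective ((knotFunctor.comap boundaryIncl).hom torusBase) := by
  rw [injective_iff_map_eq_one]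
  intro p hp
  obtain ⟨i, j, rfl⟩ := exists_zpow_mul p
  rw [hom_boundaryIncl] at hp
  obtain ⟨rfl, rfl⟩ := lon_mul_mer_eq_one hp
  simp

theorem range_boundaryIncl :
    ((knotFunctor.comap boundaryIncl).hom torusBase).range = periph := by
  ext g
  constructor
  · rintro ⟨p, rfl⟩
    obtain ⟨i, j, rfl⟩ := exists_zpow_mul p
    exact ⟨i, j, hom_boundaryIncl i j⟩
  · rintro ⟨i, j, rfl⟩
    exact ⟨_, hom_boundaryIncl i j⟩

/-- The inclusions of the peripheral subgroup in the two knot groups, for a gluing map. -/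
theorem exists_amalgam (f : boundary ≃ₜ boundary) :
    ∃ (ζ : Path torusBase (f torusBase))
      (φ : Bool → (FundamentalGroup boundary torusBase →* KnotGroup)),
      (∀ i, Function.Injective (φ i)) ∧ (∀ i, (φ i).range = periph) ∧
      (∀ i j : ℤ, φ false (lonLoop ^ i * merLoop ^ j) = lon ^ i * mer ^ j) ∧
      (∀ p, φ true p = φ false (transport (f : C(boundary, boundary)) ζ p)) ∧
      ∃ Φ : PathFunctor (Glued f) (Monoid.PushoutI φ),
        ∀ x, Function.Bijective (Φ.hom x) := by
  let ζ : Path torusBase (f torusBase) := PathConnectedSpace.somePath _ _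
  let K := knotFunctor.comap boundaryIncl
  let c := K.val ζ
  -- Conjugating by the value of `ζ` makes the second inclusion equal to the first one after
  -- `transport`.
  let F' : PathFunctor KnotComplement KnotGroup := knotFunctor.gauge fun _ => c⁻¹
  let φ : Bool → (FundamentalGroup boundary torusBase →* KnotGroup) := fun i =>
    if i then (F'.comap (glueIncl f)).hom torusBase else K.hom torusBase
  have hφ : ∀ p, φ true p = φ false (transport (f : C(boundary, boundary)) ζ p) := by
    intro p
    refine Eq.trans ?_ (hom_transport K (f : C(boundary, boundary)) ζ p).symm
    change c⁻¹ * knotFunctor.map ((FundamentalGroup.toPath p).map (glueIncl f)) * (c⁻¹)⁻¹ =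
      c⁻¹ * knotFunctor.map (((FundamentalGroup.toPath p).map
        (f : C(boundary, boundary))).map boundaryIncl) * c
    rw [inv_inv]
    induction FundamentalGroup.toPath p using Path.Homotopic.Quotient.ind with
    | mk γ => rfl
  have hbij : ∀ y, Function.Bijective (F'.hom y) := by
    intro y
    have h1 := bijective_knotFunctor y
    have h2 : ⇑(F'.hom y) = MulAut.conj c⁻¹ ∘ knotFunctor.hom y := rfl
    rw [h2]
    exact (MulAut.conj c⁻¹).bijective.comp h1
  obtain ⟨Φ, hΦ⟩ := exists_functor_pushout f isClosed_boundary isClosed_boundary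
    hasCollar_boundary torusBase locallyTrivial_knotFunctor
    (locallyTrivial_knotFunctor.gauge fun _ => c⁻¹) (bijective_knotFunctor _) (hbij _) φ rfl rfl
  have : Nonempty boundary := ⟨torusBase⟩
  have := pathConnectedSpace_glued f
  refine ⟨ζ, φ, ?_, ?_, hom_boundaryIncl, hφ, Φ, fun x => Φ.hom_bijective x hΦ⟩
  · rintro (_ | _)
    · exact injective_boundaryIncl
    · have h1 : ⇑(φ true) = φ false ∘ transport (f : C(boundary, boundary)) ζ := funext hφ
      rw [h1]
      exact injective_boundaryIncl.comp (injective_transport f ζ)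
  · rintro (_ | _)
    · exact range_boundaryIncl
    · rw [← range_boundaryIncl]
      ext g
      constructor
      · rintro ⟨p, rfl⟩
        exact ⟨_, (hφ p).symm⟩
      · rintro ⟨p, rfl⟩
        obtain ⟨q, rfl⟩ := surjective_transport f ζ p
        exact ⟨q, hφ q⟩

/-- An amalgam of two knot groups along their peripheral subgroups has no faithful representation
if the meridians, but not the longitudes, are identified up to direction. -/
theorem longitude_of_faithful {H : Type} [Group H] {φ : Bool → (H →* KnotGroup)}
    (hφ : ∀ i, Function.Injective (φ i)) {ρ : Monoid.PushoutI φ →* SL2}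
    (hρ : Function.Injective ρ) {l m : H} (hl : φ false l = lon) (hm : φ false m = mer)
    (hm' : φ true m = mer ∨ φ true m = mer⁻¹) : φ true l = lon ∨ φ true l = lon⁻¹ := by
  let o : ∀ i, KnotGroup →* Monoid.PushoutI φ := fun i =>
    Monoid.PushoutI.of (G := fun _ => KnotGroup) (φ := φ) i
  have ho : ∀ i, Function.Injective (o i) := fun i => Monoid.PushoutI.of_injective hφ i
  have hglue : ∀ p, o false (φ false p) = o true (φ true p) := fun p => by
    rw [Monoid.PushoutI.of_apply_eq_base, Monoid.PushoutI.of_apply_eq_base]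
  have hrep : ∀ i, SL2.KnotRep (ρ (o i (ofF genA))) (ρ (o i (ofF genB))) (ρ (o i mer))
      (ρ (o i lon)) := fun i => knotRep (ρ := ρ.comp (o i)) (hρ.comp (ho i))
  -- The meridians of both factors are images of the same loop `m`, up to direction.
  have hmer : ρ (o true mer) = ρ (o false mer) ∨ ρ (o true mer) = (ρ (o false mer))⁻¹ := by
    rw [← hm, hglue m]
    rcases hm' with h | h
    · left
      rw [h, hm]
    · right
      rw [h, hm, map_inv, map_inv, inv_inv]
  rcases (hrep false).longitude_eq (hrep true) hmer with h | h
  · left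
    have h1 := hρ h
    rw [← hl, hglue l, hl] at h1
    exact (ho true h1).symm
  · right
    rw [← map_inv, ← map_inv] at h
    have h1 := hρ h
    rw [← hl, ← map_inv, hglue, hl, map_inv] at h1
    rw [ho true h1, inv_inv]

end FigureEight

end

theorem theorem5p2
    (f : FigureEight.boundary ≃ₜ FigureEight.boundary)
    (hmeridian : FigureEight.SameCurve
      ((f : C(FigureEight.boundary, FigureEight.boundary)).comp FigureEight.meridian)
      FigureEight.meridian)
    (hlongitude : ¬ FigureEight.SameCurve
      ((f : C(FigureEight.boundary, FigureEight.boundary)).comp FigureEight.longitude)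
      FigureEight.longitude)
    (x : FigureEight.Glued f) :
    (¬ ∃ φ : FundamentalGroup (FigureEight.Glued f) x →*
        Matrix.SpecialLinearGroup (Fin 2) ℂ, Function.Injective φ) ∧
      FigureEight.IsCSA (FundamentalGroup (FigureEight.Glued f) x) ∧
      FigureEight.IsCT (FundamentalGroup (FigureEight.Glued f) x) := by
  open FigureEight FigureEight.KnotGroup in
  obtain ⟨ζ, φ, hφ, hrange, hφf, hφt, Φ, hΦ⟩ := exists_amalgam f
  have hm : ∀ i (k : KnotGroup) (p : FundamentalGroup boundary torusBase), p ≠ 1 →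
      k * φ i p * k⁻¹ ∈ (φ i).range → k ∈ (φ i).range := by
    intro i k p hp hk
    have h1 : φ i p ∈ (φ i).range := ⟨p, rfl⟩
    rw [hrange] at hk h1 ⊢
    exact periph_malnormal h1 (fun h => hp (hφ i (h.trans (map_one _).symm))) hk
  have hct : ∀ a b c : FundamentalGroup (Glued f) x, a ≠ 1 → Commute b a → Commute c a →
      Commute b c := fun a b c ha hb hc => Commute.of_map (hΦ x).1 <|
    BassSerre.commute_trans hφ hm (fun _ _ _ _ h => commute_trans h)
      (fun h => ha ((hΦ x).1 (h.trans (map_one _).symm))) (hb.map (Φ.hom x)) (hc.map (Φ.hom x))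
  have hcc : ∀ a g : FundamentalGroup (Glued f) x, a ≠ 1 → Commute (g * a * g⁻¹) a →
      Commute g a := by
    intro a g ha h
    have h1 := h.map (Φ.hom x)
    rw [map_mul, map_mul, map_inv] at h1
    exact Commute.of_map (hΦ x).1 <| BassSerre.commute_of_conj hφ hm
      (fun _ y hy => eq_one_of_pow_eq_one two_ne_zero (by rw [pow_two, hy]))
      (fun _ _ _ h => commute_of_conj h) (fun h => ha ((hΦ x).1 (h.trans (map_one _).symm))) h1
  refine ⟨?_, isCSA_of_commute_of_conj hct hcc, isCT_of_commute_trans hct⟩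
  rintro ⟨ρ, hρ⟩
  apply hlongitude
  let e := MulEquiv.ofBijective (Φ.hom x) (hΦ x)
  have hlon : φ false lonLoop = lon := by simpa using hφf 1 0
  have hmer : φ false merLoop = mer := by simpa using hφf 0 1
  have key := longitude_of_faithful hφ (ρ := ρ.comp e.symm.toMonoidHom)
    (hρ.comp e.symm.injective) hlon hmer (by
      rw [hφt]
      refine (transport_merLoop ζ hmeridian).imp (fun h => ?_) fun h => ?_
      · rw [h, hmer]
      · rw [h, map_inv, hmer])
  -- The algebraic identity of the longitudes is pulled back by the injective inclusion `φ false`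
  -- and becomes a free homotopy, against `hlongitude`.
  refine sameCurve_longitude ζ (key.imp (fun h => hφ false ?_) fun h => hφ false ?_)
  · rw [← hφt, h, hlon]
  · rw [← hφt, h, map_inv, hlon]
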